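/- **Setting.** Let $h,a,b,q,l,p$ be integers with $h\ge 2$, $1\le a,b\le q$, $0\le l\le p\le 2h-1$, let $s>0$, $u_1,\dots,u_{2h-1}\in\mathbb R$, and put $$H(x,y)=\frac{y^2}{2}+U(x),\quad U(x)=\frac{x^{2h}}{2h}+\sum_{i=1}^{2h-1}u_ix^i,\quad S(t)=s\,t^{1+b/q}.$$ Consider, for $t>0$, the system $$x'=\partial_yH(x,y)+t^{-a/q}f(x,y,S(t),t),\qquad y'=-\partial_xH(x,y)+t^{-a/q}g(x,y,S(t),t),\tag{1}$$ where $f,g$ are $C^\infty$ on $\mathbb R^3\times(0,\infty)$ and $2\pi$-periodic in $S$. Assume: (fg) $f\sim\sum_{k\ge0}t^{-k/q}f_k(x,y,S)$ and $g\sim\sum_{k\ge0}t^{-k/q}g_k(x,y,S)$ as $t\to\infty$, where $f_k=\sum_{i=0}^{p}\sum_{j=0}^{l-1}A_{k,i,j}(S)x^iy^j$, $g_k=\sum_{i=0}^{p}\sum_{j=0}^{l}B_{k,i,j}(S)x^iy^j$ with $2\pi$-periodic $A_{k,i,j},B_{k,i,j}$ that vanish if $i+j>p$ (and $f_k=0$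 if $l=0$). This means: there is $m$ such that for every $n$ there are $C,t_n>0$ with $|f-\sum_{k<n}t^{-k/q}f_k|\le C\,t^{-n/q}(1+|x|+|y|)^m$ for all $x,y,S$ and $t\ge t_n$, and likewise for $g$. (rc) $-1\le\sigma<\frac bq$, where $\sigma=\frac bq\big(l-1+\frac{p-1}{h-1}\big)-\frac aq$. Put $\mu=\frac12(\frac bq-\sigma)>0$, $\nu=1+\frac bq$, $\vartheta=s(1+\frac bq)$, $M=2\mu q(h-1)$, $N=2\nu q(h-1)$ (positive integers). **Energy-angle variables.** For large $E$ let $x_-(E)<0<x_+(E)$ be the roots of $U(x)=E$, $T(E)=\int_{x_-(E)}^{x_+(E)}\frac{\sqrt2\,dx}{\sqrt{E-U(x)}}$, $\omega(E)=2\pi/T(E)$, and let $(x_0(t,E),y_0(t,E))$ be the solution of $x'=y$, $y'=-U'(x)$ with value $(x_+(E),0)$ at $t=0$. Put $X(\phi,E)=x_0(\phi/\omega(E),E)$, $Y(\phi,E)=y_0(\phi/\omega(E),E)$. With $f,g$ evaluated at $(X(\phi,I),Y(\phi,I),S(t),t)$, the change of variables $x=X(\phi,I)$, $y=Y(\phi,I)$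 turns (1) into $I'=t^{-a/q}F$, $\phi'=\omega(I)+t^{-a/q}G$, where $F=fU'(X)+gY$, $G=\omega(I)(f\,\partial_EY-g\,\partial_EX)$. **Resonance variables.** Let $\varkappa\ge1$ be an integer. Let $I_*(t)$ be the large solution of $\omega(I_*(t))=\varkappa^{-1}S'(t)$ ($t$ large). The substitution $I=I_*(t)(1+t^{-\mu}r)^{2h}$, $\phi=\theta+\varkappa^{-1}S(t)$, $\tau=t^\nu/\nu$ leads to $$\frac{dr}{d\tau}=\tau^{-M/N}\mathcal A,\quad \frac{d\theta}{d\tau}=\tau^{-M/N}\mathcal B,\qquad \mathcal A\sim\sum_{K\ge0}\tau^{-K/N}\mathcal A_K(r,\theta,\zeta),\quad \mathcal B\sim\sum_{K\ge0}\tau^{-K/N}\mathcal B_K(r,\theta,\zeta)$$ as $\tau\to\infty$, with $\zeta=S(t)=\vartheta\tau$; $\mathcal A_K,\mathcal B_K$ are $2\pi$-periodic in $\theta$ and $2\pi\varkappa$-periodic in $\zeta$. **Averaging.** Let $\langle\cdot\rangle$ be the mean value over a period in $\zeta$. There are unique functions $\rho_K(r,\theta,\zeta),\psi_K(r,\theta,\zeta)$,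 $2\pi\varkappa$-periodic in $\zeta$ with $\langle\rho_K\rangle=\langle\psi_K\rangle=0$, and $\Lambda_K(r,\theta),\Omega_K(r,\theta)$ ($K\ge0$), such that formally, as power series in $\tau^{-1/N}$, the substitution $$R=r+\sum_{K\ge0}\tau^{-\frac{M+K}N}\rho_K(r,\theta,\vartheta\tau),\qquad \Psi=\theta+\sum_{K\ge0}\tau^{-\frac{M+K}N}\psi_K(r,\theta,\vartheta\tau)$$ transforms the system for $(r,\theta)$ into $\frac{dR}{d\tau}=\sum_{K}\tau^{-\frac{M+K}N}\Lambda_K(R,\Psi)$, $\frac{d\Psi}{d\tau}=\sum_{K}\tau^{-\frac{M+K}N}\Omega_K(R,\Psi)$. Assume that there are integers $L,D$ and $\varphi_0\in\mathbb R$ with: (as0) $0\le L\le\min\{N-M,2M-1\}$, $\Lambda_K\equiv0$ for all $K<L$, and $\Lambda_L\not\equiv0$; (as1) $\Lambda_L(0,\varphi_0)=0$ and $\lambda_L:=\partial_\theta\Lambda_L(0,\varphi_0)<0$; (asg) $D\ge M$, $\partial_r\Lambda_K+\partial_\theta\Omega_K\equiv0$ for all $K<D$, and $\gamma_D:=\partial_r\Lambda_D(0,\varphi_0)+\partial_\theta\Omega_D(0,\varphi_0)\ne0$;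 and that $M+D\le N$ and $\hat\gamma_D:=\gamma_D+\delta_{M+D,N}\frac LN<0$ ($\delta$ is Kronecker's symbol). Let $\kappa=\sqrt2\,(2h)^{\frac1{2h}}\int_{-1}^1\frac{dx}{\sqrt{1-x^{2h}}}$, $c_\varkappa=\big(\frac{2\pi\varkappa}{\kappa\vartheta}\big)^{\frac1{h-1}}$, and let $(X_0,Y_0)$ be the $2\pi$-periodic solution of $$\frac{2\pi}\kappa X_0'=Y_0,\qquad \frac{2\pi}\kappa Y_0'=-X_0^{2h-1},\qquad \frac{X_0^{2h}}{2h}+\frac{Y_0^2}2=1,\qquad Y_0(0)=0,\quad X_0(0)>0.$$ **Theorem.** For every $\varsigma\in(0,1)$ and every $E_0\in\mathbb R$ there are $t_s>0$ and a nonempty open set $\mathcal D_s\subset\{(x,y):H(x,y)>E_0\}$ such that for every $(x_s,y_s)\in\mathcal D_s$ a solution of (1) with $x(t_s)=x_s$, $y(t_s)=y_s$ exists on $[t_s,\infty)$, and for every such solution there are functions $R(\tau),\Psi(\tau)$ with $$R(\tau)=\delta_{M+D,N}\,O\big(\tau^{-\frac\varsigma2|\hat\gamma_D|}\big)+O\big(\tau^{-\frac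 MN}\big),\qquad \Psi(\tau)=\varphi_0+\delta_{M+D,N}\,O\big(\tau^{-\frac\varsigma2|\hat\gamma_D|}\big)+O\big(\tau^{-\frac1N}\big)\qquad(\tau\to\infty)$$ such that, with $\tau=t^\nu/\nu$, as $t\to\infty$, $$x(t)=t^{\frac b{(h-1)q}}\,c_\varkappa^{-1}\,X_0\big(\varkappa^{-1}S(t)+\Psi(\tau)\big)\,\big(1+t^{-\mu}R(\tau)\big)\,\Big(1+O\big(t^{-\frac b{(h-1)q}}\big)\Big),$$ $$y(t)=t^{\frac{hb}{(h-1)q}}\,c_\varkappa^{-h}\,Y_0\big(\varkappa^{-1}S(t)+\Psi(\tau)\big)\,\big(1+t^{-\mu}R(\tau)\big)^{h}\,\Big(1+O\big(t^{-\frac b{(h-1)q}}\big)\Big).$$ -/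

import Mathlib

open Set Filter Topology Asymptotics

noncomputable section

/-- Coefficients of an asymptotic power series.  If `F ε ~ ∑ₙ cₙ εⁿ` as `ε → 0+`, then
`asympCoeff F n = cₙ`:  `cₙ = lim_{ε → 0+} (F ε - ∑_{j<n} c_j ε^j) / ε^n`. -/
def asympCoeff (F : ℝ → ℝ) (n : ℕ) : ℝ :=
  limUnder (𝓝[>] (0 : ℝ))
    (fun ε : ℝ => (F ε - ∑ j : Fin n, asympCoeff F j * ε ^ (j : ℕ)) / ε ^ n)
termination_by n
decreasing_by exact j.2

/-- The data of the perturbed system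
`x' = ∂_y H + t^{-a/q} f(x,y,S(t),t)`, `y' = -∂_x H + t^{-a/q} g(x,y,S(t),t)`:
`h` is half of the degree of the potential, `u i` are the lower coefficients of the potential,
`S(t) = s t^{1+b/q}`, and `A k i j`, `B k i j` are the coefficient functions of the monomials
`x^i y^j` in the `k`-th terms of the expansions of `f` and `g`; `p` bounds the degree of these
monomials and `l` the power of `y`. -/
structure PerturbedSystem where
  h : ℕ
  a : ℕ
  b : ℕ
  q : ℕ
  l : ℕ
  p : ℕ
  s : ℝ
  u : ℕ → ℝ
  f : ℝ → ℝ → ℝ → ℝ → ℝ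
  g : ℝ → ℝ → ℝ → ℝ → ℝ
  A : ℕ → ℕ → ℕ → ℝ → ℝ
  B : ℕ → ℕ → ℕ → ℝ → ℝ

namespace PerturbedSystem

/-! ### The system and its standing assumptions -/

/-- The potential `U(x) = x^{2h}/(2h) + ∑_{i=1}^{2h-1} u_i x^i`. -/
def U (P : PerturbedSystem) (x : ℝ) : ℝ :=
  x ^ (2 * P.h) / (2 * P.h) + ∑ i ∈ Finset.Icc 1 (2 * P.h - 1), P.u i * x ^ i

/-- The Hamiltonian `H(x,y) = y²/2 + U(x)`. -/
def H (P : PerturbedSystem) (x y : ℝ) : ℝ := y ^ 2 / 2 + P.U x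

/-- The phase `S(t) = s t^{1+b/q}`. -/
def S (P : PerturbedSystem) (t : ℝ) : ℝ := P.s * t ^ (1 + (P.b : ℝ) / P.q)

/-- `(x, y)` solves the perturbed system on `[t₀, ∞)`. -/
def IsSolutionFrom (P : PerturbedSystem) (t₀ : ℝ) (x y : ℝ → ℝ) : Prop :=
  ∀ t ∈ Ici t₀,
    HasDerivWithinAt x
      (deriv (fun v => P.H (x t) v) (y t)
        + t ^ (-((P.a : ℝ) / P.q)) * P.f (x t) (y t) (P.S t) t) (Ici t₀) t ∧
    HasDerivWithinAt y
      (-deriv (fun v => P.H v (y t)) (x t)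
        + t ^ (-((P.a : ℝ) / P.q)) * P.g (x t) (y t) (P.S t) t) (Ici t₀) t

/-- `f_k(x,y,S) = ∑_{i=0}^{p} ∑_{j=0}^{l-1} A_{k,i,j}(S) x^i y^j` (zero if `l = 0`). -/
def fk (P : PerturbedSystem) (k : ℕ) (x y S : ℝ) : ℝ :=
  ∑ i ∈ Finset.range (P.p + 1), ∑ j ∈ Finset.range P.l, P.A k i j S * x ^ i * y ^ j

/-- `g_k(x,y,S) = ∑_{i=0}^{p} ∑_{j=0}^{l} B_{k,i,j}(S) x^i y^j`. -/
def gk (P : PerturbedSystem) (k : ℕ) (x y S : ℝ) : ℝ :=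
  ∑ i ∈ Finset.range (P.p + 1), ∑ j ∈ Finset.range (P.l + 1), P.B k i j S * x ^ i * y ^ j

/-- Standing assumptions on the parameters and the regularity of the perturbations. -/
structure IsAdmissible (P : PerturbedSystem) : Prop where
  two_le_h : 2 ≤ P.h
  one_le_a : 1 ≤ P.a
  a_le_q : P.a ≤ P.q
  one_le_b : 1 ≤ P.b
  b_le_q : P.b ≤ P.q
  s_pos : 0 < P.s
  l_le_p : P.l ≤ P.p
  p_le : P.p ≤ 2 * P.h - 1
  f_smooth : ContDiffOn ℝ ((⊤ : ℕ∞) : WithTop ℕ∞)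
    (fun v : ℝ × ℝ × ℝ × ℝ => P.f v.1 v.2.1 v.2.2.1 v.2.2.2) {v | 0 < v.2.2.2}
  g_smooth : ContDiffOn ℝ ((⊤ : ℕ∞) : WithTop ℕ∞)
    (fun v : ℝ × ℝ × ℝ × ℝ => P.g v.1 v.2.1 v.2.2.1 v.2.2.2) {v | 0 < v.2.2.2}
  f_periodic : ∀ x y t, 0 < t → Function.Periodic (fun S => P.f x y S t) (2 * Real.pi)
  g_periodic : ∀ x y t, 0 < t → Function.Periodic (fun S => P.g x y S t) (2 * Real.pi)

/-- The perturbations have power-law asymptotics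
`f ~ ∑_k t^{-k/q} f_k`, `g ~ ∑_k t^{-k/q} g_k` as `t → ∞`, with coefficients that are
`2π`-periodic in `S` and polynomial of degree at most `p` in `(x,y)`.  The remainders are
estimated uniformly in `S`, and in `(x,y)` up to a fixed polynomial weight. -/
structure HasPowerAsymptotics (P : PerturbedSystem) : Prop where
  A_periodic : ∀ k i j, Function.Periodic (P.A k i j) (2 * Real.pi)
  B_periodic : ∀ k i j, Function.Periodic (P.B k i j) (2 * Real.pi)
  A_zero : ∀ k i j, P.p < i + j → ∀ S, P.A k i j S = 0
  B_zero : ∀ k i j, P.p < i + j → ∀ S, P.B k i j S = 0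
  f_asymp : ∃ m : ℕ, ∀ n : ℕ, ∃ C t₀ : ℝ, 0 < t₀ ∧ ∀ x y S t, t₀ ≤ t →
    |P.f x y S t - ∑ k ∈ Finset.range n, t ^ (-((k : ℝ) / P.q)) * P.fk k x y S|
      ≤ C * t ^ (-((n : ℝ) / P.q)) * (1 + |x| + |y|) ^ m
  g_asymp : ∃ m : ℕ, ∀ n : ℕ, ∃ C t₀ : ℝ, 0 < t₀ ∧ ∀ x y S t, t₀ ≤ t →
    |P.g x y S t - ∑ k ∈ Finset.range n, t ^ (-((k : ℝ) / P.q)) * P.gk k x y S|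
      ≤ C * t ^ (-((n : ℝ) / P.q)) * (1 + |x| + |y|) ^ m

/-- `σ = (b/q) (l - 1 + (p-1)/(h-1)) - a/q`. -/
def sigma (P : PerturbedSystem) : ℝ :=
  (P.b : ℝ) / P.q * ((P.l : ℝ) - 1 + ((P.p : ℝ) - 1) / ((P.h : ℝ) - 1)) - (P.a : ℝ) / P.q

/-- The condition `-1 ≤ σ < b/q`. -/
def SigmaCondition (P : PerturbedSystem) : Prop :=
  -1 ≤ P.sigma ∧ P.sigma < (P.b : ℝ) / P.q

/-- `μ = (b/q - σ)/2`. -/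
def mu (P : PerturbedSystem) : ℝ := ((P.b : ℝ) / P.q - P.sigma) / 2

/-- `ν = 1 + 2μ + σ = 1 + b/q`. -/
def nu (P : PerturbedSystem) : ℝ := 1 + 2 * P.mu + P.sigma

/-- `ϑ = s (1 + b/q)`, so that `S'(t) = ϑ t^{b/q}`. -/
def vartheta (P : PerturbedSystem) : ℝ := P.s * (1 + (P.b : ℝ) / P.q)

/-- The integer `M = 2 μ q (h-1)`, positive under the condition on `σ`. -/
def M (P : PerturbedSystem) : ℕ :=
  (((P.h : ℤ) - 1) * (P.a + P.b)
    - P.b * (((P.l : ℤ) - 1) * ((P.h : ℤ) - 1) + ((P.p : ℤ) - 1))).toNat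

/-- The integer `N = 2 ν q (h-1)`. -/
def N (P : PerturbedSystem) : ℕ := 2 * (P.q + P.b) * (P.h - 1)

lemma nu_eq (P : PerturbedSystem) : P.nu = 1 + (P.b : ℝ) / P.q := by
  unfold nu mu; ring

lemma N_cast (P : PerturbedSystem) (hP : P.IsAdmissible) :
    (P.N : ℝ) = 2 * P.nu * P.q * ((P.h : ℝ) - 1) := by
  have h1 : 1 ≤ P.h := le_trans (by norm_num) hP.two_le_h
  have hq : (P.q : ℝ) ≠ 0 := by
    have := le_trans hP.one_le_a hP.a_le_q
    exact_mod_cast (by omega : P.q ≠ 0)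
  rw [nu_eq, N]
  push_cast [Nat.cast_sub h1]
  field_simp

lemma M_cast (P : PerturbedSystem) (hP : P.IsAdmissible) (hs : P.SigmaCondition) :
    (P.M : ℝ) = 2 * P.mu * P.q * ((P.h : ℝ) - 1) ∧ 1 ≤ P.M := by
  have hq : (0 : ℝ) < P.q := by
    have := le_trans hP.one_le_a hP.a_le_q
    exact_mod_cast this
  have hh : (0 : ℝ) < (P.h : ℝ) - 1 := by
    have : (2 : ℝ) ≤ P.h := by exact_mod_cast hP.two_le_h
    linarith
  set m : ℤ := ((P.h : ℤ) - 1) * (P.a + P.b)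
    - P.b * (((P.l : ℤ) - 1) * ((P.h : ℤ) - 1) + ((P.p : ℤ) - 1)) with hm
  have e : (m : ℝ) = 2 * P.mu * P.q * ((P.h : ℝ) - 1) := by
    rw [hm, mu, sigma]
    push_cast
    field_simp
    ring
  have hpos : (0 : ℝ) < (m : ℝ) := by
    rw [e]
    have : 0 < P.mu := by unfold mu; linarith [hs.2]
    positivity
  have hpos' : 0 < m := by exact_mod_cast hpos
  have hM : (P.M : ℤ) = m := Int.toNat_of_nonneg hpos'.le
  refine ⟨?_, by omega⟩
  rw [← e, ← hM]
  push_cast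
  rfl

/-! ### Energy-angle variables of the limiting system -/

/-- The right turning point `x₊(E)`, the largest root of `U(x) = E`. -/
def xPlus (P : PerturbedSystem) (E : ℝ) : ℝ := sSup {x | P.U x = E}

/-- The left turning point `x₋(E)`, the smallest root of `U(x) = E`. -/
def xMinus (P : PerturbedSystem) (E : ℝ) : ℝ := sInf {x | P.U x = E}

/-- The period `T(E) = ∫_{x₋(E)}^{x₊(E)} √2 dx / √(E - U(x))`. -/
def T (P : PerturbedSystem) (E : ℝ) : ℝ :=
  ∫ x in (P.xMinus E)..(P.xPlus E), Real.sqrt 2 / Real.sqrt (E - P.U x)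

/-- The frequency `ω(E) = 2π / T(E)`. -/
def omega (P : PerturbedSystem) (E : ℝ) : ℝ := 2 * Real.pi / P.T E

/-- The solution `(x₀(t,E), y₀(t,E))` of the limiting system `x' = ∂_y H`, `y' = -∂_x H` on the
level `H = E`, with the origin of time at the right turning point.  (The solution of this initial
value problem exists on the whole line and is unique.) -/
def orbit (P : PerturbedSystem) (E : ℝ) : ℝ → ℝ × ℝ :=
  Classical.epsilon fun γ : ℝ → ℝ × ℝ =>
    γ 0 = (P.xPlus E, 0) ∧
    ∀ t, HasDerivAt γ ((γ t).2, -deriv P.U (γ t).1) t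

/-- `X(φ,E) = x₀(φ/ω(E), E)`. -/
def X (P : PerturbedSystem) (φ E : ℝ) : ℝ := (P.orbit E (φ / P.omega E)).1

/-- `Y(φ,E) = y₀(φ/ω(E), E)`. -/
def Y (P : PerturbedSystem) (φ E : ℝ) : ℝ := (P.orbit E (φ / P.omega E)).2

/-- `F_k(I,φ,S) = f_k(X,Y,S) U'(X) + g_k(X,Y,S) Y`. -/
def Fk (P : PerturbedSystem) (k : ℕ) (I φ S : ℝ) : ℝ :=
  P.fk k (P.X φ I) (P.Y φ I) S * deriv P.U (P.X φ I)
    + P.gk k (P.X φ I) (P.Y φ I) S * P.Y φ I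

/-- `G_k(I,φ,S) = ω(I) (f_k(X,Y,S) ∂_E Y - g_k(X,Y,S) ∂_E X)`. -/
def Gk (P : PerturbedSystem) (k : ℕ) (I φ S : ℝ) : ℝ :=
  P.omega I * (P.fk k (P.X φ I) (P.Y φ I) S * deriv (fun E => P.Y φ E) I
    - P.gk k (P.X φ I) (P.Y φ I) S * deriv (fun E => P.X φ E) I)

/-! ### Amplitude and phase difference -/

/-- `κ = √2 (2h)^{1/(2h)} ∫_{-1}^{1} dx / √(1 - x^{2h})`. -/
def kappa (P : PerturbedSystem) : ℝ :=
  Real.sqrt 2 * (2 * (P.h : ℝ)) ^ (1 / (2 * (P.h : ℝ)))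
    * ∫ x in (-1 : ℝ)..1, 1 / Real.sqrt (1 - x ^ (2 * P.h))

/-- `c_ϰ = (ω₀ ϰ / ϑ)^{1/(h-1)}` with `ω₀ = 2π/κ`. -/
def c (P : PerturbedSystem) (ϰ : ℕ) : ℝ :=
  (2 * Real.pi / P.kappa * ϰ / P.vartheta) ^ (1 / ((P.h : ℝ) - 1))

/-- The resonant energy `I_*(t)`: the large solution of `ω(I_*(t)) = ϰ⁻¹ S'(t)`.  (For large `E`
the frequency increases to infinity, so for large `t` this is the only large solution.) -/
def Istar (P : PerturbedSystem) (ϰ : ℕ) (t : ℝ) : ℝ :=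
  sSup {E | P.omega E = deriv P.S t / ϰ}

/-- The time `t = (ν τ)^{1/ν}` corresponding to `τ = t^ν / ν`. -/
def time (P : PerturbedSystem) (τ : ℝ) : ℝ := (P.nu * τ) ^ (1 / P.nu)

/-- The energy `I = I_*(t) (1 + t^{-μ} r)^{2h}`. -/
def energy (P : PerturbedSystem) (ϰ : ℕ) (r t : ℝ) : ℝ :=
  P.Istar ϰ t * (1 + t ^ (-P.mu) * r) ^ (2 * P.h)

/-- The substitution `I = I_*(t) (1 + t^{-μ} r)^{2h}`, `φ = θ + ϰ⁻¹ S(t)`, `τ = t^ν/ν` transforms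
`I' = t^{-a/q} F`, `φ' = ω(I) + t^{-a/q} G` into
`dr/dτ = τ^{-M/N} 𝒜`, `dθ/dτ = τ^{-M/N} ℬ`.  This is `𝒜`, where `S(t)` is replaced by the
independent variable `ζ`, and the expansion of `F` is truncated after the `n`-th term. -/
def calA (P : PerturbedSystem) (ϰ n : ℕ) (r θ ζ τ : ℝ) : ℝ :=
  let t := P.time τ
  let I := P.energy ϰ r t
  τ ^ ((P.M : ℝ) / P.N) * t ^ (1 - P.nu) *
    (t ^ P.mu * (1 + t ^ (-P.mu) * r) / (2 * P.h) *
        (t ^ (-((P.a : ℝ) / P.q)) *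
            (∑ k ∈ Finset.range (n + 1), t ^ (-((k : ℝ) / P.q)) * P.Fk k I (θ + ζ / ϰ) ζ) / I
          - deriv (P.Istar ϰ) t / P.Istar ϰ t)
      + P.mu * r / t)

/-- The function `ℬ` of the transformed system, with the same conventions as `calA`. -/
def calB (P : PerturbedSystem) (ϰ n : ℕ) (r θ ζ τ : ℝ) : ℝ :=
  let t := P.time τ
  let I := P.energy ϰ r t
  τ ^ ((P.M : ℝ) / P.N) * t ^ (1 - P.nu) *
    (P.omega I - P.omega (P.Istar ϰ t)
      + t ^ (-((P.a : ℝ) / P.q)) *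
          (∑ k ∈ Finset.range (n + 1), t ^ (-((k : ℝ) / P.q)) * P.Gk k I (θ + ζ / ϰ) ζ))

/-- The coefficient `𝒜_K(r,θ,ζ)` of `τ^{-K/N}` in the expansion of `𝒜` as `τ → ∞`.  The terms of
`F` of index `k > K` contribute only to coefficients of higher order. -/
def Acoeff (P : PerturbedSystem) (ϰ K : ℕ) (r θ ζ : ℝ) : ℝ :=
  asympCoeff (fun ε => P.calA ϰ K r θ ζ (ε ^ P.N)⁻¹) K

/-- The coefficient `ℬ_K(r,θ,ζ)` of `τ^{-K/N}` in the expansion of `ℬ` as `τ → ∞`. -/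
def Bcoeff (P : PerturbedSystem) (ϰ K : ℕ) (r θ ζ : ℝ) : ℝ :=
  asympCoeff (fun ε => P.calB ϰ K r θ ζ (ε ^ P.N)⁻¹) K

/-! ### Averaging -/

/-- The terms `(ρ_K, ψ_K, Λ_K, Ω_K)` of one order of the averaging procedure. -/
structure AvgTerm where
  rho : ℝ → ℝ → ℝ → ℝ
  psi : ℝ → ℝ → ℝ → ℝ
  Lam : ℝ → ℝ → ℝ
  Om : ℝ → ℝ → ℝ

/-- The zero term. -/
def AvgTerm.zero : AvgTerm where
  rho := fun _ _ _ => 0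
  psi := fun _ _ _ => 0
  Lam := fun _ _ => 0
  Om := fun _ _ => 0

/-- The mean value of a `2πϰ`-periodic function. -/
def mean (ϰ : ℕ) (C : ℝ → ℝ) : ℝ :=
  1 / (2 * Real.pi * ϰ) * ∫ ζ in (0 : ℝ)..(2 * Real.pi * ϰ), C ζ

/-- The primitive of zero mean of `-(C - ⟨C⟩)/ϑ`. -/
def zeroMeanPrimitive (P : PerturbedSystem) (ϰ : ℕ) (C : ℝ → ℝ) (ζ : ℝ) : ℝ :=
  let Q : ℝ → ℝ := fun z => -(1 / P.vartheta) * ∫ v in (0 : ℝ)..z, (C v - mean ϰ C)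
  Q ζ - mean ϰ Q

/-- The near-identity change of variables
`R = r + ∑_K τ^{-(M+K)/N} ρ_K(r,θ,ζ)`, `Ψ = θ + ∑_K τ^{-(M+K)/N} ψ_K(r,θ,ζ)`, `ζ = ϑ τ`,
is to transform the system into `dR/dτ = ∑_K τ^{-(M+K)/N} Λ_K(R,Ψ)`,
`dΨ/dτ = ∑_K τ^{-(M+K)/N} Ω_K(R,Ψ)`.  Comparing the coefficients of `τ^{-(M+K)/N}` gives
`ϑ ∂_ζ ρ_K = Λ_K - 𝒜_K - 𝔄_K` and `ϑ ∂_ζ ψ_K = Ω_K - ℬ_K - 𝔅_K`, where `𝔄_K`, `𝔅_K` depend on the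
terms of order less than `K`.  For `w = ρ`, `V = Λ` this is `𝔄_K`, for `w = ψ`, `V = Ω` it is `𝔅_K`.
The three summands come from the derivatives of `w_j` along the vector field, from the derivatives
of the powers of `τ`, and from the expansion of `∑_J ε^J V_J(R,Ψ)`, `ε = τ^{-1/N}`. -/
def correction (P : PerturbedSystem) (ϰ K : ℕ) (prev : ℕ → AvgTerm)
    (w : AvgTerm → ℝ → ℝ → ℝ → ℝ) (V : AvgTerm → ℝ → ℝ → ℝ) (r θ ζ : ℝ) : ℝ :=
  (if P.M ≤ K then
      ∑ j ∈ Finset.range (K - P.M + 1),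
        (P.Acoeff ϰ (K - P.M - j) r θ ζ * deriv (fun v => w (prev j) v θ ζ) r
          + P.Bcoeff ϰ (K - P.M - j) r θ ζ * deriv (fun v => w (prev j) r v ζ) θ)
    else 0)
  - (if P.N ≤ K then
      ((P.M : ℝ) + (K - P.N : ℕ)) / P.N * w (prev (K - P.N)) r θ ζ
    else 0)
  - iteratedDeriv K
      (fun ε : ℝ => ∑ J ∈ Finset.range K, ε ^ J *
        V (prev J)
          (r + ∑ k ∈ Finset.range K, ε ^ (P.M + k) * (prev k).rho r θ ζ)
          (θ + ∑ k ∈ Finset.range K, ε ^ (P.M + k) * (prev k).psi r θ ζ)) 0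
    / (Nat.factorial K : ℝ)

/-- The term of order `K`, given the terms of lower order:
`Λ_K = ⟨𝒜_K + 𝔄_K⟩`, `Ω_K = ⟨ℬ_K + 𝔅_K⟩`, and `ρ_K`, `ψ_K` have zero mean in `ζ`. -/
def avgStep (P : PerturbedSystem) (ϰ K : ℕ) (prev : ℕ → AvgTerm) : AvgTerm where
  rho := fun r θ => P.zeroMeanPrimitive ϰ
    (fun ζ => P.Acoeff ϰ K r θ ζ + P.correction ϰ K prev AvgTerm.rho AvgTerm.Lam r θ ζ)
  psi := fun r θ => P.zeroMeanPrimitive ϰ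
    (fun ζ => P.Bcoeff ϰ K r θ ζ + P.correction ϰ K prev AvgTerm.psi AvgTerm.Om r θ ζ)
  Lam := fun r θ => mean ϰ
    (fun ζ => P.Acoeff ϰ K r θ ζ + P.correction ϰ K prev AvgTerm.rho AvgTerm.Lam r θ ζ)
  Om := fun r θ => mean ϰ
    (fun ζ => P.Bcoeff ϰ K r θ ζ + P.correction ϰ K prev AvgTerm.psi AvgTerm.Om r θ ζ)

/-- The terms `(ρ_K, ψ_K, Λ_K, Ω_K)` of all orders. -/
def avgTerm (P : PerturbedSystem) (ϰ : ℕ) (K : ℕ) : AvgTerm :=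
  P.avgStep ϰ K (fun j => if _hj : j < K then avgTerm P ϰ j else AvgTerm.zero)
termination_by K

/-- `Λ_K(r,θ)`. -/
def Lambda (P : PerturbedSystem) (ϰ K : ℕ) : ℝ → ℝ → ℝ := (P.avgTerm ϰ K).Lam

/-- `Ω_K(r,θ)`. -/
def Omega (P : PerturbedSystem) (ϰ K : ℕ) : ℝ → ℝ → ℝ := (P.avgTerm ϰ K).Om

/-! ### The assumptions on the averaged system -/

/-- `0 ≤ L ≤ min {N - M, 2M - 1}`, `Λ_K ≡ 0` for `K < L`, and `Λ_L ≢ 0`. -/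
def IsLeadingOrder (P : PerturbedSystem) (ϰ L : ℕ) : Prop :=
  L + P.M ≤ P.N ∧ L + 1 ≤ 2 * P.M ∧
  (∀ K < L, ∀ r θ, P.Lambda ϰ K r θ = 0) ∧ ∃ r θ, P.Lambda ϰ L r θ ≠ 0

/-- `λ_L`, the derivative of `Λ_L(0, ·)` at `φ₀`. -/
def lam (P : PerturbedSystem) (ϰ L : ℕ) (φ₀ : ℝ) : ℝ :=
  deriv (fun θ => P.Lambda ϰ L 0 θ) φ₀

/-- `Λ_L(0, φ₀) = 0` and `λ_L ≠ 0`. -/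
def IsSimpleZero (P : PerturbedSystem) (ϰ L : ℕ) (φ₀ : ℝ) : Prop :=
  P.Lambda ϰ L 0 φ₀ = 0 ∧ P.lam ϰ L φ₀ ≠ 0

/-- The divergence `∂_r Λ_K + ∂_θ Ω_K`. -/
def divergence (P : PerturbedSystem) (ϰ K : ℕ) (r θ : ℝ) : ℝ :=
  deriv (fun r' => P.Lambda ϰ K r' θ) r + deriv (fun θ' => P.Omega ϰ K r θ') θ

/-- `γ_D = ∂_r Λ_D(0, φ₀) + ∂_θ Ω_D(0, φ₀)`. -/
def gam (P : PerturbedSystem) (ϰ D : ℕ) (φ₀ : ℝ) : ℝ := P.divergence ϰ D 0 φ₀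

/-- `D ≥ M`, the divergence vanishes identically for `K < D`, and `γ_D ≠ 0`. -/
def IsDivergenceOrder (P : PerturbedSystem) (ϰ D : ℕ) (φ₀ : ℝ) : Prop :=
  P.M ≤ D ∧ (∀ K < D, ∀ r θ, P.divergence ϰ K r θ = 0) ∧ P.gam ϰ D φ₀ ≠ 0

/-- `γ̂_D = γ_D + δ_{M+D,N} L/N`. -/
def gamHat (P : PerturbedSystem) (ϰ L D : ℕ) (φ₀ : ℝ) : ℝ :=
  P.gam ϰ D φ₀ + if P.M + D = P.N then (L : ℝ) / P.N else 0

/-- `(X₀, Y₀)` is the `2π`-periodic solution of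
`(2π/κ) X₀' = Y₀`, `(2π/κ) Y₀' = -X₀^{2h-1}` with `X₀^{2h}/(2h) + Y₀²/2 = 1`, with the origin of the
angle at the maximum of `X₀`, as for `X` and `Y`. -/
structure IsLimitOscillation (P : PerturbedSystem) (X₀ Y₀ : ℝ → ℝ) : Prop where
  deriv_X : ∀ φ, HasDerivAt X₀ (P.kappa / (2 * Real.pi) * Y₀ φ) φ
  deriv_Y : ∀ φ, HasDerivAt Y₀ (-(P.kappa / (2 * Real.pi) * X₀ φ ^ (2 * P.h - 1))) φ
  energy_eq : ∀ φ, X₀ φ ^ (2 * P.h) / (2 * P.h) + Y₀ φ ^ 2 / 2 = 1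
  periodic_X : Function.Periodic X₀ (2 * Real.pi)
  periodic_Y : Function.Periodic Y₀ (2 * Real.pi)
  Y_zero : Y₀ 0 = 0
  X_pos : 0 < X₀ 0

/-- The asymptotics
`R(τ) = δ_{M+D,N} O(τ^{-ς|γ̂_D|/2}) + O(τ^{-M/N})`,
`Ψ(τ) = φ₀ + δ_{M+D,N} O(τ^{-ς|γ̂_D|/2}) + O(τ^{-1/N})` as `τ → ∞`. -/
def HasLockingAsymptotics (P : PerturbedSystem) (ϰ L D : ℕ) (φ₀ ς : ℝ) (R Ψ : ℝ → ℝ) : Prop :=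
  (R =O[atTop] fun τ : ℝ =>
    (if P.M + D = P.N then τ ^ (-(ς / 2 * |P.gamHat ϰ L D φ₀|)) else 0)
      + τ ^ (-((P.M : ℝ) / P.N))) ∧
  ((fun τ => Ψ τ - φ₀) =O[atTop] fun τ : ℝ =>
    (if P.M + D = P.N then τ ^ (-(ς / 2 * |P.gamHat ϰ L D φ₀|)) else 0)
      + τ ^ (-(1 / (P.N : ℝ))))

/-- With `τ = t^ν/ν`, as `t → ∞`,
`x(t) = t^{b/((h-1)q)} c_ϰ⁻¹ X₀(ϰ⁻¹ S(t) + Ψ(τ)) (1 + t^{-μ} R(τ)) (1 + O(t^{-b/((h-1)q)}))`,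
`y(t) = t^{hb/((h-1)q)} c_ϰ^{-h} Y₀(ϰ⁻¹ S(t) + Ψ(τ)) (1 + t^{-μ} R(τ))^h (1 + O(t^{-b/((h-1)q)}))`. -/
def HasResonantForm (P : PerturbedSystem) (ϰ : ℕ) (X₀ Y₀ R Ψ x y : ℝ → ℝ) : Prop :=
  let β : ℝ := (P.b : ℝ) / (((P.h : ℝ) - 1) * P.q)
  ∃ e₁ e₂ : ℝ → ℝ,
    (e₁ =O[atTop] fun t : ℝ => t ^ (-β)) ∧ (e₂ =O[atTop] fun t : ℝ => t ^ (-β)) ∧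
    ∀ᶠ t : ℝ in atTop,
      x t = t ^ β * (P.c ϰ)⁻¹ * X₀ (P.S t / ϰ + Ψ (t ^ P.nu / P.nu))
        * (1 + t ^ (-P.mu) * R (t ^ P.nu / P.nu)) * (1 + e₁ t) ∧
      y t = t ^ (P.h * β) * ((P.c ϰ) ^ P.h)⁻¹ * Y₀ (P.S t / ϰ + Ψ (t ^ P.nu / P.nu))
        * (1 + t ^ (-P.mu) * R (t ^ P.nu / P.nu)) ^ P.h * (1 + e₂ t)

end PerturbedSystem

end

open Real intervalIntegral
open scoped ContDiff
open Finset (abs_sum_le_sum_abs induction_on mul_sum smul_sum sum_Ico_eq_sub sum_add_distrib sum_congr sum_const_zero sum_div sum_eq_single sum_eq_sum_Ico_succ_bot sum_filter sum_insert sum_ite_eq' sum_le_sum sum_mul sum_neg_distrib sum_range_add sum_range_add_sum_Ico sum_range_succ sum_range_succ' sum_sub_distrib)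

local notation "Smooth" => ContDiff ℝ ∞
local notation "𝒟" => fderiv ℝ
local notation "ℝ²" => ℝ × ℝ
local notation "ℝ³" => ℝ × ℝ × ℝ
local notation "range" => Finset.range

noncomputable section

/-! ### Superposition operators on spaces of continuous functions -/

section Superposition

variable {K : Type*} [TopologicalSpace K] [CompactSpace K]
  {F G : Type} [NormedAddCommGroup F] [NormedSpace ℝ F] [NormedAddCommGroup G] [NormedSpace ℝ G]

/-- Pointwise application of a continuous family of linear maps, as a bilinear map. -/
def ContinuousMap.pointwiseApply (K : Type*) [TopologicalSpace K] [CompactSpace K]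
    (F G : Type) [NormedAddCommGroup F] [NormedSpace ℝ F] [NormedAddCommGroup G]
    [NormedSpace ℝ G] : C(K, F →L[ℝ] G) →L[ℝ] C(K, F) →L[ℝ] C(K, G) :=
  LinearMap.mkContinuous₂ (LinearMap.mk₂ ℝ (fun (A : C(K, F →L[ℝ] G)) (v : C(K, F)) =>
        (⟨fun x => A x (v x), by fun_prop⟩ : C(K, G)))
      (fun A B v => by ext x; simp) (fun c A v => by ext x; simp)
      (fun A v w => by ext x; simp) (fun c A v => by ext x; simp)) 1
    (fun A v => by
      rw [ContinuousMap.norm_le _ (by positivity)]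
      intro x
      simp only [LinearMap.mk₂_apply, ContinuousMap.coe_mk, one_mul]
      exact (ContinuousLinearMap.le_opNorm _ _).trans
        (by gcongr; exacts [A.norm_coe_le_norm x, v.norm_coe_le_norm x]))

lemma ContinuousMap.hasFDerivAt_postcomp {V : F → G} (hV : ContDiff ℝ 1 V) (u : C(K, F)) :
    HasFDerivAt (fun v : C(K, F) => (⟨V, hV.continuous⟩ : C(F, G)).comp v)
      (ContinuousMap.pointwiseApply K F G
        ((⟨𝒟 V, hV.continuous_fderiv one_ne_zero⟩ : C(F, F →L[ℝ] G)).comp u)) u := by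
  rw [hasFDerivAt_iff_isLittleO_nhds_zero, isLittleO_iff]
  intro c hc
  have hS : IsCompact (Set.range u) := isCompact_range u.continuous
  have hu := hS.uniformContinuousAt_of_continuousAt (𝒟 V)
    (fun a _ => (hV.continuous_fderiv one_ne_zero).continuousAt) (Metric.dist_mem_uniformity hc)
  rw [Metric.mem_uniformity_dist] at hu
  obtain ⟨δ, hδ, hu⟩ := hu
  filter_upwards [Metric.ball_mem_nhds (0 : C(K, F)) hδ] with w hw
  rw [ContinuousMap.norm_le _ (by positivity)]
  intro x
  have hwx : ‖w x‖ ≤ ‖w‖ := w.norm_coe_le_norm x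
  have hw' : ‖w‖ < δ := by simpa using hw
  have key := (convex_ball (u x) δ).norm_image_sub_le_of_norm_fderiv_le' (𝕜 := ℝ) (f := V)
    (φ := 𝒟 V (u x)) (C := c) (x := u x) (y := u x + w x)
    (fun y _ => hV.differentiable one_ne_zero y) (fun y hy => by
      have := @hu (u x) y (by rw [dist_comm]; exact hy) ⟨x, rfl⟩
      simp only [mem_ofPred_eq] at this
      rw [← dist_eq_norm, dist_comm]; exact this.le)
    (Metric.mem_ball_self hδ) (by simpa using hwx.trans_lt hw')
  simp only [add_sub_cancel_left] at key
  calc _ = ‖V (u x + w x) - V (u x) - 𝒟 V (u x) (w x)‖ := rfl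
    _ ≤ c * ‖w x‖ := key
    _ ≤ c * ‖w‖ := by gcongr

lemma ContinuousMap.contDiff_postcomp_nat (n : ℕ) {G : Type} [NormedAddCommGroup G]
    [NormedSpace ℝ G] {V : F → G} (hV : ContDiff ℝ n V) :
    ContDiff ℝ n (fun v : C(K, F) => (⟨V, hV.continuous⟩ : C(F, G)).comp v) := by
  induction n generalizing G with
  | zero =>
    exact contDiff_zero.2 (ContinuousMap.continuous_postcomp _)
  | succ n ih =>
    have h1 : ContDiff ℝ 1 V := hV.of_le (by norm_cast; omega)
    have hd : ContDiff ℝ n (𝒟 V) := hV.fderiv_right (by norm_cast)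
    refine contDiff_succ_iff_hasFDerivAt.2 ⟨_, ?_, fun u => hasFDerivAt_postcomp h1 u⟩
    exact (ContinuousMap.pointwiseApply K F G).contDiff.comp (ih hd)

lemma ContinuousMap.contDiff_postcomp {V : F → G} (hV : Smooth V) :
    Smooth (fun v : C(K, F) => (⟨V, hV.continuous⟩ : C(F, G)).comp v) :=
  contDiff_infty.2 fun n => ContinuousMap.contDiff_postcomp_nat n (hV.of_le (by exact_mod_cast le_top))

end Superposition

lemma ContDiff.diff {E F : Type*} [NormedAddCommGroup E] [NormedSpace ℝ E] [NormedAddCommGroup F]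
    [NormedSpace ℝ F] {f : E → F} (hf : Smooth f) : Differentiable ℝ f :=
  hf.differentiable (by simp)

/-! ### Smooth dependence of integrals on parameters -/

section ParametricIntegral

variable {E B : Type} [NormedAddCommGroup E] [NormedSpace ℝ E]
  [NormedAddCommGroup B] [NormedSpace ℝ B]

/-- A smooth function of two variables is a smooth map into the space of continuous functions of
the second variable. -/
lemma ContDiff.curry_compact {a b : ℝ} {f : E × ℝ → B} (hf : Smooth f) : Smooth (fun p : E =>
      (⟨fun s : Icc a b => f (p, s), by have := hf.continuous; fun_prop⟩ : C(Icc a b, B))) := by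
  let ι : C(Icc a b, E × ℝ) := ⟨fun s => (0, s), by fun_prop⟩
  let A : E →L[ℝ] C(Icc a b, E × ℝ) :=
    (ContinuousLinearMap.compLeftContinuous ℝ (Icc a b) (ContinuousLinearMap.inl ℝ E ℝ)).comp
      (ContinuousLinearMap.const ℝ (Icc a b))
  have h : Smooth fun p : E => A p + ι := A.contDiff.add contDiff_const
  convert (ContinuousMap.contDiff_postcomp (K := Icc a b) hf).comp h using 1
  ext p s; simp [A, ι]

def ContinuousMap.integralIcc {a b : ℝ} (hab : a ≤ b) (B : Type)
    [NormedAddCommGroup B] [NormedSpace ℝ B] : C(Icc a b, B) →L[ℝ] B :=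
  LinearMap.mkContinuous
    { toFun := fun v => ∫ s in a..b, Set.IccExtend hab v s
      map_add' := fun v w => by
        rw [← integral_add]
        · rfl
        · exact v.continuous.Icc_extend'.intervalIntegrable _ _
        · exact w.continuous.Icc_extend'.intervalIntegrable _ _
      map_smul' := fun c v => by rw [RingHom.id_apply, ← integral_smul]; rfl }
    |b - a| (fun v => by
      rw [mul_comm]
      exact norm_integral_le_of_norm_le_const fun s _ => v.norm_coe_le_norm _)

lemma ContinuousMap.integralIcc_apply {a b : ℝ} (hab : a ≤ b) (v : C(Icc a b, B)) {f : ℝ → B}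
    (hf : ∀ s : Icc a b, v s = f s) : ContinuousMap.integralIcc hab B v = ∫ s in a..b, f s := by
  refine integral_congr fun s hs => ?_
  rw [uIcc_of_le hab] at hs
  show Set.IccExtend hab v s = f s
  rw [Set.IccExtend_of_mem _ _ hs, hf]

lemma ContDiff.intervalIntegral_param {a b : ℝ} (hab : a ≤ b) {f : E × ℝ → B}
    (hf : Smooth f) : Smooth (fun p : E => ∫ s in a..b, f (p, s)) := by
  convert (ContinuousMap.integralIcc hab B).contDiff.comp
    (hf.curry_compact (a := a) (b := b)) using 1
  ext p
  exact (ContinuousMap.integralIcc_apply hab _ fun s => rfl).symm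

lemma ContDiff.exists_eq_add_smul [CompleteSpace B] {f : ℝ × E → B} (hf : Smooth f) :
    ∃ g : ℝ × E → B, Smooth g ∧ (∀ p, g (0, p) = 𝒟 f (0, p) (1, 0)) ∧
      ∀ ε p, f (ε, p) = f (0, p) + ε • g (ε, p) := by
  have hd : Smooth fun x => 𝒟 f x (1, 0) :=
    (hf.fderiv_right (by simp)).clm_apply contDiff_const
  refine ⟨fun x => ∫ s in (0 : ℝ)..1, 𝒟 f (s * x.1, x.2) (1, 0), ?_, ?_, ?_⟩
  · exact ContDiff.intervalIntegral_param zero_le_one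
      (f := fun y : (ℝ × E) × ℝ => 𝒟 f (y.2 * y.1.1, y.1.2) (1, 0)) (hd.comp (by fun_prop))
  · intro p; simp
  · intro ε p
    have h1 : ∀ s : ℝ, HasDerivAt (fun s : ℝ => f (s * ε, p))
        (ε • 𝒟 f (s * ε, p) (1, 0)) s := by
      intro s
      have h2 : HasDerivAt (fun s : ℝ => (s * ε, p)) (ε, (0 : E)) s := by
        have := ((hasDerivAt_id s).mul_const ε).prodMk (hasDerivAt_const s p)
        simpa using this
      have h3 := ((hf.diff) (s * ε, p)).hasFDerivAt.comp_hasDerivAt s h2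
      rwa [show ((ε, 0) : ℝ × E) = ε • (1, 0) by simp, map_smul] at h3
    have h4 := integral_eq_sub_of_hasDerivAt (a := 0) (b := 1) (fun s _ => h1 s)
      (Continuous.intervalIntegrable (continuous_const.smul (hd.continuous.comp (by fun_prop))) _ _)
    rw [integral_smul] at h4; simp only [h4]; simp

end ParametricIntegral

/-! ### Taylor coefficients at zero -/

section TaylorCoefficients

variable {B : Type} [NormedAddCommGroup B] [NormedSpace ℝ B]

def taylorCoef (k : ℕ) (f : ℝ → B) : B := (k.factorial : ℝ)⁻¹ • iteratedDeriv k f 0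

/-- `f` has the expansion `∑ εᵏ cₖ` up to `O(εⁿ)` as `ε → 0+`. -/
def HasExpansion (f : ℝ → B) (c : ℕ → B) (n : ℕ) : Prop :=
  (fun ε => f ε - ∑ k ∈ range n, ε ^ k • c k) =O[𝓝[>] (0 : ℝ)] fun ε => ε ^ n

lemma isBigO_pow_nhdsGT_zero {m n : ℕ} (h : m ≤ n) :
    (fun ε : ℝ => ε ^ n) =O[𝓝[>] (0 : ℝ)] fun ε => ε ^ m := by
  refine (IsBigO.of_bound 1 ?_)
  filter_upwards [Ioc_mem_nhdsGT (zero_lt_one' ℝ)] with ε hε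
  rw [one_mul, norm_pow, norm_pow, norm_of_nonneg hε.1.le]
  exact pow_le_pow_of_le_one hε.1.le hε.2 h

lemma HasExpansion.of_le {f : ℝ → B} {c : ℕ → B} {m n : ℕ} (hf : HasExpansion f c n)
    (h : m ≤ n) : HasExpansion f c m := by
  have h1 : (fun ε : ℝ => ∑ k ∈ Finset.Ico m n, ε ^ k • c k) =O[𝓝[>] (0 : ℝ)] fun ε => ε ^ m := by
    refine IsBigO.fun_sum fun k hk => ?_
    have := (isBigO_pow_nhdsGT_zero (Finset.mem_Ico.1 hk).1).smul
      (isBigO_const_const (c k) (one_ne_zero (α := ℝ)) (𝓝[>] (0 : ℝ)))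
    simpa using this
  refine ((hf.trans (isBigO_pow_nhdsGT_zero h)).add h1).congr_left fun ε => ?_
  rw [← sum_range_add_sum_Ico _ h]; abel

lemma HasExpansion.sub {f g : ℝ → B} {c d : ℕ → B} {n : ℕ} (hf : HasExpansion f c n)
    (hg : HasExpansion g d n) : HasExpansion (fun ε => f ε - g ε) (fun k => c k - d k) n := by
  refine (IsBigO.sub hf hg).congr_left fun ε => ?_
  simp only [smul_sub, sum_sub_distrib]; abel

lemma HasExpansion.congr {f g : ℝ → B} {c : ℕ → B} {n : ℕ} (hf : HasExpansion f c n)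
    (h : f =ᶠ[𝓝[>] 0] g) : HasExpansion g c n :=
  IsBigO.congr' hf (h.mono fun ε hε => by simp only [hε]) EventuallyEq.rfl

lemma HasExpansion.eq_zero {c : ℕ → B} {n : ℕ} (h : HasExpansion (fun _ => (0 : B)) c n) :
    ∀ k < n, c k = 0 := by
  intro k
  induction k using Nat.strong_induction_on with
  | _ k ih =>
    intro hk
    have h1 := h.of_le (Nat.succ_le_of_lt hk)
    have h2 : (fun ε : ℝ => ε ^ k • c k) =O[𝓝[>] (0 : ℝ)] fun ε => ε ^ (k + 1) := by
      refine (IsBigO.neg_left h1).congr_left fun ε => ?_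
      rw [sum_range_succ, Finset.sum_eq_zero]
      · simp
      · intro j hj
        rw [ih j (Finset.mem_range.1 hj) ((Finset.mem_range.1 hj).trans hk), smul_zero]
    have h3 : (fun _ : ℝ => c k) =O[𝓝[>] (0 : ℝ)] fun ε => ε := by
      refine (h2.norm_norm.mul (isBigO_refl (fun ε : ℝ => ‖(ε ^ k)⁻¹‖) _)).norm_norm.congr' ?_ ?_ |>.of_norm_norm
      · filter_upwards [self_mem_nhdsWithin] with ε hε
        have : ε ^ k ≠ 0 := pow_ne_zero _ (ne_of_gt hε)
        rw [norm_smul, mul_comm, ← mul_assoc, ← norm_mul, inv_mul_cancel₀ this]; simp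
      · filter_upwards [self_mem_nhdsWithin] with ε hε
        have : ε ^ k ≠ 0 := pow_ne_zero _ (ne_of_gt hε)
        rw [← norm_mul, pow_succ, mul_comm, ← mul_assoc, inv_mul_cancel₀ this]; simp
    have h4 : Tendsto (fun _ : ℝ => c k) (𝓝[>] (0 : ℝ)) (𝓝 0) :=
      h3.trans_tendsto (tendsto_id.mono_left nhdsWithin_le_nhds)
    exact tendsto_nhds_unique tendsto_const_nhds h4

lemma HasExpansion.unique {f : ℝ → B} {c d : ℕ → B} {n : ℕ} (hf : HasExpansion f c n)
    (hg : HasExpansion f d n) : ∀ k < n, c k = d k := by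
  intro k hk
  have := (hf.sub hg).congr (g := fun _ => 0) (by simp)
  exact sub_eq_zero.1 (this.eq_zero k hk)

lemma ContDiff.hasExpansion {f : ℝ → B} (hf : Smooth f) (n : ℕ) :
    HasExpansion f (fun k => taylorCoef k f) n := by
  have h := (taylor_isLittleO_univ (x₀ := 0) (n := n) (hf.of_le (by exact_mod_cast le_top))).isBigO
  have h3 : (fun ε => f ε - ∑ k ∈ range (n + 1), ε ^ k • taylorCoef k f)
      =O[𝓝[>] (0 : ℝ)] fun ε => ε ^ n := by
    refine (h.mono nhdsWithin_le_nhds).congr (fun ε => ?_) (fun ε => by simp)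
    rw [taylor_within_apply]; congr 1
    refine sum_congr rfl fun k _ => ?_
    rw [iteratedDerivWithin_univ, taylorCoef, smul_smul, sub_zero, mul_comm]
  have h4 : (fun ε : ℝ => ε ^ n • taylorCoef n f) =O[𝓝[>] (0 : ℝ)] fun ε => ε ^ n := by
    have := (isBigO_refl (fun ε : ℝ => ε ^ n) (𝓝[>] (0 : ℝ))).smul
      (isBigO_const_const (taylorCoef n f) (one_ne_zero (α := ℝ)) (𝓝[>] (0 : ℝ)))
    simpa using this
  refine (h3.add h4).congr_left fun ε => ?_
  rw [sum_range_succ]; abel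

lemma HasExpansion.taylorCoef_eq {f : ℝ → B} (hf : Smooth f) {c : ℕ → B} {n : ℕ}
    (h : HasExpansion f c n) {k : ℕ} (hk : k < n) : taylorCoef k f = c k :=
  (hf.hasExpansion n).unique h k hk

lemma HasExpansion.asympCoeff_eq {F : ℝ → ℝ} {c : ℕ → ℝ} {n : ℕ} (h : HasExpansion F c n) :
    ∀ k < n, asympCoeff F k = c k := by
  intro k
  induction k using Nat.strong_induction_on with
  | _ k ih =>
    intro hk
    rw [asympCoeff]
    refine Tendsto.limUnder_eq ?_
    have h1 : (fun ε => F ε - ∑ j ∈ range (k + 1), ε ^ j • c j) =o[𝓝[>] (0 : ℝ)]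
        fun ε => ε ^ k := by
      refine (h.of_le hk).trans_isLittleO ?_
      exact (isLittleO_pow_pow (𝕜 := ℝ) (Nat.lt_succ_self k)).mono nhdsWithin_le_nhds
    have h2 := h1.tendsto_div_nhds_zero.add_const (c k); rw [zero_add] at h2
    refine h2.congr' ?_
    filter_upwards [self_mem_nhdsWithin] with ε hε
    have h3 : ε ^ k ≠ 0 := pow_ne_zero _ hε.ne'
    have h4 : ∑ j : Fin k, asympCoeff F j * ε ^ (j : ℕ) = ∑ j ∈ range k, ε ^ j • c j := by
      rw [← Fin.sum_univ_eq_sum_range (fun j => ε ^ j • c j)]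
      refine sum_congr rfl fun j _ => ?_
      rw [ih j j.2 (j.2.trans hk), smul_eq_mul, mul_comm]
    rw [h4, sum_range_succ, smul_eq_mul]; field_simp; ring

lemma asympCoeff_eq_taylorCoef {F f : ℝ → ℝ} (hf : Smooth f) (h : F =ᶠ[𝓝[>] 0] f)
    (k : ℕ) : asympCoeff F k = taylorCoef k f :=
  ((hf.hasExpansion (k + 1)).congr h.symm).asympCoeff_eq k (Nat.lt_succ_self k)

end TaylorCoefficients

section TaylorCoefficientCalculus

variable {B : Type} [NormedAddCommGroup B] [NormedSpace ℝ B]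

lemma taylorCoef_zero (f : ℝ → B) : taylorCoef 0 f = f 0 := by simp [taylorCoef]

lemma taylorCoef_add {f g : ℝ → B} (hf : Smooth f) (hg : Smooth g) (k : ℕ) :
    taylorCoef k (fun ε => f ε + g ε) = taylorCoef k f + taylorCoef k g := by
  have := iteratedDeriv_fun_add (n := k) (x := 0) (hf.of_le (by exact_mod_cast le_top)).contDiffAt
    (hg.of_le (by exact_mod_cast le_top)).contDiffAt
  rw [taylorCoef, this, smul_add]; rfl

lemma taylorCoef_sub {f g : ℝ → B} (hf : Smooth f) (hg : Smooth g) (k : ℕ) :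
    taylorCoef k (fun ε => f ε - g ε) = taylorCoef k f - taylorCoef k g := by
  have := iteratedDeriv_fun_sub (n := k) (x := 0) (hf.of_le (by exact_mod_cast le_top)).contDiffAt
    (hg.of_le (by exact_mod_cast le_top)).contDiffAt
  rw [taylorCoef, this, smul_sub]; rfl

lemma taylorCoef_sum {ι : Type} {s : Finset ι} {f : ι → ℝ → B}
    (hf : ∀ i ∈ s, Smooth (f i)) (k : ℕ) :
    taylorCoef k (fun ε => ∑ i ∈ s, f i ε) = ∑ i ∈ s, taylorCoef k (f i) := by
  classical
  induction s using induction_on with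
  | empty => simp [taylorCoef]
  | insert a s ha ih =>
    simp only [sum_insert ha]
    rw [taylorCoef_add (hf a (by simp)) (ContDiff.sum fun i hi => hf i (by simp [hi])),
      ih fun i hi => hf i (by simp [hi])]

lemma taylorCoef_clm {B' : Type} [NormedAddCommGroup B'] [NormedSpace ℝ B'] (A : B →L[ℝ] B')
    {f : ℝ → B} (hf : Smooth f) (k : ℕ) : taylorCoef k (fun ε => A (f ε)) = A (taylorCoef k f) := by
  have h : HasExpansion (fun ε => A (f ε)) (fun k => A (taylorCoef k f)) (k + 1) := by
    refine ((A.isBigO_comp _ _).trans (hf.hasExpansion (k + 1))).congr_left fun ε => ?_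
    simp [map_sum]
  exact h.taylorCoef_eq (A.contDiff.comp hf) (Nat.lt_succ_self k)

lemma taylorCoef_smul_const {f : ℝ → ℝ} (hf : Smooth f) (b : B) (k : ℕ) :
    taylorCoef k (fun ε => f ε • b) = taylorCoef k f • b :=
  taylorCoef_clm (ContinuousLinearMap.toSpanSingleton ℝ b) hf k

lemma HasExpansion.pow_smul {f : ℝ → B} {c : ℕ → B} {n : ℕ} (hf : HasExpansion f c n) (j : ℕ) :
    HasExpansion (fun ε => ε ^ j • f ε) (fun k => if j ≤ k then c (k - j) else 0) (n + j) := by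
  have h := (isBigO_refl (fun ε : ℝ => ε ^ j) (𝓝[>] (0 : ℝ))).smul hf
  refine h.congr (fun ε => ?_) (fun ε => by rw [smul_eq_mul, pow_add, mul_comm])
  have h0 : ∑ k ∈ range j, ε ^ k • (if j ≤ k then c (k - j) else 0) = 0 :=
    Finset.sum_eq_zero fun k hk => by rw [if_neg (by simpa using hk), smul_zero]
  rw [smul_sub, smul_sum, add_comm n j, sum_range_add, h0, zero_add]
  refine congrArg _ (sum_congr rfl fun k _ => ?_)
  simp [smul_smul, pow_add]

lemma taylorCoef_pow_smul {f : ℝ → B} (hf : Smooth f) (j k : ℕ) :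
    taylorCoef k (fun ε => ε ^ j • f ε) = if j ≤ k then taylorCoef (k - j) f else 0 :=
  ((hf.hasExpansion (k + 1)).pow_smul j).taylorCoef_eq ((contDiff_id.pow j).smul hf) (by omega)

lemma taylorCoef_pow_smul_const (j k : ℕ) (b : B) :
    taylorCoef k (fun ε : ℝ => ε ^ j • b) = if j = k then b else 0 := by
  rw [taylorCoef_pow_smul contDiff_const]
  split_ifs with h1 h2 h2
  · subst h2; simp [taylorCoef_zero]
  · rw [taylorCoef, iteratedDeriv_const, if_neg (by omega), smul_zero]
  · omega
  · rfl

lemma taylorCoef_eq_zero_of_isBigO {f : ℝ → B} (hf : Smooth f) {n : ℕ}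
    (h : f =O[𝓝[>] (0 : ℝ)] fun ε => ε ^ n) {k : ℕ} (hk : k < n) : taylorCoef k f = 0 :=
  HasExpansion.taylorCoef_eq (c := fun _ => 0) hf (IsBigO.congr_left h fun ε => by simp) hk

lemma taylorCoef_congr_of_isBigO {f g : ℝ → B} (hf : Smooth f) (hg : Smooth g) {n : ℕ}
    (h : (fun ε => f ε - g ε) =O[𝓝[>] (0 : ℝ)] fun ε => ε ^ n) {k : ℕ} (hk : k < n) :
    taylorCoef k f = taylorCoef k g := by
  rw [← sub_eq_zero, ← taylorCoef_sub hf hg]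
  exact taylorCoef_eq_zero_of_isBigO (hf.sub hg) h hk

variable {E : Type} [NormedAddCommGroup E] [NormedSpace ℝ E] [CompleteSpace B]

/-- Taylor's formula with a smooth remainder, with parameters. -/
lemma ContDiff.taylor_smooth_remainder {f : ℝ × E → B} (hf : Smooth f) (n : ℕ) :
    (∀ k < n, Smooth fun p => taylorCoef k fun ε => f (ε, p)) ∧
    ∃ g : ℝ × E → B, Smooth g ∧ ∀ ε p, f (ε, p) =
      ∑ k ∈ range n, ε ^ k • taylorCoef k (fun ε => f (ε, p)) + ε ^ n • g (ε, p) := by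
  induction n generalizing f with
  | zero => exact ⟨by simp, f, hf, by simp⟩
  | succ n ih =>
    obtain ⟨f1, hf1, -, h1⟩ := hf.exists_eq_add_smul
    obtain ⟨hs, g, hg, hfg⟩ := ih hf1
    have hcoef : ∀ k p, taylorCoef (k + 1) (fun ε => f (ε, p)) =
        taylorCoef k (fun ε => f1 (ε, p)) := by
      intro k p
      have hp : Smooth fun ε => f1 (ε, p) := hf1.comp (by fun_prop)
      have h2 := taylorCoef_pow_smul hp 1 (k + 1)
      rw [if_pos (by omega), Nat.add_sub_cancel] at h2
      have h3 : (fun ε => f (ε, p)) = fun ε => f (0, p) + ε ^ 1 • f1 (ε, p) := by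
        ext ε; rw [h1, pow_one]
      rw [← h2, h3, taylorCoef_add (f := fun _ => f (0, p)) contDiff_const (by fun_prop)]
      simp [taylorCoef, iteratedDeriv_const]
    refine ⟨fun k hk => ?_, g, hg, fun ε p => ?_⟩
    · rcases k with _ | k
      · simp only [taylorCoef_zero]; exact hf.comp (by fun_prop)
      · simp only [hcoef]; exact hs k (by omega)
    · rw [sum_range_succ']
      simp only [hcoef, taylorCoef_zero, pow_zero, one_smul]
      rw [h1, hfg, smul_add, smul_sum]
      simp only [smul_smul, ← pow_succ']
      abel

lemma ContDiff.taylorCoef_param {f : ℝ × E → B} (hf : Smooth f) (k : ℕ) :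
    Smooth fun p => taylorCoef k fun ε => f (ε, p) :=
  (hf.taylor_smooth_remainder (k + 1)).1 k (Nat.lt_succ_self k)

lemma ContDiff.exists_eq_pow_smul {f : ℝ × E → B} (hf : Smooth f) {n : ℕ}
    (h0 : ∀ k < n, ∀ p, taylorCoef k (fun ε => f (ε, p)) = 0) :
    ∃ g : ℝ × E → B, Smooth g ∧ ∀ ε p, f (ε, p) = ε ^ n • g (ε, p) := by
  obtain ⟨-, g, hg, h⟩ := hf.taylor_smooth_remainder n
  refine ⟨g, hg, fun ε p => ?_⟩
  rw [h, Finset.sum_eq_zero fun k hk => by rw [h0 k (Finset.mem_range.1 hk), smul_zero], zero_add]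

lemma ContDiff.uniform_bound_of_taylorCoef {f : ℝ × E → B} (hf : Smooth f) {n : ℕ}
    (h0 : ∀ k < n, ∀ p, taylorCoef k (fun ε => f (ε, p)) = 0) {S : Set E} (hS : IsCompact S) :
    ∃ C, 0 ≤ C ∧ ∀ ε ∈ Icc (0 : ℝ) 1, ∀ p ∈ S, ‖f (ε, p)‖ ≤ C * ε ^ n := by
  obtain ⟨g, hg, h⟩ := hf.exists_eq_pow_smul h0
  obtain ⟨C, hC⟩ := ((isCompact_Icc (a := (0 : ℝ)) (b := 1)).prod hS).exists_bound_of_continuousOn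
    hg.continuous.continuousOn
  refine ⟨max C 0, le_max_right _ _, fun ε hε p hp => ?_⟩
  rw [h, norm_smul, mul_comm, norm_pow, norm_of_nonneg hε.1]; gcongr
  · exact pow_nonneg hε.1 _
  · exact (hC (ε, p) ⟨hε, hp⟩).trans (le_max_left _ _)

end TaylorCoefficientCalculus

/-! ### Smooth families of periodic functions -/

/-- A family `F p` of continuous `T`-periodic functions that depends smoothly on `p`, in the sense
of uniform convergence. -/
structure ParamSmooth {E : Type} [NormedAddCommGroup E] [NormedSpace ℝ E] (T : ℝ)
    (F : E → ℝ → ℝ) : Prop where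
  cont : ∀ p, Continuous (F p)
  per : ∀ p, Function.Periodic (F p) T
  smooth : ∃ Fh : E → C(Icc 0 T, ℝ), Smooth Fh ∧ ∀ p ζ, Fh p ζ = F p ζ

namespace ParamSmooth

variable {E E' : Type} [NormedAddCommGroup E] [NormedSpace ℝ E] [NormedAddCommGroup E']
  [NormedSpace ℝ E'] {T : ℝ} {F G : E → ℝ → ℝ}

lemma exists_mem_Icc (hT : 0 < T) (ζ : ℝ) :
    ∃ ξ : Icc 0 T, ∀ f : ℝ → ℝ, Function.Periodic f T → f ζ = f ξ := by
  refine ⟨⟨toIcoMod hT 0 ζ, Ico_subset_Icc_self (by simpa using toIcoMod_mem_Ico hT 0 ζ)⟩,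
    fun f hf => ?_⟩
  simp only [toIcoMod]
  exact (hf.sub_zsmul_eq _).symm

lemma eval (hT : 0 < T) (hF : ParamSmooth T F) (ζ : ℝ) : Smooth fun p => F p ζ := by
  obtain ⟨ξ, hξ⟩ := exists_mem_Icc hT ζ
  obtain ⟨Fh, h1, h2⟩ := hF.smooth
  convert (ContinuousMap.evalCLM ℝ ξ).contDiff.comp h1 using 1
  ext p
  rw [hξ _ (hF.per p), ← h2]; rfl

lemma of_param {f : E → ℝ} (hf : Smooth f) : ParamSmooth T fun p _ => f p where
  cont _ := continuous_const
  per _ _ := rfl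
  smooth := ⟨fun p => ContinuousLinearMap.const ℝ (Icc 0 T) (f p),
    (ContinuousLinearMap.const ℝ (M := ℝ) (Icc 0 T)).contDiff.comp hf, fun _ _ => rfl⟩

lemma of_periodic {c : ℝ → ℝ} (hc : Continuous c) (hper : Function.Periodic c T) :
    ParamSmooth T fun (_ : E) ζ => c ζ where
  cont _ := hc
  per _ := hper
  smooth := ⟨fun _ => ⟨fun ζ => c ζ, by fun_prop⟩, contDiff_const, fun _ _ => rfl⟩

lemma of_contDiff {f : E × ℝ → ℝ} (hf : Smooth f)
    (hper : ∀ p, Function.Periodic (fun ζ => f (p, ζ)) T) : ParamSmooth T fun p ζ => f (p, ζ) where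
  cont p := hf.continuous.comp (by fun_prop)
  per := hper
  smooth := ⟨_, hf.curry_compact, fun _ _ => rfl⟩

lemma comp (hF : ParamSmooth T F) {φ : E' → E} (hφ : Smooth φ) :
    ParamSmooth T fun p => F (φ p) where
  cont p := hF.cont _
  per p := hF.per _
  smooth := by obtain ⟨Fh, h1, h2⟩ := hF.smooth; exact ⟨_, h1.comp hφ, fun p => h2 _⟩

lemma add (hF : ParamSmooth T F) (hG : ParamSmooth T G) :
    ParamSmooth T fun p ζ => F p ζ + G p ζ where
  cont p := (hF.cont p).add (hG.cont p)
  per p := (hF.per p).add (hG.per p)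
  smooth := by
    obtain ⟨Fh, h1, h2⟩ := hF.smooth
    obtain ⟨Gh, h3, h4⟩ := hG.smooth
    exact ⟨_, h1.add h3, fun p ζ => by simp [h2, h4]⟩

lemma mul (hF : ParamSmooth T F) (hG : ParamSmooth T G) :
    ParamSmooth T fun p ζ => F p ζ * G p ζ where
  cont p := (hF.cont p).mul (hG.cont p)
  per p := (hF.per p).mul (hG.per p)
  smooth := by
    obtain ⟨Fh, h1, h2⟩ := hF.smooth
    obtain ⟨Gh, h3, h4⟩ := hG.smooth
    exact ⟨_, h1.mul h3, fun p ζ => by simp [h2, h4]⟩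

lemma neg (hF : ParamSmooth T F) : ParamSmooth T fun p ζ => -F p ζ := by
  simpa using (of_param (E := E) (f := fun _ => (-1 : ℝ)) contDiff_const).mul hF

lemma sub (hF : ParamSmooth T F) (hG : ParamSmooth T G) :
    ParamSmooth T fun p ζ => F p ζ - G p ζ := by
  simpa [sub_eq_add_neg] using hF.add hG.neg

lemma const (c : ℝ) : ParamSmooth T fun (_ : E) _ => c := of_param contDiff_const

lemma sum {ι : Type} {s : Finset ι} {F : ι → E → ℝ → ℝ} (h : ∀ i ∈ s, ParamSmooth T (F i)) :
    ParamSmooth T fun p ζ => ∑ i ∈ s, F i p ζ := by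
  classical
  induction s using induction_on with
  | empty => simpa using const 0
  | insert a s ha ih =>
    simp only [sum_insert ha]
    exact (h a (by simp)).add (ih fun i hi => h i (by simp [hi]))

lemma comp₂ (hF : ParamSmooth T F) (hG : ParamSmooth T G) {V : ℝ² → ℝ}
    (hV : Smooth V) : ParamSmooth T fun p ζ => V (F p ζ, G p ζ) where
  cont p := hV.continuous.comp ((hF.cont p).prodMk (hG.cont p))
  per p ζ := by simp only [hF.per p ζ, hG.per p ζ]
  smooth := by
    obtain ⟨Fh, h1, h2⟩ := hF.smooth
    obtain ⟨Gh, h3, h4⟩ := hG.smooth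
    have h5 : Smooth fun p =>
        ContinuousLinearMap.compLeftContinuous ℝ (Icc 0 T) (ContinuousLinearMap.inl ℝ ℝ ℝ) (Fh p) +
        ContinuousLinearMap.compLeftContinuous ℝ (Icc 0 T) (ContinuousLinearMap.inr ℝ ℝ ℝ) (Gh p) :=
      ((ContinuousLinearMap.contDiff _).comp h1).add ((ContinuousLinearMap.contDiff _).comp h3)
    exact ⟨_, (ContinuousMap.contDiff_postcomp hV).comp h5, fun p ζ => by simp [h2, h4]⟩

lemma _root_.Function.Periodic.continuous_of_continuousOn_Icc {f : ℝ → ℝ} (hT : 0 < T)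
    (hf : Function.Periodic f T) (hc : ContinuousOn f (Icc 0 T)) : Continuous f := by
  have : Fact (0 < T) := ⟨hT⟩
  have h1 : Continuous (AddCircle.liftIco T 0 f) :=
    AddCircle.liftIco_continuous (by simpa using (hf 0).symm) (by simpa using hc)
  convert h1.comp (AddCircle.continuous_mk' T) using 1
  ext ζ
  have h2 : (ζ : AddCircle T) = ((toIcoMod hT 0 ζ : ℝ) : AddCircle T) := by
    rw [toIcoMod, AddCircle.coe_sub, AddCircle.coe_zsmul, AddCircle.coe_period, smul_zero, sub_zero]
  show f ζ = AddCircle.liftIco T 0 f (ζ : AddCircle T)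
  rw [h2, AddCircle.liftIco_coe_apply (toIcoMod_mem_Ico hT 0 ζ), toIcoMod]
  exact (hf.sub_zsmul_eq _).symm

lemma fderiv_apply (hT : 0 < T) (hF : ParamSmooth T F) (v : E) :
    ParamSmooth T fun p ζ => 𝒟 (fun p => F p ζ) p v := by
  obtain ⟨Fh, h1, h2⟩ := hF.smooth
  have key : ∀ p (ζ : Icc 0 T), 𝒟 Fh p v ζ = 𝒟 (fun p => F p ζ) p v := by
    intro p ζ
    have h3 := (ContinuousMap.evalCLM ℝ ζ).hasFDerivAt.comp p (h1.diff p).hasFDerivAt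
    have h4 : (⇑(ContinuousMap.evalCLM ℝ ζ) ∘ Fh) = fun p => F p ζ := by ext p; exact h2 p ζ
    rw [h4] at h3; rw [h3.fderiv]; rfl
  have hper : ∀ p, Function.Periodic (fun ζ => 𝒟 (fun p => F p ζ) p v) T := by
    intro p ζ
    simp only [fun q => hF.per q ζ]
  refine ⟨fun p => ?_, hper, _, (h1.fderiv_right (by simp)).clm_apply contDiff_const, key⟩
  have hc : ContinuousOn (fun ζ => 𝒟 (fun p => F p ζ) p v) (Icc 0 T) := by
    rw [continuousOn_iff_continuous_domRestrict]
    convert (𝒟 Fh p v).continuous using 1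
    ext ζ; exact (key p ζ).symm
  exact (hper p).continuous_of_continuousOn_Icc hT hc

lemma continuous_uncurry (hT : 0 < T) (hF : ParamSmooth T F) :
    Continuous fun x : E × ℝ => F x.1 x.2 := by
  obtain ⟨Fh, h1, h2⟩ := hF.smooth
  rw [continuous_iff_continuousAt]
  rintro ⟨p, ζ⟩
  rw [Metric.continuousAt_iff]
  intro δ hδ
  obtain ⟨δ1, hδ1, h3⟩ := Metric.continuousAt_iff.1 h1.continuous.continuousAt (δ / 2) (half_pos hδ)
  obtain ⟨δ2, hδ2, h4⟩ := Metric.continuousAt_iff.1 ((hF.cont p).continuousAt (x := ζ)) (δ / 2)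
    (half_pos hδ)
  refine ⟨min δ1 δ2, lt_min hδ1 hδ2, ?_⟩
  rintro ⟨q, ξ⟩ h
  rw [Prod.dist_eq, max_lt_iff] at h
  obtain ⟨η, hη⟩ := exists_mem_Icc hT ξ
  have h5 : dist (F q ξ) (F p ξ) < δ / 2 := by
    rw [hη _ (hF.per q), hη _ (hF.per p), ← h2, ← h2]
    exact (ContinuousMap.dist_apply_le_dist η).trans_lt (h3 (h.1.trans_le (min_le_left _ _)))
  have h6 := h4 (h.2.trans_le (min_le_right _ _))
  calc _ ≤ dist (F q ξ) (F p ξ) + dist (F p ξ) (F p ζ) := dist_triangle _ _ _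
    _ < δ := by linarith

lemma exists_bound (hT : 0 < T) (hF : ParamSmooth T F) {S : Set E} (hS : IsCompact S) :
    ∃ C, 0 ≤ C ∧ ∀ p ∈ S, ∀ ζ, |F p ζ| ≤ C := by
  obtain ⟨Fh, h1, h2⟩ := hF.smooth
  obtain ⟨C, hC⟩ := hS.exists_bound_of_continuousOn h1.continuous.continuousOn
  refine ⟨max C 0, le_max_right _ _, fun p hp ζ => ?_⟩
  obtain ⟨η, hη⟩ := exists_mem_Icc hT ζ
  rw [hη _ (hF.per p), ← h2]
  exact ((Fh p).norm_coe_le_norm η).trans ((hC p hp).trans (le_max_left _ _))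

lemma taylorCoef_param (hT : 0 < T) {F : ℝ × E → ℝ → ℝ} (hF : ParamSmooth T F) (k : ℕ) :
    ParamSmooth T fun p ζ => taylorCoef k fun ε => F (ε, p) ζ := by
  obtain ⟨Fh, h1, h2⟩ := hF.smooth
  have key : ∀ p (ζ : Icc 0 T), taylorCoef k (fun ε => Fh (ε, p)) ζ =
      taylorCoef k fun ε => F (ε, p) ζ := by
    intro p ζ
    have h3 : Smooth fun ε => Fh (ε, p) := h1.comp (by fun_prop)
    have h4 := taylorCoef_clm (ContinuousMap.evalCLM ℝ ζ) h3 k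
    have h5 : (fun ε => ContinuousMap.evalCLM ℝ ζ (Fh (ε, p))) = fun ε => F (ε, p) ζ := by
      ext ε; exact h2 _ ζ
    rw [← h5, h4]; rfl
  have hper : ∀ p, Function.Periodic (fun ζ => taylorCoef k fun ε => F (ε, p) ζ) T := by
    intro p ζ
    simp only [fun q => hF.per q ζ]
  refine ⟨fun p => ?_, hper, _, h1.taylorCoef_param k, key⟩
  refine (hper p).continuous_of_continuousOn_Icc hT ?_
  rw [continuousOn_iff_continuous_domRestrict]
  convert (taylorCoef k (fun ε => Fh (ε, p))).continuous using 1
  ext ζ; exact (key p ζ).symm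

/-- If the Taylor coefficients of order less than `n` vanish, then the family is `O(εⁿ)`
uniformly on compact sets. -/
lemma uniform_bound_of_taylorCoef (hT : 0 < T) {F : ℝ × E → ℝ → ℝ} (hF : ParamSmooth T F) {n : ℕ}
    (h0 : ∀ k < n, ∀ p ζ, taylorCoef k (fun ε => F (ε, p) ζ) = 0) {S : Set E} (hS : IsCompact S) :
    ∃ C, 0 ≤ C ∧ ∀ ε ∈ Icc (0 : ℝ) 1, ∀ p ∈ S, ∀ ζ, |F (ε, p) ζ| ≤ C * ε ^ n := by
  obtain ⟨Fh, h1, h2⟩ := hF.smooth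
  have key : ∀ k < n, ∀ p, taylorCoef k (fun ε => Fh (ε, p)) = 0 := by
    intro k hk p
    ext ζ
    have h3 : Smooth fun ε => Fh (ε, p) := h1.comp (by fun_prop)
    have h4 := taylorCoef_clm (ContinuousMap.evalCLM ℝ ζ) h3 k
    have h5 : (fun ε => ContinuousMap.evalCLM ℝ ζ (Fh (ε, p))) = fun ε => F (ε, p) ζ := by
      ext ε; exact h2 _ ζ
    rw [h5, h0 k hk] at h4; exact h4.symm
  obtain ⟨C, hC0, hC⟩ := h1.uniform_bound_of_taylorCoef key hS
  refine ⟨C, hC0, fun ε hε p hp ζ => ?_⟩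
  obtain ⟨η, hη⟩ := exists_mem_Icc hT ζ
  rw [hη _ (hF.per _), ← h2]
  exact ((Fh _).norm_coe_le_norm η).trans (hC ε hε p hp)

/-- The primitive vanishing at zero, as a continuous linear operator. -/
def primitiveCLM (hT : 0 < T) : C(Icc 0 T, ℝ) →L[ℝ] C(Icc 0 T, ℝ) := LinearMap.mkContinuous
    { toFun := fun v => ⟨fun z => ∫ s in (0 : ℝ)..z, Set.IccExtend hT.le v s,
        (continuous_primitive (fun _ _ => v.continuous.Icc_extend'.intervalIntegrable _ _) 0).comp
          continuous_subtype_val⟩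
      map_add' := fun v w => by
        ext z
        simp only [ContinuousMap.coe_mk, ContinuousMap.add_apply]
        rw [← integral_add]
        · rfl
        · exact v.continuous.Icc_extend'.intervalIntegrable _ _
        · exact w.continuous.Icc_extend'.intervalIntegrable _ _
      map_smul' := fun c v => by
        ext z
        simp only [ContinuousMap.coe_mk, ContinuousMap.smul_apply, RingHom.id_apply]
        rw [← integral_smul]; rfl }
    T (fun v => by
      rw [ContinuousMap.norm_le _ (by positivity)]
      intro z
      rw [mul_comm]
      refine (norm_integral_le_of_norm_le_const fun s _ => v.norm_coe_le_norm _).trans ?_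
      gcongr
      rw [sub_zero, abs_of_nonneg z.2.1]; exact z.2.2)

lemma primitiveCLM_apply (hT : 0 < T) (v : C(Icc 0 T, ℝ)) {f : ℝ → ℝ}
    (hf : ∀ s : Icc 0 T, v s = f s) (z : Icc 0 T) :
    primitiveCLM hT v z = ∫ s in (0 : ℝ)..z, f s := by
  refine integral_congr fun s hs => ?_
  rw [uIcc_of_le z.2.1] at hs
  have hs' : s ∈ Icc 0 T := ⟨hs.1, hs.2.trans z.2.2⟩
  show Set.IccExtend hT.le v s = f s
  rw [Set.IccExtend_of_mem _ _ hs', hf]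

lemma integral_period (hT : 0 < T) (hF : ParamSmooth T F) :
    Smooth fun p => ∫ ζ in (0 : ℝ)..T, F p ζ := by
  obtain ⟨Fh, h1, h2⟩ := hF.smooth
  convert (ContinuousMap.integralIcc hT.le ℝ).contDiff.comp h1 using 1
  ext p
  exact (ContinuousMap.integralIcc_apply hT.le _ fun s => h2 p s).symm

lemma primitive (hT : 0 < T) (hF : ParamSmooth T F) (h0 : ∀ p, ∫ ζ in (0 : ℝ)..T, F p ζ = 0) :
    ParamSmooth T fun p z => ∫ ζ in (0 : ℝ)..z, F p ζ where
  cont p := continuous_primitive (fun _ _ => (hF.cont p).intervalIntegrable _ _) 0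
  per p z := by
    have h := (hF.per p).intervalIntegral_add_eq z 0; rw [zero_add, h0] at h
    have := integral_add_adjacent_intervals
      ((hF.cont p).intervalIntegrable 0 z) ((hF.cont p).intervalIntegrable z (z + T))
      (μ := MeasureTheory.volume)
    simp only; linarith
  smooth := by
    obtain ⟨Fh, h1, h2⟩ := hF.smooth
    exact ⟨_, (primitiveCLM hT).contDiff.comp h1, fun p z => primitiveCLM_apply hT _ (h2 p) z⟩

lemma hasDerivWithinAt_curve (hT : 0 < T) (hF : ParamSmooth T F) {F' : E → ℝ → ℝ}
    (hF' : ∀ p ζ, HasDerivAt (F p) (F' p ζ) ζ) (hF'c : Continuous fun x : E × ℝ => F' x.1 x.2)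
    [FiniteDimensional ℝ E] {p : ℝ → E} {ζ : ℝ → ℝ} {p' : E} {ζ' : ℝ} {s : Set ℝ} {τ : ℝ}
    (hp : HasDerivWithinAt p p' s τ) (hζ : HasDerivWithinAt ζ ζ' s τ) :
    HasDerivWithinAt (fun τ => F (p τ) (ζ τ))
      (𝒟 (fun q => F q (ζ τ)) (p τ) p' + ζ' * F' (p τ) (ζ τ)) s τ := by
  have h1 : Continuous fun x : E × ℝ => 𝒟 (fun q => F q x.2) x.1 := by
    rw [continuous_clm_apply]
    intro v
    exact (hF.fderiv_apply hT v).continuous_uncurry hT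
  have h2 := hasStrictFDerivAt_uncurry_coprod (𝕜 := ℝ) (u := (p τ, ζ τ)) (f := F)
    (f₁ := fun q ξ => 𝒟 (fun q => F q ξ) q)
    (f₂ := fun q ξ => ContinuousLinearMap.toSpanSingleton ℝ (F' q ξ)) (.of_forall fun v =>
      ((hF.eval hT v.2).diff v.1).hasFDerivAt)
    (.of_forall fun v => (hF' v.1 v.2).hasFDerivAt) h1.continuousAt (by
      have : Continuous fun x : E × ℝ => ContinuousLinearMap.toSpanSingleton ℝ (F' x.1 x.2) := by
        rw [continuous_clm_apply]
        intro y
        have := (continuous_const (y := y)).mul hF'c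
        simpa [ContinuousLinearMap.toSpanSingleton_apply] using! this
      exact this.continuousAt)
  have h3 := h2.hasFDerivAt.comp_hasDerivWithinAt τ (hp.prodMk hζ)
  simpa [Function.HasUncurry.uncurry] using! h3

end ParamSmooth

/-! ### Partial derivatives of functions of three real variables -/

section ThreeVariables

variable {F : ℝ³ → ℝ}

lemma hasDerivAt_fst₃ (hF : Differentiable ℝ F) (a b c : ℝ) :
    HasDerivAt (fun x => F (x, b, c)) (𝒟 F (a, b, c) (1, 0, 0)) a :=
  (hF (a, b, c)).hasFDerivAt.comp_hasDerivAt a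
    ((hasDerivAt_id a).prodMk ((hasDerivAt_const a b).prodMk (hasDerivAt_const a c)))

lemma hasDerivAt_snd₃ (hF : Differentiable ℝ F) (a b c : ℝ) :
    HasDerivAt (fun x => F (a, x, c)) (𝒟 F (a, b, c) (0, 1, 0)) b :=
  (hF (a, b, c)).hasFDerivAt.comp_hasDerivAt b
    ((hasDerivAt_const b a).prodMk ((hasDerivAt_id b).prodMk (hasDerivAt_const b c)))

lemma hasDerivAt_trd₃ (hF : Differentiable ℝ F) (a b c : ℝ) :
    HasDerivAt (fun x => F (a, b, x)) (𝒟 F (a, b, c) (0, 0, 1)) c :=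
  (hF (a, b, c)).hasFDerivAt.comp_hasDerivAt c
    ((hasDerivAt_const c a).prodMk ((hasDerivAt_const c b).prodMk (hasDerivAt_id c)))

lemma fderiv_apply₃ (x : ℝ³) (a b c : ℝ) : 𝒟 F x (a, b, c) =
    a * 𝒟 F x (1, 0, 0) + b * 𝒟 F x (0, 1, 0) + c * 𝒟 F x (0, 0, 1) := by
  have : ((a, b, c) : ℝ³) = a • ((1, 0, 0) : ℝ³) + b • ((0, 1, 0) : ℝ³) + c • ((0, 0, 1) : ℝ³) := by
    simp
  rw [this]
  simp only [map_add, map_smul, smul_eq_mul]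

lemma ContDiff.fderiv_apply_const (hF : Smooth F) (v : ℝ³) : Smooth fun x => 𝒟 F x v :=
  (hF.fderiv_right (by simp)).clm_apply contDiff_const

lemma ContDiff.linear_approx (hF : Smooth F) (h0 : ∀ η, F (η, 0, 0) = 0) {a b κ : ℝ}
    (ha : 𝒟 F (0, 0, 0) (0, 1, 0) = a) (hb : 𝒟 F (0, 0, 0) (0, 0, 1) = b)
    (hκ : 0 < κ) : ∃ δ > 0, ∀ η v u, |η| ≤ δ → |v| ≤ δ → |u| ≤ δ →
      |F (η, v, u) - a * v - b * u| ≤ κ * (|v| + |u|) := by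
  have hc : Continuous (𝒟 F) := hF.continuous_fderiv (by simp)
  obtain ⟨δ, hδ, h⟩ := Metric.continuousAt_iff.1 (hc.continuousAt (x := (0, 0, 0))) κ hκ
  refine ⟨δ / 2, half_pos hδ, fun η v u h1 h2 h3 => ?_⟩
  have hb1 : ∀ v u, |v| ≤ δ / 2 → |u| ≤ δ / 2 → ((η, v, u) : ℝ³) ∈
      Metric.ball ((0, 0, 0) : ℝ³) δ := by
    intro v u h2 h3
    rw [Metric.mem_ball, Prod.dist_eq, Prod.dist_eq]
    simp only [dist_eq, sub_zero]
    have : δ / 2 < δ := by linarith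
    exact max_lt (by linarith) (max_lt (by linarith) (by linarith))
  have key := (convex_ball ((0, 0, 0) : ℝ³) δ).norm_image_sub_le_of_norm_fderiv_le' (𝕜 := ℝ)
    (f := F) (φ := 𝒟 F (0, 0, 0)) (C := κ) (x := (η, 0, 0)) (y := (η, v, u))
    (fun y _ => hF.diff y) (fun y hy => by rw [← dist_eq_norm]; exact (h hy).le)
    (hb1 0 0 (by simp; linarith) (by simp; linarith)) (hb1 v u h2 h3)
  rw [h0, sub_zero, Prod.mk_sub_mk, Prod.mk_sub_mk, sub_self, sub_zero, sub_zero, fderiv_apply₃,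
    ha, hb] at key
  have e : F (η, v, u) - a * v - b * u = F (η, v, u) - (0 * 𝒟 F (0, 0, 0) (1, 0, 0) + v * a
    + u * b) := by ring
  rw [e, ← norm_eq_abs]
  refine key.trans (mul_le_mul_of_nonneg_left ?_ hκ.le)
  rw [Prod.norm_def, Prod.norm_def]
  simp only [norm_zero, norm_eq_abs]
  exact max_le (by positivity) (max_le (by linarith [abs_nonneg u]) (by linarith [abs_nonneg v]))

lemma ContDiff.quadratic_form (hF : Smooth F) (h0 : ∀ η, F (η, 0, 0) = 0)
    (hv : ∀ η, 𝒟 F (η, 0, 0) (0, 1, 0) = 0) (hu : ∀ η, 𝒟 F (η, 0, 0) (0, 0, 1) = 0) :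
    ∃ A₁ A₂ A₃ : ℝ³ → ℝ, Smooth A₁ ∧ Smooth A₂ ∧ Smooth A₃ ∧
      ∀ η v u, F (η, v, u) = v ^ 2 * A₁ (η, v, u) + u * v * A₂ (η, v, u) + u ^ 2 * A₃ (η, v, u) := by
  have hd := hF.diff
  obtain ⟨A, hA, hA0, h1⟩ := (show Smooth fun x : ℝ³ => F (x.2.1, x.1, x.2.2) from
    hF.comp (by fun_prop)).exists_eq_add_smul
  obtain ⟨A1, hA1, -, h2⟩ := hA.exists_eq_add_smul
  obtain ⟨A2, hA2, -, h3⟩ := (show Smooth fun x : ℝ² => A (0, x.2, x.1) from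
    hA.comp (by fun_prop)).exists_eq_add_smul
  obtain ⟨A3, hA3, hA30, h4⟩ := (show Smooth fun x : ℝ² => F (x.2, 0, x.1) from
    hF.comp (by fun_prop)).exists_eq_add_smul
  obtain ⟨A4, hA4, -, h5⟩ := hA3.exists_eq_add_smul
  have e1 : ∀ η, A (0, η, 0) = 0 := by
    intro η
    have hfun : Differentiable ℝ fun x : ℝ³ => F (x.2.1, x.1, x.2.2) := hd.comp (by fun_prop)
    rw [hA0]
    exact (hasDerivAt_fst₃ hfun 0 η 0).deriv.symm.trans
      (((hasDerivAt_snd₃ hd η 0 0).deriv).trans (hv η))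
  have e2 : ∀ η, A3 (0, η) = 0 := by
    intro η
    have hfun : Differentiable ℝ fun x : ℝ² => F (x.2, 0, x.1) := hd.comp (by fun_prop)
    have h6 := (hfun (0, η)).hasFDerivAt.comp_hasDerivAt (0 : ℝ)
      ((hasDerivAt_id (0 : ℝ)).prodMk (hasDerivAt_const (0 : ℝ) η))
    rw [hA30, ← h6.deriv]
    exact ((hasDerivAt_trd₃ hd η 0 0).deriv).trans (hu η)
  refine ⟨fun x => A1 (x.2.1, x.1, x.2.2), fun x => A2 (x.2.2, x.1), fun x => A4 (x.2.2, x.1),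
    hA1.comp (by fun_prop), hA2.comp (by fun_prop), hA4.comp (by fun_prop), fun η v u => ?_⟩
  have g1 := h1 v (η, u)
  have g2 := h2 v (η, u)
  have g3 := h3 u η
  have g4 := h4 u η
  have g5 := h5 u η
  simp only [smul_eq_mul, e1, e2, h0] at g1 g2 g3 g4 g5; simp only
  rw [g1, g2, g3, g4, g5]; ring

end ThreeVariables

/-! ### Formal solutions of a slowly varying Hamiltonian system -/

section FormalSolution

variable {h g : ℝ³ → ℝ}

/-- The system `V' = -η^s ∂_Ψ h + η^(s+e) V g`, `Ψ' = η^s ∂_V h`, with `η' = -c η^(s+a)`, has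
approximate solutions `V = Vs η`, `Ψ = Ps η` of any order. -/
lemma exists_formal_solution (hh : Smooth h) (hg : Smooth g) {φ₀ p₀ b₀ c : ℝ}
    {e a : ℕ} (he : 1 ≤ e) (ha : 2 ≤ a) (hp₀ : p₀ ≠ 0) (hb₀ : b₀ ≠ 0)
    (hV : 𝒟 h (0, 0, φ₀) (0, 1, 0) = 0) (hP : 𝒟 h (0, 0, φ₀) (0, 0, 1) = 0)
    (hVV : 𝒟 (fun x => 𝒟 h x (0, 1, 0)) (0, 0, φ₀) (0, 1, 0) = p₀)
    (hVP : 𝒟 (fun x => 𝒟 h x (0, 1, 0)) (0, 0, φ₀) (0, 0, 1) = 0)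
    (hPV : 𝒟 (fun x => 𝒟 h x (0, 0, 1)) (0, 0, φ₀) (0, 1, 0) = 0)
    (hPP : 𝒟 (fun x => 𝒟 h x (0, 0, 1)) (0, 0, φ₀) (0, 0, 1) = b₀) (n : ℕ) :
    ∃ Vs Ps r₁ r₂ : ℝ → ℝ, Smooth Vs ∧ Smooth Ps ∧ Smooth r₁ ∧ Smooth r₂ ∧ Vs 0 = 0 ∧ Ps 0 = φ₀ ∧
      (∀ η, 𝒟 h (η, Vs η, Ps η) (0, 1, 0) + c * η ^ a * deriv Ps η = η ^ n * r₁ η) ∧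
      ∀ η, -𝒟 h (η, Vs η, Ps η) (0, 0, 1) + η ^ e * (Vs η * g (η, Vs η, Ps η))
        + c * η ^ a * deriv Vs η = η ^ n * r₂ η := by
  have hhV := hh.fderiv_apply_const (0, 1, 0)
  have hhP := hh.fderiv_apply_const (0, 0, 1)
  have div : ∀ f : ℝ → ℝ, Smooth f → f 0 = 0 → ∃ g : ℝ → ℝ, Smooth g ∧ ∀ η, f η = η * g η := by
    intro f hf h0
    obtain ⟨g, hg, -, h⟩ := (show Smooth fun x : ℝ² => f x.1 from
      hf.comp (by fun_prop)).exists_eq_add_smul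
    refine ⟨fun η => g (η, 0), hg.comp (by fun_prop), fun η => ?_⟩
    simpa [h0] using h η 0
  have hadd : ∀ Vs Ps : ℝ → ℝ, Smooth Vs → Smooth Ps → Vs 0 = 0 → Ps 0 = φ₀ →
      ∀ f : ℝ³ → ℝ, Smooth f → ∀ α β : ℝ, ∃ G : ℝ² → ℝ, Smooth G ∧
        G (0, 0) = α * 𝒟 f (0, 0, φ₀) (0, 1, 0) + β * 𝒟 f (0, 0, φ₀) (0, 0, 1) ∧
        ∀ δ η, f (η, Vs η + α * δ, Ps η + β * δ) = f (η, Vs η, Ps η) + δ * G (δ, η) := by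
    intro Vs Ps hVs hPs hVs0 hPs0 f hf α β
    have hF : Smooth fun x : ℝ² => f (x.2, Vs x.2 + α * x.1, Ps x.2 + β * x.1) :=
      hf.comp (by fun_prop)
    obtain ⟨G, hG, hG0, h⟩ := hF.exists_eq_add_smul
    refine ⟨G, hG, ?_, fun δ η => by simpa using h δ η⟩
    have h5 : HasDerivAt (fun δ : ℝ => ((δ, 0) : ℝ²)) (1, 0) 0 :=
      (hasDerivAt_id (0 : ℝ)).prodMk (hasDerivAt_const (0 : ℝ) (0 : ℝ))
    have h6 := HasFDerivAt.comp_hasDerivAt (f := fun δ : ℝ => ((δ, 0) : ℝ²)) (0 : ℝ)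
      ((hF.diff) (0, 0)).hasFDerivAt h5
    have h7 : HasDerivAt (fun δ : ℝ => ((0 : ℝ), Vs 0 + α * δ, Ps 0 + β * δ)) (0, α, β) 0 := by
      refine (hasDerivAt_const _ _).prodMk (HasDerivAt.prodMk ?_ ?_)
      · simpa using ((hasDerivAt_id (0 : ℝ)).const_mul α).const_add (Vs 0)
      · simpa using ((hasDerivAt_id (0 : ℝ)).const_mul β).const_add (Ps 0)
    have h8 := ((hf.diff) (0, Vs 0 + α * 0, Ps 0 + β * 0)).hasFDerivAt.comp_hasDerivAt (0 : ℝ) h7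
    rw [hG0, ← h6.deriv]
    refine h8.deriv.trans ?_
    rw [hVs0, hPs0, mul_zero, mul_zero, add_zero, add_zero, fderiv_apply₃]; ring
  have step : ∀ n : ℕ, ∃ Vs Ps r₁ r₂ : ℝ → ℝ, Smooth Vs ∧ Smooth Ps ∧ Smooth r₁ ∧
      Smooth r₂ ∧ Vs 0 = 0 ∧ Ps 0 = φ₀ ∧
      (∀ η, 𝒟 h (η, Vs η, Ps η) (0, 1, 0) + c * η ^ a * deriv Ps η = η ^ (n + 1) * r₁ η) ∧
      ∀ η, -𝒟 h (η, Vs η, Ps η) (0, 0, 1) + η ^ e * (Vs η * g (η, Vs η, Ps η))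
        + c * η ^ a * deriv Vs η = η ^ (n + 1) * r₂ η := by
    intro n
    induction n with
    | zero =>
      obtain ⟨r₁, hr₁, h1⟩ := div (fun η => 𝒟 h (η, 0, φ₀) (0, 1, 0))
        (hhV.comp (by fun_prop)) hV
      obtain ⟨r₂, hr₂, h2⟩ := div (fun η => 𝒟 h (η, 0, φ₀) (0, 0, 1))
        (hhP.comp (by fun_prop)) hP
      exact ⟨fun _ => 0, fun _ => φ₀, r₁, fun η => -r₂ η, contDiff_const, contDiff_const, hr₁,
        hr₂.neg, rfl, rfl, fun η => by simp [h1], fun η => by simp [h2]⟩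
    | succ n ih =>
      obtain ⟨Vs, Ps, r₁, r₂, hVs, hPs, hr₁, hr₂, hVs0, hPs0, h1, h2⟩ := ih
      set α := -r₁ 0 / p₀ with hα
      set β := r₂ 0 / b₀ with hβ
      have hadd' := hadd Vs Ps hVs hPs hVs0 hPs0
      obtain ⟨G1, hG1, hG10, e1⟩ := hadd' _ hhV α β
      obtain ⟨G2, hG2, hG20, e2⟩ := hadd' _ hhP α β
      obtain ⟨G3, hG3, -, e3⟩ := hadd' (fun x => x.2.1 * g x) (by fun_prop) α β
      obtain ⟨a', rfl⟩ : ∃ a', a = a' + 2 := ⟨a - 2, by omega⟩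
      obtain ⟨e', rfl⟩ : ∃ e', e = e' + 1 := ⟨e - 1, by omega⟩
      obtain ⟨R1, hR1, k1⟩ := div
        (fun η => r₁ η + G1 (η ^ (n + 1), η) + c * η ^ (a' + 1) * ((n + 1) * β)) (by fun_prop)
        (by simp [hG10, hVV, hVP, hα]; field_simp; ring)
      obtain ⟨R2, hR2, k2⟩ := div
        (fun η => r₂ η - G2 (η ^ (n + 1), η) + η ^ (e' + 1) * G3 (η ^ (n + 1), η)
          + c * η ^ (a' + 1) * ((n + 1) * α)) (by fun_prop)
        (by simp [hG20, hPV, hPP, hβ]; field_simp; ring)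
      have hder : ∀ (f : ℝ → ℝ), Smooth f → ∀ x η : ℝ,
          deriv (fun η => f η + x * η ^ (n + 1)) η = deriv f η + x * ((n + 1) * η ^ n) := by
        intro f hf x η
        have := ((hf.diff) η).hasDerivAt.add ((hasDerivAt_pow (n + 1) η).const_mul x)
        simpa using! this.deriv
      refine ⟨fun η => Vs η + α * η ^ (n + 1), fun η => Ps η + β * η ^ (n + 1), R1, R2,
        by fun_prop, by fun_prop, hR1, hR2, by simp [hVs0], by simp [hPs0], fun η => ?_, fun η => ?_⟩
      · rw [hder _ hPs]
        have e1' := e1 (η ^ (n + 1)) η; rw [e1']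
        have h1' := h1 η
        have k1' := k1 η
        rw [show η ^ (n + 1 + 1) * R1 η = η ^ (n + 1) * (η * R1 η) by ring, ← k1']
        linear_combination h1'
      · rw [hder _ hVs]
        have e2' := e2 (η ^ (n + 1)) η
        have e3' := e3 (η ^ (n + 1)) η; simp only at e3'; rw [e2', e3']
        have h2' := h2 η
        have k2' := k2 η
        rw [show η ^ (n + 1 + 1) * R2 η = η ^ (n + 1) * (η * R2 η) by ring, ← k2']
        linear_combination h2'
  obtain ⟨Vs, Ps, r₁, r₂, hVs, hPs, hr₁, hr₂, hVs0, hPs0, h1, h2⟩ := step n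
  refine ⟨Vs, Ps, fun η => η * r₁ η, fun η => η * r₂ η, hVs, hPs, by fun_prop, by fun_prop, hVs0,
    hPs0, fun η => ?_, fun η => ?_⟩
  · rw [h1]; ring
  · rw [h2]; ring

end FormalSolution

section LyapunovEstimates

lemma le_of_deriv_le_neg_div {W W' : ℝ → ℝ} {a b G C : ℝ} (ha : 1 ≤ a) (hC : 0 ≤ C)
    (hW : ∀ τ ∈ Icc a b, HasDerivWithinAt W (W' τ) (Icc a b) τ)
    (hW' : ∀ τ ∈ Icc a b, W' τ ≤ -(G / τ) * W τ + C * τ ^ (-(G + 2))) :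
    ∀ τ ∈ Icc a b, W τ ≤ (a / τ) ^ G * (W a + C * a ^ (-(G + 1))) := by
  intro τ hτ
  have hpos : ∀ t ∈ Icc a b, 0 < t := fun t ht => by linarith [ht.1]
  have hd : ∀ t ∈ Icc a b, HasDerivWithinAt (fun t => t ^ G * W t + C * t⁻¹)
      (G * t ^ (G - 1) * W t + t ^ G * W' t + C * (-(t ^ 2)⁻¹)) (Icc a b) t := by
    intro t ht
    have h1 := (hasDerivAt_rpow_const (x := t) (p := G) (Or.inl (hpos t ht).ne')).hasDerivWithinAt
      (s := Icc a b)
    exact (h1.mul (hW t ht)).add (((hasDerivAt_inv (hpos t ht).ne').hasDerivWithinAt).const_mul C)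
  have hanti : AntitoneOn (fun t => t ^ G * W t + C * t⁻¹) (Icc a b) := by
    refine antitoneOn_of_deriv_nonpos (convex_Icc a b)
      (fun t ht => (hd t ht).continuousWithinAt) ?_ ?_
    · intro t ht
      rw [interior_Icc] at ht
      exact ((hd t (Ioo_subset_Icc_self ht)).differentiableWithinAt.mono
        (by rw [interior_Icc]; exact Ioo_subset_Icc_self))
    · intro t ht
      rw [interior_Icc] at ht
      have ht' := Ioo_subset_Icc_self ht
      rw [((hd t ht').hasDerivAt (Icc_mem_nhds ht.1 ht.2)).deriv]
      have h0 := hpos t ht'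
      have h2 := mul_le_mul_of_nonneg_left (hW' t ht') (rpow_nonneg h0.le G)
      have h3 : t ^ (G - 1) = t ^ G / t := by rw [rpow_sub h0, rpow_one]
      have h4 : t ^ G * t ^ (-(G + 2)) = (t ^ 2)⁻¹ := by
        rw [← rpow_add h0, show G + -(G + 2) = -(2 : ℕ) by push_cast; ring,
          rpow_neg h0.le, rpow_natCast]
      calc _ ≤ G * t ^ (G - 1) * W t + t ^ G * (-(G / t) * W t + C * t ^ (-(G + 2)))
            + C * (-(t ^ 2)⁻¹) := by linarith
        _ = C * (t ^ G * t ^ (-(G + 2))) - C * (t ^ 2)⁻¹ := by rw [h3]; ring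
        _ = 0 := by rw [h4, sub_self]
        _ ≤ 0 := le_rfl
  have hab : a ≤ b := hτ.1.trans hτ.2
  have h := hanti (left_mem_Icc.2 hab) hτ hτ.1; simp only at h
  have hτ0 := hpos τ hτ
  have ha0 : 0 < a := by linarith
  have hG : 0 < τ ^ G := rpow_pos_of_pos hτ0 G
  rw [div_rpow ha0.le hτ0.le, div_mul_eq_mul_div, le_div_iff₀ hG]
  have h5 : a ^ G * a ^ (-(G + 1)) = a⁻¹ := by
    rw [← rpow_add ha0, show G + -(G + 1) = -1 by ring, rpow_neg_one]
  have h6 : 0 ≤ C * τ⁻¹ := by positivity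
  calc W τ * τ ^ G ≤ a ^ G * W a + C * a⁻¹ := by linarith
    _ = _ := by rw [← h5]; ring

lemma dissipation_le {p b γ κ hv hu q v u : ℝ} (hp : 0 ≤ p) (hκ0 : 0 ≤ κ) (hκ : κ ≤ 1)
    (h1 : |hv - p * v| ≤ κ * (|v| + |u|)) (h2 : |hu - b * u| ≤ κ * (|v| + |u|))
    (h3 : |q - γ * v| ≤ κ * (|v| + |u|)) : hv * q - γ / 2 * (v * hv - u * hu) ≤
      γ * ((p * v ^ 2 + b * u ^ 2) / 2) + κ * (p + 2 * |γ| + 1) * (|v| + |u|) ^ 2 := by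
  set m := |v| + |u|
  have hv' : |v| ≤ m := by linarith [abs_nonneg u]
  have hu' : |u| ≤ m := by linarith [abs_nonneg v]
  set x1 := hv - p * v with hx1
  set x2 := hu - b * u with hx2
  set x3 := q - γ * v with hx3
  have e : hv * q - γ / 2 * (v * hv - u * hu) = γ * ((p * v ^ 2 + b * u ^ 2) / 2)
      + (p * (v * x3) + γ / 2 * (v * x1) + x1 * x3 + γ / 2 * (u * x2)) := by
    rw [hx1, hx2, hx3]; ring
  rw [e]
  have b1 : p * (v * x3) ≤ p * (m * (κ * m)) := by
    refine mul_le_mul_of_nonneg_left ((le_abs_self _).trans ?_) hp; rw [abs_mul]; gcongr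
  have b2 : γ / 2 * (v * x1) ≤ |γ| / 2 * (m * (κ * m)) := by
    refine (le_abs_self _).trans ?_
    rw [abs_mul, abs_mul, abs_div, abs_two]; gcongr
  have b3 : x1 * x3 ≤ κ * m * (1 * m) := by
    refine (le_abs_self _).trans ?_; rw [abs_mul]
    have : |x3| ≤ 1 * m := h3.trans (by gcongr); gcongr
  have b4 : γ / 2 * (u * x2) ≤ |γ| / 2 * (m * (κ * m)) := by
    refine (le_abs_self _).trans ?_
    rw [abs_mul, abs_mul, abs_div, abs_two]; gcongr
  have : 0 ≤ |γ| * (m * (κ * m)) := by positivity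
  nlinarith [this]

/-- The value of a function from its approximate gradient on rays. -/
lemma abs_sub_quadratic_le {f fv fu : ℝ → ℝ} {p b κ v u : ℝ}
    (hf : ∀ s ∈ Icc (0 : ℝ) 1, HasDerivAt f (v * fv s + u * fu s) s) (h0 : f 0 = 0)
    (h1 : ∀ s ∈ Icc (0 : ℝ) 1, |fv s - p * (s * v)| ≤ κ * (|s * v| + |s * u|))
    (h2 : ∀ s ∈ Icc (0 : ℝ) 1, |fu s - b * (s * u)| ≤ κ * (|s * v| + |s * u|)) (hκ : 0 ≤ κ) :
    |f 1 - (p * v ^ 2 + b * u ^ 2) / 2| ≤ κ * (|v| + |u|) ^ 2 := by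
  have hd : ∀ s ∈ Icc (0 : ℝ) 1, HasDerivWithinAt
      (fun s => f s - s ^ 2 * ((p * v ^ 2 + b * u ^ 2) / 2))
      (v * (fv s - p * (s * v)) + u * (fu s - b * (s * u))) (Icc 0 1) s := by
    intro s hs
    have := ((hf s hs).sub ((hasDerivAt_pow 2 s).mul_const ((p * v ^ 2 + b * u ^ 2) / 2)))
    rw [show v * (fv s - p * (s * v)) + u * (fu s - b * (s * u)) = v * fv s + u * fu s -
      (2 : ℕ) * s ^ (2 - 1) * ((p * v ^ 2 + b * u ^ 2) / 2) by push_cast; ring]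
    exact this.hasDerivWithinAt
  have := norm_image_sub_le_of_norm_deriv_le_segment' (C := κ * (|v| + |u|) ^ 2) hd (fun s hs => by
    have hs' := Ico_subset_Icc_self hs
    have hm : |s * v| + |s * u| ≤ |v| + |u| := by
      rw [abs_mul, abs_mul, abs_of_nonneg hs.1]
      have := hs.2.le
      nlinarith [abs_nonneg v, abs_nonneg u]
    calc _ ≤ |v| * |fv s - p * (s * v)| + |u| * |fu s - b * (s * u)| := by
          rw [norm_eq_abs, ← abs_mul, ← abs_mul]; exact abs_add_le _ _
      _ ≤ |v| * (κ * (|v| + |u|)) + |u| * (κ * (|v| + |u|)) := by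
          gcongr
          · exact (h1 s hs').trans (by gcongr)
          · exact (h2 s hs').trans (by gcongr)
      _ = _ := by ring) 1 (right_mem_Icc.2 zero_le_one)
  simpa [h0] using this

end LyapunovEstimates

section RelativeEnergy

variable {h : ℝ³ → ℝ} {Vs Ps : ℝ → ℝ}

/-- The energy relative to the curve `(Vs, Ps)`. -/
def relativeEnergy (h : ℝ³ → ℝ) (Vs Ps : ℝ → ℝ) (x : ℝ³) : ℝ :=
  h (x.1, Vs x.1 + x.2.1, Ps x.1 + x.2.2) - h (x.1, Vs x.1, Ps x.1)
    - x.2.1 * 𝒟 h (x.1, Vs x.1, Ps x.1) (0, 1, 0)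
    - x.2.2 * 𝒟 h (x.1, Vs x.1, Ps x.1) (0, 0, 1)

variable (hh : Smooth h) (hVs : Smooth Vs) (hPs : Smooth Ps)
include hh hVs hPs

lemma contDiff_relativeEnergy : Smooth (relativeEnergy h Vs Ps) := by
  have h1 := hh.fderiv_apply_const (0, 1, 0)
  have h2 := hh.fderiv_apply_const (0, 0, 1)
  unfold relativeEnergy
  fun_prop

lemma fderiv_relativeEnergy_snd (η v u : ℝ) :
    𝒟 (relativeEnergy h Vs Ps) (η, v, u) (0, 1, 0) =
      𝒟 h (η, Vs η + v, Ps η + u) (0, 1, 0) - 𝒟 h (η, Vs η, Ps η) (0, 1, 0) := by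
  have h1 := hasDerivAt_snd₃ ((contDiff_relativeEnergy hh hVs hPs).diff) η v u
  have h2 := (hasDerivAt_snd₃ (hh.diff) η (Vs η + v) (Ps η + u)).scomp v
    ((hasDerivAt_id v).const_add (Vs η))
  have h3 := ((h2.sub_const (h (η, Vs η, Ps η))).sub
    ((hasDerivAt_id v).mul_const (𝒟 h (η, Vs η, Ps η) (0, 1, 0)))).sub_const
      (u * 𝒟 h (η, Vs η, Ps η) (0, 0, 1))
  have := h1.unique h3; simpa using this

lemma fderiv_relativeEnergy_trd (η v u : ℝ) :
    𝒟 (relativeEnergy h Vs Ps) (η, v, u) (0, 0, 1) =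
      𝒟 h (η, Vs η + v, Ps η + u) (0, 0, 1) - 𝒟 h (η, Vs η, Ps η) (0, 0, 1) := by
  have h1 := hasDerivAt_trd₃ ((contDiff_relativeEnergy hh hVs hPs).diff) η v u
  have h2 := (hasDerivAt_trd₃ (hh.diff) η (Vs η + v) (Ps η + u)).scomp u
    ((hasDerivAt_id u).const_add (Ps η))
  have h3 := (((h2.sub_const (h (η, Vs η, Ps η))).sub_const
    (v * 𝒟 h (η, Vs η, Ps η) (0, 1, 0)))).sub
      ((hasDerivAt_id u).mul_const (𝒟 h (η, Vs η, Ps η) (0, 0, 1)))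
  have := h1.unique h3; simpa using this

/-- The relative energy and its derivative in `η` vanish to second order on the curve. -/
lemma exists_bound_relativeEnergy : ∃ C, 0 ≤ C ∧ ∀ η v u, |η| ≤ 1 → |v| ≤ 1 → |u| ≤ 1 →
    |𝒟 (relativeEnergy h Vs Ps) (η, v, u) (1, 0, 0)| ≤ C * (|v| + |u|) ^ 2 := by
  have hc := contDiff_relativeEnergy hh hVs hPs
  obtain ⟨A₁, A₂, A₃, h1, h2, h3, e⟩ := hc.quadratic_form (fun η => by simp [relativeEnergy])
    (fun η => by rw [fderiv_relativeEnergy_snd hh hVs hPs]; simp)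
    (fun η => by rw [fderiv_relativeEnergy_trd hh hVs hPs]; simp)
  have hK : IsCompact (Icc (-1 : ℝ) 1 ×ˢ Icc (-1 : ℝ) 1 ×ˢ Icc (-1 : ℝ) 1) :=
    isCompact_Icc.prod (isCompact_Icc.prod isCompact_Icc)
  have hb : ∀ A : ℝ³ → ℝ, Smooth A → ∃ C, 0 ≤ C ∧ ∀ η v u, |η| ≤ 1 → |v| ≤ 1 → |u| ≤ 1 →
      |𝒟 A (η, v, u) (1, 0, 0)| ≤ C := by
    intro A hA
    obtain ⟨C, hC⟩ := hK.exists_bound_of_continuousOn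
      (hA.fderiv_apply_const (1, 0, 0)).continuous.continuousOn
    exact ⟨max C 0, le_max_right _ _, fun η v u h1 h2 h3 => (hC (η, v, u)
      ⟨abs_le.1 h1, abs_le.1 h2, abs_le.1 h3⟩).trans (le_max_left _ _)⟩
  obtain ⟨C₁, p1, b1⟩ := hb A₁ h1
  obtain ⟨C₂, p2, b2⟩ := hb A₂ h2
  obtain ⟨C₃, p3, b3⟩ := hb A₃ h3
  refine ⟨C₁ + C₂ + C₃, by positivity, fun η v u k1 k2 k3 => ?_⟩
  have h4 := hasDerivAt_fst₃ (hc.diff) η v u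
  have h5 := (((hasDerivAt_fst₃ (h1.diff) η v u).const_mul (v ^ 2)).add
    ((hasDerivAt_fst₃ (h2.diff) η v u).const_mul (u * v))).add
    ((hasDerivAt_fst₃ (h3.diff) η v u).const_mul (u ^ 2))
  have h6 := h4.unique (h5.congr_of_eventuallyEq (.of_forall fun x => e x v u))
  rw [h6]
  have q1 : |v ^ 2| ≤ (|v| + |u|) ^ 2 := by rw [abs_pow]; gcongr; linarith [abs_nonneg u]
  have q2 : |u * v| ≤ (|v| + |u|) ^ 2 := by rw [abs_mul]; nlinarith [abs_nonneg u, abs_nonneg v]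
  have q3 : |u ^ 2| ≤ (|v| + |u|) ^ 2 := by rw [abs_pow]; gcongr; linarith [abs_nonneg v]
  calc _ ≤ |v ^ 2| * |𝒟 A₁ (η, v, u) (1, 0, 0)| + |u * v| * |𝒟 A₂ (η, v, u) (1, 0, 0)|
      + |u ^ 2| * |𝒟 A₃ (η, v, u) (1, 0, 0)| := by
        rw [← abs_mul, ← abs_mul, ← abs_mul]; exact abs_add_three _ _ _
    _ ≤ (|v| + |u|) ^ 2 * C₁ + (|v| + |u|) ^ 2 * C₂ + (|v| + |u|) ^ 2 * C₃ := by
        gcongr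
        exacts [b1 _ _ _ k1 k2 k3, b2 _ _ _ k1 k2 k3, b3 _ _ _ k1 k2 k3]
    _ = _ := by ring

end RelativeEnergy

lemma abs_mul_le_sq_add (v u : ℝ) : |u * v| ≤ (|v| + |u|) ^ 2 := by
  rw [abs_mul]; nlinarith [abs_nonneg u, abs_nonneg v]

set_option maxHeartbeats 1000000 in
lemma modifiedEnergy_deriv_le {p b γ γ₁ κ mn CH Cρ hv hu hη q v u η ρ₁ ρ₂ F : ℝ} {e s N : ℕ}
    (hN : 1 ≤ N) (he : 1 ≤ e) (hdN : s + e ≤ 2 * N) (hp : 0 ≤ p) (hb : 0 ≤ b) (hγ : γ < γ₁)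
    (hγ₁ : γ₁ < 0) (_ : 0 < mn) (hCH : 0 ≤ CH) (hκ0 : 0 < κ) (hκ1 : κ ≤ 1)
    (hκ3 : κ * (p + 2 * |γ| + 1 + CH + |γ| * (e + 1) + |γ| * (|γ| + 1) + |γ| * (1 + |γ|)) * (8 / mn)
      ≤ γ₁ - γ) (hη0 : 0 < η) (hηκ : η ≤ κ)
    (h1 : |hv - p * v| ≤ κ * (|v| + |u|)) (h2 : |hu - b * u| ≤ κ * (|v| + |u|))
    (h3 : |q - γ * v| ≤ κ * (|v| + |u|)) (h4 : |hη| ≤ CH * (|v| + |u|) ^ 2)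
    (hm : (|v| + |u|) ^ 2 ≤ 4 / mn * ((p * v ^ 2 + b * u ^ 2) / 2)) (hm2 : |v| + |u| ≤ 2)
    (hF : |F - (p * v ^ 2 + b * u ^ 2) / 2| ≤ κ * (1 + |γ|) * (|v| + |u|) ^ 2)
    (hρ₁ : |ρ₁| ≤ Cρ) (hρ₂ : |ρ₂| ≤ Cρ) :
    hη * (-(1 / (2 * N)) * η ^ (2 * N + 1)) + hv * (-(η ^ s * hu) + η ^ (s + e) * q + ρ₁)
      + hu * (η ^ s * hv + ρ₂)
      - γ / 2 * ((e * η ^ (e - 1) * (-(1 / (2 * N)) * η ^ (2 * N + 1))) * (u * v)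
        + η ^ e * ((η ^ s * hv + ρ₂) * v + u * (-(η ^ s * hu) + η ^ (s + e) * q + ρ₁))) ≤
      η ^ (s + e) * (γ₁ * F) + (2 * (p + 1) + 2 * (b + 1) + 2 * |γ|) * Cρ := by
  have hdis := dissipation_le hp hκ0.le hκ1 h1 h2 h3
  set m := |v| + |u| with hm_def
  set Q := (p * v ^ 2 + b * u ^ 2) / 2
  have hv' : |v| ≤ m := by linarith [abs_nonneg u]
  have hu' : |u| ≤ m := by linarith [abs_nonneg v]
  have hη1 : η ≤ 1 := hηκ.trans hκ1
  have hCρ : 0 ≤ Cρ := (abs_nonneg _).trans hρ₁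
  have hE0 : 0 < η ^ (s + e) := pow_pos hη0 _
  have hηN : η ^ (2 * N + 1) ≤ η ^ (s + e) * κ := by
    calc η ^ (2 * N + 1) ≤ η ^ (s + e + 1) := pow_le_pow_of_le_one hη0.le hη1 (by omega)
      _ = η ^ (s + e) * η := pow_succ _ _
      _ ≤ _ := by gcongr
  have hηe : η ^ e ≤ κ := (pow_le_of_le_one hη0.le hη1 (by omega)).trans hηκ
  have hN' : (1 : ℝ) / (2 * N) ≤ 1 := by
    have : (1 : ℝ) ≤ N := by exact_mod_cast hN
    rw [div_le_one (by positivity)]; linarith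
  have hN0 : (0 : ℝ) ≤ 1 / (2 * N) := by positivity
  have hη' : |(-(1 / (2 * N)) * η ^ (2 * N + 1))| ≤ η ^ (s + e) * κ := by
    rw [abs_mul, abs_neg, abs_of_nonneg hN0, abs_of_pos (pow_pos hη0 _)]
    calc _ ≤ 1 * η ^ (2 * N + 1) := by gcongr
      _ ≤ _ := by linarith
  set η' := (-(1 / (2 * N)) * η ^ (2 * N + 1) : ℝ)
  have k1 : κ * m ≤ 1 * 2 := by gcongr
  have hvb : |hv| ≤ 2 * (p + 1) := by
    have : |hv| ≤ |hv - p * v| + p * |v| := by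
      have := abs_sub_abs_le_abs_sub hv (p * v)
      rw [abs_mul, abs_of_nonneg hp] at this; linarith
    have k2 : p * |v| ≤ p * 2 := by gcongr; linarith
    linarith
  have hub : |hu| ≤ 2 * (b + 1) := by
    have : |hu| ≤ |hu - b * u| + b * |u| := by
      have := abs_sub_abs_le_abs_sub hu (b * u)
      rw [abs_mul, abs_of_nonneg hb] at this; linarith
    have k2 : b * |u| ≤ b * 2 := by gcongr; linarith
    linarith
  have hqb : |q| ≤ (|γ| + 1) * m := by
    have : |q| ≤ |q - γ * v| + |γ| * |v| := by
      have := abs_sub_abs_le_abs_sub q (γ * v)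
      rw [abs_mul] at this; linarith
    have k2 : |γ| * |v| ≤ |γ| * m := by gcongr
    have k3 : κ * m ≤ 1 * m := by gcongr
    linarith
  have huv : |u * v| ≤ m ^ 2 := by rw [abs_mul, sq]; gcongr
  have t1 : hη * η' ≤ η ^ (s + e) * (κ * CH * m ^ 2) := by
    refine (le_abs_self _).trans ?_; rw [abs_mul]
    calc _ ≤ (CH * m ^ 2) * (η ^ (s + e) * κ) := by gcongr
      _ = _ := by ring
  have t2 : -(γ / 2) * (e * η ^ (e - 1) * η' * (u * v)) ≤ η ^ (s + e) * (κ * (|γ| * (e + 1)) * m ^ 2) := by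
    refine (le_abs_self _).trans ?_
    rw [abs_mul, abs_mul, abs_mul, abs_neg, abs_div, abs_two, abs_mul, Nat.abs_cast,
      abs_of_pos (pow_pos hη0 _)]
    have : η ^ (e - 1) ≤ 1 := pow_le_one₀ hη0.le hη1
    calc _ ≤ |γ| / 1 * ((e + 1) * 1 * (η ^ (s + e) * κ) * m ^ 2) := by gcongr <;> linarith
      _ = _ := by ring
  have t3 : -(γ / 2) * (η ^ e * (u * (η ^ (s + e) * q))) ≤
      η ^ (s + e) * (κ * (|γ| * (|γ| + 1)) * m ^ 2) := by
    refine (le_abs_self _).trans ?_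
    rw [abs_mul, abs_mul, abs_mul, abs_neg, abs_div, abs_two, abs_mul, abs_of_pos hE0,
      abs_of_pos (pow_pos hη0 _)]
    calc _ ≤ |γ| / 1 * (κ * (m * (η ^ (s + e) * ((|γ| + 1) * m)))) := by gcongr; linarith
      _ = _ := by ring
  have t4 : hv * ρ₁ + hu * ρ₂ - γ / 2 * (η ^ e * (ρ₂ * v + u * ρ₁)) ≤
      (2 * (p + 1) + 2 * (b + 1) + 2 * |γ|) * Cρ := by
    have s1 : hv * ρ₁ ≤ 2 * (p + 1) * Cρ := (le_abs_self _).trans (by rw [abs_mul]; gcongr)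
    have s2 : hu * ρ₂ ≤ 2 * (b + 1) * Cρ := (le_abs_self _).trans (by rw [abs_mul]; gcongr)
    have s3 : -(γ / 2) * (η ^ e * (ρ₂ * v + u * ρ₁)) ≤ |γ| / 1 * (1 * (2 * Cρ)) := by
      refine (le_abs_self _).trans ?_
      rw [abs_mul, abs_mul, abs_neg, abs_div, abs_two, abs_of_pos (pow_pos hη0 _)]
      have : |ρ₂ * v + u * ρ₁| ≤ 2 * Cρ := by
        calc _ ≤ |ρ₂| * |v| + |u| * |ρ₁| := by rw [← abs_mul, ← abs_mul]; exact abs_add_le _ _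
          _ ≤ Cρ * |v| + |u| * Cρ := by gcongr
          _ = m * Cρ := by rw [hm_def]; ring
          _ ≤ _ := by gcongr
      have h5 : η ^ e ≤ 1 := hηe.trans hκ1; gcongr; linarith
    linarith
  have key : γ * Q + κ * (p + 2 * |γ| + 1 + CH + |γ| * (e + 1) + |γ| * (|γ| + 1)) * m ^ 2
      ≤ γ₁ * F := by
    set Cx := p + 2 * |γ| + 1 + CH + |γ| * (e + 1) + |γ| * (|γ| + 1)
    have hQ0 : 0 ≤ Q := by positivity
    have hg : |γ₁| ≤ |γ| := by rw [abs_of_neg hγ₁, abs_of_neg (hγ.trans hγ₁)]; linarith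
    have a1 : γ₁ * Q - |γ| * (κ * (1 + |γ|) * m ^ 2) ≤ γ₁ * F := by
      have : |γ₁ * (F - Q)| ≤ |γ| * (κ * (1 + |γ|) * m ^ 2) := by rw [abs_mul]; gcongr
      have := neg_abs_le (γ₁ * (F - Q)); linarith
    have a2 : κ * (Cx + |γ| * (1 + |γ|)) * m ^ 2 ≤ (γ₁ - γ) * Q := by
      calc _ ≤ κ * (Cx + |γ| * (1 + |γ|)) * (4 / mn * Q) := by gcongr
        _ = (κ * (Cx + |γ| * (1 + |γ|)) * (8 / mn)) * (Q / 2) := by ring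
        _ ≤ (γ₁ - γ) * (Q / 2) := by gcongr
        _ ≤ _ := mul_le_mul_of_nonneg_left (by linarith) (by linarith)
    linarith
  have key' := mul_le_mul_of_nonneg_left key hE0.le
  have hdis' := mul_le_mul_of_nonneg_left hdis hE0.le
  have expand : hη * η' + hv * (-(η ^ s * hu) + η ^ (s + e) * q + ρ₁) + hu * (η ^ s * hv + ρ₂)
      - γ / 2 * ((e * η ^ (e - 1) * η') * (u * v)
        + η ^ e * ((η ^ s * hv + ρ₂) * v + u * (-(η ^ s * hu) + η ^ (s + e) * q + ρ₁))) =
      η ^ (s + e) * (hv * q - γ / 2 * (v * hv - u * hu)) + hη * η'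
      + -(γ / 2) * (e * η ^ (e - 1) * η' * (u * v)) + -(γ / 2) * (η ^ e * (u * (η ^ (s + e) * q)))
      + (hv * ρ₁ + hu * ρ₂ - γ / 2 * (η ^ e * (ρ₂ * v + u * ρ₁))) := by
    rw [pow_add η s e]; ring
  rw [expand]; linarith

lemma hasDerivAt_rpow_neg_inv {N : ℕ} (hN : 1 ≤ N) {τ : ℝ} (hτ : 0 < τ) :
    HasDerivAt (fun τ : ℝ => τ ^ (-(1 / (2 * N : ℝ))))
      (-(1 / (2 * N)) * (τ ^ (-(1 / (2 * N : ℝ)))) ^ (2 * N + 1)) τ := by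
  have hN' : (N : ℝ) ≠ 0 := by positivity
  have := hasDerivAt_rpow_const (x := τ) (p := -(1 / (2 * N : ℝ))) (Or.inl hτ.ne')
  rw [← rpow_natCast, ← rpow_mul hτ.le]
  convert this using 3
  push_cast; field_simp; ring

lemma rpow_neg_inv_pow {N : ℕ} (hN : 1 ≤ N) {τ : ℝ} (hτ : 0 < τ) :
    (τ ^ (-(1 / (2 * N : ℝ)))) ^ (2 * N) = τ⁻¹ := by
  have hN' : (N : ℝ) ≠ 0 := by positivity
  rw [← rpow_natCast, ← rpow_mul hτ.le, ← rpow_neg_one]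
  congr 1; push_cast; field_simp

lemma tendsto_rpow_neg_inv {N : ℕ} (hN : 1 ≤ N) :
    Tendsto (fun τ : ℝ => τ ^ (-(1 / (2 * N : ℝ)))) atTop (𝓝 0) :=
  tendsto_rpow_neg_atTop (by have : (1 : ℝ) ≤ N := by exact_mod_cast hN
                             positivity)

set_option maxHeartbeats 2000000 in
/-- Trapping and decay near the formal solution of a slowly varying dissipative perturbation of a
Hamiltonian system near a minimum of the energy, `η = τ^{-1/(2N)}`. -/
lemma lyapunov_trapping {h g : ℝ³ → ℝ} (hh : Smooth h) (hg : Smooth g)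
    {φ₀ p₀ b₀ γ : ℝ} {N s e n : ℕ} {G C₀ δ₀ : ℝ} (hN : 1 ≤ N) (he : 1 ≤ e) (hdN : s + e ≤ 2 * N)
    (hp₀ : 0 < p₀) (hb₀ : 0 < b₀) (hγ : γ < 0)
    (hVV : 𝒟 (fun x => 𝒟 h x (0, 1, 0)) (0, 0, φ₀) (0, 1, 0) = p₀)
    (hVP : 𝒟 (fun x => 𝒟 h x (0, 1, 0)) (0, 0, φ₀) (0, 0, 1) = 0)
    (hPV : 𝒟 (fun x => 𝒟 h x (0, 0, 1)) (0, 0, φ₀) (0, 1, 0) = 0)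
    (hPP : 𝒟 (fun x => 𝒟 h x (0, 0, 1)) (0, 0, φ₀) (0, 0, 1) = b₀)
    (hgγ : g (0, 0, φ₀) = γ) (hG : 0 < G) (hGγ : s + e = 2 * N → G < -γ)
    (hn : 2 * N * (G + 2) ≤ n) (hδ₀ : 0 < δ₀) (hC₀ : 0 ≤ C₀) {Vs Ps r₁ r₂ : ℝ → ℝ}
    (hVs : Smooth Vs) (hPs : Smooth Ps) (hr₁ : Smooth r₁) (hr₂ : Smooth r₂)
    (hVs0 : Vs 0 = 0) (hPs0 : Ps 0 = φ₀) (hf₁ : ∀ η, 𝒟 h (η, Vs η, Ps η) (0, 1, 0)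
      + 1 / (2 * N) * η ^ (2 * N + 1 - s) * deriv Ps η = η ^ n * r₁ η)
    (hf₂ : ∀ η, -𝒟 h (η, Vs η, Ps η) (0, 0, 1) + η ^ e * (Vs η * g (η, Vs η, Ps η))
        + 1 / (2 * N) * η ^ (2 * N + 1 - s) * deriv Vs η = η ^ n * r₂ η) :
    ∃ δ, 0 < δ ∧ δ ≤ δ₀ ∧ ∃ δ', 0 < δ' ∧ ∃ τ₀, 1 ≤ τ₀ ∧ ∀ a ≥ τ₀, ∀ b ≥ a, ∀ V Ψ V' Ψ' : ℝ → ℝ,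
      (∀ τ ∈ Icc a b, HasDerivWithinAt V (V' τ) (Icc a b) τ ∧
        HasDerivWithinAt Ψ (Ψ' τ) (Icc a b) τ ∧ |V τ| ≤ δ ∧ |Ψ τ - φ₀| ≤ δ ∧
        ∀ η, η = τ ^ (-(1 / (2 * N : ℝ))) →
          |V' τ - (-(η ^ s * 𝒟 h (η, V τ, Ψ τ) (0, 0, 1))
            + η ^ (s + e) * (V τ * g (η, V τ, Ψ τ)))| ≤ C₀ * η ^ n ∧
          |Ψ' τ - η ^ s * 𝒟 h (η, V τ, Ψ τ) (0, 1, 0)| ≤ C₀ * η ^ n) →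
      |V a| ≤ δ' → |Ψ a - φ₀| ≤ δ' → ∀ τ ∈ Icc a b, |V τ| ≤ δ / 4 ∧ |Ψ τ - φ₀| ≤ δ / 4 ∧
        ∀ η, η = τ ^ (-(1 / (2 * N : ℝ))) →
          (V τ - Vs η) ^ 2 + (Ψ τ - Ps η) ^ 2 ≤ δ ^ 2 * (a / τ) ^ G := by
  set H := relativeEnergy h Vs Ps with hHdef
  have hH : Smooth H := contDiff_relativeEnergy hh hVs hPs
  have hHd := hH.diff
  obtain ⟨γ₁, hγ₁, hγ₁0, hγ₁G⟩ : ∃ γ₁, γ < γ₁ ∧ γ₁ < 0 ∧ (s + e = 2 * N → γ₁ ≤ -G) := by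
    by_cases hc : s + e = 2 * N
    · exact ⟨-G, by linarith [hGγ hc], by linarith, fun _ => le_rfl⟩
    · exact ⟨γ / 2, by linarith, by linarith, fun h => absurd h hc⟩
  set mn := min p₀ b₀
  have hmn0 : 0 < mn := lt_min hp₀ hb₀
  obtain ⟨CH, hCH0, hCH⟩ := exists_bound_relativeEnergy hh hVs hPs
  set C₁ := p₀ + 2 * |γ| + 1 with hC₁
  set C₂ := C₁ + CH + |γ| * (e + 1) + |γ| * (|γ| + 1) + |γ| * (1 + |γ|) with hC₂
  obtain ⟨κ, hκ0, hκ1, hκ2, hκ3⟩ : ∃ κ > 0, κ ≤ 1 ∧ κ * (1 + |γ|) * (4 / mn) ≤ 1 / 2 ∧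
      κ * C₂ * (8 / mn) ≤ γ₁ - γ := by
    refine ⟨min 1 (min (1 / 2 / ((1 + |γ|) * (4 / mn))) ((γ₁ - γ) / (C₂ * (8 / mn)))), ?_, ?_, ?_, ?_⟩
    · refine lt_min one_pos (lt_min (by positivity) (div_pos (by linarith) (by positivity)))
    · exact min_le_left _ _
    · rw [mul_assoc, ← le_div_iff₀ (by positivity)]
      exact (min_le_right _ _).trans (min_le_left _ _)
    · rw [mul_assoc, ← le_div_iff₀ (by positivity)]
      exact (min_le_right _ _).trans (min_le_right _ _)
  have hHv := hH.fderiv_apply_const (0, 1, 0)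
  have hHu := hH.fderiv_apply_const (0, 0, 1)
  have eHv := fderiv_relativeEnergy_snd hh hVs hPs
  have eHu := fderiv_relativeEnergy_trd hh hVs hPs
  set q : ℝ³ → ℝ := fun x => (Vs x.1 + x.2.1) * g (x.1, Vs x.1 + x.2.1, Ps x.1 + x.2.2)
    - Vs x.1 * g (x.1, Vs x.1, Ps x.1) with hqdef
  have hq : Smooth q := by fun_prop
  have hpart : ∀ (f : ℝ³ → ℝ), Smooth f → ∀ F : ℝ³ → ℝ, Smooth F →
      (∀ v u, F (0, v, u) = f (0, v, φ₀ + u) - f (0, 0, φ₀)) →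
      𝒟 F (0, 0, 0) (0, 1, 0) = 𝒟 f (0, 0, φ₀) (0, 1, 0) ∧
      𝒟 F (0, 0, 0) (0, 0, 1) = 𝒟 f (0, 0, φ₀) (0, 0, 1) := by
    intro f hf F hF hfF
    constructor
    · have h1 := hasDerivAt_snd₃ (hF.diff) 0 0 0
      have h2 := (hasDerivAt_snd₃ (hf.diff) 0 0 φ₀).sub_const (f (0, 0, φ₀))
      refine h1.unique (h2.congr_of_eventuallyEq (.of_forall fun x => ?_))
      simp [hfF]
    · have h1 := hasDerivAt_trd₃ (hF.diff) 0 0 0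
      have h2 := ((hasDerivAt_trd₃ (hf.diff) 0 0 (φ₀ + 0)).scomp (0 : ℝ)
        ((hasDerivAt_id (0 : ℝ)).const_add φ₀)).sub_const (f (0, 0, φ₀))
      have h3 := h1.unique (h2.congr_of_eventuallyEq (.of_forall fun x => by simp [hfF]))
      simpa using h3
  obtain ⟨d1, hd1, l1⟩ := hHv.linear_approx (a := p₀) (b := 0) (κ := κ) (fun η => by rw [eHv]; simp)
    ((hpart _ (hh.fderiv_apply_const (0, 1, 0)) _ hHv fun v u => by
      rw [eHv, hVs0, hPs0, zero_add]).1.trans hVV)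
    ((hpart _ (hh.fderiv_apply_const (0, 1, 0)) _ hHv fun v u => by
      rw [eHv, hVs0, hPs0, zero_add]).2.trans hVP) hκ0
  obtain ⟨d2, hd2, l2⟩ := hHu.linear_approx (a := 0) (b := b₀) (κ := κ) (fun η => by rw [eHu]; simp)
    ((hpart _ (hh.fderiv_apply_const (0, 0, 1)) _ hHu fun v u => by
      rw [eHu, hVs0, hPs0, zero_add]).1.trans hPV)
    ((hpart _ (hh.fderiv_apply_const (0, 0, 1)) _ hHu fun v u => by
      rw [eHu, hVs0, hPs0, zero_add]).2.trans hPP) hκ0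
  have hVg : Smooth fun x : ℝ³ => x.2.1 * g x := by fun_prop
  have hq' := hpart (fun x => x.2.1 * g x) hVg q hq fun v u => by simp [hqdef, hVs0, hPs0]
  have hg1 : 𝒟 (fun x : ℝ³ => x.2.1 * g x) (0, 0, φ₀) (0, 1, 0) = γ := by
    have h1 := hasDerivAt_snd₃ (hVg.diff) 0 0 φ₀
    have h2 := (hasDerivAt_id (0 : ℝ)).mul (hasDerivAt_snd₃ (hg.diff) 0 0 φ₀)
    have := h1.unique h2
    simpa [hgγ] using this
  have hg2 : 𝒟 (fun x : ℝ³ => x.2.1 * g x) (0, 0, φ₀) (0, 0, 1) = 0 := by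
    have h1 := hasDerivAt_trd₃ (hVg.diff) 0 0 φ₀
    have h2 := (hasDerivAt_const φ₀ (0 : ℝ))
    exact h1.unique (h2.congr_of_eventuallyEq (.of_forall fun x => by simp))
  obtain ⟨d3, hd3, l3⟩ := hq.linear_approx (a := γ) (b := 0) (κ := κ)
    (fun η => by simp [hqdef]) (hq'.1.trans hg1) (hq'.2.trans hg2) hκ0
  set δ := min (δ₀) (min 1 (min d1 (min d2 d3)) / 2)
  have hδ : 0 < δ := by positivity
  have h2δ : 2 * δ ≤ min 1 (min d1 (min d2 d3)) := by
    have : δ ≤ min 1 (min d1 (min d2 d3)) / 2 := min_le_right _ _; linarith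
  simp only [le_min_iff] at h2δ
  obtain ⟨h2δ1, h2δd1, h2δd2, h2δd3⟩ := h2δ
  obtain ⟨Cr, hCr0, hCr1, hCr2⟩ : ∃ Cr, 0 ≤ Cr ∧ (∀ η ∈ Icc (0 : ℝ) 1, |r₁ η| ≤ Cr) ∧
      ∀ η ∈ Icc (0 : ℝ) 1, |r₂ η| ≤ Cr := by
    obtain ⟨c1, h1⟩ := (isCompact_Icc (a := (0 : ℝ)) (b := 1)).exists_bound_of_continuousOn
      hr₁.continuous.continuousOn
    obtain ⟨c2, h2⟩ := (isCompact_Icc (a := (0 : ℝ)) (b := 1)).exists_bound_of_continuousOn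
      hr₂.continuous.continuousOn
    exact ⟨max 0 (max c1 c2), le_max_left _ _,
      fun η hη => (h1 η hη).trans ((le_max_left _ _).trans (le_max_right _ _)),
      fun η hη => (h2 η hη).trans ((le_max_right _ _).trans (le_max_right _ _))⟩
  set CC := (2 * (p₀ + 1) + 2 * (b₀ + 1) + 2 * |γ|) * (C₀ + Cr) with hCC
  have hCC0 : 0 ≤ CC := by positivity
  have hA0 : mn ≤ 24 * (p₀ + b₀) := by have : mn ≤ p₀ := min_le_left _ _; linarith
  set κ' := mn / (24 * (p₀ + b₀)) with hκ'
  have hκ'0 : 0 < κ' := by positivity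
  have hκ'1 : κ' ≤ 1 := (div_le_one (by positivity)).2 hA0
  set δ' := δ / 16 * κ' with hδ'
  have hδ'0 : 0 < δ' := by positivity
  have hδ'1 : δ' ≤ δ / 16 := mul_le_of_le_one_right (by positivity) hκ'1
  have hδ'2 : 3 * (p₀ + b₀) * δ' ^ 2 ≤ mn / 8 * (δ / 16) ^ 2 := by
    have : κ' ^ 2 ≤ κ' := pow_le_of_le_one hκ'0.le hκ'1 two_ne_zero
    calc 3 * (p₀ + b₀) * δ' ^ 2 = 3 * (p₀ + b₀) * (δ / 16) ^ 2 * κ' ^ 2 := by rw [hδ']; ring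
      _ ≤ 3 * (p₀ + b₀) * (δ / 16) ^ 2 * κ' := by gcongr
      _ = _ := by rw [hκ']; field_simp; ring
  have hev := tendsto_rpow_neg_inv hN
  have hevV : Tendsto (fun τ : ℝ => Vs (τ ^ (-(1 / (2 * N : ℝ))))) atTop (𝓝 0) := by
    have := (hVs.continuous.tendsto 0).comp hev
    rwa [hVs0] at this
  have hevP : Tendsto (fun τ : ℝ => Ps (τ ^ (-(1 / (2 * N : ℝ)))) - φ₀) atTop (𝓝 0) := by
    have := ((hPs.continuous.tendsto 0).comp hev).sub_const φ₀
    rwa [hPs0, sub_self] at this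
  have hevC : Tendsto (fun τ : ℝ => CC * τ⁻¹) atTop (𝓝 0) := by
    simpa using tendsto_inv_atTop_zero.const_mul CC
  have hδpos : 0 < mn / 8 * (δ / 16) ^ 2 := by positivity
  have hall := ((hev.eventually (eventually_le_nhds hκ0)).and
    ((hev.eventually (eventually_le_nhds (div_pos (neg_pos.2 hγ₁0) hG))).and
    ((hev.eventually (eventually_le_nhds hδ)).and
    ((hevV.abs.eventually (eventually_le_nhds (by simpa using hδ'0))).and
    ((hevP.abs.eventually (eventually_le_nhds (by simpa using hδ'0))).and
    ((hevC.eventually (eventually_le_nhds hδpos)).and (eventually_ge_atTop (1 : ℝ))))))))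
  obtain ⟨τ₀, hτ₀⟩ := eventually_atTop.1 hall
  refine ⟨δ, hδ, min_le_left _ _, δ', hδ'0, max 1 τ₀, le_max_left _ _, ?_⟩
  intro a ha b hab V Ψ V' Ψ' hsol hVa hΨa
  have ha1 : 1 ≤ a := (le_max_left _ _).trans ha
  have hτa : ∀ τ ∈ Icc a b, τ₀ ≤ τ := fun τ hτ => (le_max_right _ _).trans (ha.trans hτ.1)
  set ηf : ℝ → ℝ := fun τ => τ ^ (-(1 / (2 * N : ℝ))) with hηf
  have hτpos : ∀ τ ∈ Icc a b, 0 < τ := fun τ hτ => by linarith [hτ.1]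
  set v : ℝ → ℝ := fun τ => V τ - Vs (ηf τ) with hv
  set u : ℝ → ℝ := fun τ => Ψ τ - Ps (ηf τ) with hu
  set Q : ℝ → ℝ := fun τ => (p₀ * v τ ^ 2 + b₀ * u τ ^ 2) / 2 with hQ
  set W : ℝ → ℝ := fun τ => H (ηf τ, v τ, u τ) - γ / 2 * (ηf τ ^ e * (u τ * v τ)) with hW
  have hbox : ∀ τ ∈ Icc a b, 0 < ηf τ ∧ ηf τ ≤ κ ∧ ηf τ ≤ δ ∧ ηf τ ≤ 1 ∧ |v τ| ≤ 2 * δ ∧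
      |u τ| ≤ 2 * δ ∧ |Vs (ηf τ)| ≤ δ' ∧ |Ps (ηf τ) - φ₀| ≤ δ' := by
    intro τ hτ
    obtain ⟨k1, k2, k3, k4, k5, k6, k7⟩ := hτ₀ τ (hτa τ hτ)
    obtain ⟨-, -, k8, k9, -⟩ := hsol τ hτ
    refine ⟨rpow_pos_of_pos (hτpos τ hτ) _, k1, k3, k1.trans hκ1, ?_, ?_, k4, k5⟩
    · have := abs_sub (V τ) (Vs (ηf τ)); simp only [hv]; linarith
    · have : u τ = (Ψ τ - φ₀) - (Ps (ηf τ) - φ₀) := by simp only [hu]; ring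
      rw [this]
      have := abs_sub (Ψ τ - φ₀) (Ps (ηf τ) - φ₀); linarith
  have hvu : ∀ τ, mn * (v τ ^ 2 + u τ ^ 2) ≤ 2 * Q τ := fun τ => by
    have h1 : mn * v τ ^ 2 ≤ p₀ * v τ ^ 2 := by gcongr; exact min_le_left _ _
    have h2 : mn * u τ ^ 2 ≤ b₀ * u τ ^ 2 := by gcongr; exact min_le_right _ _
    simp only [hQ]; linarith
  have hmQ : ∀ τ, (|v τ| + |u τ|) ^ 2 ≤ 4 / mn * Q τ := by
    intro τ
    have h1 := hvu τ
    rw [div_mul_eq_mul_div, le_div_iff₀ hmn0]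
    have h2 : (|v τ| + |u τ|) ^ 2 ≤ 2 * (v τ ^ 2 + u τ ^ 2) := by
      have := sq_nonneg (|v τ| - |u τ|)
      rw [← sq_abs (v τ), ← sq_abs (u τ)]; linarith
    calc _ ≤ 2 * (v τ ^ 2 + u τ ^ 2) * mn := by gcongr
      _ ≤ _ := by linarith
  have hWQ : ∀ τ ∈ Icc a b, |W τ - Q τ| ≤ κ * (1 + |γ|) * (|v τ| + |u τ|) ^ 2 := by
    intro τ hτ
    obtain ⟨k1, k2, k3, k4, k5, k6, -, -⟩ := hbox τ hτ
    have hsc : ∀ s ∈ Icc (0 : ℝ) 1, |s * v τ| ≤ 2 * δ ∧ |s * u τ| ≤ 2 * δ := by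
      intro s hs
      rw [abs_mul, abs_mul, abs_of_nonneg hs.1]
      exact ⟨(mul_le_of_le_one_left (abs_nonneg _) hs.2).trans k5,
        (mul_le_of_le_one_left (abs_nonneg _) hs.2).trans k6⟩
    have hηδ : ∀ d, 2 * δ ≤ d → |ηf τ| ≤ d := fun d hd => by rw [abs_of_pos k1]; linarith
    have := abs_sub_quadratic_le (f := fun s => H (ηf τ, s * v τ, s * u τ))
      (fv := fun s => 𝒟 H (ηf τ, s * v τ, s * u τ) (0, 1, 0))
      (fu := fun s => 𝒟 H (ηf τ, s * v τ, s * u τ) (0, 0, 1)) (p := p₀) (b := b₀) (κ := κ)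
      (v := v τ) (u := u τ) (fun s _ => by
        have h1 := (hHd (ηf τ, s * v τ, s * u τ)).hasFDerivAt.comp_hasDerivAt
          (f := fun s : ℝ => (ηf τ, s * v τ, s * u τ)) s ((hasDerivAt_const s (ηf τ)).prodMk
          (((hasDerivAt_id s).mul_const (v τ)).prodMk ((hasDerivAt_id s).mul_const (u τ))))
        rw [fderiv_apply₃] at h1
        rw [show v τ * 𝒟 H (ηf τ, s * v τ, s * u τ) (0, 1, 0)
          + u τ * 𝒟 H (ηf τ, s * v τ, s * u τ) (0, 0, 1) =
          0 * 𝒟 H (ηf τ, s * v τ, s * u τ) (1, 0, 0) +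
          1 * v τ * 𝒟 H (ηf τ, s * v τ, s * u τ) (0, 1, 0) +
          1 * u τ * 𝒟 H (ηf τ, s * v τ, s * u τ) (0, 0, 1) by ring]
        exact h1) (by simp [hHdef, relativeEnergy])
      (fun s hs => by
        have := l1 (ηf τ) (s * v τ) (s * u τ) (hηδ _ h2δd1) ((hsc s hs).1.trans h2δd1)
          ((hsc s hs).2.trans h2δd1)
        simpa using this)
      (fun s hs => by
        have := l2 (ηf τ) (s * v τ) (s * u τ) (hηδ _ h2δd2) ((hsc s hs).1.trans h2δd2)
          ((hsc s hs).2.trans h2δd2)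
        simpa using this) hκ0.le
    simp only [one_mul] at this
    have h2 : |γ / 2 * (ηf τ ^ e * (u τ * v τ))| ≤ κ * |γ| * (|v τ| + |u τ|) ^ 2 := by
      rw [abs_mul, abs_mul, abs_div, abs_two, abs_of_pos (pow_pos k1 _)]
      have h3 : |u τ * v τ| ≤ (|v τ| + |u τ|) ^ 2 := abs_mul_le_sq_add _ _
      have h4 : ηf τ ^ e ≤ κ := (pow_le_of_le_one k1.le k4 (by omega)).trans k2
      calc _ ≤ |γ| / 1 * (κ * (|v τ| + |u τ|) ^ 2) := by gcongr; linarith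
        _ = _ := by ring
    have h3 : W τ - Q τ = (H (ηf τ, v τ, u τ) - (p₀ * v τ ^ 2 + b₀ * u τ ^ 2) / 2)
      - γ / 2 * (ηf τ ^ e * (u τ * v τ)) := by simp only [hW, hQ]; ring
    rw [h3]
    refine (abs_sub _ _).trans ?_; linarith
  have hWQ2 : ∀ τ ∈ Icc a b, Q τ / 2 ≤ W τ ∧ W τ ≤ 3 / 2 * Q τ := by
    intro τ hτ
    have h1 := abs_le.1 (hWQ τ hτ)
    have hQ0 : 0 ≤ Q τ := by simp only [hQ]; positivity
    have h2 : κ * (1 + |γ|) * (|v τ| + |u τ|) ^ 2 ≤ Q τ / 2 := by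
      calc _ ≤ κ * (1 + |γ|) * (4 / mn * Q τ) := by gcongr; exact hmQ τ
        _ = κ * (1 + |γ|) * (4 / mn) * Q τ := by ring
        _ ≤ 1 / 2 * Q τ := by gcongr
        _ = _ := by ring
    constructor <;> linarith
  have hη2N : ∀ τ ∈ Icc a b, ηf τ ^ (2 * N) = τ⁻¹ := fun τ hτ => rpow_neg_inv_pow hN (hτpos τ hτ)
  have hηn : ∀ τ ∈ Icc a b, ηf τ ^ n ≤ τ ^ (-(G + 2)) := by
    intro τ hτ
    simp only [hηf]
    rw [← rpow_natCast, ← rpow_mul (hτpos τ hτ).le]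
    refine rpow_le_rpow_of_exponent_le (ha1.trans hτ.1) ?_
    rw [neg_mul, neg_le_neg_iff, one_div, inv_mul_eq_div, le_div_iff₀ (by positivity)]
    linarith
  have hWd : ∀ τ ∈ Icc a b, ∃ w', HasDerivWithinAt W w' (Icc a b) τ ∧
      w' ≤ -(G / τ) * W τ + CC * τ ^ (-(G + 2)) := by
    intro τ hτ
    obtain ⟨k1, k2, k3, k4, k5, k6, -, -⟩ := hbox τ hτ
    obtain ⟨dV, dΨ, -, -, hres⟩ := hsol τ hτ
    obtain ⟨e1, e2⟩ := hres (ηf τ) rfl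
    have dη := (hasDerivAt_rpow_neg_inv hN (hτpos τ hτ)).hasDerivWithinAt (s := Icc a b)
    change HasDerivWithinAt ηf (-(1 / (2 * N)) * ηf τ ^ (2 * N + 1)) (Icc a b) τ at dη
    set η := ηf τ with hη
    set η' := (-(1 / (2 * N)) * η ^ (2 * N + 1) : ℝ) with hη'
    have dv : HasDerivWithinAt v (V' τ - deriv Vs η * η') (Icc a b) τ :=
      dV.sub (((hVs.diff) η).hasDerivAt.comp_hasDerivWithinAt τ dη)
    have du : HasDerivWithinAt u (Ψ' τ - deriv Ps η * η') (Icc a b) τ :=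
      dΨ.sub (((hPs.diff) η).hasDerivAt.comp_hasDerivWithinAt τ dη)
    have dH := (hHd (η, v τ, u τ)).hasFDerivAt.comp_hasDerivWithinAt τ (dη.prodMk (dv.prodMk du))
    rw [fderiv_apply₃] at dH
    set hv1 := 𝒟 H (η, v τ, u τ) (0, 1, 0) with hhv1
    set hu1 := 𝒟 H (η, v τ, u τ) (0, 0, 1) with hhu1
    have dW := dH.sub ((((dη.pow e).mul (du.mul dv))).const_mul (γ / 2))
    refine ⟨_, dW, ?_⟩
    set q1 := q (η, v τ, u τ) with hq1
    set ρ₁ := V' τ - deriv Vs η * η' - (-(η ^ s * hu1) + η ^ (s + e) * q1) with hρ₁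
    set ρ₂ := Ψ' τ - deriv Ps η * η' - η ^ s * hv1 with hρ₂
    have x1 : V' τ - deriv Vs η * η' = -(η ^ s * hu1) + η ^ (s + e) * q1 + ρ₁ := by rw [hρ₁]; ring
    have x2 : Ψ' τ - deriv Ps η * η' = η ^ s * hv1 + ρ₂ := by rw [hρ₂]; ring
    have hs2N : η ^ s * η ^ (2 * N + 1 - s) = η ^ (2 * N + 1) := by rw [← pow_add]; congr 1; omega
    have eV : Vs η + v τ = V τ := by simp only [hv]; ring
    have eP : Ps η + u τ = Ψ τ := by simp only [hu]; ring
    have hηs : η ^ s ≤ 1 := pow_le_one₀ k1.le k4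
    have y1 : |ρ₁| ≤ (C₀ + Cr) * η ^ n := by
      have z : ρ₁ = (V' τ - (-(η ^ s * 𝒟 h (η, V τ, Ψ τ) (0, 0, 1))
            + η ^ (s + e) * (V τ * g (η, V τ, Ψ τ)))) + η ^ s * (η ^ n * r₂ η) := by
        rw [← hf₂ η, hρ₁, hhu1, eHu, hq1, hqdef]; simp only
        rw [eV, eP, hη', ← hs2N]; ring
      rw [z]
      refine (abs_add_le _ _).trans ?_; rw [add_mul]
      refine add_le_add e1 ?_
      rw [abs_mul, abs_mul, abs_of_pos (pow_pos k1 s), abs_of_pos (pow_pos k1 n)]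
      calc _ ≤ 1 * (η ^ n * Cr) := by gcongr; exact hCr2 η ⟨k1.le, k4⟩
        _ = _ := by ring
    have y2 : |ρ₂| ≤ (C₀ + Cr) * η ^ n := by
      have z : ρ₂ = (Ψ' τ - η ^ s * 𝒟 h (η, V τ, Ψ τ) (0, 1, 0))
          + η ^ s * (η ^ n * r₁ η) := by
        rw [← hf₁ η, hρ₂, hhv1, eHv]
        rw [eV, eP, hη', ← hs2N]; ring
      rw [z]
      refine (abs_add_le _ _).trans ?_; rw [add_mul]
      refine add_le_add e2 ?_
      rw [abs_mul, abs_mul, abs_of_pos (pow_pos k1 s), abs_of_pos (pow_pos k1 n)]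
      calc _ ≤ 1 * (η ^ n * Cr) := by gcongr; exact hCr1 η ⟨k1.le, k4⟩
        _ = _ := by ring
    have hηδ : ∀ d, 2 * δ ≤ d → |η| ≤ d := fun d hd => by rw [abs_of_pos k1]; linarith
    have g1 := l1 η (v τ) (u τ) (hηδ _ h2δd1) (k5.trans h2δd1) (k6.trans h2δd1)
    have g2 := l2 η (v τ) (u τ) (hηδ _ h2δd2) (k5.trans h2δd2) (k6.trans h2δd2)
    have g3 := l3 η (v τ) (u τ) (hηδ _ h2δd3) (k5.trans h2δd3) (k6.trans h2δd3)
    have g4 := hCH η (v τ) (u τ) (hηδ _ h2δ1) (k5.trans h2δ1) (k6.trans h2δ1)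
    rw [x1, x2]
    have main := modifiedEnergy_deriv_le (p := p₀) (b := b₀) (γ := γ) (γ₁ := γ₁) (κ := κ) (mn := mn)
      (CH := CH) (Cρ := (C₀ + Cr) * η ^ n) (hv := hv1) (hu := hu1)
      (hη := 𝒟 H (η, v τ, u τ) (1, 0, 0)) (q := q1) (v := v τ) (u := u τ) (η := η)
      (ρ₁ := ρ₁) (ρ₂ := ρ₂) (F := W τ) (e := e) (s := s) (N := N) hN he hdN hp₀.le hb₀.le hγ₁ hγ₁0
      hmn0 hCH0 hκ0 hκ1 (by rw [hC₂, hC₁] at hκ3; exact hκ3) k1 k2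
      (by simpa using g1) (by simpa using g2) (by simpa using g3) g4 (hmQ τ) (by linarith)
      (hWQ τ hτ) y1 y2
    have hQ0 : 0 ≤ Q τ := by simp only [hQ]; positivity
    have hW0 : 0 ≤ W τ := by linarith [(hWQ2 τ hτ).1]
    have hdecay : η ^ (s + e) * (γ₁ * W τ) ≤ -(G / τ) * W τ := by
      rw [← mul_assoc]
      refine mul_le_mul_of_nonneg_right ?_ hW0
      rw [div_eq_mul_inv, ← hη2N τ hτ]
      by_cases hc : s + e = 2 * N
      · rw [hc]
        have := mul_le_mul_of_nonneg_left (hγ₁G hc) (pow_pos k1 (2 * N)).le; linarith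
      · have z1 : η ^ (2 * N) ≤ η ^ (s + e) * η := by
          rw [← pow_succ]
          exact pow_le_pow_of_le_one k1.le k4 (by omega)
        have z2 : G * η ≤ -γ₁ := by
          have := (hτ₀ τ (hτa τ hτ)).2.1
          rw [le_div_iff₀ hG] at this; linarith
        have z3 : G * η ^ (2 * N) ≤ η ^ (s + e) * (G * η) := by
          calc _ ≤ G * (η ^ (s + e) * η) := by gcongr
            _ = _ := by ring
        have z4 : η ^ (s + e) * (G * η) ≤ η ^ (s + e) * (-γ₁) := by gcongr
        linarith
    have herr : (2 * (p₀ + 1) + 2 * (b₀ + 1) + 2 * |γ|) * ((C₀ + Cr) * η ^ n) ≤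
        CC * τ ^ (-(G + 2)) := by
      rw [← mul_assoc, ← hCC]; gcongr; exact hηn τ hτ
    calc _ = 𝒟 H (η, v τ, u τ) (1, 0, 0) * η'
          + hv1 * (-(η ^ s * hu1) + η ^ (s + e) * q1 + ρ₁) + hu1 * (η ^ s * hv1 + ρ₂)
          - γ / 2 * ((e * η ^ (e - 1) * η') * (u τ * v τ) + η ^ e * ((η ^ s * hv1 + ρ₂) * v τ
            + u τ * (-(η ^ s * hu1) + η ^ (s + e) * q1 + ρ₁))) := by
          simp only [Pi.mul_apply, Pi.pow_apply]; ring
      _ ≤ _ := main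
      _ ≤ _ := by linarith
  choose! W' hW'1 hW'2 using hWd
  have hfin := le_of_deriv_le_neg_div ha1 hCC0 hW'1 hW'2
  have haI : a ∈ Icc a b := ⟨le_rfl, hab⟩
  have hWa : W a + CC * a ^ (-(G + 1)) ≤ mn / 4 * (δ / 16) ^ 2 := by
    obtain ⟨k1, k2, k3, k4, k5, k6, k7, k8⟩ := hbox a haI
    have h1 : |v a| ≤ 2 * δ' := by have := abs_sub (V a) (Vs (ηf a)); simp only [hv]; linarith
    have h2 : |u a| ≤ 2 * δ' := by
      have e1 : u a = (Ψ a - φ₀) - (Ps (ηf a) - φ₀) := by simp only [hu]; ring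
      rw [e1]
      have := abs_sub (Ψ a - φ₀) (Ps (ηf a) - φ₀); linarith
    have h3 : Q a ≤ (p₀ * (2 * δ') ^ 2 + b₀ * (2 * δ') ^ 2) / 2 := by
      simp only [hQ]
      rw [← sq_abs (v a), ← sq_abs (u a)]; gcongr
    have h4 := (hWQ2 a haI).2
    have h5 : CC * a ^ (-(G + 1)) ≤ mn / 8 * (δ / 16) ^ 2 := by
      refine le_trans ?_ (hτ₀ a (hτa a haI)).2.2.2.2.2.1; gcongr
      rw [← rpow_neg_one]
      exact rpow_le_rpow_of_exponent_le ha1 (by linarith)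
    linarith
  intro τ hτ
  obtain ⟨k1, k2, k3, k4, k5, k6, k7, k8⟩ := hbox τ hτ
  have hq0 : 0 < a / τ := div_pos (by linarith) (hτpos τ hτ)
  have hq1 : (a / τ) ^ G ≤ 1 := rpow_le_one hq0.le ((div_le_one (hτpos τ hτ)).2 hτ.1) hG.le
  have hsum : v τ ^ 2 + u τ ^ 2 ≤ (δ / 16) ^ 2 * (a / τ) ^ G := by
    have h1 := hvu τ
    have h2 := (hWQ2 τ hτ).1
    have h3 := hfin τ hτ
    have h4 : (a / τ) ^ G * (W a + CC * a ^ (-(G + 1))) ≤ (a / τ) ^ G * (mn / 4 * (δ / 16) ^ 2) := by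
      gcongr
    have h5 : mn / 4 * (v τ ^ 2 + u τ ^ 2) ≤ mn / 4 * ((δ / 16) ^ 2 * (a / τ) ^ G) := by linarith
    exact le_of_mul_le_mul_left h5 (by positivity)
  have hsum1 : v τ ^ 2 + u τ ^ 2 ≤ (δ / 16) ^ 2 :=
    hsum.trans (mul_le_of_le_one_right (by positivity) hq1)
  have hv1 : |v τ| ≤ δ / 16 := abs_le_of_sq_le_sq ((le_add_of_nonneg_right (sq_nonneg _)).trans hsum1) (by positivity)
  have hu1 : |u τ| ≤ δ / 16 := abs_le_of_sq_le_sq ((le_add_of_nonneg_left (sq_nonneg _)).trans hsum1) (by positivity)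
  refine ⟨?_, ?_, ?_⟩
  · have e1 : V τ = v τ + Vs (ηf τ) := by simp only [hv]; ring
    rw [e1]
    refine (abs_add_le _ _).trans ?_; linarith
  · have e1 : Ψ τ - φ₀ = u τ + (Ps (ηf τ) - φ₀) := by simp only [hu]; ring
    rw [e1]
    refine (abs_add_le _ _).trans ?_; linarith
  · rintro η rfl
    refine hsum.trans ?_; gcongr; linarith

section FormalSolutionOrder

lemma isBigO_pow_of_le {m n : ℕ} (h : m ≤ n) : (fun η : ℝ => η ^ n) =O[𝓝[>] 0] fun η => η ^ m :=
  IsBigO.of_bound 1 (by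
    filter_upwards [Ioo_mem_nhdsGT one_pos] with η hη
    rw [one_mul, norm_pow, norm_pow]
    exact pow_le_pow_of_le_one (norm_nonneg _) (by rw [norm_eq_abs, abs_of_pos hη.1]; exact hη.2.le) h)

lemma Continuous.isBigO_one_nhdsGT {f : ℝ → ℝ} (hf : Continuous f) :
    f =O[𝓝[>] 0] fun _ => (1 : ℝ) :=
  (hf.tendsto 0).isBigO_one ℝ |>.mono nhdsWithin_le_nhds

lemma isBigO_of_mul_isBigO {f p g : ℝ → ℝ} (hp : Continuous p) (hp0 : p 0 ≠ 0)
    (h : (fun η => p η * f η) =O[𝓝[>] 0] g) : f =O[𝓝[>] 0] g := by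
  have h1 : (fun η => (p η)⁻¹) =O[𝓝[>] 0] fun _ => (1 : ℝ) :=
    ((hp.tendsto 0).inv₀ hp0).isBigO_one ℝ |>.mono nhdsWithin_le_nhds
  have h2 := h1.mul h
  simp only [one_mul] at h2
  refine h2.congr' ?_ EventuallyEq.rfl
  filter_upwards [((hp.tendsto 0).eventually_ne hp0).filter_mono nhdsWithin_le_nhds] with η hη
  field_simp

/-- The orders of the formal solution if `h = p(η) V²/2 + η^m V A + B(η², Ψ)`. -/
lemma formal_solution_isBigO {h g A : ℝ³ → ℝ} {p : ℝ → ℝ} {B : ℝ² → ℝ}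
    (hg : Smooth g) (hA : Smooth A) (hp : Smooth p) (hB : Smooth B)
    {φ₀ b₀ c : ℝ} {m e a n : ℕ} (hm : 1 ≤ m) (he : 1 ≤ e) (ha : 2 ≤ a) (ham : m ≤ a)
    (hnm : m ≤ n) (hn2 : 2 ≤ n) (hh : ∀ η V Ψ, h (η, V, Ψ) = p η * V ^ 2 / 2
      + η ^ m * (V * A (η, V, Ψ)) + B (η ^ 2, Ψ))
    (hp0 : p 0 ≠ 0) (hb₀ : b₀ ≠ 0) (hB0 : 𝒟 B (0, φ₀) (0, 1) = 0)
    (hB1 : 𝒟 (fun x => 𝒟 B x (0, 1)) (0, φ₀) (0, 1) = b₀)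
    {Vs Ps r₁ r₂ : ℝ → ℝ} (hVs : Smooth Vs) (hPs : Smooth Ps) (hr₁ : Smooth r₁)
    (hr₂ : Smooth r₂) (hPs0 : Ps 0 = φ₀)
    (hf₁ : ∀ η, 𝒟 h (η, Vs η, Ps η) (0, 1, 0) + c * η ^ a * deriv Ps η = η ^ n * r₁ η)
    (hf₂ : ∀ η, -𝒟 h (η, Vs η, Ps η) (0, 0, 1) + η ^ e * (Vs η * g (η, Vs η, Ps η))
        + c * η ^ a * deriv Vs η = η ^ n * r₂ η) :
    (Vs =O[𝓝[>] 0] fun η => η ^ m) ∧ ((fun η => Ps η - φ₀) =O[𝓝[>] 0] fun η => η ^ 2) := by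
  have hhs : Smooth h := by
    have : h = fun x => p x.1 * x.2.1 ^ 2 / 2 + x.1 ^ m * (x.2.1 * A x) + B (x.1 ^ 2, x.2.2) :=
      funext fun x => hh x.1 x.2.1 x.2.2
    rw [this]; fun_prop
  have hBd := hB.diff
  have hAd := hA.diff
  have hBP : Smooth fun x => 𝒟 B x (0, 1) :=
    (hB.fderiv_right (by simp)).clm_apply contDiff_const
  have d1 : ∀ η V Ψ, 𝒟 h (η, V, Ψ) (0, 1, 0) = p η * V
      + η ^ m * (A (η, V, Ψ) + V * 𝒟 A (η, V, Ψ) (0, 1, 0)) := by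
    intro η V Ψ
    have h1 := hasDerivAt_snd₃ (hhs.diff) η V Ψ
    have h2 := ((((hasDerivAt_pow 2 V).const_mul (p η)).div_const 2).add
      (((hasDerivAt_id V).mul (hasDerivAt_snd₃ hAd η V Ψ)).const_mul (η ^ m))).add_const (B (η ^ 2, Ψ))
    have h3 := h1.unique (h2.congr_of_eventuallyEq (.of_forall fun x => hh η x Ψ))
    rw [h3]; simp; ring
  have d2 : ∀ η V Ψ, 𝒟 h (η, V, Ψ) (0, 0, 1) =
      η ^ m * (V * 𝒟 A (η, V, Ψ) (0, 0, 1)) + 𝒟 B (η ^ 2, Ψ) (0, 1) := by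
    intro η V Ψ
    have h1 := hasDerivAt_trd₃ (hhs.diff) η V Ψ
    have h4 := (hBd (η ^ 2, Ψ)).hasFDerivAt.comp_hasDerivAt (f := fun y : ℝ => (η ^ 2, y)) Ψ
      ((hasDerivAt_const Ψ (η ^ 2)).prodMk (hasDerivAt_id Ψ))
    have h2 := (((hasDerivAt_trd₃ hAd η V Ψ).const_mul V).const_mul (η ^ m)).const_add
      (p η * V ^ 2 / 2) |>.add h4
    exact h1.unique (h2.congr_of_eventuallyEq (.of_forall fun x => hh η V x))
  have hAv := hA.fderiv_apply_const (0, 1, 0)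
  have hAp := hA.fderiv_apply_const (0, 0, 1)
  have cPs : Continuous (deriv Ps) := hPs.continuous_deriv (by simp)
  have cVs : Continuous (deriv Vs) := hVs.continuous_deriv (by simp)
  have cV := hVs.continuous
  have cP := hPs.continuous
  have c1 := hA.continuous
  have c2 := hAv.continuous
  have c3 := hAp.continuous
  have c4 := hg.continuous
  have c5 := hr₁.continuous
  have c6 := hr₂.continuous
  have pw : ∀ {i j : ℕ} {f : ℝ → ℝ}, j ≤ i → Continuous f →
      (fun η : ℝ => η ^ i * f η) =O[𝓝[>] 0] fun η => η ^ j := by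
    intro i j f hij hf
    simpa using (isBigO_pow_of_le hij).mul hf.isBigO_one_nhdsGT
  have hV : Vs =O[𝓝[>] 0] fun η => η ^ m := by
    refine isBigO_of_mul_isBigO hp.continuous hp0 ?_
    have e1 : (fun η => p η * Vs η) = fun η => η ^ n * r₁ η
        - η ^ m * (A (η, Vs η, Ps η) + Vs η * 𝒟 A (η, Vs η, Ps η) (0, 1, 0))
        - η ^ a * (c * deriv Ps η) := by
      funext η; rw [← hf₁ η, d1]; ring
    rw [e1]
    refine ((pw hnm c5).sub (pw le_rfl ?_)).sub (pw ham (by fun_prop))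
    have := c2.comp (f := fun η => (η, Vs η, Ps η)) (by fun_prop)
    simp only [Function.comp_def] at this
    fun_prop
  refine ⟨hV, ?_⟩
  have hBη : (fun η => 𝒟 B (η ^ 2, Ps η) (0, 1)) =O[𝓝[>] 0] fun η => η ^ 2 := by
    have e1 : (fun η => 𝒟 B (η ^ 2, Ps η) (0, 1)) = fun η =>
        Vs η * (η ^ e * g (η, Vs η, Ps η)) - Vs η * (η ^ m * 𝒟 A (η, Vs η, Ps η) (0, 0, 1))
          + η ^ a * (c * deriv Vs η) - η ^ n * r₂ η := by
      funext η; rw [← hf₂ η, d2]; ring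
    rw [e1]
    have hV1 : Vs =O[𝓝[>] 0] fun η => η ^ 1 := hV.trans (isBigO_pow_of_le hm)
    have c7 := c3.comp (f := fun η => (η, Vs η, Ps η)) (by fun_prop)
    simp only [Function.comp_def] at c7
    have k1 := hV1.mul (pw (f := fun η => g (η, Vs η, Ps η)) he (by fun_prop))
    have k2 := hV1.mul (pw (f := fun η => 𝒟 A (η, Vs η, Ps η) (0, 0, 1)) hm c7)
    simp only [pow_one, ← sq] at k1 k2
    exact ((k1.sub k2).add (pw ha (by fun_prop))).sub (pw hn2 c6)
  obtain ⟨G1, hG1, -, k1⟩ := hBP.exists_eq_add_smul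
  obtain ⟨G2, hG2, hG20, k2⟩ := (show Smooth fun x : ℝ² => 𝒟 B (0, φ₀ + x.1) (0, 1)
    from hBP.comp (f := fun x : ℝ² => ((0 : ℝ), φ₀ + x.1)) (by fun_prop)).exists_eq_add_smul
  have hG2' : G2 (0, 0) = b₀ := by
    rw [hG20, ← hB1]
    have h1 := ((hBP.comp (f := fun x : ℝ² => ((0 : ℝ), φ₀ + x.1)) (by fun_prop)).differentiable
      (by simp) ((0 : ℝ), (0 : ℝ))).hasFDerivAt.comp_hasDerivAt (f := fun y : ℝ => (y, (0 : ℝ))) 0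
      ((hasDerivAt_id (0 : ℝ)).prodMk (hasDerivAt_const (0 : ℝ) (0 : ℝ)))
    have h2 := (hBP.diff ((0 : ℝ), φ₀ + 0)).hasFDerivAt.comp_hasDerivAt
      (f := fun y : ℝ => ((0 : ℝ), φ₀ + y)) 0
      ((hasDerivAt_const (0 : ℝ) (0 : ℝ)).prodMk ((hasDerivAt_id (0 : ℝ)).const_add φ₀))
    rw [add_zero] at h2; exact h1.unique h2
  refine isBigO_of_mul_isBigO (p := fun η => G2 (Ps η - φ₀, 0)) (by fun_prop) (by simp [hPs0, hG2', hb₀]) ?_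
  have e2 : (fun η => G2 (Ps η - φ₀, 0) * (Ps η - φ₀)) = fun η =>
      𝒟 B (η ^ 2, Ps η) (0, 1) - η ^ 2 * G1 (η ^ 2, Ps η) := by
    funext η
    have q1 := k1 (η ^ 2) (Ps η)
    have q2 := k2 (Ps η - φ₀) 0
    simp only [smul_eq_mul, add_sub_cancel, add_zero, hB0, zero_add] at q1 q2
    rw [q1, q2]; ring
  rw [e2]
  exact hBη.sub (pw le_rfl (by fun_prop))

end FormalSolutionOrder

section AveragedHamiltonian

lemma hasDerivAt_mul_integral_comp_mul {f : ℝ → ℝ} (hf : Continuous f) (x : ℝ) :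
    HasDerivAt (fun x => x * ∫ s in (0 : ℝ)..1, f (s * x)) (f x) x := by
  have : (fun x => x * ∫ s in (0 : ℝ)..1, f (s * x)) = fun x => ∫ s in (0 : ℝ)..x, f s := by
    funext x
    rw [mul_integral_comp_mul_right]; simp
  rw [this]
  exact integral_hasDerivAt_right (hf.intervalIntegrable _ _)
    hf.stronglyMeasurable.stronglyMeasurableAtFilter hf.continuousAt

lemma hasDerivAt_fst₂ {F : ℝ² → ℝ} (hF : Differentiable ℝ F) (a b : ℝ) :
    HasDerivAt (fun x => F (x, b)) (𝒟 F (a, b) (1, 0)) a :=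
  (hF (a, b)).hasFDerivAt.comp_hasDerivAt a ((hasDerivAt_id a).prodMk (hasDerivAt_const a b))

lemma hasDerivAt_snd₂ {F : ℝ² → ℝ} (hF : Differentiable ℝ F) (a b : ℝ) :
    HasDerivAt (fun x => F (a, x)) (𝒟 F (a, b) (0, 1)) b :=
  (hF (a, b)).hasFDerivAt.comp_hasDerivAt b ((hasDerivAt_const b a).prodMk (hasDerivAt_id b))

/-- Splitting of a planar vector field `(Λ, Ω)` into a Hamiltonian part, with the Hamiltonian
`R A(R,Ψ) - B(Ψ)`, and a part that depends on the divergence. -/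
lemma exists_hamiltonian_splitting {Λ Ω : ℝ² → ℝ} (hΛ : Smooth Λ) (hΩ : Smooth Ω)
    (φ₀ : ℝ) : ∃ A G : ℝ² → ℝ, ∃ B : ℝ → ℝ, Smooth A ∧ Smooth G ∧ Smooth B ∧
      (∀ R Ψ, HasDerivAt (fun x => x * A (x, Ψ)) (Ω (R, Ψ)) R) ∧ (∀ Ψ, HasDerivAt B (Λ (0, Ψ)) Ψ) ∧
      (∀ R Ψ, Λ (R, Ψ) = Λ (0, Ψ) - R * 𝒟 A (R, Ψ) (0, 1) + R * G (R, Ψ)) ∧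
      (∀ Ψ, G (0, Ψ) = 𝒟 Λ (0, Ψ) (1, 0) + 𝒟 Ω (0, Ψ) (0, 1)) ∧
      ((∀ x, 𝒟 Λ x (1, 0) + 𝒟 Ω x (0, 1) = 0) → ∀ x, G x = 0) ∧
      (∀ c, (∀ R Ψ, Ω (R, Ψ) = c * R) → ∀ R Ψ, A (R, Ψ) = c * R / 2) ∧
      ((∀ Ψ, Λ (0, Ψ) = 0) → ∀ Ψ, B Ψ = 0) := by
  set dv : ℝ² → ℝ := fun x => 𝒟 Λ x (1, 0) + 𝒟 Ω x (0, 1) with hdv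
  have hdvs : Smooth dv := ((hΛ.fderiv_right (by simp)).clm_apply contDiff_const).add
    ((hΩ.fderiv_right (by simp)).clm_apply contDiff_const)
  set A : ℝ² → ℝ := fun x => ∫ s in (0 : ℝ)..1, Ω (s * x.1, x.2) with hA
  set G : ℝ² → ℝ := fun x => ∫ s in (0 : ℝ)..1, dv (s * x.1, x.2) with hG
  set B : ℝ → ℝ := fun y => (y - φ₀) * ∫ s in (0 : ℝ)..1, Λ (0, φ₀ + s * (y - φ₀)) with hB
  have hAs : Smooth A := ContDiff.intervalIntegral_param (E := ℝ²)
    (f := fun q : ℝ² × ℝ => Ω (q.2 * q.1.1, q.1.2)) zero_le_one (by fun_prop)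
  have hGs : Smooth G := ContDiff.intervalIntegral_param (E := ℝ²)
    (f := fun q : ℝ² × ℝ => dv (q.2 * q.1.1, q.1.2)) zero_le_one (by fun_prop)
  have hBs : Smooth B := by
    have := ContDiff.intervalIntegral_param (E := ℝ)
      (f := fun q : ℝ² => Λ (0, φ₀ + q.2 * (q.1 - φ₀))) zero_le_one (by fun_prop)
    fun_prop
  have hA1 : ∀ R Ψ, HasDerivAt (fun x => x * A (x, Ψ)) (Ω (R, Ψ)) R := fun R Ψ =>
    hasDerivAt_mul_integral_comp_mul (f := fun x => Ω (x, Ψ)) (by fun_prop) R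
  have hG1 : ∀ R Ψ, HasDerivAt (fun x => x * G (x, Ψ)) (dv (R, Ψ)) R := fun R Ψ =>
    hasDerivAt_mul_integral_comp_mul (f := fun x => dv (x, Ψ)) (by fun_prop) R
  refine ⟨A, G, B, hAs, hGs, hBs, hA1, ?_, ?_, ?_, ?_, ?_, ?_⟩
  · intro Ψ
    have h1 := hasDerivAt_mul_integral_comp_mul (f := fun x => Λ (0, φ₀ + x)) (by fun_prop) (Ψ - φ₀)
    have h2 := h1.comp Ψ ((hasDerivAt_id Ψ).sub_const φ₀); simpa using! h2
  · intro R Ψ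
    have hF : Smooth fun x : ℝ² => x.1 * A x := by fun_prop
    have hFd := hF.diff
    have hFR : ∀ x, 𝒟 (fun x : ℝ² => x.1 * A x) x (1, 0) = Ω x := fun x =>
      (hasDerivAt_fst₂ hFd x.1 x.2).unique (hA1 x.1 x.2)
    have hFP : ∀ x, 𝒟 (fun x : ℝ² => x.1 * A x) x (0, 1) = x.1 * 𝒟 A x (0, 1) :=
      fun x => (hasDerivAt_snd₂ hFd x.1 x.2).unique
        ((hasDerivAt_snd₂ (hAs.diff) x.1 x.2).const_mul x.1)
    have hsym : ∀ x, 𝒟 (fun x => 𝒟 (fun x : ℝ² => x.1 * A x) x (0, 1)) x (1, 0) =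
        𝒟 Ω x (0, 1) := by
      intro x
      have h1 : IsSymmSndFDerivAt ℝ (fun x : ℝ² => x.1 * A x) x :=
        hF.contDiffAt.isSymmSndFDerivAt (by
        simp only [minSmoothness_of_isRCLikeNormedField]
        exact WithTop.coe_le_coe.2 (le_top : (2 : ℕ∞) ≤ ⊤))
      have h2 := h1.eq (1, 0) (0, 1)
      have hd : Differentiable ℝ (𝒟 fun x : ℝ² => x.1 * A x) :=
        (hF.fderiv_right (m := ∞) (by simp)).diff
      have h3 : ∀ v w, 𝒟 (fun y => 𝒟 (fun x : ℝ² => x.1 * A x) y v) x w =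
          𝒟 (𝒟 fun x : ℝ² => x.1 * A x) x w v := by
        intro v w
        have := ((hd x).hasFDerivAt.clm_apply (hasFDerivAt_const v x)).fderiv
        rw [this]; simp
      rw [h3, h2, ← h3]; congr 2; exact funext hFR
    have hFPs : Smooth fun x => 𝒟 (fun x : ℝ² => x.1 * A x) x (0, 1) :=
      (hF.fderiv_right (by simp)).clm_apply contDiff_const
    have hder : ∀ R, HasDerivAt (fun R => Λ (R, Ψ) + 𝒟 (fun x : ℝ² => x.1 * A x) (R, Ψ) (0, 1)
        - R * G (R, Ψ)) 0 R := by
      intro R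
      have h1 := ((hasDerivAt_fst₂ (hΛ.diff) R Ψ).add
        (hasDerivAt_fst₂ (hFPs.diff) R Ψ)).sub (hG1 R Ψ)
      rw [hsym, hdv, sub_self] at h1; exact h1
    have hc := is_const_of_deriv_eq_zero (fun R => (hder R).differentiableAt) (fun R => (hder R).deriv) R 0
    simp only [hFP, zero_mul, sub_zero, add_zero] at hc; linarith
  · intro Ψ; simp [hG, hdv]
  · intro h0 x
    simp only [hG]
    rw [show (fun s : ℝ => dv (s * x.1, x.2)) = fun _ => 0 from funext fun s => h0 _]
    simp
  · intro c hc R Ψ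
    simp only [hA, hc]
    rw [show (fun s : ℝ => c * (s * R)) = fun s => s * (c * R) from funext fun s => by ring,
      integral_mul_const, integral_id]
    ring
  · intro h0 Ψ
    simp [hB, h0]

end AveragedHamiltonian

set_option maxHeartbeats 1000000 in
/-- Capture into resonance for a truncated averaged system: solutions that start near the
equilibrium stay there and converge. -/
lemma averaged_capture {Λ Ω : ℕ → ℝ² → ℝ} (hΛ : ∀ K, Smooth (Λ K))
    (hΩ : ∀ K, Smooth (Ω K)) {φ₀ ς γ : ℝ} {M N L D n : ℕ} {C₀ δ₀ : ℝ} {c : ℕ → ℝ} (hM : 1 ≤ M)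
    (hL : L + 1 ≤ 2 * M) (hMD : M ≤ D) (hDN : M + D ≤ N)
    (hΛ0 : ∀ K < L, ∀ x, Λ K x = 0) (hΩc : ∀ K < M, ∀ R Ψ, Ω K (R, Ψ) = c K * R) (hc : 0 < c 0)
    (hdiv : ∀ K < D, ∀ x, 𝒟 (Λ K) x (1, 0) + 𝒟 (Ω K) x (0, 1) = 0)
    (hφ : Λ L (0, φ₀) = 0) (hlam : 𝒟 (Λ L) (0, φ₀) (0, 1) < 0)
    (hγ : 𝒟 (Λ D) (0, φ₀) (1, 0) + 𝒟 (Ω D) (0, φ₀) (0, 1) = γ)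
    (hγ0 : γ + (if M + D = N then (L : ℝ) / N else 0) < 0) (hς : ς ∈ Ioo (0 : ℝ) 1)
    (hn : 2 * N * (|γ| + 4) ≤ n) (hδ₀ : 0 < δ₀) (hC₀ : 0 ≤ C₀) :
    ∃ δ, 0 < δ ∧ δ ≤ δ₀ ∧ ∃ δ', 0 < δ' ∧ ∃ τ₀, 1 ≤ τ₀ ∧ ∀ a ≥ τ₀, ∃ K, 0 ≤ K ∧ ∀ b ≥ a,
      ∀ R Ψ R' Ψ' : ℝ → ℝ, (∀ τ ∈ Icc a b, HasDerivWithinAt R (R' τ) (Icc a b) τ ∧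
        HasDerivWithinAt Ψ (Ψ' τ) (Icc a b) τ ∧
        ∀ η, η = τ ^ (-(1 / (2 * N : ℝ))) → |R τ| ≤ δ * η ^ L ∧ |Ψ τ - φ₀| ≤ δ ∧
          |R' τ - (η ^ 2) ^ M * ∑ J ∈ range n, (η ^ 2) ^ J * Λ J (R τ, Ψ τ)|
            ≤ C₀ * (η ^ 2) ^ (M + n) ∧
          |Ψ' τ - (η ^ 2) ^ M * ∑ J ∈ range n, (η ^ 2) ^ J * Ω J (R τ, Ψ τ)|
            ≤ C₀ * (η ^ 2) ^ (M + n)) →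
      (∀ η, η = a ^ (-(1 / (2 * N : ℝ))) → |R a| ≤ δ' * η ^ L) → |Ψ a - φ₀| ≤ δ' →
      ∀ τ ∈ Icc a b, |Ψ τ - φ₀| ≤ δ / 4 ∧
        (∀ η, η = τ ^ (-(1 / (2 * N : ℝ))) → |R τ| ≤ δ / 4 * η ^ L) ∧
        |R τ| ≤ K * ((if M + D = N then
          τ ^ (-(ς / 2 * |γ + (if M + D = N then (L : ℝ) / N else 0)|)) else 0)
            + τ ^ (-((M : ℝ) / N))) ∧
        |Ψ τ - φ₀| ≤ K * ((if M + D = N then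
          τ ^ (-(ς / 2 * |γ + (if M + D = N then (L : ℝ) / N else 0)|)) else 0)
            + τ ^ (-(1 / (N : ℝ)))) := by
  have hN : 1 ≤ N := by omega
  have hsplit := fun K => exists_hamiltonian_splitting (hΛ K) (hΩ K) φ₀
  choose A G₁ B hA hG₁ hB hA1 hB1 hΛs hG0 hGz hAc hBz using hsplit
  obtain ⟨m, hm⟩ : ∃ m, m = 2 * M - L := ⟨_, rfl⟩
  obtain ⟨s, hs⟩ : ∃ s, s = 2 * M + L := ⟨_, rfl⟩
  obtain ⟨e, he⟩ : ∃ e, e = 2 * D - L := ⟨_, rfl⟩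
  have hDn : D < n ∧ N < n := by
    have h1 : (2 * N * 4 : ℝ) ≤ n := by
      refine le_trans ?_ hn
      have := abs_nonneg γ; gcongr; linarith
    have h2 : 2 * N * 4 ≤ n := by exact_mod_cast h1
    omega
  set p : ℝ → ℝ := fun η => ∑ K ∈ range n, if K < M then c K * η ^ (2 * K) else 0 with hp
  set A₁ : ℝ³ → ℝ := fun x => ∑ K ∈ range n,
    if K < M then 0 else x.1 ^ (2 * (K - M)) * A K (x.1 ^ L * x.2.1, x.2.2) with hA₁
  set B₁ : ℝ² → ℝ := fun x => ∑ K ∈ range n,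
    if K < L then 0 else -(x.1 ^ (K - L) * B K x.2) with hB₁
  set h : ℝ³ → ℝ := fun x => p x.1 * x.2.1 ^ 2 / 2 + x.1 ^ m * (x.2.1 * A₁ x)
    + B₁ (x.1 ^ 2, x.2.2) with hh
  set g : ℝ³ → ℝ := fun x => (∑ K ∈ range n,
    if K < D then 0 else x.1 ^ (2 * (K - D)) * G₁ K (x.1 ^ L * x.2.1, x.2.2))
      + L / (2 * N) * x.1 ^ (2 * N - (s + e)) with hg
  have hps : Smooth p := by refine ContDiff.sum fun K _ => ?_; split_ifs <;> fun_prop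
  have hA₁s : Smooth A₁ := by
    refine ContDiff.sum fun K _ => ?_
    have := hA K
    split_ifs <;> fun_prop
  have hB₁s : Smooth B₁ := by
    refine ContDiff.sum fun K _ => ?_
    have := hB K
    split_ifs <;> fun_prop
  have hgs : Smooth g := by
    refine ContDiff.add (ContDiff.sum fun K _ => ?_) (by fun_prop)
    have := hG₁ K
    split_ifs <;> fun_prop
  have hhs : Smooth h := by fun_prop
  have hhd := hhs.diff
  have hz : ∀ K, K ≠ 0 → (0 : ℝ) ^ (2 * K) = 0 := fun K hK => by rw [zero_pow]; omega
  have hp0 : p 0 = c 0 := by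
    simp only [hp]
    rw [sum_eq_single 0]
    · simp [show 0 < M by omega]
    · intro K _ hK; simp [hz K hK]
    · intro h0; simp at h0; omega
  have hB₁0 : ∀ Ψ, B₁ (0, Ψ) = -B L Ψ := by
    intro Ψ
    simp only [hB₁]
    rw [sum_eq_single L]
    · simp
    · intro K _ hK
      split_ifs with h1
      · rfl
      · rw [zero_pow (by omega)]; simp
    · intro h0; simp at h0; omega
  have hg0 : g (0, 0, φ₀) = γ + (if M + D = N then (L : ℝ) / (2 * N) else 0) := by
    simp only [hg]
    rw [sum_eq_single D]
    · congr 1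
      · simp [hG0, hγ]
      · split_ifs with h1
        · rw [show 2 * N - (s + e) = 0 by omega]; simp
        · rw [zero_pow (by omega)]; simp
    · intro K _ hK
      split_ifs with h1
      · rfl
      · rw [zero_pow (by omega)]; simp
    · intro h0; simp at h0; omega
  have hh0 : ∀ V Ψ, h (0, V, Ψ) = c 0 * V ^ 2 / 2 - B L Ψ := by
    intro V Ψ
    simp only [hh]
    rw [hp0, zero_pow (show m ≠ 0 by omega), zero_pow two_ne_zero, hB₁0]; ring
  have hV0 : ∀ V Ψ, 𝒟 h (0, V, Ψ) (0, 1, 0) = c 0 * V := by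
    intro V Ψ
    have h2 := (((hasDerivAt_pow 2 V).const_mul (c 0)).div_const 2).sub_const (B L Ψ)
    rw [(hasDerivAt_snd₃ hhd 0 V Ψ).unique (h2.congr_of_eventuallyEq (.of_forall fun x => hh0 x Ψ))]
    simp; ring
  have hP0 : ∀ V Ψ, 𝒟 h (0, V, Ψ) (0, 0, 1) = -Λ L (0, Ψ) := by
    intro V Ψ
    have h2 := (hB1 L Ψ).const_sub (c 0 * V ^ 2 / 2)
    exact (hasDerivAt_trd₃ hhd 0 V Ψ).unique
      (h2.congr_of_eventuallyEq (.of_forall fun x => hh0 V x))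
  have dV := (hhs.fderiv_apply_const (0, 1, 0)).diff
  have dP := (hhs.fderiv_apply_const (0, 0, 1)).diff
  set b₀ := -𝒟 (Λ L) (0, φ₀) (0, 1) with hb₀
  have hb₀' : 0 < b₀ := neg_pos.2 hlam
  have dΛ := hasDerivAt_snd₂ ((hΛ L).diff) 0 φ₀
  have hVV : 𝒟 (fun x => 𝒟 h x (0, 1, 0)) (0, 0, φ₀) (0, 1, 0) = c 0 :=
    (hasDerivAt_snd₃ dV 0 0 φ₀).unique ((by simpa using! (hasDerivAt_id (0 : ℝ)).const_mul (c 0) :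
      HasDerivAt (fun V => c 0 * V) (c 0) 0).congr_of_eventuallyEq (.of_forall fun x => hV0 x φ₀))
  have hVP : 𝒟 (fun x => 𝒟 h x (0, 1, 0)) (0, 0, φ₀) (0, 0, 1) = 0 :=
    (hasDerivAt_trd₃ dV 0 0 φ₀).unique ((hasDerivAt_const φ₀ (c 0 * 0)).congr_of_eventuallyEq
      (.of_forall fun x => hV0 0 x))
  have hPV : 𝒟 (fun x => 𝒟 h x (0, 0, 1)) (0, 0, φ₀) (0, 1, 0) = 0 :=
    (hasDerivAt_snd₃ dP 0 0 φ₀).unique ((hasDerivAt_const 0 (-Λ L (0, φ₀))).congr_of_eventuallyEq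
      (.of_forall fun x => hP0 x φ₀))
  have hPP : 𝒟 (fun x => 𝒟 h x (0, 0, 1)) (0, 0, φ₀) (0, 0, 1) = b₀ :=
    (hasDerivAt_trd₃ dP 0 0 φ₀).unique (dΛ.neg.congr_of_eventuallyEq (.of_forall fun x => hP0 0 x))
  have hscale : ∀ η V Ψ, η ^ (2 * L) * h (η, V, Ψ) = ∑ K ∈ range n,
      (η ^ 2) ^ K * ((η ^ L * V) * A K (η ^ L * V, Ψ) - B K Ψ) := by
    intro η V Ψ
    simp only [hh, hp, hA₁, hB₁]
    rw [sum_mul, sum_div, mul_sum, mul_sum, ← sum_add_distrib,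
      ← sum_add_distrib, mul_sum]
    refine sum_congr rfl fun K _ => ?_
    have t1 : η ^ (2 * L) * ((if K < M then c K * η ^ (2 * K) else 0) * V ^ 2 / 2
        + η ^ m * (V * if K < M then 0 else η ^ (2 * (K - M)) * A K (η ^ L * V, Ψ))) =
        (η ^ 2) ^ K * ((η ^ L * V) * A K (η ^ L * V, Ψ)) := by
      split_ifs with h1
      · rw [hAc K (c K) (hΩc K h1)]; ring
      · have : η ^ (2 * L) * (η ^ m * η ^ (2 * (K - M))) = (η ^ 2) ^ K * η ^ L := by
          rw [← pow_add, ← pow_add, ← pow_mul, ← pow_add]; congr 1; omega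
        linear_combination (V * A K (η ^ L * V, Ψ)) * this
    have t2 : η ^ (2 * L) * (if K < L then 0 else -((η ^ 2) ^ (K - L) * B K Ψ)) =
        -((η ^ 2) ^ K * B K Ψ) := by
      split_ifs with h1
      · rw [hBz K fun Ψ => hΛ0 K h1 _]; simp
      · have : η ^ (2 * L) * (η ^ 2) ^ (K - L) = (η ^ 2) ^ K := by
          rw [← pow_mul, ← pow_mul, ← pow_add]; congr 1; omega
        linear_combination (-B K Ψ) * this
    linear_combination t1 + t2
  have hfV : ∀ η V Ψ, η ≠ 0 → η ^ L * 𝒟 h (η, V, Ψ) (0, 1, 0) =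
      ∑ J ∈ range n, (η ^ 2) ^ J * Ω J (η ^ L * V, Ψ) := by
    intro η V Ψ hη
    have h1 := (hasDerivAt_snd₃ hhd η V Ψ).const_mul (η ^ (2 * L))
    have h2 : HasDerivAt (fun V => ∑ K ∈ range n,
        (η ^ 2) ^ K * ((η ^ L * V) * A K (η ^ L * V, Ψ) - B K Ψ))
        (∑ K ∈ range n, (η ^ 2) ^ K * (Ω K (η ^ L * V, Ψ) * η ^ L)) V := by
      refine HasDerivAt.fun_sum fun K _ => ?_
      have := (hA1 K (η ^ L * V) Ψ).comp V ((hasDerivAt_id V).const_mul (η ^ L))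
      rw [mul_one] at this
      exact (this.sub_const (B K Ψ)).const_mul _
    have h3 := h1.unique (h2.congr_of_eventuallyEq (.of_forall fun x => hscale η x Ψ))
    have h4 : η ^ L * (η ^ L * 𝒟 h (η, V, Ψ) (0, 1, 0)) =
        η ^ L * ∑ J ∈ range n, (η ^ 2) ^ J * Ω J (η ^ L * V, Ψ) := by
      rw [mul_sum, ← mul_assoc, ← pow_add, ← two_mul, h3]
      exact sum_congr rfl fun K _ => by ring
    exact mul_left_cancel₀ (pow_ne_zero L hη) h4
  have hfP : ∀ η V Ψ, η ≠ 0 → η ^ L * (η ^ L * (-𝒟 h (η, V, Ψ) (0, 0, 1))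
        + η ^ (2 * D) * (V * (g (η, V, Ψ) - L / (2 * N) * η ^ (2 * N - (s + e))))) =
      ∑ J ∈ range n, (η ^ 2) ^ J * Λ J (η ^ L * V, Ψ) := by
    intro η V Ψ hη
    have h1 := (hasDerivAt_trd₃ hhd η V Ψ).const_mul (η ^ (2 * L))
    have h2 : HasDerivAt (fun Ψ => ∑ K ∈ range n,
        (η ^ 2) ^ K * ((η ^ L * V) * A K (η ^ L * V, Ψ) - B K Ψ))
        (∑ K ∈ range n, (η ^ 2) ^ K * ((η ^ L * V) * 𝒟 (A K) (η ^ L * V, Ψ) (0, 1)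
          - Λ K (0, Ψ))) Ψ := by
      refine HasDerivAt.fun_sum fun K _ => ?_
      exact (((hasDerivAt_snd₂ ((hA K).diff) _ Ψ).const_mul _).sub (hB1 K Ψ)).const_mul _
    have h3 := h1.unique (h2.congr_of_eventuallyEq (.of_forall fun x => hscale η V x))
    have h4 : η ^ L * (η ^ (2 * D) * (V * (g (η, V, Ψ) - L / (2 * N) * η ^ (2 * N - (s + e))))) =
        ∑ J ∈ range n, (η ^ 2) ^ J * ((η ^ L * V) * G₁ J (η ^ L * V, Ψ)) := by
      simp only [hg, add_sub_cancel_right]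
      rw [mul_sum, mul_sum, mul_sum]
      refine sum_congr rfl fun K _ => ?_
      split_ifs with h1
      · rw [hGz K (hdiv K h1)]; simp
      · have : η ^ (2 * D) * η ^ (2 * (K - D)) = (η ^ 2) ^ K := by
          rw [← pow_add, ← pow_mul]; congr 1; omega
        linear_combination (η ^ L * V * G₁ K (η ^ L * V, Ψ)) * this
    have h5 : η ^ L * (η ^ L * (-𝒟 h (η, V, Ψ) (0, 0, 1))) =
        ∑ J ∈ range n, (η ^ 2) ^ J * (Λ J (0, Ψ)
          - (η ^ L * V) * 𝒟 (A J) (η ^ L * V, Ψ) (0, 1)) := by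
      rw [← mul_assoc, ← pow_add, ← two_mul, mul_neg, h3, ← sum_neg_distrib]
      exact sum_congr rfl fun K _ => by ring
    rw [mul_add, h4, h5, ← sum_add_distrib]
    refine sum_congr rfl fun K _ => ?_
    rw [hΛs K (η ^ L * V) Ψ]; ring
  set γh := γ + (if M + D = N then (L : ℝ) / N else 0) with hγh
  set G : ℝ := if M + D = N then ς * |γh| else (2 * M + 2) / N with hGdef
  have hL0 : (0 : ℝ) ≤ L / N := by positivity
  have hγh' : |γh| ≤ |γ| := by
    rw [abs_of_neg hγ0]
    refine le_trans ?_ (neg_le_abs γ); rw [hγh]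
    split_ifs <;> linarith
  have hG : 0 < G := by
    rw [hGdef]
    split_ifs
    · exact mul_pos hς.1 (abs_pos.2 hγ0.ne)
    · positivity
  have hG2 : G ≤ |γ| + 2 := by
    rw [hGdef]
    split_ifs with h1
    · have := mul_le_of_le_one_left (abs_nonneg γh) hς.2.le; linarith
    · have h2 : M + 1 ≤ N := by omega
      have h3 : (M : ℝ) + 1 ≤ N := by exact_mod_cast h2
      have h4 : (2 * M + 2 : ℝ) / N ≤ 2 := by rw [div_le_iff₀ (by positivity)]; linarith
      have := abs_nonneg γ; linarith
  have hg0' : g (0, 0, φ₀) ≤ γh := by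
    rw [hg0, hγh]
    split_ifs
    · have : (L : ℝ) / (2 * N) = L / N / 2 := by field_simp
      linarith
    · exact le_rfl
  obtain ⟨Vs, Ps, r₁, r₂, hVs, hPs, hr₁, hr₂, hVs0, hPs0, hf₁, hf₂⟩ :=
    exists_formal_solution hhs hgs (c := 1 / (2 * N)) (e := e) (a := 2 * N + 1 - s) (by omega)
      (by omega) hc.ne' hb₀'.ne' (by rw [hV0, mul_zero]) (by rw [hP0, hφ, neg_zero]) hVV hVP hPV hPP n
  obtain ⟨oV, oP⟩ := formal_solution_isBigO (h := h) hgs hA₁s hps hB₁s (m := m) (e := e)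
    (a := 2 * N + 1 - s) (n := n) (φ₀ := φ₀) (b₀ := b₀) (by omega) (by omega) (by omega) (by omega)
    (by omega) (by omega) (fun _ _ _ => rfl) (by rw [hp0]; exact hc.ne') hb₀'.ne' (by
      have h1 := (hasDerivAt_snd₂ (hB₁s.diff) 0 φ₀)
      rw [h1.unique ((hB1 L φ₀).neg.congr_of_eventuallyEq (.of_forall fun x => hB₁0 x)),
        hφ, neg_zero])
    (by
      have h0 : ∀ x, 𝒟 B₁ (0, x) (0, 1) = -Λ L (0, x) := fun x =>
        (hasDerivAt_snd₂ (hB₁s.diff) 0 x).unique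
          ((hB1 L x).neg.congr_of_eventuallyEq (.of_forall fun x => hB₁0 x))
      have h1 := hasDerivAt_snd₂ (((hB₁s.fderiv_right (m := ∞) (by simp)).clm_apply
        (contDiff_const (c := ((0 : ℝ), (1 : ℝ))))).diff) 0 φ₀
      exact h1.unique (dΛ.neg.congr_of_eventuallyEq (.of_forall fun x => h0 x)))
    hVs hPs hr₁ hr₂ hPs0 hf₁ hf₂
  obtain ⟨K1, hK1, oV⟩ := oV.exists_pos
  obtain ⟨K2, hK2, oP⟩ := oP.exists_pos
  obtain ⟨η₁, hη₁, hVP1⟩ : ∃ η₁ > 0, ∀ η, 0 < η → η < η₁ → |Vs η| ≤ K1 * η ^ m ∧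
      |Ps η - φ₀| ≤ K2 * η ^ 2 := by
    obtain ⟨η₁, hη₁, h1⟩ := mem_nhdsGT_iff_exists_Ioo_subset.1 (oV.bound.and oP.bound)
    refine ⟨η₁, hη₁, fun η h2 h3 => ?_⟩
    have := h1 ⟨h2, h3⟩
    simpa [abs_of_pos h2] using this
  obtain ⟨δ, hδ, hδδ, δ', hδ', τ₀, hτ₀, main⟩ := lyapunov_trapping hhs hgs (C₀ := C₀) (n := n) (s := s)
    (e := e) hN (by omega) (by omega) hc hb₀' (hg0'.trans_lt hγ0) hVV hVP hPV hPP rfl hG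
    (fun h1 => by
      have h2 : M + D = N := by omega
      rw [hGdef, if_pos h2]
      have h3 : |γh| = -γh := abs_of_neg hγ0
      have h4 : 0 < |γh| := abs_pos.2 hγ0.ne
      have := mul_lt_of_lt_one_left h4 hς.2
      linarith)
    (le_trans (mul_le_mul_of_nonneg_left (by linarith) (by positivity)) hn) hδ₀ hC₀ hVs hPs hr₁ hr₂ hVs0 hPs0 hf₁ hf₂
  obtain ⟨τ₁, hτ₁⟩ := eventually_atTop.1 ((tendsto_rpow_neg_inv hN).eventually_lt_const hη₁)
  refine ⟨δ, hδ, hδδ, δ', hδ', max τ₀ τ₁, hτ₀.trans (le_max_left _ _), fun a ha => ?_⟩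
  have ha1 : 1 ≤ a := hτ₀.trans ((le_max_left _ _).trans ha)
  have ha0 : 0 < a := by linarith
  refine ⟨K1 + K2 + δ * a ^ (G / 2), by positivity, fun b hb R Ψ R' Ψ' hsol hRa hΨa => ?_⟩
  set ηf : ℝ → ℝ := fun τ => τ ^ (-(1 / (2 * N : ℝ))) with hηf
  have hτpos : ∀ τ ∈ Icc a b, 0 < τ := fun τ hτ => by linarith [hτ.1]
  have hηpos : ∀ τ ∈ Icc a b, 0 < ηf τ := fun τ hτ => rpow_pos_of_pos (hτpos τ hτ) _
  have hη1 : ∀ τ ∈ Icc a b, ηf τ ≤ 1 := fun τ hτ =>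
    rpow_le_one_of_one_le_of_nonpos (ha1.trans hτ.1) (by rw [neg_nonpos]; positivity)
  have hRV : ∀ τ ∈ Icc a b, ηf τ ^ L * (R τ * (ηf τ ^ L)⁻¹) = R τ := fun τ hτ => by
    have := (pow_pos (hηpos τ hτ) L).ne'; field_simp
  have haI : a ∈ Icc a b := ⟨le_rfl, hb⟩
  have hVb : ∀ τ ∈ Icc a b, ∀ d, |R τ * (ηf τ ^ L)⁻¹| ≤ d ↔ |R τ| ≤ d * ηf τ ^ L := by
    intro τ hτ d
    have h1 := pow_pos (hηpos τ hτ) L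
    rw [abs_mul, abs_inv, abs_of_pos h1, ← div_eq_mul_inv, div_le_iff₀ h1]
  have := main a ((le_max_left _ _).trans ha) b hb (fun τ => R τ * (ηf τ ^ L)⁻¹) Ψ
    (fun τ => R' τ * (ηf τ ^ L)⁻¹ + L / (2 * N) * ηf τ ^ (2 * N) * (R τ * (ηf τ ^ L)⁻¹)) Ψ'
    (fun τ hτ => by
      obtain ⟨dR, dΨ, hb'⟩ := hsol τ hτ
      obtain ⟨b1, b2, b3, b4⟩ := hb' (ηf τ) rfl
      have hη := hηpos τ hτ
      refine ⟨?_, dΨ, (hVb τ hτ δ).2 b1, b2, ?_⟩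
      · have dη := (hasDerivAt_rpow_neg_inv hN (hτpos τ hτ)).hasDerivWithinAt (s := Icc a b)
        have d2 := dR.mul ((dη.pow L).inv (pow_pos hη L).ne')
        refine d2.congr_deriv ?_
        simp only [Pi.pow_apply, Pi.inv_apply]
        change R' τ * (ηf τ ^ L)⁻¹ + R τ * (-(L * ηf τ ^ (L - 1) * (-(1 / (2 * N)) * ηf τ ^ (2 * N + 1)))
          / (ηf τ ^ L) ^ 2) = _
        congr 1
        rcases Nat.eq_zero_or_pos L with h0 | h0
        · simp [h0]
        · obtain ⟨L', rfl⟩ : ∃ L', L = L' + 1 := ⟨L - 1, by omega⟩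
          rw [Nat.add_sub_cancel]; field_simp; ring
      · rintro η rfl
        have e1 := hfV (ηf τ) (R τ * (ηf τ ^ L)⁻¹) (Ψ τ) hη.ne'
        have e2 := hfP (ηf τ) (R τ * (ηf τ ^ L)⁻¹) (Ψ τ) hη.ne'; rw [hRV τ hτ] at e1 e2
        rw [← e1] at b4; rw [← e2] at b3
        change |R' τ * (ηf τ ^ L)⁻¹ + L / (2 * N) * ηf τ ^ (2 * N) * (R τ * (ηf τ ^ L)⁻¹) -
          (-(ηf τ ^ s * 𝒟 h (ηf τ, R τ * (ηf τ ^ L)⁻¹, Ψ τ) (0, 0, 1)) + ηf τ ^ (s + e)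
          * (R τ * (ηf τ ^ L)⁻¹ * g (ηf τ, R τ * (ηf τ ^ L)⁻¹, Ψ τ)))| ≤ C₀ * ηf τ ^ n ∧
          |Ψ' τ - ηf τ ^ s * 𝒟 h (ηf τ, R τ * (ηf τ ^ L)⁻¹, Ψ τ) (0, 1, 0)| ≤ C₀ * ηf τ ^ n
        set V := R τ * (ηf τ ^ L)⁻¹
        set η := ηf τ
        have h1 := hη1 τ hτ
        constructor
        · have e3 : R' τ * (η ^ L)⁻¹ + L / (2 * N) * η ^ (2 * N) * V -
              (-(η ^ s * 𝒟 h (η, V, Ψ τ) (0, 0, 1)) + η ^ (s + e) * (V * g (η, V, Ψ τ))) =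
              (R' τ - (η ^ 2) ^ M * (η ^ L * (η ^ L * (-𝒟 h (η, V, Ψ τ) (0, 0, 1))
              + η ^ (2 * D) * (V * (g (η, V, Ψ τ) - L / (2 * N) * η ^ (2 * N - (s + e))))))) *
              (η ^ L)⁻¹ := by
            have p1 : η ^ (2 * M) * η ^ (2 * D) * η ^ (2 * N - (s + e)) = η ^ (2 * N) := by
              rw [← pow_add, ← pow_add]; congr 1; omega
            have p2 : η ^ (s + e) = η ^ (2 * M) * η ^ (2 * D) := by rw [← pow_add]; congr 1; omega
            have p3 : η ^ s = η ^ (2 * M) * η ^ L := by rw [← pow_add, hs]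
            have p4 : η ^ L * (η ^ L)⁻¹ = 1 := mul_inv_cancel₀ (pow_pos hη L).ne'
            rw [p2, p3, ← p1, ← pow_mul]
            linear_combination (η ^ (2 * M) * (η ^ L * (-𝒟 h (η, V, Ψ τ) (0, 0, 1))
              + η ^ (2 * D) * (V * (g (η, V, Ψ τ) - L / (2 * N) * η ^ (2 * N - (s + e)))))) * p4
          rw [e3, abs_mul, abs_inv, abs_of_pos (pow_pos hη L), ← div_eq_mul_inv,
            div_le_iff₀ (pow_pos hη L)]
          refine b3.trans ?_
          rw [mul_assoc, ← pow_add, ← pow_mul]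
          exact mul_le_mul_of_nonneg_left (pow_le_pow_of_le_one hη.le h1 (by omega)) hC₀
        · have e3 : η ^ s * 𝒟 h (η, V, Ψ τ) (0, 1, 0) =
              (η ^ 2) ^ M * (η ^ L * 𝒟 h (η, V, Ψ τ) (0, 1, 0)) := by
            rw [hs, pow_add, ← pow_mul]; ring
          rw [e3]; refine b4.trans ?_; rw [← pow_mul]
          exact mul_le_mul_of_nonneg_left (pow_le_pow_of_le_one hη.le h1 (by omega)) hC₀)
    ((hVb a haI δ').2 (hRa _ rfl)) hΨa
  intro τ hτ
  obtain ⟨q1, q2, q3⟩ := this τ hτ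
  have hη := hηpos τ hτ
  have hη1' := hη1 τ hτ
  have hτ0 := hτpos τ hτ
  have hτ1 : 1 ≤ τ := ha1.trans hτ.1
  have q3 := q3 (ηf τ) rfl
  set x := δ * a ^ (G / 2) * τ ^ (-(G / 2)) with hx
  have hx2 : δ ^ 2 * (a / τ) ^ G = x ^ 2 := by
    rw [hx, div_rpow ha0.le hτ0.le, mul_pow, mul_pow, ← rpow_natCast, ← rpow_natCast,
      ← rpow_natCast, ← rpow_mul ha0.le, ← rpow_mul hτ0.le, div_eq_mul_inv,
      ← rpow_neg hτ0.le, ← mul_assoc]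
    push_cast; congr 2
    · congr 1; ring
    · ring
  have hx0 : 0 ≤ x := by positivity
  rw [hx2] at q3
  have y1 : |R τ * (ηf τ ^ L)⁻¹ - Vs (ηf τ)| ≤ x :=
    abs_le_of_sq_le_sq ((le_add_of_nonneg_right (sq_nonneg _)).trans q3) hx0
  have y2 : |Ψ τ - Ps (ηf τ)| ≤ x :=
    abs_le_of_sq_le_sq ((le_add_of_nonneg_left (sq_nonneg _)).trans q3) hx0
  obtain ⟨z1, z2⟩ := hVP1 (ηf τ) hη (hτ₁ τ ((le_max_right _ _).trans (ha.trans hτ.1)))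
  have hNr0 : (N : ℝ) ≠ 0 := by positivity
  have hpow : ∀ k : ℕ, ηf τ ^ (2 * k) = τ ^ (-((k : ℝ) / N)) := by
    intro k
    simp only [hηf]
    rw [← rpow_natCast, ← rpow_mul hτ0.le]; congr 1; push_cast; field_simp
  set E := (if M + D = N then τ ^ (-(ς / 2 * |γh|)) else 0) with hE
  have hE0 : 0 ≤ E := by positivity
  have hEG : ∀ k : ℕ, k ≤ M + 1 → τ ^ (-(G / 2)) ≤ E + τ ^ (-((k : ℝ) / N)) := by
    intro k hk
    have h0 : 0 ≤ τ ^ (-((k : ℝ) / N)) := by positivity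
    by_cases hc : M + D = N
    · have : τ ^ (-(G / 2)) = E := by rw [hE, hGdef, if_pos hc, if_pos hc]; congr 1; ring
      linarith
    · have : τ ^ (-(G / 2)) ≤ τ ^ (-((k : ℝ) / N)) := by
        refine rpow_le_rpow_of_exponent_le hτ1 ?_
        rw [hGdef, if_neg hc, neg_le_neg_iff, div_div, div_le_div_iff₀ (by positivity) (by positivity)]
        have : (k : ℝ) ≤ M + 1 := by exact_mod_cast hk
        nlinarith
      linarith
  refine ⟨q2, ?_, ?_, ?_⟩
  · rintro η rfl
    exact (hVb τ hτ _).1 q1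
  · have h1 : |R τ * (ηf τ ^ L)⁻¹| ≤ x + K1 * ηf τ ^ m := by
      have := abs_sub_abs_le_abs_sub (R τ * (ηf τ ^ L)⁻¹) (Vs (ηf τ)); linarith
    have h2 := (hVb τ hτ _).1 h1
    have h3 : ηf τ ^ m * ηf τ ^ L = τ ^ (-((M : ℝ) / N)) := by
      rw [← pow_add, ← hpow]; congr 1; omega
    have h4 : ηf τ ^ L ≤ 1 := pow_le_one₀ hη.le hη1'
    have h5 := hEG M (by omega)
    calc |R τ| ≤ (x + K1 * ηf τ ^ m) * ηf τ ^ L := h2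
      _ = x * ηf τ ^ L + K1 * τ ^ (-((M : ℝ) / N)) := by rw [← h3]; ring
      _ ≤ x * 1 + K1 * τ ^ (-((M : ℝ) / N)) := by gcongr
      _ ≤ δ * a ^ (G / 2) * (E + τ ^ (-((M : ℝ) / N))) + K1 * (E + τ ^ (-((M : ℝ) / N))) := by
        rw [hx, mul_one]; gcongr; linarith
      _ ≤ _ := by
        have : 0 ≤ K2 * (E + τ ^ (-((M : ℝ) / N))) := by positivity
        linarith
  · have h1 : |Ψ τ - φ₀| ≤ x + K2 * ηf τ ^ 2 := by
      have : Ψ τ - φ₀ = (Ψ τ - Ps (ηf τ)) + (Ps (ηf τ) - φ₀) := by ring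
      rw [this]
      exact (abs_add_le _ _).trans (by linarith)
    have h3 := hpow 1
    rw [mul_one, Nat.cast_one] at h3
    have h5 := hEG 1 (by omega)
    rw [Nat.cast_one] at h5
    calc |Ψ τ - φ₀| ≤ x + K2 * τ ^ (-(1 / (N : ℝ))) := by rw [← h3]; exact h1
      _ ≤ δ * a ^ (G / 2) * (E + τ ^ (-(1 / (N : ℝ)))) + K2 * (E + τ ^ (-(1 / (N : ℝ)))) := by
        rw [hx]; gcongr; linarith
      _ ≤ _ := by
        have : 0 ≤ K1 * (E + τ ^ (-(1 / (N : ℝ)))) := by positivity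
        linarith

/-! ### Averaging -/

namespace PerturbedSystem

section Mean

variable (P : PerturbedSystem) {ϰ : ℕ} {E : Type} [NormedAddCommGroup E] [NormedSpace ℝ E]

lemma contDiff_mean (hT : 0 < 2 * π * ϰ) {C : E → ℝ → ℝ}
    (hC : ParamSmooth (2 * π * ϰ) C) : Smooth fun p => mean ϰ (C p) :=
  contDiff_const.mul (hC.integral_period hT)

lemma zeroMeanPrimitive_paramSmooth (hT : 0 < 2 * π * ϰ) {C : E → ℝ → ℝ}
    (hC : ParamSmooth (2 * π * ϰ) C) :
    ParamSmooth (2 * π * ϰ) fun p => P.zeroMeanPrimitive ϰ (C p) := by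
  have h1 : ParamSmooth (2 * π * ϰ) fun p ζ => C p ζ - mean ϰ (C p) :=
    hC.sub (.of_param (contDiff_mean hT hC))
  have h2 : ∀ p, ∫ ζ in (0 : ℝ)..(2 * π * ϰ), (C p ζ - mean ϰ (C p)) = 0 := by
    intro p
    rw [integral_sub ((hC.cont p).intervalIntegrable _ _) (by simp)]
    simp only [mean, integral_const, sub_zero, smul_eq_mul]
    rw [← mul_assoc, mul_one_div_cancel hT.ne', one_mul, sub_self]
  have h3 := (ParamSmooth.const (E := E) (T := 2 * π * ϰ) (-(1 / P.vartheta))).mul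
    (h1.primitive hT h2)
  exact h3.sub (.of_param (contDiff_mean hT h3))

lemma hasDerivAt_zeroMeanPrimitive {C : ℝ → ℝ} (hC : Continuous C) (ζ : ℝ) :
    HasDerivAt (P.zeroMeanPrimitive ϰ C) (-(1 / P.vartheta) * (C ζ - mean ϰ C)) ζ := by
  have h1 : Continuous fun ζ => C ζ - mean ϰ C := by fun_prop
  have h2 := integral_hasDerivAt_right (h1.intervalIntegrable 0 ζ)
    h1.stronglyMeasurable.stronglyMeasurableAtFilter h1.continuousAt
  exact (h2.const_mul _).sub_const _

end Mean

section Correction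

variable {P : PerturbedSystem} {ϰ : ℕ}

lemma correction_congr (hM : 1 ≤ P.M) (hN : 1 ≤ P.N) {K : ℕ} {prev prev' : ℕ → AvgTerm}
    (h : ∀ j < K, prev j = prev' j) (w : AvgTerm → ℝ → ℝ → ℝ → ℝ) (V : AvgTerm → ℝ → ℝ → ℝ)
    (r θ ζ : ℝ) : P.correction ϰ K prev w V r θ ζ = P.correction ϰ K prev' w V r θ ζ := by
  unfold correction; congr 1
  · congr 1
    · split_ifs with h1
      · refine sum_congr rfl fun j hj => ?_
        rw [Finset.mem_range] at hj; rw [h j (by omega)]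
      · rfl
    · split_ifs with h1
      · rw [h _ (by omega)]
      · rfl
  · congr 2
    funext ε
    refine sum_congr rfl fun J hJ => ?_
    rw [h J (Finset.mem_range.1 hJ)]; congr 3
    · exact sum_congr rfl fun k hk => by rw [h k (Finset.mem_range.1 hk)]
    · exact sum_congr rfl fun k hk => by rw [h k (Finset.mem_range.1 hk)]

lemma avgTerm_eq (hM : 1 ≤ P.M) (hN : 1 ≤ P.N) (K : ℕ) :
    P.avgTerm ϰ K = P.avgStep ϰ K (P.avgTerm ϰ) := by
  have h : ∀ j < K, (if _hj : j < K then P.avgTerm ϰ j else AvgTerm.zero) = P.avgTerm ϰ j :=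
    fun j hj => by rw [dif_pos hj]
  rw [avgTerm]
  unfold avgStep
  simp only [correction_congr hM hN h]

structure AvgTerm.Regular (T : ℝ) (t : AvgTerm) : Prop where
  rho : ParamSmooth T fun (p : ℝ²) ζ => t.rho p.1 p.2 ζ
  psi : ParamSmooth T fun (p : ℝ²) ζ => t.psi p.1 p.2 ζ
  Lam : Smooth fun p : ℝ² => t.Lam p.1 p.2
  Om : Smooth fun p : ℝ² => t.Om p.1 p.2

/-- The sum `∑_{J<n} ε^J V_J(R, Ψ)` with `R = r + ∑_{k<n} ε^(M+k) ρ_k`,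
`Ψ = θ + ∑_{k<n} ε^(M+k) ψ_k`. -/
def transformedSum (P : PerturbedSystem) (t : ℕ → AvgTerm) (V : AvgTerm → ℝ → ℝ → ℝ) (m n : ℕ)
    (x : ℝ³) (ζ : ℝ) : ℝ :=
  ∑ J ∈ range m, x.1 ^ J * V (t J)
    (x.2.1 + ∑ k ∈ range n, x.1 ^ (P.M + k) * (t k).rho x.2.1 x.2.2 ζ)
    (x.2.2 + ∑ k ∈ range n, x.1 ^ (P.M + k) * (t k).psi x.2.1 x.2.2 ζ)

variable {T : ℝ}

lemma paramSmooth_transform {w : ℕ → ℝ → ℝ → ℝ → ℝ} {n : ℕ}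
    (hw : ∀ k < n, ParamSmooth T fun (p : ℝ²) ζ => w k p.1 p.2 ζ)
    {pr : ℝ³ → ℝ} (hpr : Smooth pr) : ParamSmooth T fun (x : ℝ³) ζ =>
      pr x + ∑ k ∈ range n, x.1 ^ (P.M + k) * w k x.2.1 x.2.2 ζ :=
  (ParamSmooth.of_param hpr).add (ParamSmooth.sum fun k hk =>
    (ParamSmooth.of_param (f := fun x : ℝ³ => x.1 ^ (P.M + k)) (by fun_prop)).mul
      ((hw k (Finset.mem_range.1 hk)).comp (φ := fun x : ℝ³ => x.2) contDiff_snd))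

lemma paramSmooth_transformedSum {t : ℕ → AvgTerm} {V : AvgTerm → ℝ → ℝ → ℝ} {m n : ℕ}
    (ht : ∀ k < n, (t k).Regular T) (hV : ∀ k < m, Smooth fun p : ℝ² => V (t k) p.1 p.2) :
    ParamSmooth T (P.transformedSum t V m n) :=
  ParamSmooth.sum fun J hJ =>
    (ParamSmooth.of_param (f := fun x : ℝ³ => x.1 ^ J) (by fun_prop)).mul
    ((paramSmooth_transform (fun k hk => (ht k hk).rho) (by fun_prop)).comp₂
      (paramSmooth_transform (fun k hk => (ht k hk).psi) (by fun_prop))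
      (hV J (Finset.mem_range.1 hJ)))

lemma correction_eq {K : ℕ} {t : ℕ → AvgTerm} {w : AvgTerm → ℝ → ℝ → ℝ → ℝ}
    {V : AvgTerm → ℝ → ℝ → ℝ} (r θ ζ : ℝ) : P.correction ϰ K t w V r θ ζ = (if P.M ≤ K then
      ∑ j ∈ range (K - P.M + 1),
        (P.Acoeff ϰ (K - P.M - j) r θ ζ * deriv (fun v => w (t j) v θ ζ) r
          + P.Bcoeff ϰ (K - P.M - j) r θ ζ * deriv (fun v => w (t j) r v ζ) θ)
    else 0)
  - (if P.N ≤ K then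
      ((P.M : ℝ) + (K - P.N : ℕ)) / P.N * w (t (K - P.N)) r θ ζ
    else 0)
  - taylorCoef K (fun ε => P.transformedSum t V K K (ε, r, θ) ζ) := by
  rw [correction, taylorCoef, smul_eq_mul, inv_mul_eq_div]; rfl

lemma paramSmooth_correction (hT : 0 < T) (hM : 1 ≤ P.M) (hN : 1 ≤ P.N)
    (hA : ∀ k, ParamSmooth T fun (p : ℝ²) ζ => P.Acoeff ϰ k p.1 p.2 ζ)
    (hB : ∀ k, ParamSmooth T fun (p : ℝ²) ζ => P.Bcoeff ϰ k p.1 p.2 ζ)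
    {K : ℕ} {t : ℕ → AvgTerm} {w : AvgTerm → ℝ → ℝ → ℝ → ℝ} {V : AvgTerm → ℝ → ℝ → ℝ}
    (ht : ∀ k < K, (t k).Regular T)
    (hw : ∀ k < K, ParamSmooth T fun (p : ℝ²) ζ => w (t k) p.1 p.2 ζ)
    (hV : ∀ k < K, Smooth fun p : ℝ² => V (t k) p.1 p.2) :
    ParamSmooth T fun (p : ℝ²) ζ => P.correction ϰ K t w V p.1 p.2 ζ := by
  simp only [correction_eq]
  refine ((?_ : ParamSmooth T _).sub ?_).sub ?_
  · split_ifs with h1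
    · refine ParamSmooth.sum fun j hj => ?_
      rw [Finset.mem_range] at hj
      have hj' := hw j (by omega)
      have e1 := hj'.fderiv_apply hT (1, 0)
      have e2 := hj'.fderiv_apply hT (0, 1)
      have d : ∀ ζ, Differentiable ℝ fun p : ℝ² => w (t j) p.1 p.2 ζ := fun ζ =>
        (hj'.eval hT ζ).diff
      have e3 : ParamSmooth T fun (p : ℝ²) ζ => deriv (fun v => w (t j) v p.2 ζ) p.1 := by
        convert e1 using 3 with p ζ
        exact (hasDerivAt_fst₂ (d ζ) p.1 p.2).deriv
      have e4 : ParamSmooth T fun (p : ℝ²) ζ => deriv (fun v => w (t j) p.1 v ζ) p.2 := by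
        convert e2 using 3 with p ζ
        exact (hasDerivAt_snd₂ (d ζ) p.1 p.2).deriv
      exact ((hA _).mul e3).add ((hB _).mul e4)
    · exact ParamSmooth.const 0
  · split_ifs with h1
    · exact (ParamSmooth.const _).mul (hw _ (by omega))
    · exact ParamSmooth.const 0
  · have := (paramSmooth_transformedSum (P := P) (m := K) ht hV).taylorCoef_param hT K
    exact this

end Correction

section AvgTerm

variable {P : PerturbedSystem} {ϰ : ℕ} (hT : 0 < 2 * π * ϰ) (hM : 1 ≤ P.M) (hN : 1 ≤ P.N)
    (hA : ∀ k, ParamSmooth (2 * π * ϰ) fun (p : ℝ²) ζ => P.Acoeff ϰ k p.1 p.2 ζ)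
    (hB : ∀ k, ParamSmooth (2 * π * ϰ) fun (p : ℝ²) ζ => P.Bcoeff ϰ k p.1 p.2 ζ)
include hT hM hN hA hB

lemma avgTerm_regular (K : ℕ) : (P.avgTerm ϰ K).Regular (2 * π * ϰ) := by
  induction K using Nat.strong_induction_on with
  | _ K ih =>
    have h1 := (hA K).add (paramSmooth_correction (w := AvgTerm.rho) (V := AvgTerm.Lam) hT hM hN hA hB
      ih (fun k hk => (ih k hk).rho) (fun k hk => (ih k hk).Lam))
    have h2 := (hB K).add (paramSmooth_correction (w := AvgTerm.psi) (V := AvgTerm.Om) hT hM hN hA hB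
      ih (fun k hk => (ih k hk).psi) (fun k hk => (ih k hk).Om))
    rw [avgTerm_eq hM hN]
    exact ⟨P.zeroMeanPrimitive_paramSmooth hT h1, P.zeroMeanPrimitive_paramSmooth hT h2,
      contDiff_mean hT h1, contDiff_mean hT h2⟩

lemma paramSmooth_correction_avgTerm_rho (K : ℕ) : ParamSmooth (2 * π * ϰ)
    fun (p : ℝ²) ζ => P.correction ϰ K (P.avgTerm ϰ) AvgTerm.rho AvgTerm.Lam p.1 p.2 ζ :=
  have ih := avgTerm_regular hT hM hN hA hB
  paramSmooth_correction hT hM hN hA hB (fun k _ => ih k) (fun k _ => (ih k).rho) (fun k _ => (ih k).Lam)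

lemma paramSmooth_correction_avgTerm_psi (K : ℕ) : ParamSmooth (2 * π * ϰ)
    fun (p : ℝ²) ζ => P.correction ϰ K (P.avgTerm ϰ) AvgTerm.psi AvgTerm.Om p.1 p.2 ζ :=
  have ih := avgTerm_regular hT hM hN hA hB
  paramSmooth_correction hT hM hN hA hB (fun k _ => ih k) (fun k _ => (ih k).psi) (fun k _ => (ih k).Om)

lemma hasDerivAt_avgTerm_rho (K : ℕ) (r θ ζ : ℝ) :
    HasDerivAt ((P.avgTerm ϰ K).rho r θ) (-(1 / P.vartheta) * (P.Acoeff ϰ K r θ ζ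
      + P.correction ϰ K (P.avgTerm ϰ) AvgTerm.rho AvgTerm.Lam r θ ζ - P.Lambda ϰ K r θ)) ζ := by
  have h1 := (hA K).add (paramSmooth_correction_avgTerm_rho hT hM hN hA hB K)
  have := P.hasDerivAt_zeroMeanPrimitive (ϰ := ϰ) (h1.cont (r, θ)) ζ
  rw [Lambda, avgTerm_eq hM hN]; exact this

lemma hasDerivAt_avgTerm_psi (K : ℕ) (r θ ζ : ℝ) :
    HasDerivAt ((P.avgTerm ϰ K).psi r θ) (-(1 / P.vartheta) * (P.Bcoeff ϰ K r θ ζ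
      + P.correction ϰ K (P.avgTerm ϰ) AvgTerm.psi AvgTerm.Om r θ ζ - P.Omega ϰ K r θ)) ζ := by
  have h1 := (hB K).add (paramSmooth_correction_avgTerm_psi hT hM hN hA hB K)
  have := P.hasDerivAt_zeroMeanPrimitive (ϰ := ϰ) (h1.cont (r, θ)) ζ
  rw [Omega, avgTerm_eq hM hN]; exact this

end AvgTerm

section Residual

variable {P : PerturbedSystem} {ϰ : ℕ} {T : ℝ}

/-- The residual of the averaging transformation: `Fh` is the component of the field, `w` that of
the transformation, `w'` its derivative in the fast time and `V` the averaged component. -/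
def averagingResidual (P : PerturbedSystem) (t : ℕ → AvgTerm) (Ah Bh Fh : ℝ³ → ℝ → ℝ)
    (w w' : ℕ → ℝ → ℝ → ℝ → ℝ) (V : AvgTerm → ℝ → ℝ → ℝ) (n : ℕ) (x : ℝ³) (ζ : ℝ) : ℝ :=
  Fh x ζ + ∑ k ∈ range n, (x.1 ^ (P.M + k) *
      (Ah x ζ * deriv (fun v => w k v x.2.2 ζ) x.2.1 + Bh x ζ * deriv (fun v => w k x.2.1 v ζ) x.2.2)
      + x.1 ^ k * w' k x.2.1 x.2.2 ζ - x.1 ^ (k + P.N) * ((P.M + k) / P.N * w k x.2.1 x.2.2 ζ))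
    - P.transformedSum t V n n x ζ

lemma paramSmooth_averagingResidual (hT : 0 < T) {t : ℕ → AvgTerm} {Ah Bh Fh : ℝ³ → ℝ → ℝ}
    (hA : ParamSmooth T Ah) (hB : ParamSmooth T Bh) (hF : ParamSmooth T Fh)
    {w w' : ℕ → ℝ → ℝ → ℝ → ℝ} {V : AvgTerm → ℝ → ℝ → ℝ} (ht : ∀ k, (t k).Regular T)
    (hw : ∀ k, ParamSmooth T fun (p : ℝ²) ζ => w k p.1 p.2 ζ)
    (hw' : ∀ k, ParamSmooth T fun (p : ℝ²) ζ => w' k p.1 p.2 ζ)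
    (hV : ∀ k, Smooth fun p : ℝ² => V (t k) p.1 p.2) (n : ℕ) :
    ParamSmooth T (P.averagingResidual t Ah Bh Fh w w' V n) := by
  have d : ∀ k ζ, Differentiable ℝ fun p : ℝ² => w k p.1 p.2 ζ := fun k ζ =>
    ((hw k).eval hT ζ).diff
  refine (hF.add (ParamSmooth.sum fun k _ => ?_)).sub
    (paramSmooth_transformedSum (fun k _ => ht k) (fun k _ => hV k))
  have e3 : ParamSmooth T fun (p : ℝ²) ζ => deriv (fun v => w k v p.2 ζ) p.1 := by
    convert (hw k).fderiv_apply hT (1, 0) using 3 with p ζ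
    exact (hasDerivAt_fst₂ (d k ζ) p.1 p.2).deriv
  have e4 : ParamSmooth T fun (p : ℝ²) ζ => deriv (fun v => w k p.1 v ζ) p.2 := by
    convert (hw k).fderiv_apply hT (0, 1) using 3 with p ζ
    exact (hasDerivAt_snd₂ (d k ζ) p.1 p.2).deriv
  have s : Smooth (fun x : ℝ³ => x.2) := contDiff_snd
  refine (ParamSmooth.add ?_ ?_).sub ?_
  · exact (ParamSmooth.of_param (f := fun x : ℝ³ => x.1 ^ (P.M + k)) (by fun_prop)).mul
      ((hA.mul (e3.comp s)).add (hB.mul (e4.comp s)))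
  · exact (ParamSmooth.of_param (f := fun x : ℝ³ => x.1 ^ k) (by fun_prop)).mul ((hw' k).comp s)
  · exact (ParamSmooth.of_param (f := fun x : ℝ³ => x.1 ^ (k + P.N)) (by fun_prop)).mul
      ((ParamSmooth.const _).mul ((hw k).comp s))

/-- The coefficient of order `K` of the transformed sum depends on the highest term only through
its value. -/
lemma taylorCoef_transformedSum (hM : 1 ≤ P.M) {t : ℕ → AvgTerm}
    {V : AvgTerm → ℝ → ℝ → ℝ} (hV : ∀ k, Smooth fun p : ℝ² => V (t k) p.1 p.2) {n K : ℕ} (hK : K < n) (r θ ζ : ℝ) :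
    taylorCoef K (fun ε => P.transformedSum t V n n (ε, r, θ) ζ) =
      V (t K) r θ + taylorCoef K (fun ε => P.transformedSum t V K K (ε, r, θ) ζ) := by
  have hR : ∀ n, Smooth fun ε : ℝ =>
      r + ∑ k ∈ range n, ε ^ (P.M + k) * (t k).rho r θ ζ := fun n => by fun_prop
  have hS : ∀ n, Smooth fun ε : ℝ =>
      θ + ∑ k ∈ range n, ε ^ (P.M + k) * (t k).psi r θ ζ := fun n => by fun_prop
  have hVn : ∀ J n, Smooth fun ε : ℝ => V (t J)
      (r + ∑ k ∈ range n, ε ^ (P.M + k) * (t k).rho r θ ζ)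
      (θ + ∑ k ∈ range n, ε ^ (P.M + k) * (t k).psi r θ ζ) := fun J n =>
    (hV J).comp ((hR n).prodMk (hS n))
  have hterm : ∀ J n, Smooth fun ε : ℝ => ε ^ J * V (t J)
      (r + ∑ k ∈ range n, ε ^ (P.M + k) * (t k).rho r θ ζ)
      (θ + ∑ k ∈ range n, ε ^ (P.M + k) * (t k).psi r θ ζ) := fun J n => by
    have := hVn J n
    fun_prop
  have hsm : ∀ m n, Smooth fun ε => P.transformedSum t V m n (ε, r, θ) ζ := fun m n =>
    ContDiff.sum fun J _ => hterm J n
  have h1 : taylorCoef K (fun ε => P.transformedSum t V n n (ε, r, θ) ζ) =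
      taylorCoef K (fun ε => P.transformedSum t V n K (ε, r, θ) ζ) := by
    refine taylorCoef_congr_of_isBigO (hsm n n) (hsm n K) (n := K + 1) ?_ (Nat.lt_succ_self K)
    have hsub : (fun ε => P.transformedSum t V n n (ε, r, θ) ζ - P.transformedSum t V n K (ε, r, θ) ζ)
        = fun ε => ∑ J ∈ range n, ε ^ J * (V (t J)
          (r + ∑ k ∈ range n, ε ^ (P.M + k) * (t k).rho r θ ζ)
          (θ + ∑ k ∈ range n, ε ^ (P.M + k) * (t k).psi r θ ζ) - V (t J)
          (r + ∑ k ∈ range K, ε ^ (P.M + k) * (t k).rho r θ ζ)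
          (θ + ∑ k ∈ range K, ε ^ (P.M + k) * (t k).psi r θ ζ)) := by
      funext ε
      simp only [transformedSum]
      rw [← sum_sub_distrib]
      exact sum_congr rfl fun J _ => by ring
    rw [hsub]
    refine IsBigO.fun_sum fun J _ => ?_
    have htail : ∀ f : ℕ → ℝ, (fun ε : ℝ => ∑ k ∈ range n, ε ^ (P.M + k) * f k
        - ∑ k ∈ range K, ε ^ (P.M + k) * f k) =O[𝓝[>] 0] fun ε => ε ^ (K + 1) := by
      intro f
      have : (fun ε : ℝ => ∑ k ∈ range n, ε ^ (P.M + k) * f k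
        - ∑ k ∈ range K, ε ^ (P.M + k) * f k) =
          fun ε => ∑ k ∈ Finset.Ico K n, ε ^ (P.M + k) * f k := by
        funext ε
        rw [sum_Ico_eq_sub _ hK.le]
      rw [this]
      refine IsBigO.fun_sum fun k hk => ?_
      rw [Finset.mem_Ico] at hk
      have := (isBigO_pow_of_le (m := K + 1) (n := P.M + k) (by omega)).mul
        (isBigO_const_const (f k) (one_ne_zero (α := ℝ)) (𝓝[>] (0 : ℝ)))
      simpa using this
    have hlip : (fun ε : ℝ => V (t J) (r + ∑ k ∈ range n, ε ^ (P.M + k) * (t k).rho r θ ζ)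
          (θ + ∑ k ∈ range n, ε ^ (P.M + k) * (t k).psi r θ ζ) - V (t J)
          (r + ∑ k ∈ range K, ε ^ (P.M + k) * (t k).rho r θ ζ)
          (θ + ∑ k ∈ range K, ε ^ (P.M + k) * (t k).psi r θ ζ)) =O[𝓝[>] 0]
        fun ε => ε ^ (K + 1) := by
      have hst := ((hV J).contDiffAt (x := (r, θ))).hasStrictFDerivAt (by simp)
      have hlim : ∀ n, Tendsto (fun ε : ℝ =>
          ((r + ∑ k ∈ range n, ε ^ (P.M + k) * (t k).rho r θ ζ,
            θ + ∑ k ∈ range n, ε ^ (P.M + k) * (t k).psi r θ ζ) : ℝ²)) (𝓝[>] 0)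
          (𝓝 (r, θ)) := by
        intro n
        have := ((hR n).prodMk (hS n)).continuous.tendsto 0
        have h0 : ∀ k, (0 : ℝ) ^ (P.M + k) = 0 := fun k => zero_pow (by omega)
        simp only [h0, zero_mul, sum_const_zero, add_zero] at this
        exact this.mono_left nhdsWithin_le_nhds
      have h2 := hst.isBigO_sub.comp_tendsto ((hlim n).prodMk_nhds (hlim K))
      refine h2.trans ?_
      have h3 := (htail fun k => (t k).rho r θ ζ).prod_left (htail fun k => (t k).psi r θ ζ)
      refine h3.congr_left fun ε => ?_; simp
    have := (Continuous.isBigO_one_nhdsGT (f := fun ε : ℝ => ε ^ J) (by fun_prop)).mul hlip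
    simpa using this
  have h2 : taylorCoef K (fun ε => P.transformedSum t V n K (ε, r, θ) ζ) =
      ∑ J ∈ range n, taylorCoef K (fun ε => ε ^ J * V (t J)
        (r + ∑ k ∈ range K, ε ^ (P.M + k) * (t k).rho r θ ζ)
        (θ + ∑ k ∈ range K, ε ^ (P.M + k) * (t k).psi r θ ζ)) :=
    taylorCoef_sum (fun J _ => hterm J K) K
  have h3 : taylorCoef K (fun ε => P.transformedSum t V K K (ε, r, θ) ζ) =
      ∑ J ∈ range K, taylorCoef K (fun ε => ε ^ J * V (t J)
        (r + ∑ k ∈ range K, ε ^ (P.M + k) * (t k).rho r θ ζ)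
        (θ + ∑ k ∈ range K, ε ^ (P.M + k) * (t k).psi r θ ζ)) :=
    taylorCoef_sum (fun J _ => hterm J K) K
  have h4 : ∀ J, K < J → taylorCoef K (fun ε => ε ^ J * V (t J)
        (r + ∑ k ∈ range K, ε ^ (P.M + k) * (t k).rho r θ ζ)
        (θ + ∑ k ∈ range K, ε ^ (P.M + k) * (t k).psi r θ ζ)) = 0 := by
    intro J hJ
    have := taylorCoef_pow_smul (hVn J K) J K
    rw [if_neg (by omega)] at this; exact this
  have h5 : taylorCoef K (fun ε => ε ^ K * V (t K)
        (r + ∑ k ∈ range K, ε ^ (P.M + k) * (t k).rho r θ ζ)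
        (θ + ∑ k ∈ range K, ε ^ (P.M + k) * (t k).psi r θ ζ)) = V (t K) r θ := by
    have := taylorCoef_pow_smul (hVn K K) K K
    rw [if_pos le_rfl, Nat.sub_self, taylorCoef_zero] at this
    have h0 : ∀ k, (0 : ℝ) ^ (P.M + k) = 0 := fun k => zero_pow (by omega)
    simp only [h0, zero_mul, sum_const_zero, add_zero] at this; exact this
  rw [h1, h2, h3, ← sum_range_add_sum_Ico _ hK.le, add_comm, sum_eq_sum_Ico_succ_bot hK,
    h5, Finset.sum_eq_zero fun J hJ => h4 J (by rw [Finset.mem_Ico] at hJ; omega), add_zero]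

lemma taylorCoef_averagingResidual (hT : 0 < T) (hM : 1 ≤ P.M) {t : ℕ → AvgTerm}
    {Ah Bh Fh : ℝ³ → ℝ → ℝ} (hA : ParamSmooth T Ah) (hB : ParamSmooth T Bh)
    (hF : ParamSmooth T Fh) {Fc : ℕ → ℝ → ℝ → ℝ → ℝ}
    {n : ℕ} (hAc : ∀ K < n, ∀ r θ ζ, P.Acoeff ϰ K r θ ζ = taylorCoef K fun ε => Ah (ε, r, θ) ζ)
    (hBc : ∀ K < n, ∀ r θ ζ, P.Bcoeff ϰ K r θ ζ = taylorCoef K fun ε => Bh (ε, r, θ) ζ)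
    (hFc : ∀ K < n, ∀ r θ ζ, Fc K r θ ζ = taylorCoef K fun ε => Fh (ε, r, θ) ζ)
    {w : AvgTerm → ℝ → ℝ → ℝ → ℝ} {w' : ℕ → ℝ → ℝ → ℝ → ℝ} {V : AvgTerm → ℝ → ℝ → ℝ}
    (ht : ∀ k, (t k).Regular T) (hV : ∀ k, Smooth fun p : ℝ² => V (t k) p.1 p.2)
    (hhom : ∀ K r θ ζ, w' K r θ ζ = V (t K) r θ - Fc K r θ ζ - P.correction ϰ K t w V r θ ζ)
    {K : ℕ} (hK : K < n) (r θ ζ : ℝ) :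
    taylorCoef K (fun ε => P.averagingResidual t Ah Bh Fh (fun k => w (t k)) w' V n (ε, r, θ) ζ) = 0 := by
  have ev : ∀ {F : ℝ³ → ℝ → ℝ}, ParamSmooth T F → Smooth fun ε => F (ε, r, θ) ζ :=
    fun hF => (hF.eval hT ζ).comp (f := fun ε : ℝ => (ε, r, θ)) (by fun_prop)
  obtain ⟨a, ha⟩ : ∃ a : ℝ → ℝ, ∀ ε, Ah (ε, r, θ) ζ = a ε := ⟨_, fun _ => rfl⟩
  obtain ⟨b, hb⟩ : ∃ b : ℝ → ℝ, ∀ ε, Bh (ε, r, θ) ζ = b ε := ⟨_, fun _ => rfl⟩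
  obtain ⟨f, hf⟩ : ∃ f : ℝ → ℝ, ∀ ε, Fh (ε, r, θ) ζ = f ε := ⟨_, fun _ => rfl⟩
  have eA : Smooth a := by have := ev hA; simpa only [ha] using this
  have eB : Smooth b := by have := ev hB; simpa only [hb] using this
  have eF : Smooth f := by have := ev hF; simpa only [hf] using this
  have eS := ev (paramSmooth_transformedSum (P := P) (m := n) (n := n) (fun k _ => ht k) fun k _ => hV k)
  have t1 : ∀ k, taylorCoef K (fun ε => ε ^ (P.M + k) *
      (a ε * deriv (fun v => w (t k) v θ ζ) r + b ε * deriv (fun v => w (t k) r v ζ) θ)) =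
      if P.M + k ≤ K then P.Acoeff ϰ (K - P.M - k) r θ ζ * deriv (fun v => w (t k) v θ ζ) r
          + P.Bcoeff ϰ (K - P.M - k) r θ ζ * deriv (fun v => w (t k) r v ζ) θ else 0 := by
    intro k
    have h1 := taylorCoef_pow_smul (f := fun ε => a ε * deriv (fun v => w (t k) v θ ζ) r
        + b ε * deriv (fun v => w (t k) r v ζ) θ) (by fun_prop) (P.M + k) K
    have h2 := taylorCoef_smul_const eA (deriv (fun v => w (t k) v θ ζ) r) (K - P.M - k)
    have h3 := taylorCoef_smul_const eB (deriv (fun v => w (t k) r v ζ) θ) (K - P.M - k)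
    simp only [smul_eq_mul] at h1 h2 h3
    rw [h1, Nat.sub_add_eq, taylorCoef_add (by fun_prop) (by fun_prop), h2, h3,
      hAc _ (by omega), hBc _ (by omega)]
    simp only [ha, hb]
  have t2 : ∀ k, taylorCoef K (fun ε : ℝ => ε ^ k * w' k r θ ζ) = if k = K then w' k r θ ζ else 0 :=
    fun k => taylorCoef_pow_smul_const k K (w' k r θ ζ)
  have t3 : ∀ k, taylorCoef K (fun ε : ℝ => ε ^ (k + P.N) * ((P.M + k) / P.N * w (t k) r θ ζ)) =
      if k + P.N = K then ((P.M + k : ℝ) / P.N * w (t k) r θ ζ) else 0 :=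
    fun k => taylorCoef_pow_smul_const (k + P.N) K _
  have t4 : taylorCoef K (fun ε => P.averagingResidual t Ah Bh Fh (fun k => w (t k)) w' V n (ε, r, θ) ζ)
      = Fc K r θ ζ + ∑ k ∈ range n, (
        (if P.M + k ≤ K then P.Acoeff ϰ (K - P.M - k) r θ ζ * deriv (fun v => w (t k) v θ ζ) r
          + P.Bcoeff ϰ (K - P.M - k) r θ ζ * deriv (fun v => w (t k) r v ζ) θ else 0)
        + (if k = K then w' k r θ ζ else 0)
        - (if k + P.N = K then ((P.M + k : ℝ) / P.N * w (t k) r θ ζ) else 0))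
      - taylorCoef K (fun ε => P.transformedSum t V n n (ε, r, θ) ζ) := by
    unfold averagingResidual; simp only [ha, hb, hf]
    have hk : ∀ k, Smooth fun ε : ℝ => ε ^ (P.M + k) *
      (a ε * deriv (fun v => w (t k) v θ ζ) r + b ε * deriv (fun v => w (t k) r v ζ) θ) := by
      intro k; fun_prop
    have hk2 : ∀ k, Smooth fun ε : ℝ => ε ^ k * w' k r θ ζ := by intro k; fun_prop
    have hk3 : ∀ k, Smooth fun ε : ℝ => ε ^ (k + P.N) * ((P.M + k) / P.N * w (t k) r θ ζ) := by
      intro k; fun_prop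
    have hsum : Smooth fun ε : ℝ => ∑ k ∈ range n, (ε ^ (P.M + k) *
      (a ε * deriv (fun v => w (t k) v θ ζ) r + b ε * deriv (fun v => w (t k) r v ζ) θ)
      + ε ^ k * w' k r θ ζ - ε ^ (k + P.N) * ((P.M + k) / P.N * w (t k) r θ ζ)) :=
      ContDiff.sum fun k _ => ((hk k).add (hk2 k)).sub (hk3 k)
    rw [taylorCoef_sub (eF.add hsum) eS, taylorCoef_add eF hsum, taylorCoef_sum
      (fun k _ => ((hk k).add (hk2 k)).sub (hk3 k)), hFc _ hK]
    simp only [hf]; congr 2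
    refine sum_congr rfl fun k _ => ?_
    rw [taylorCoef_sub ((hk k).add (hk2 k)) (hk3 k), taylorCoef_add (hk k) (hk2 k), t1, t2, t3]
  rw [t4, taylorCoef_transformedSum hM hV hK, sum_sub_distrib, sum_add_distrib,
    sum_ite_eq' (range n) K, if_pos (Finset.mem_range.2 hK), hhom, correction_eq]
  have s1 : ∑ k ∈ range n, (if P.M + k ≤ K then
      P.Acoeff ϰ (K - P.M - k) r θ ζ * deriv (fun v => w (t k) v θ ζ) r
          + P.Bcoeff ϰ (K - P.M - k) r θ ζ * deriv (fun v => w (t k) r v ζ) θ else 0) =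
      if P.M ≤ K then ∑ j ∈ range (K - P.M + 1),
        (P.Acoeff ϰ (K - P.M - j) r θ ζ * deriv (fun v => w (t j) v θ ζ) r
          + P.Bcoeff ϰ (K - P.M - j) r θ ζ * deriv (fun v => w (t j) r v ζ) θ) else 0 := by
    split_ifs with h1
    · rw [← sum_filter]
      refine sum_congr ?_ fun _ _ => rfl
      ext k
      simp only [Finset.mem_filter, Finset.mem_range]; omega
    · exact Finset.sum_eq_zero fun k _ => if_neg (by omega)
  have s2 : ∑ k ∈ range n, (if k + P.N = K then ((P.M + k : ℝ) / P.N * w (t k) r θ ζ) else 0) =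
      if P.N ≤ K then ((P.M : ℝ) + (K - P.N : ℕ)) / P.N * w (t (K - P.N)) r θ ζ else 0 := by
    split_ifs with h1
    · rw [sum_eq_single (K - P.N)]
      · rw [if_pos (by omega)]
      · intro k _ hk; exact if_neg (by omega)
      · intro h; exact absurd (Finset.mem_range.2 (by omega)) h
    · exact Finset.sum_eq_zero fun k _ => if_neg (by omega)
  rw [s1, s2]; ring

end Residual

end PerturbedSystem

lemma hasDerivAt_rpow_neg_inv' {N : ℕ} (hN : 1 ≤ N) {τ : ℝ} (hτ : 0 < τ) :
    HasDerivAt (fun τ : ℝ => τ ^ (-(1 / (N : ℝ))))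
      (-(1 / N) * (τ ^ (-(1 / (N : ℝ)))) ^ (N + 1)) τ := by
  have hN' : (N : ℝ) ≠ 0 := by positivity
  have := hasDerivAt_rpow_const (x := τ) (p := -(1 / (N : ℝ))) (Or.inl hτ.ne')
  rw [← rpow_natCast, ← rpow_mul hτ.le]
  convert this using 3
  push_cast; field_simp; ring

namespace PerturbedSystem

variable {P : PerturbedSystem} {ϰ : ℕ} {T : ℝ}

lemma transform_component (hT : 0 < T) (hM : 1 ≤ P.M) (hN : 1 ≤ P.N) {t : ℕ → AvgTerm}
    {Ah Bh Fh : ℝ³ → ℝ → ℝ} (hA : ParamSmooth T Ah) (hB : ParamSmooth T Bh)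
    (hF : ParamSmooth T Fh) {w w' : ℕ → ℝ → ℝ → ℝ → ℝ} {V : AvgTerm → ℝ → ℝ → ℝ}
    (ht : ∀ k, (t k).Regular T) (hw : ∀ k, ParamSmooth T fun (p : ℝ²) ζ => w k p.1 p.2 ζ)
    (hw' : ∀ k, ParamSmooth T fun (p : ℝ²) ζ => w' k p.1 p.2 ζ)
    (hV : ∀ k, Smooth fun p : ℝ² => V (t k) p.1 p.2)
    (hϑ : P.vartheta ≠ 0) (hww' : ∀ k r θ ζ, HasDerivAt (w k r θ) (1 / P.vartheta * w' k r θ ζ) ζ)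
    {n : ℕ} (hres : ∀ K < n, ∀ r θ ζ,
      taylorCoef K (fun ε => P.averagingResidual t Ah Bh Fh w w' V n (ε, r, θ) ζ) = 0)
    {S : Set ℝ²} (hS : IsCompact S) {C₁ : ℝ} (hC₁ : 0 ≤ C₁) :
    ∃ C, 0 ≤ C ∧ ∀ a b, 1 ≤ a → ∀ r θ y r' θ' y' : ℝ → ℝ,
      (∀ τ ∈ Icc a b, HasDerivWithinAt r (r' τ) (Icc a b) τ ∧
        HasDerivWithinAt θ (θ' τ) (Icc a b) τ ∧ HasDerivWithinAt y (y' τ) (Icc a b) τ ∧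
        (r τ, θ τ) ∈ S ∧ ∀ ε, ε = τ ^ (-(1 / (P.N : ℝ))) →
          |r' τ - ε ^ P.M * Ah (ε, r τ, θ τ) (P.vartheta * τ)| ≤ C₁ * ε ^ (P.M + n) ∧
          |θ' τ - ε ^ P.M * Bh (ε, r τ, θ τ) (P.vartheta * τ)| ≤ C₁ * ε ^ (P.M + n) ∧
          |y' τ - ε ^ P.M * Fh (ε, r τ, θ τ) (P.vartheta * τ)| ≤ C₁ * ε ^ (P.M + n)) →
      ∃ Y' : ℝ → ℝ, ∀ τ ∈ Icc a b,
        HasDerivWithinAt (fun τ => y τ + ∑ k ∈ range n, (τ ^ (-(1 / (P.N : ℝ)))) ^ (P.M + k) *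
          w k (r τ) (θ τ) (P.vartheta * τ)) (Y' τ) (Icc a b) τ ∧
        ∀ ε, ε = τ ^ (-(1 / (P.N : ℝ))) →
          |∑ k ∈ range n, ε ^ (P.M + k) * w k (r τ) (θ τ) (P.vartheta * τ)| ≤ C * ε ^ P.M ∧
          |Y' τ - ε ^ P.M * P.transformedSum t V n n (ε, r τ, θ τ) (P.vartheta * τ)|
            ≤ C * ε ^ (P.M + n) := by
  have d : ∀ k ζ, Differentiable ℝ fun p : ℝ² => w k p.1 p.2 ζ := fun k ζ =>
    ((hw k).eval hT ζ).diff
  have e3 : ∀ k, ParamSmooth T fun (p : ℝ²) ζ => deriv (fun v => w k v p.2 ζ) p.1 := fun k => by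
    convert (hw k).fderiv_apply hT (1, 0) using 3 with p ζ
    exact (hasDerivAt_fst₂ (d k ζ) p.1 p.2).deriv
  have e4 : ∀ k, ParamSmooth T fun (p : ℝ²) ζ => deriv (fun v => w k p.1 v ζ) p.2 := fun k => by
    convert (hw k).fderiv_apply hT (0, 1) using 3 with p ζ
    exact (hasDerivAt_snd₂ (d k ζ) p.1 p.2).deriv
  obtain ⟨C₂, hC₂, b2⟩ := (paramSmooth_averagingResidual hT hA hB hF ht hw hw' hV n).uniform_bound_of_taylorCoef
    hT (n := n) (fun K hK p ζ => hres K hK p.1 p.2 ζ) hS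
  choose c3 hc3 b3 using fun k => (e3 k).exists_bound hT hS
  choose c4 hc4 b4 using fun k => (e4 k).exists_bound hT hS
  choose c5 hc5 b5 using fun k => (hw k).exists_bound hT hS
  refine ⟨C₂ + C₁ * (1 + ∑ k ∈ range n, (c3 k + c4 k)) + ∑ k ∈ range n, c5 k, ?_, ?_⟩
  · have h1 : 0 ≤ ∑ k ∈ range n, (c3 k + c4 k) :=
      Finset.sum_nonneg fun k _ => add_nonneg (hc3 k) (hc4 k)
    have h2 : 0 ≤ ∑ k ∈ range n, c5 k := Finset.sum_nonneg fun k _ => hc5 k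
    positivity
  intro a b ha r θ y r' θ' y' hsol
  refine ⟨fun τ => y' τ + ∑ k ∈ range n, (((P.M + k : ℕ) * (τ ^ (-(1 / (P.N : ℝ)))) ^ (P.M + k - 1)
    * (-(1 / P.N) * (τ ^ (-(1 / (P.N : ℝ)))) ^ (P.N + 1))) * w k (r τ) (θ τ) (P.vartheta * τ)
    + (τ ^ (-(1 / (P.N : ℝ)))) ^ (P.M + k) * (r' τ * deriv (fun v => w k v (θ τ) (P.vartheta * τ)) (r τ)
      + θ' τ * deriv (fun v => w k (r τ) v (P.vartheta * τ)) (θ τ)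
      + w' k (r τ) (θ τ) (P.vartheta * τ))), fun τ hτ => ?_⟩
  have hτ0 : 0 < τ := by linarith [hτ.1]
  obtain ⟨dr, dθ, dy, hmem, hb⟩ := hsol τ hτ
  have dε := (hasDerivAt_rpow_neg_inv' hN hτ0).hasDerivWithinAt (s := Icc a b)
  refine ⟨?_, ?_⟩
  · refine dy.add (HasDerivWithinAt.fun_sum fun k _ => ?_)
    have h1 := (hw k).hasDerivWithinAt_curve hT (F' := fun p ζ => 1 / P.vartheta * w' k p.1 p.2 ζ)
      (fun p ζ => hww' k p.1 p.2 ζ) (((hw' k).continuous_uncurry hT).const_mul (1 / P.vartheta)) (dr.prodMk dθ)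
      (((hasDerivAt_id τ).const_mul P.vartheta).hasDerivWithinAt (s := Icc a b))
    have h2 : 𝒟 (fun q : ℝ² => w k q.1 q.2 (P.vartheta * τ)) (r τ, θ τ) (r' τ, θ' τ) =
        r' τ * deriv (fun v => w k v (θ τ) (P.vartheta * τ)) (r τ)
        + θ' τ * deriv (fun v => w k (r τ) v (P.vartheta * τ)) (θ τ) := by
      rw [show ((r' τ, θ' τ) : ℝ²) = r' τ • ((1, 0) : ℝ²) + θ' τ • ((0, 1) : ℝ²) by simp,
        map_add, map_smul, map_smul, (hasDerivAt_fst₂ (d k _) (r τ) (θ τ)).deriv,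
        (hasDerivAt_snd₂ (d k _) (r τ) (θ τ)).deriv]
      rfl
    have h3 : P.vartheta * 1 * (1 / P.vartheta * w' k (r τ) (θ τ) (P.vartheta * τ)) =
        w' k (r τ) (θ τ) (P.vartheta * τ) := by field_simp
    simp only [id_eq, h2, h3] at h1
    exact (dε.pow (P.M + k)).mul h1
  · rintro ε rfl
    obtain ⟨b6, b7, b8⟩ := hb _ rfl
    set ε := τ ^ (-(1 / (P.N : ℝ)))
    have hε0 : 0 < ε := rpow_pos_of_pos hτ0 _
    have hε1 : ε ≤ 1 := rpow_le_one_of_one_le_of_nonpos (ha.trans hτ.1)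
      (by rw [neg_nonpos]; positivity)
    set ζ := P.vartheta * τ
    have n1 : 0 ≤ ∑ k ∈ range n, (c3 k + c4 k) :=
      Finset.sum_nonneg fun k _ => add_nonneg (hc3 k) (hc4 k)
    have n2 : 0 ≤ ∑ k ∈ range n, c5 k := Finset.sum_nonneg fun k _ => hc5 k
    have hεk : ∀ k, ε ^ (P.M + k) ≤ ε ^ P.M := fun k =>
      pow_le_pow_of_le_one hε0.le hε1 (by omega)
    have hεk1 : ∀ k, ε ^ (P.M + k) ≤ 1 := fun k => pow_le_one₀ hε0.le hε1
    constructor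
    · calc |∑ k ∈ range n, ε ^ (P.M + k) * w k (r τ) (θ τ) ζ|
          ≤ ∑ k ∈ range n, |ε ^ (P.M + k) * w k (r τ) (θ τ) ζ| := abs_sum_le_sum_abs _ _
        _ ≤ ∑ k ∈ range n, c5 k * ε ^ P.M := by
          refine sum_le_sum fun k _ => ?_
          rw [abs_mul, abs_of_pos (pow_pos hε0 _), mul_comm]
          exact mul_le_mul (b5 k _ hmem ζ) (hεk k) (by positivity) (hc5 k)
        _ = (∑ k ∈ range n, c5 k) * ε ^ P.M := by rw [sum_mul]
        _ ≤ _ := by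
          have : 0 ≤ C₂ + C₁ * (1 + ∑ k ∈ range n, (c3 k + c4 k)) := by positivity
          gcongr; linarith
    · have hb2 := b2 ε ⟨hε0.le, hε1⟩ (r τ, θ τ) hmem ζ
      have key : y' τ + ∑ k ∈ range n, (((P.M + k : ℕ) * ε ^ (P.M + k - 1)
          * (-(1 / P.N) * ε ^ (P.N + 1))) * w k (r τ) (θ τ) ζ
          + ε ^ (P.M + k) * (r' τ * deriv (fun v => w k v (θ τ) ζ) (r τ)
          + θ' τ * deriv (fun v => w k (r τ) v ζ) (θ τ) + w' k (r τ) (θ τ) ζ))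
          - ε ^ P.M * P.transformedSum t V n n (ε, r τ, θ τ) ζ =
          ε ^ P.M * P.averagingResidual t Ah Bh Fh w w' V n (ε, r τ, θ τ) ζ
          + (y' τ - ε ^ P.M * Fh (ε, r τ, θ τ) ζ) + ∑ k ∈ range n, ε ^ (P.M + k) *
            ((r' τ - ε ^ P.M * Ah (ε, r τ, θ τ) ζ) * deriv (fun v => w k v (θ τ) ζ) (r τ)
            + (θ' τ - ε ^ P.M * Bh (ε, r τ, θ τ) ζ) * deriv (fun v => w k (r τ) v ζ) (θ τ)) := by
        have h1 : ∑ k ∈ range n, (((P.M + k : ℕ) * ε ^ (P.M + k - 1)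
          * (-(1 / P.N) * ε ^ (P.N + 1))) * w k (r τ) (θ τ) ζ
          + ε ^ (P.M + k) * (r' τ * deriv (fun v => w k v (θ τ) ζ) (r τ)
          + θ' τ * deriv (fun v => w k (r τ) v ζ) (θ τ) + w' k (r τ) (θ τ) ζ)) =
          ε ^ P.M * (∑ k ∈ range n, (ε ^ (P.M + k) *
          (Ah (ε, r τ, θ τ) ζ * deriv (fun v => w k v (θ τ) ζ) (r τ)
            + Bh (ε, r τ, θ τ) ζ * deriv (fun v => w k (r τ) v ζ) (θ τ))
          + ε ^ k * w' k (r τ) (θ τ) ζ - ε ^ (k + P.N) * ((P.M + k) / P.N * w k (r τ) (θ τ) ζ)))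
          + ∑ k ∈ range n, ε ^ (P.M + k) *
            ((r' τ - ε ^ P.M * Ah (ε, r τ, θ τ) ζ) * deriv (fun v => w k v (θ τ) ζ) (r τ)
            + (θ' τ - ε ^ P.M * Bh (ε, r τ, θ τ) ζ) * deriv (fun v => w k (r τ) v ζ) (θ τ)) := by
          rw [mul_sum, ← sum_add_distrib]
          refine sum_congr rfl fun k _ => ?_
          have h2 : ε ^ (P.M + k - 1) * ε ^ (P.N + 1) = ε ^ P.M * ε ^ (k + P.N) := by
            rw [← pow_add, ← pow_add]; congr 1; omega
          have h3 : ε ^ (P.M + k) = ε ^ P.M * ε ^ k := pow_add _ _ _; push_cast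
          linear_combination (-((P.M + k) * (1 / P.N) * w k (r τ) (θ τ) ζ)) * h2
            + (w' k (r τ) (θ τ) ζ) * h3
        rw [h1, averagingResidual]; ring
      rw [key]
      have hsum : |∑ k ∈ range n, ε ^ (P.M + k) *
            ((r' τ - ε ^ P.M * Ah (ε, r τ, θ τ) ζ) * deriv (fun v => w k v (θ τ) ζ) (r τ)
            + (θ' τ - ε ^ P.M * Bh (ε, r τ, θ τ) ζ) * deriv (fun v => w k (r τ) v ζ) (θ τ))| ≤
          ∑ k ∈ range n, (C₁ * ε ^ (P.M + n)) * (c3 k + c4 k) := by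
        refine (abs_sum_le_sum_abs _ _).trans (sum_le_sum fun k _ => ?_)
        rw [abs_mul, abs_of_pos (pow_pos hε0 _)]
        have h1 : |(r' τ - ε ^ P.M * Ah (ε, r τ, θ τ) ζ) * deriv (fun v => w k v (θ τ) ζ) (r τ)
            + (θ' τ - ε ^ P.M * Bh (ε, r τ, θ τ) ζ) * deriv (fun v => w k (r τ) v ζ) (θ τ)| ≤
            (C₁ * ε ^ (P.M + n)) * (c3 k + c4 k) := by
          refine (abs_add_le _ _).trans ?_
          rw [abs_mul, abs_mul, mul_add]
          exact add_le_add (mul_le_mul b6 (b3 k _ hmem ζ) (abs_nonneg _) (by positivity))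
            (mul_le_mul b7 (b4 k _ hmem ζ) (abs_nonneg _) (by positivity))
        calc _ ≤ 1 * ((C₁ * ε ^ (P.M + n)) * (c3 k + c4 k)) :=
              mul_le_mul (hεk1 k) h1 (abs_nonneg _) zero_le_one
          _ = _ := one_mul _
      have hres' : |ε ^ P.M * P.averagingResidual t Ah Bh Fh w w' V n (ε, r τ, θ τ) ζ| ≤
          C₂ * ε ^ (P.M + n) := by
        rw [abs_mul, abs_of_pos (pow_pos hε0 _), pow_add]
        calc _ ≤ ε ^ P.M * (C₂ * ε ^ n) := by gcongr
          _ = _ := by ring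
      refine (abs_add_three _ _ _).trans ?_
      rw [← mul_sum] at hsum
      have : 0 ≤ (∑ k ∈ range n, c5 k) * ε ^ (P.M + n) := by positivity
      linarith

/-- Smooth extensions `Ah`, `Bh` of the field `(𝒜, ℬ)`, up to terms of order `n`, as functions of
`ε = τ^(-1/N)` up to `ε = 0`; the phase component is `c(ε) r` up to order `M`. -/
structure HatField (P : PerturbedSystem) (ϰ n : ℕ) (Ah Bh : ℝ³ → ℝ → ℝ) (c : ℝ → ℝ) : Prop where
  A : ParamSmooth (2 * π * ϰ) Ah
  B : ParamSmooth (2 * π * ϰ) Bh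
  Acoeff_smooth : ∀ k, ParamSmooth (2 * π * ϰ) fun (p : ℝ²) ζ => P.Acoeff ϰ k p.1 p.2 ζ
  Bcoeff_smooth : ∀ k, ParamSmooth (2 * π * ϰ) fun (p : ℝ²) ζ => P.Bcoeff ϰ k p.1 p.2 ζ
  Acoeff_eq : ∀ K < n, ∀ r θ ζ, P.Acoeff ϰ K r θ ζ = taylorCoef K fun ε => Ah (ε, r, θ) ζ
  Bcoeff_eq : ∀ K < n, ∀ r θ ζ, P.Bcoeff ϰ K r θ ζ = taylorCoef K fun ε => Bh (ε, r, θ) ζ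
  c_smooth : Smooth c
  c_pos : 0 < c 0
  B_eq : ∃ B₁ : ℝ³ → ℝ → ℝ, ParamSmooth (2 * π * ϰ) B₁ ∧
    ∀ x ζ, Bh x ζ = c x.1 * x.2.1 + x.1 ^ P.M * B₁ x ζ

namespace HatField

variable {P : PerturbedSystem} {ϰ n : ℕ} {Ah Bh : ℝ³ → ℝ → ℝ} {c : ℝ → ℝ}
  (H : P.HatField ϰ n Ah Bh c) (hϰ : 1 ≤ ϰ) (hM : 1 ≤ P.M) (hN : 1 ≤ P.N)
include H hϰ

lemma period_pos : 0 < 2 * π * ϰ := by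
  have := H.c_pos; positivity

include hM hN

lemma regular (k : ℕ) : (P.avgTerm ϰ k).Regular (2 * π * ϰ) :=
  avgTerm_regular (H.period_pos hϰ) hM hN (H.Acoeff_smooth) (H.Bcoeff_smooth) k

lemma averaging (hϑ : P.vartheta ≠ 0) {S : Set ℝ²} (hS : IsCompact S) {C₁ : ℝ}
    (hC₁ : 0 ≤ C₁) : ∃ C, 0 ≤ C ∧ ∀ a b, 1 ≤ a → ∀ r θ r' θ' : ℝ → ℝ,
      (∀ τ ∈ Icc a b, HasDerivWithinAt r (r' τ) (Icc a b) τ ∧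
        HasDerivWithinAt θ (θ' τ) (Icc a b) τ ∧ (r τ, θ τ) ∈ S ∧ ∀ ε, ε = τ ^ (-(1 / (P.N : ℝ))) →
          |r' τ - ε ^ P.M * Ah (ε, r τ, θ τ) (P.vartheta * τ)| ≤ C₁ * ε ^ (P.M + n) ∧
          |θ' τ - ε ^ P.M * Bh (ε, r τ, θ τ) (P.vartheta * τ)| ≤ C₁ * ε ^ (P.M + n)) →
      ∃ R Ψ R' Ψ' : ℝ → ℝ, ∀ τ ∈ Icc a b, HasDerivWithinAt R (R' τ) (Icc a b) τ ∧
        HasDerivWithinAt Ψ (Ψ' τ) (Icc a b) τ ∧ ∀ ε, ε = τ ^ (-(1 / (P.N : ℝ))) →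
          |R τ - r τ| ≤ C * ε ^ P.M ∧ |Ψ τ - θ τ| ≤ C * ε ^ P.M ∧
          |R' τ - ε ^ P.M * ∑ J ∈ range n, ε ^ J * P.Lambda ϰ J (R τ) (Ψ τ)|
            ≤ C * ε ^ (P.M + n) ∧
          |Ψ' τ - ε ^ P.M * ∑ J ∈ range n, ε ^ J * P.Omega ϰ J (R τ) (Ψ τ)|
            ≤ C * ε ^ (P.M + n) := by
  have hT := H.period_pos hϰ
  have hreg := H.regular hϰ hM hN
  have hA' := H.Acoeff_smooth
  have hB' := H.Bcoeff_smooth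
  set t := P.avgTerm ϰ
  have w1 : ∀ k, ParamSmooth (2 * π * ϰ) fun (p : ℝ²) ζ => (t k).Lam p.1 p.2
      - P.Acoeff ϰ k p.1 p.2 ζ - P.correction ϰ k t AvgTerm.rho AvgTerm.Lam p.1 p.2 ζ := fun k =>
    ((ParamSmooth.of_param (hreg k).Lam).sub (hA' k)).sub
      (paramSmooth_correction_avgTerm_rho hT hM hN hA' hB' k)
  have w2 : ∀ k, ParamSmooth (2 * π * ϰ) fun (p : ℝ²) ζ => (t k).Om p.1 p.2
      - P.Bcoeff ϰ k p.1 p.2 ζ - P.correction ϰ k t AvgTerm.psi AvgTerm.Om p.1 p.2 ζ := fun k =>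
    ((ParamSmooth.of_param (hreg k).Om).sub (hB' k)).sub
      (paramSmooth_correction_avgTerm_psi hT hM hN hA' hB' k)
  obtain ⟨Ca, hCa, ta⟩ := transform_component hT hM hN H.A H.B H.A (w := fun k => (t k).rho)
    (V := AvgTerm.Lam) hreg (fun k => (hreg k).rho) (w' := fun k r θ ζ => (t k).Lam r θ
      - P.Acoeff ϰ k r θ ζ - P.correction ϰ k t AvgTerm.rho AvgTerm.Lam r θ ζ) w1
    (fun k => (hreg k).Lam) hϑ (fun k r θ ζ => by
      refine (hasDerivAt_avgTerm_rho hT hM hN hA' hB' k r θ ζ).congr_deriv ?_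
      rw [Lambda]; ring)
    (fun K hK r θ ζ => taylorCoef_averagingResidual (w := AvgTerm.rho) hT hM H.A H.B H.A
      H.Acoeff_eq H.Bcoeff_eq H.Acoeff_eq hreg (fun k => (hreg k).Lam) (fun _ _ _ _ => rfl) hK r θ ζ)
    hS hC₁ (n := n)
  obtain ⟨Cb, hCb, tb⟩ := transform_component hT hM hN H.A H.B H.B (w := fun k => (t k).psi)
    (V := AvgTerm.Om) hreg (fun k => (hreg k).psi) (w' := fun k r θ ζ => (t k).Om r θ
      - P.Bcoeff ϰ k r θ ζ - P.correction ϰ k t AvgTerm.psi AvgTerm.Om r θ ζ) w2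
    (fun k => (hreg k).Om) hϑ (fun k r θ ζ => by
      refine (hasDerivAt_avgTerm_psi hT hM hN hA' hB' k r θ ζ).congr_deriv ?_
      rw [Omega]; ring)
    (fun K hK r θ ζ => taylorCoef_averagingResidual (w := AvgTerm.psi) hT hM H.A H.B H.B
      H.Acoeff_eq H.Bcoeff_eq H.Bcoeff_eq hreg (fun k => (hreg k).Om) (fun _ _ _ _ => rfl) hK r θ ζ)
    hS hC₁ (n := n)
  refine ⟨max Ca Cb, le_max_of_le_left hCa, fun a b hab r θ r' θ' hsol => ?_⟩
  obtain ⟨R', hR'⟩ := ta a b hab r θ r r' θ' r' fun τ hτ => by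
    obtain ⟨h1, h2, h3, h4⟩ := hsol τ hτ
    exact ⟨h1, h2, h1, h3, fun ε hε => ⟨(h4 ε hε).1, (h4 ε hε).2, (h4 ε hε).1⟩⟩
  obtain ⟨Ψ', hΨ'⟩ := tb a b hab r θ θ r' θ' θ' fun τ hτ => by
    obtain ⟨h1, h2, h3, h4⟩ := hsol τ hτ
    exact ⟨h1, h2, h2, h3, fun ε hε => ⟨(h4 ε hε).1, (h4 ε hε).2, (h4 ε hε).2⟩⟩
  refine ⟨_, _, R', Ψ', fun τ hτ => ⟨(hR' τ hτ).1, (hΨ' τ hτ).1, ?_⟩⟩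
  rintro ε rfl
  have hτ0 : 0 < τ := by linarith [hτ.1]
  obtain ⟨a1, a2⟩ := (hR' τ hτ).2 _ rfl
  obtain ⟨b1, b2⟩ := (hΨ' τ hτ).2 _ rfl
  have m1 : Ca ≤ max Ca Cb := le_max_left _ _
  have m2 : Cb ≤ max Ca Cb := le_max_right _ _
  refine ⟨?_, ?_, ?_, ?_⟩
  · rw [add_sub_cancel_left]
    exact a1.trans (by gcongr)
  · rw [add_sub_cancel_left]
    exact b1.trans (by gcongr)
  · exact a2.trans (by gcongr)
  · exact b2.trans (by gcongr)

lemma Omega_eq_mul (hMN : P.M ≤ P.N) (hMn : P.M ≤ n) {K : ℕ} (hK : K < P.M) (r θ : ℝ) :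
    P.Omega ϰ K r θ = taylorCoef K c * r := by
  have hT := H.period_pos hϰ
  have hreg := H.regular hϰ hM hN
  obtain ⟨B₁, hB₁, hB⟩ := H.B_eq
  have h1 : ∀ ζ, P.Bcoeff ϰ K r θ ζ = taylorCoef K c * r := by
    intro ζ
    rw [H.Bcoeff_eq K (by omega)]
    obtain ⟨b, hb⟩ : ∃ b : ℝ → ℝ, ∀ ε, B₁ (ε, r, θ) ζ = b ε := ⟨_, fun _ => rfl⟩
    have hbs : Smooth b := by
      have := (hB₁.eval hT ζ).comp (f := fun ε : ℝ => (ε, r, θ)) (by fun_prop)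
      simpa only [Function.comp_def, hb] using this
    have hc := H.c_smooth; simp only [hB, hb]
    rw [taylorCoef_add (by fun_prop) (by fun_prop)]
    have h2 := taylorCoef_pow_smul hbs P.M K
    have h3 := taylorCoef_smul_const hc r K
    rw [if_neg (by omega)] at h2
    simp only [smul_eq_mul] at h2 h3; rw [h2, h3, add_zero]
  have h2 : ∀ ζ, P.correction ϰ K (P.avgTerm ϰ) AvgTerm.psi AvgTerm.Om r θ ζ = 0 := by
    intro ζ
    rw [correction_eq, if_neg (by omega), if_neg (by omega), sub_zero, zero_sub, neg_eq_zero]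
    have hterm : ∀ J, Smooth fun ε : ℝ => ε ^ J * (P.avgTerm ϰ J).Om
        (r + ∑ k ∈ range K, ε ^ (P.M + k) * (P.avgTerm ϰ k).rho r θ ζ)
        (θ + ∑ k ∈ range K, ε ^ (P.M + k) * (P.avgTerm ϰ k).psi r θ ζ) := by
      intro J
      have h3 : Smooth fun ε : ℝ => (P.avgTerm ϰ J).Om
        (r + ∑ k ∈ range K, ε ^ (P.M + k) * (P.avgTerm ϰ k).rho r θ ζ)
        (θ + ∑ k ∈ range K, ε ^ (P.M + k) * (P.avgTerm ϰ k).psi r θ ζ) :=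
        (hreg J).Om.comp ((show Smooth fun ε : ℝ =>
          r + ∑ k ∈ range K, ε ^ (P.M + k) * (P.avgTerm ϰ k).rho r θ ζ by fun_prop).prodMk
          (show Smooth fun ε : ℝ =>
          θ + ∑ k ∈ range K, ε ^ (P.M + k) * (P.avgTerm ϰ k).psi r θ ζ by fun_prop))
      exact (contDiff_id.pow J).mul h3
    have hsm : Smooth fun ε => P.transformedSum (P.avgTerm ϰ) AvgTerm.Om K K (ε, r, θ) ζ :=
      ContDiff.sum fun J _ => hterm J
    have hpoly : Smooth fun ε : ℝ => ∑ J ∈ range K, ε ^ J * (P.avgTerm ϰ J).Om r θ :=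
      ContDiff.sum fun J _ => by fun_prop
    rw [taylorCoef_congr_of_isBigO hsm hpoly (n := K + 1) ?_ (Nat.lt_succ_self K)]
    · rw [taylorCoef_sum (fun J _ => by fun_prop)]
      refine Finset.sum_eq_zero fun J hJ => ?_
      have := taylorCoef_pow_smul_const J K ((P.avgTerm ϰ J).Om r θ)
      rw [if_neg (by rw [Finset.mem_range] at hJ; omega)] at this; exact this
    · simp only [transformedSum]
      simp only [← sum_sub_distrib]
      refine IsBigO.fun_sum fun J _ => ?_
      have htail : ∀ f : ℕ → ℝ, (fun ε : ℝ => ∑ k ∈ range K, ε ^ (P.M + k) * f k)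
          =O[𝓝[>] 0] fun ε => ε ^ (K + 1) := by
        intro f
        refine IsBigO.fun_sum fun k _ => ?_
        have := (isBigO_pow_of_le (m := K + 1) (n := P.M + k) (by omega)).mul
          (isBigO_const_const (f k) (one_ne_zero (α := ℝ)) (𝓝[>] (0 : ℝ)))
        simpa using this
      have hst := ((hreg J).Om.contDiffAt (x := (r, θ))).hasStrictFDerivAt (by simp)
      have hlim : Tendsto (fun ε : ℝ =>
          ((r + ∑ k ∈ range K, ε ^ (P.M + k) * (P.avgTerm ϰ k).rho r θ ζ,
            θ + ∑ k ∈ range K, ε ^ (P.M + k) * (P.avgTerm ϰ k).psi r θ ζ) : ℝ²)) (𝓝[>] 0)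
          (𝓝 (r, θ)) := by
        have hcont : Continuous fun ε : ℝ =>
          ((r + ∑ k ∈ range K, ε ^ (P.M + k) * (P.avgTerm ϰ k).rho r θ ζ,
            θ + ∑ k ∈ range K, ε ^ (P.M + k) * (P.avgTerm ϰ k).psi r θ ζ) : ℝ²) := by
          fun_prop
        have := hcont.tendsto 0
        have h0 : ∀ k, (0 : ℝ) ^ (P.M + k) = 0 := fun k => zero_pow (by omega)
        simp only [h0, zero_mul, sum_const_zero, add_zero] at this
        exact this.mono_left nhdsWithin_le_nhds
      have h2 := hst.isBigO_sub.comp_tendsto (hlim.prodMk_nhds tendsto_const_nhds)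
      have h3 := h2.trans (((htail fun k => (P.avgTerm ϰ k).rho r θ ζ).prod_left
        (htail fun k => (P.avgTerm ϰ k).psi r θ ζ)).congr_left fun ε => by simp)
      have := (Continuous.isBigO_one_nhdsGT (f := fun ε : ℝ => ε ^ J) (by fun_prop)).mul h3
      simpa [mul_sub] using! this
  have hmean : P.Omega ϰ K r θ = mean ϰ (fun ζ => P.Bcoeff ϰ K r θ ζ
      + P.correction ϰ K (P.avgTerm ϰ) AvgTerm.psi AvgTerm.Om r θ ζ) := by
    rw [Omega, avgTerm_eq hM hN]; rfl
  rw [hmean]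
  simp only [h1, h2, add_zero, mean, integral_const, sub_zero, smul_eq_mul]
  rw [← mul_assoc, one_div_mul_cancel hT.ne', one_mul]

end HatField

/-- The size of the deviation from the locked state in terms of `τ` and an exponent `k`. -/
def lockingRate (P : PerturbedSystem) (ϰ L D : ℕ) (φ₀ ς x τ : ℝ) : ℝ :=
  (if P.M + D = P.N then τ ^ (-(ς / 2 * |P.gamHat ϰ L D φ₀|)) else 0) + τ ^ (-x)

namespace HatField

variable {P : PerturbedSystem} {ϰ n : ℕ} {Ah Bh : ℝ³ → ℝ → ℝ} {c : ℝ → ℝ}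

/-- Capture into resonance in the original resonance variables. -/
lemma capture (H : P.HatField ϰ n Ah Bh c) (hϰ : 1 ≤ ϰ) (hM : 1 ≤ P.M) (hϑ : P.vartheta ≠ 0)
    {L D : ℕ} {φ₀ ς : ℝ}
    (hL : P.IsLeadingOrder ϰ L) (hφ₀ : P.IsSimpleZero ϰ L φ₀) (hlam : P.lam ϰ L φ₀ < 0)
    (hD : P.IsDivergenceOrder ϰ D φ₀) (hgam : P.gamHat ϰ L D φ₀ < 0) (hMD : P.M + D ≤ P.N)
    (hς : ς ∈ Ioo (0 : ℝ) 1) (hn : 2 * P.N * (|P.gam ϰ D φ₀| + 4) ≤ n) {C₁ : ℝ} (hC₁ : 0 ≤ C₁)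
    {δ₀ : ℝ} (hδ₀ : 0 < δ₀) :
    ∃ δ, 0 < δ ∧ δ ≤ δ₀ ∧ ∃ δ', 0 < δ' ∧ ∃ τ₀, 1 ≤ τ₀ ∧ ∀ a ≥ τ₀, ∃ K, 0 ≤ K ∧ ∀ b ≥ a,
      ∀ r θ r' θ' : ℝ → ℝ, (∀ τ ∈ Icc a b, HasDerivWithinAt r (r' τ) (Icc a b) τ ∧
        HasDerivWithinAt θ (θ' τ) (Icc a b) τ ∧
        |r τ| ≤ δ * (τ ^ (-(1 / (2 * P.N : ℝ)))) ^ L ∧ |θ τ - φ₀| ≤ δ ∧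
        ∀ ε, ε = τ ^ (-(1 / (P.N : ℝ))) →
          |r' τ - ε ^ P.M * Ah (ε, r τ, θ τ) (P.vartheta * τ)| ≤ C₁ * ε ^ (P.M + n) ∧
          |θ' τ - ε ^ P.M * Bh (ε, r τ, θ τ) (P.vartheta * τ)| ≤ C₁ * ε ^ (P.M + n)) →
      |r a| ≤ δ' * (a ^ (-(1 / (2 * P.N : ℝ)))) ^ L → |θ a - φ₀| ≤ δ' →
      ∀ τ ∈ Icc a b, |r τ| ≤ 3 / 4 * δ * (τ ^ (-(1 / (2 * P.N : ℝ)))) ^ L ∧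
        |θ τ - φ₀| ≤ 3 / 4 * δ ∧
        |r τ| ≤ K * P.lockingRate ϰ L D φ₀ ς (P.M / P.N) τ ∧
        |θ τ - φ₀| ≤ K * P.lockingRate ϰ L D φ₀ ς (1 / P.N) τ := by
  have hN : 1 ≤ P.N := by omega
  have hreg := H.regular hϰ hM hN
  have dL : ∀ K, Differentiable ℝ fun p : ℝ² => P.Lambda ϰ K p.1 p.2 := fun K =>
    (hreg K).Lam.diff
  have dO : ∀ K, Differentiable ℝ fun p : ℝ² => P.Omega ϰ K p.1 p.2 := fun K =>
    (hreg K).Om.diff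
  have hdv : ∀ K r θ, 𝒟 (fun p : ℝ² => P.Lambda ϰ K p.1 p.2) (r, θ) (1, 0)
      + 𝒟 (fun p : ℝ² => P.Omega ϰ K p.1 p.2) (r, θ) (0, 1) = P.divergence ϰ K r θ :=
    fun K r θ => by
      rw [divergence, (hasDerivAt_fst₂ (dL K) r θ).deriv, (hasDerivAt_snd₂ (dO K) r θ).deriv]
  have hMn : P.M ≤ n := by
    have h1 : (P.N : ℝ) ≤ n := by
      have : (0 : ℝ) ≤ P.N * |P.gam ϰ D φ₀| := by positivity
      have : (0 : ℝ) ≤ P.N := by positivity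
      linarith
    have h2 : P.N ≤ n := by exact_mod_cast h1
    omega
  obtain ⟨Ca, hCa, hav⟩ := H.averaging hϰ hM hN hϑ
    (S := Icc (-1) 1 ×ˢ Icc (φ₀ - 1) (φ₀ + 1)) (isCompact_Icc.prod isCompact_Icc) hC₁
  obtain ⟨δ, hδ, hδδ, δ', hδ', τ₀, hτ₀, main⟩ := averaged_capture
    (Λ := fun K p => P.Lambda ϰ K p.1 p.2) (Ω := fun K p => P.Omega ϰ K p.1 p.2)
    (fun K => (hreg K).Lam) (fun K => (hreg K).Om) (φ₀ := φ₀) (ς := ς) (γ := P.gam ϰ D φ₀) (M := P.M)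
    (N := P.N) (L := L) (D := D) (n := n) (C₀ := Ca) (δ₀ := min δ₀ 1) (c := fun K => taylorCoef K c)
    hM hL.2.1 hD.1 hMD (fun K hK x => hL.2.2.1 K hK x.1 x.2)
    (fun K hK R Ψ => H.Omega_eq_mul hϰ hM hN (by omega) hMn hK R Ψ)
    (by rw [taylorCoef_zero]; exact H.c_pos) (fun K hK x => by
      have := hdv K x.1 x.2
      rw [hD.2.1 K hK] at this; exact this) hφ₀.1
    (by rw [← (hasDerivAt_snd₂ (dL L) 0 φ₀).deriv]; exact hlam)
    (hdv D 0 φ₀) hgam hς hn (lt_min hδ₀ one_pos) hCa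
  have hδ1 : δ ≤ 1 := hδδ.trans (min_le_right _ _)
  have hsmall : Tendsto (fun τ : ℝ => Ca * τ ^ (-(1 / (2 * P.N : ℝ)))) atTop (𝓝 0) := by
    simpa using (tendsto_rpow_neg_inv hN).const_mul Ca
  obtain ⟨τ₁, hτ₁⟩ := eventually_atTop.1 (hsmall.eventually_le_const
    (lt_min (show (0 : ℝ) < δ / 8 by positivity) (show (0 : ℝ) < δ' / 2 by positivity)))
  refine ⟨δ / 2, by positivity, by linarith [hδδ.trans (min_le_left δ₀ 1)], δ' / 2, by positivity,
    max τ₀ τ₁, hτ₀.trans (le_max_left _ _), fun a ha => ?_⟩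
  have ha0 := (le_max_left _ _).trans ha
  have ha1 : 1 ≤ a := hτ₀.trans ha0
  obtain ⟨K, hK, main⟩ := main a ha0
  refine ⟨K + Ca, by positivity, fun b hb r θ r' θ' hsol hra hθa => ?_⟩
  have hη : ∀ τ ∈ Icc a b, 0 < τ ^ (-(1 / (2 * P.N : ℝ))) ∧ τ ^ (-(1 / (2 * P.N : ℝ))) ≤ 1 ∧
      τ ^ (-(1 / (P.N : ℝ))) = (τ ^ (-(1 / (2 * P.N : ℝ)))) ^ 2 := by
    intro τ hτ
    have hτ0 : 0 < τ := by linarith [hτ.1]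
    refine ⟨rpow_pos_of_pos hτ0 _, rpow_le_one_of_one_le_of_nonpos (ha1.trans hτ.1)
      (by rw [neg_nonpos]; positivity), ?_⟩
    have hN0 : (P.N : ℝ) ≠ 0 := by positivity
    rw [← rpow_natCast, ← rpow_mul hτ0.le]; congr 1; push_cast; field_simp
  have hηL : ∀ τ ∈ Icc a b, Ca * ((τ ^ (-(1 / (2 * P.N : ℝ)))) ^ 2) ^ P.M ≤
      min (δ / 8) (δ' / 2) * (τ ^ (-(1 / (2 * P.N : ℝ)))) ^ L := by
    intro τ hτ
    obtain ⟨h1, h2, -⟩ := hη τ hτ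
    set η := τ ^ (-(1 / (2 * P.N : ℝ)))
    have h3 : Ca * η ≤ min (δ / 8) (δ' / 2) := hτ₁ τ ((le_max_right _ _).trans (ha.trans hτ.1))
    have h4 : (η ^ 2) ^ P.M ≤ η * η ^ L := by
      rw [← pow_mul, ← pow_succ']
      exact pow_le_pow_of_le_one h1.le h2 (by have := hL.2.1; omega)
    calc _ ≤ Ca * (η * η ^ L) := by gcongr
      _ = (Ca * η) * η ^ L := by ring
      _ ≤ _ := by gcongr
  have hηL' : ∀ τ ∈ Icc a b, (τ ^ (-(1 / (2 * P.N : ℝ)))) ^ L ≤ 1 := fun τ hτ =>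
    pow_le_one₀ (hη τ hτ).1.le (hη τ hτ).2.1
  obtain ⟨R, Ψ, R', Ψ', htr⟩ := hav a b ha1 r θ r' θ' fun τ hτ => by
    obtain ⟨h1, h2, h3, h4, h5⟩ := hsol τ hτ
    refine ⟨h1, h2, ⟨abs_le.1 (h3.trans ?_), ?_⟩, h5⟩
    · have := mul_le_mul_of_nonneg_left (hηL' τ hτ) (half_pos hδ).le; linarith
    · have := abs_le.1 h4
      constructor <;> linarith
  have hcmp : ∀ τ ∈ Icc a b, |R τ - r τ| ≤ min (δ / 8) (δ' / 2) * (τ ^ (-(1 / (2 * P.N : ℝ)))) ^ L ∧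
      |Ψ τ - θ τ| ≤ min (δ / 8) (δ' / 2) ∧ |R τ - r τ| ≤ Ca * τ ^ (-((P.M : ℝ) / P.N)) ∧
      |Ψ τ - θ τ| ≤ Ca * τ ^ (-(1 / (P.N : ℝ))) := by
    intro τ hτ
    obtain ⟨-, -, h3⟩ := htr τ hτ
    obtain ⟨h4, h5, -, -⟩ := h3 _ rfl
    have hτ0 : 0 < τ := by linarith [hτ.1]
    have hmn : 0 < min (δ / 8) (δ' / 2) := lt_min (by positivity) (by positivity)
    have hε0 : 0 < τ ^ (-(1 / (P.N : ℝ))) := rpow_pos_of_pos hτ0 _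
    have hε1 : τ ^ (-(1 / (P.N : ℝ))) ≤ 1 := rpow_le_one_of_one_le_of_nonpos
      (ha1.trans hτ.1) (by rw [neg_nonpos]; positivity)
    have e1 : (τ ^ (-(1 / (P.N : ℝ)))) ^ P.M = τ ^ (-((P.M : ℝ) / P.N)) := by
      rw [← rpow_natCast, ← rpow_mul hτ0.le]; congr 1; ring
    have e2 := hηL τ hτ
    rw [← (hη τ hτ).2.2] at e2
    refine ⟨h4.trans e2, h5.trans (e2.trans ?_), ?_, ?_⟩
    · exact mul_le_of_le_one_right hmn.le (hηL' τ hτ)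
    · rw [← e1]; exact h4
    · refine h5.trans ?_; gcongr
      exact pow_le_of_le_one hε0.le hε1 (by omega)
  have haI : a ∈ Icc a b := ⟨le_rfl, hb⟩
  have tri : ∀ x y : ℝ, |x| ≤ |y| + |x - y| := fun x y => by
    have := abs_sub_abs_le_abs_sub x y; linarith
  have res := main b hb R Ψ R' Ψ' (fun τ hτ => by
      obtain ⟨h1, h2, h3⟩ := htr τ hτ
      obtain ⟨-, -, s3, s4, -⟩ := hsol τ hτ
      refine ⟨h1, h2, ?_⟩
      rintro η rfl
      obtain ⟨q1, q2, q3⟩ := hη τ hτ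
      obtain ⟨c1, c2, -, -⟩ := hcmp τ hτ
      obtain ⟨-, -, h6, h7⟩ := h3 _ rfl
      rw [q3] at h6 h7
      have m1 : min (δ / 8) (δ' / 2) ≤ δ / 8 := min_le_left _ _
      refine ⟨?_, ?_, h6, h7⟩
      · have := tri (R τ) (r τ)
        have e1 : min (δ / 8) (δ' / 2) * (τ ^ (-(1 / (2 * P.N : ℝ)))) ^ L ≤
          δ / 8 * (τ ^ (-(1 / (2 * P.N : ℝ)))) ^ L := by gcongr
        have : 0 ≤ δ * (τ ^ (-(1 / (2 * P.N : ℝ)))) ^ L := by positivity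
        linarith
      · have := tri (Ψ τ - φ₀) (θ τ - φ₀)
        rw [sub_sub_sub_cancel_right] at this
        linarith)
    (by
      rintro η rfl
      obtain ⟨c1, -⟩ := hcmp a haI
      have := tri (R a) (r a)
      have e1 : min (δ / 8) (δ' / 2) * (a ^ (-(1 / (2 * P.N : ℝ)))) ^ L ≤
          δ' / 2 * (a ^ (-(1 / (2 * P.N : ℝ)))) ^ L := by
        have := (hη a haI).1; gcongr; exact min_le_right _ _
      linarith)
    (by
      obtain ⟨-, c2, -⟩ := hcmp a haI
      have := tri (Ψ a - φ₀) (θ a - φ₀)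
      rw [sub_sub_sub_cancel_right] at this
      have m2 : min (δ / 8) (δ' / 2) ≤ δ' / 2 := min_le_right _ _
      linarith)
  intro τ hτ
  obtain ⟨r1, r2, r3, r4⟩ := res τ hτ
  obtain ⟨c1, c2, c3, c4⟩ := hcmp τ hτ
  have r2 := r2 _ rfl
  have m1 : min (δ / 8) (δ' / 2) ≤ δ / 8 := min_le_left _ _
  have t1 := tri (r τ) (R τ)
  have t2 := tri (θ τ - φ₀) (Ψ τ - φ₀)
  rw [sub_sub_sub_cancel_right] at t2
  rw [abs_sub_comm] at c1 c2 c3 c4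
  have hτ0 : 0 < τ := by linarith [hτ.1]
  have hE : ∀ x : ℝ, τ ^ (-x) ≤ P.lockingRate ϰ L D φ₀ ς x τ := by
    intro x
    rw [lockingRate]
    have : 0 ≤ (if P.M + D = P.N then τ ^ (-(ς / 2 * |P.gamHat ϰ L D φ₀|)) else 0) := by positivity
    linarith
  refine ⟨?_, ?_, ?_, ?_⟩
  · have e1 : min (δ / 8) (δ' / 2) * (τ ^ (-(1 / (2 * P.N : ℝ)))) ^ L ≤
          δ / 8 * (τ ^ (-(1 / (2 * P.N : ℝ)))) ^ L := by
      have := (hη τ hτ).1; gcongr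
    linarith
  · linarith
  · have := mul_le_mul_of_nonneg_left (hE (P.M / P.N)) hCa
    have r3' : |R τ| ≤ K * P.lockingRate ϰ L D φ₀ ς (P.M / P.N) τ := r3; linarith
  · have := mul_le_mul_of_nonneg_left (hE (1 / P.N)) hCa
    have r4' : |Ψ τ - φ₀| ≤ K * P.lockingRate ϰ L D φ₀ ς (1 / P.N) τ := r4; linarith

end HatField

end PerturbedSystem

lemma ContDiff.ode_unique {E : Type} [NormedAddCommGroup E] [NormedSpace ℝ E] [ProperSpace E]
    {v : E → E} (hv : ContDiff ℝ 1 v) {f g : ℝ → E} {t₀ : ℝ}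
    (hf : ∀ t, HasDerivAt f (v (f t)) t) (hg : ∀ t, HasDerivAt g (v (g t)) t)
    (h₀ : f t₀ = g t₀) : f = g := by
  ext t
  obtain ⟨A, B, Ht, Ht₀⟩ : ∃ A B, t ∈ Set.Ioo A B ∧ t₀ ∈ Set.Ioo A B := by
    use (min (-|t|) (-|t₀|) - 1), (max |t| |t₀| + 1)
    grind
  have hcf : Continuous f := continuous_iff_continuousAt.2 fun t => (hf t).continuousAt
  have hcg : Continuous g := continuous_iff_continuousAt.2 fun t => (hg t).continuousAt
  obtain ⟨R, hR⟩ := (((isCompact_Icc (a := A) (b := B)).image hcf).union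
    ((isCompact_Icc (a := A) (b := B)).image hcg)).isBounded.subset_closedBall 0
  obtain ⟨K, hK⟩ := (hv.contDiffOn (s := Metric.closedBall (0 : E) R)).exists_lipschitzOnWith
    (by simp) (convex_closedBall _ _) (isCompact_closedBall _ _)
  exact ODE_solution_unique_of_mem_Ioo (v := fun _ => v) (s := fun _ => Metric.closedBall 0 R)
    (K := K) (fun _ _ => hK) Ht₀
    (fun s hs => ⟨hf s, hR (Or.inl (mem_image_of_mem _ (Ioo_subset_Icc_self hs)))⟩)
    (fun s hs => ⟨hg s, hR (Or.inr (mem_image_of_mem _ (Ioo_subset_Icc_self hs)))⟩) h₀ Ht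

/-- A smooth function of two variables whose derivative in the second one is bounded below by a
positive number has a smooth fibrewise inverse. -/
lemma ContDiff.exists_fibre_inverse {F F' : ℝ² → ℝ} (hF : Smooth F) {m : ℝ} (hm : 0 < m)
    (hd : ∀ a w, HasDerivAt (fun w => F (a, w)) (F' (a, w)) w) (hF' : ∀ a w, m ≤ F' (a, w)) :
    ∃ W : ℝ² → ℝ, Smooth W ∧ (∀ a z, F (a, W (a, z)) = z) ∧ ∀ a w, W (a, F (a, w)) = w := by
  have hmono : ∀ a, StrictMono fun w => F (a, w) := fun a =>
    strictMono_of_hasDerivAt_pos (hd a) fun w => hm.trans_le (hF' a w)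
  have hcont : ∀ a, Continuous fun w => F (a, w) := fun a =>
    hF.continuous.comp (by fun_prop)
  have hgrow : ∀ a x y, x ≤ y → m * (y - x) ≤ F (a, y) - F (a, x) := fun a x y hxy =>
    mul_sub_le_image_sub_of_le_deriv (fun w => (hd a w).differentiableAt)
      (fun w => by rw [(hd a w).deriv]; exact hF' a w) hxy
  have hsurj : ∀ a z, ∃ w, F (a, w) = z := by
    intro a z
    have h1 : F (a, -(|z - F (a, 0)| / m)) ≤ z := by
      have := hgrow a (-(|z - F (a, 0)| / m)) 0 (by simp; positivity)
      have e : m * (0 - -(|z - F (a, 0)| / m)) = |z - F (a, 0)| := by field_simp; ring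
      rw [e] at this
      linarith [neg_abs_le (z - F (a, 0))]
    have h2 : z ≤ F (a, |z - F (a, 0)| / m) := by
      have := hgrow a 0 (|z - F (a, 0)| / m) (by positivity)
      have e : m * (|z - F (a, 0)| / m - 0) = |z - F (a, 0)| := by field_simp; ring
      rw [e] at this
      linarith [le_abs_self (z - F (a, 0))]
    obtain ⟨w, -, hw⟩ := intermediate_value_Icc (show -(|z - F (a, 0)| / m) ≤ |z - F (a, 0)| / m by
        have : 0 ≤ |z - F (a, 0)| / m := by positivity
        linarith) (hcont a).continuousOn ⟨h1, h2⟩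
    exact ⟨w, hw⟩
  choose W hW using hsurj
  have hW' : ∀ a w, W a (F (a, w)) = w := fun a w => (hmono a).injective (hW a _)
  let Φ : ℝ² ≃ ℝ² :=
    { toFun := fun p => (p.1, F p)
      invFun := fun p => (p.1, W p.1 p.2)
      left_inv := fun p => Prod.ext rfl (hW' p.1 p.2)
      right_inv := fun p => Prod.ext rfl (hW p.1 p.2) }
  have hΦ : Smooth Φ := contDiff_fst.prodMk hF
  have hβ : ∀ p, 𝒟 F p (0, 1) = F' p := by
    rintro ⟨a, w⟩
    have h1 := ((hF.diff (a, w)).hasFDerivAt.comp_hasDerivAt w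
      (((hasDerivAt_const w a).prodMk (hasDerivAt_id w)) :
        HasDerivAt (fun w : ℝ => ((a, w) : ℝ²)) (0, 1) w))
    exact h1.unique (hd a w)
  have hβ0 : ∀ p, F' p ≠ 0 := fun p => (hm.trans_le (hF' p.1 p.2)).ne'
  let Φ' : ℝ² → ℝ² ≃L[ℝ] ℝ² := fun p =>
    ContinuousLinearEquiv.equivOfInverse ((ContinuousLinearMap.fst ℝ ℝ ℝ).prod (𝒟 F p))
      ((ContinuousLinearMap.fst ℝ ℝ ℝ).prod ((F' p)⁻¹ • (ContinuousLinearMap.snd ℝ ℝ ℝ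
        - (𝒟 F p (1, 0)) • ContinuousLinearMap.fst ℝ ℝ ℝ)))
      (by
        rintro ⟨x, y⟩
        have : 𝒟 F p (x, y) = x * 𝒟 F p (1, 0) + y * F' p := by
          rw [← hβ p]
          have e : ((x, y) : ℝ²) = x • ((1, 0) : ℝ²) + y • ((0, 1) : ℝ²) := by simp
          conv_lhs => rw [e]
          simp only [map_add, map_smul, smul_eq_mul]
        have h0 := hβ0 p
        ext
        · simp
        · simp [this]; field_simp
          ring)
      (by
        rintro ⟨x, y⟩
        have h0 := hβ0 p
        have : ∀ y, 𝒟 F p (x, y) = x * 𝒟 F p (1, 0) + y * F' p := by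
          intro y
          rw [← hβ p]
          have e : ((x, y) : ℝ²) = x • ((1, 0) : ℝ²) + y • ((0, 1) : ℝ²) := by simp
          conv_lhs => rw [e]
          simp only [map_add, map_smul, smul_eq_mul]
        ext
        · simp
        · simp [this]; field_simp
          ring)
  have hΦd : ∀ p, HasFDerivAt Φ ((Φ' p : ℝ² ≃L[ℝ] ℝ²) : ℝ² →L[ℝ] ℝ²) p :=
    fun p => hasFDerivAt_fst.prodMk (hF.diff p).hasFDerivAt
  have hstr : ∀ p, HasStrictFDerivAt Φ ((Φ' p : ℝ² ≃L[ℝ] ℝ²) : ℝ² →L[ℝ] ℝ²) p := fun p =>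
    hΦ.contDiffAt.hasStrictFDerivAt' (hΦd p) (by simp)
  let Ψ := Φ.toHomeomorphOfContinuousOpen hΦ.continuous (isOpenMap_of_hasStrictFDerivAt_equiv hstr)
  have hΨ : Smooth Ψ.symm := Ψ.contDiff_symm hΦd hΦ
  exact ⟨fun p => W p.1 p.2, contDiff_snd.comp hΨ, fun a z => hW a z, fun a w => hW' a w⟩

/-- The time that a conservative motion needs for half of a period. -/
lemma integral_sqrt_two_div_sqrt_eq {x y k G : ℝ → ℝ} {α β : ℝ} (hαβ : α ≤ β)
    (hx : ContinuousOn x (Icc α β))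
    (hx' : ∀ a ∈ Ioo α β, HasDerivAt x (y a * k a) a) (hy : ∀ a ∈ Ioo α β, y a < 0)
    (hk : ∀ a ∈ Ioo α β, 0 < k a) (hG : ∀ a ∈ Ioo α β, G (x a) = y a ^ 2 / 2) :
    ∫ ξ in x β..x α, sqrt 2 / sqrt (G ξ) = 2 * ∫ a in α..β, k a := by
  have h1 := integral_comp_mul_deriv_of_deriv_nonpos
    (f := x) (f' := fun a => y a * k a) (g := fun ξ => sqrt 2 / sqrt (G ξ))
    (a := α) (b := β) (by rwa [uIcc_of_le hαβ])
    (by rw [min_eq_left hαβ, max_eq_right hαβ]; exact hx') (by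
      rw [min_eq_left hαβ, max_eq_right hαβ]
      exact fun a ha => mul_nonpos_of_nonpos_of_nonneg (hy a ha).le (hk a ha).le)
  rw [integral_symm, ← h1, ← integral_const_mul, ← integral_neg]
  rw [integral_of_le hαβ, integral_of_le hαβ,
    MeasureTheory.integral_Ioc_eq_integral_Ioo, MeasureTheory.integral_Ioc_eq_integral_Ioo]
  refine MeasureTheory.setIntegral_congr_fun measurableSet_Ioo fun a ha => ?_
  have e : sqrt (G (x a)) = -y a / sqrt 2 := by
    rw [hG a ha, sqrt_div (sq_nonneg _), sqrt_sq_eq_abs, abs_of_neg (hy a ha)]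
  have h2 : sqrt 2 ^ 2 = 2 := sq_sqrt (by norm_num)
  have h3 : y a ≠ 0 := (hy a ha).ne
  simp only [Function.comp_apply, e]; field_simp; rw [h2]; ring

namespace PerturbedSystem

lemma kappa_pos (P : PerturbedSystem) (hh : 2 ≤ P.h) : 0 < P.kappa := by
  have hint : IntervalIntegrable (fun x : ℝ => 1 / sqrt (1 - x ^ 2)) MeasureTheory.volume
      (-1) 1 := by
    refine intervalIntegrable_deriv_of_nonneg (g := arcsin)
      continuous_arcsin.continuousOn (fun x hx => ?_) fun x _ => by positivity
    rw [min_eq_left (by norm_num), max_eq_right (by norm_num)] at hx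
    exact hasDerivAt_arcsin hx.1.ne' hx.2.ne
  have hpow : ∀ x : ℝ, x ^ 2 ≤ 1 → x ^ (2 * P.h) ≤ x ^ 2 := fun x hx => by
    have := pow_le_pow_of_le_one (sq_nonneg x) hx (show 1 ≤ P.h by omega)
    rwa [pow_one, ← pow_mul] at this
  have hint' : IntervalIntegrable (fun x : ℝ => 1 / sqrt (1 - x ^ (2 * P.h)))
      MeasureTheory.volume (-1) 1 := by
    refine hint.mono_fun' (Measurable.aestronglyMeasurable (by fun_prop)) ?_
    rw [uIoc_of_le (by norm_num)]
    refine (MeasureTheory.ae_restrict_iff' measurableSet_Ioc).2 (.of_forall fun x hx => ?_)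
    have hx2 : x ^ 2 ≤ 1 := by nlinarith [hx.1, hx.2]
    beta_reduce
    rw [norm_of_nonneg (by positivity)]
    rcases hx2.eq_or_lt with h | h
    · have : x ^ (2 * P.h) = 1 := by rw [pow_mul, h, one_pow]
      rw [this, h]
    · have h1 : 0 < sqrt (1 - x ^ 2) := sqrt_pos.2 (by linarith)
      exact one_div_le_one_div_of_le h1 (sqrt_le_sqrt (by linarith [hpow x hx2]))
  have hpos : 0 < ∫ x in (-1 : ℝ)..1, 1 / sqrt (1 - x ^ (2 * P.h)) := by
    refine intervalIntegral_pos_of_pos_on hint' (fun x hx => ?_) (by norm_num)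
    have hx2 : x ^ 2 < 1 := by nlinarith [hx.1, hx.2]
    have := sqrt_pos.2 (show 0 < 1 - x ^ (2 * P.h) by linarith [hpow x hx2.le])
    positivity
  unfold kappa; positivity

namespace IsLimitOscillation

variable {P : PerturbedSystem} {X₀ Y₀ : ℝ → ℝ}

lemma contDiff (hXY : P.IsLimitOscillation X₀ Y₀) : Smooth X₀ ∧ Smooth Y₀ := by
  have hX : Differentiable ℝ X₀ := fun a => (hXY.deriv_X a).differentiableAt
  have hY : Differentiable ℝ Y₀ := fun a => (hXY.deriv_Y a).differentiableAt
  have key : ∀ n : ℕ, ContDiff ℝ n X₀ ∧ ContDiff ℝ n Y₀ := by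
    intro n
    induction n with
    | zero => exact ⟨contDiff_zero.2 hX.continuous, contDiff_zero.2 hY.continuous⟩
    | succ n ih =>
      refine ⟨?_, ?_⟩
      · push_cast
        refine contDiff_succ_iff_deriv.2 ⟨hX, fun h => by simp at h, ?_⟩
        rw [show deriv X₀ = fun a => P.kappa / (2 * π) * Y₀ a from
          funext fun a => (hXY.deriv_X a).deriv]
        exact contDiff_const.mul ih.2
      · push_cast
        refine contDiff_succ_iff_deriv.2 ⟨hY, fun h => by simp at h, ?_⟩
        rw [show deriv Y₀ = fun a => -(P.kappa / (2 * π) * X₀ a ^ (2 * P.h - 1)) from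
          funext fun a => (hXY.deriv_Y a).deriv]
        exact (contDiff_const.mul (ih.1.pow _)).neg
  exact ⟨contDiff_infty.2 fun n => (key n).1, contDiff_infty.2 fun n => (key n).2⟩

lemma X_zero_pow (hXY : P.IsLimitOscillation X₀ Y₀) (hh : 2 ≤ P.h) :
    X₀ 0 ^ (2 * P.h) = 2 * P.h := by
  have h2 := hXY.energy_eq 0; rw [hXY.Y_zero] at h2
  field_simp at h2; linarith

lemma symm (hXY : P.IsLimitOscillation X₀ Y₀) (a : ℝ) : X₀ (-a) = X₀ a ∧ Y₀ (-a) = -Y₀ a := by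
  have hv : ContDiff ℝ 1 fun p : ℝ² =>
      ((P.kappa / (2 * π) * p.2, -(P.kappa / (2 * π) * p.1 ^ (2 * P.h - 1))) : ℝ²) :=
    by fun_prop
  have := hv.ode_unique (f := fun a => (X₀ (-a), -Y₀ (-a))) (g := fun a => (X₀ a, Y₀ a)) (t₀ := 0)
    (fun t => by
      have h1 : HasDerivAt (fun a => X₀ (-a)) (P.kappa / (2 * π) * -Y₀ (-t)) t := by
        simpa using! (hXY.deriv_X (-t)).comp t (hasDerivAt_neg t)
      have h2 : HasDerivAt (fun a => -Y₀ (-a))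
          (-(P.kappa / (2 * π) * X₀ (-t) ^ (2 * P.h - 1))) t := by
        simpa using! ((hXY.deriv_Y (-t)).comp t (hasDerivAt_neg t)).neg
      exact h1.prodMk h2)
    (fun t => (hXY.deriv_X t).prodMk (hXY.deriv_Y t)) (by simp [hXY.Y_zero])
  have h := congrFun this a
  simp only [Prod.mk.injEq] at h
  exact ⟨h.1, by linarith [h.2]⟩

/-- The angle of the limiting motion from the right to the left turning point is `π`. -/
lemma half_period (hXY : P.IsLimitOscillation X₀ Y₀) (hh : 2 ≤ P.h) :
    (∀ a ∈ Ioo 0 π, Y₀ a < 0) ∧ Y₀ π = 0 ∧ X₀ π = -X₀ 0 := by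
  have hκ := P.kappa_pos hh
  have hpr := pi_pos
  set k := P.kappa / (2 * π) with hk
  have hk0 : 0 < k := by positivity
  have hYc : Continuous Y₀ := hXY.contDiff.2.continuous
  have hXc : Continuous X₀ := hXY.contDiff.1.continuous
  obtain ⟨ε, hε, hneg⟩ : ∃ ε > 0, ∀ a ∈ Ioo 0 ε, Y₀ a < 0 := by
    have h1 : HasDerivAt Y₀ (-(k * X₀ 0 ^ (2 * P.h - 1))) 0 := hXY.deriv_Y 0
    have h2 : -(k * X₀ 0 ^ (2 * P.h - 1)) < 0 := by
      have := pow_pos hXY.X_pos (2 * P.h - 1)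
      have := mul_pos hk0 this; linarith
    have h3 := h1.tendsto_slope.eventually (gt_mem_nhds h2)
    rw [eventually_nhdsWithin_iff] at h3
    obtain ⟨ε, hε, H⟩ := Metric.eventually_nhds_iff.1 h3
    refine ⟨ε, hε, fun a ha => ?_⟩
    have := H (y := a) (by simp [abs_of_pos ha.1, ha.2]) (by simpa using ha.1.ne')
    rw [slope_def_field, hXY.Y_zero, sub_zero, sub_zero, div_neg_iff] at this
    rcases this with h | h
    · exact absurd h.2 (by linarith [ha.1])
    · exact h.1
  obtain ⟨a₁, ⟨ha1, ha1'⟩, hmin⟩ : ∃ a₁, IsLeast (Icc (ε / 2) (2 * π) ∩ {a | Y₀ a = 0}) a₁ := by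
    refine (isCompact_Icc.inter_right (isClosed_eq hYc continuous_const)).exists_isLeast ?_
    refine ⟨2 * π, ⟨?_, le_rfl⟩, ?_⟩
    · by_contra! h
      have h1 := hneg (2 * π) ⟨by positivity, by linarith⟩
      have h2 := hXY.periodic_Y 0
      rw [zero_add, hXY.Y_zero] at h2; linarith
    · have h2 := hXY.periodic_Y 0
      rwa [zero_add, hXY.Y_zero] at h2
  have ha1' : Y₀ a₁ = 0 := ha1'
  have ha0 : 0 < a₁ := by linarith [ha1.1]
  have hYneg : ∀ a ∈ Ioo 0 a₁, Y₀ a < 0 := by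
    intro a ha
    rcases lt_or_ge a ε with h | h
    · exact hneg a ⟨ha.1, h⟩
    · by_contra! hc
      have h0 := hneg (ε / 2) ⟨by linarith, by linarith⟩
      obtain ⟨b, hb, hb0⟩ := intermediate_value_Icc (by linarith : ε / 2 ≤ a) hYc.continuousOn
        ⟨h0.le, hc⟩
      have := hmin ⟨⟨hb.1, by linarith [hb.2, ha.2, ha1.2]⟩, hb0⟩; linarith [hb.2, ha.2]
  have hXa : X₀ a₁ = -X₀ 0 := by
    have hlt : X₀ a₁ < X₀ 0 := by
      refine strictAntiOn_of_deriv_neg (convex_Icc 0 a₁) hXc.continuousOn (fun a ha => ?_)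
        (left_mem_Icc.2 ha0.le) (right_mem_Icc.2 ha0.le) ha0
      rw [interior_Icc] at ha
      rw [(hXY.deriv_X a).deriv]
      exact mul_neg_of_pos_of_neg hk0 (hYneg a ha)
    have h0 : (0 : ℝ) < 2 * P.h := by positivity
    have h1 := hXY.energy_eq a₁; rw [ha1'] at h1
    have h2 : X₀ a₁ ^ (2 * P.h) = X₀ 0 ^ (2 * P.h) := by
      rw [hXY.X_zero_pow hh]
      field_simp at h1; linarith
    rw [← (even_two_mul P.h).pow_abs] at h2
    have h3 := (pow_left_inj₀ (abs_nonneg _) hXY.X_pos.le (by omega)).1 h2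
    rcases abs_choice (X₀ a₁) with h | h
    · rw [h] at h3; linarith
    · linarith
  have hint := integral_sqrt_two_div_sqrt_eq (x := X₀) (y := Y₀) (k := fun _ => k)
    (G := fun ξ => 1 - ξ ^ (2 * P.h) / (2 * P.h)) ha0.le hXc.continuousOn
    (fun a _ => by rw [mul_comm]; exact hXY.deriv_X a) hYneg (fun _ _ => hk0)
    (fun a _ => by linarith [hXY.energy_eq a])
  have hc := hXY.X_pos
  have hL : ∫ ξ in X₀ a₁..X₀ 0, sqrt 2 / sqrt (1 - ξ ^ (2 * P.h) / (2 * P.h))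
      = P.kappa := by
    have h0 : (0 : ℝ) < 2 * P.h := by positivity
    have hcr : (2 * (P.h : ℝ)) ^ (1 / (2 * (P.h : ℝ))) = X₀ 0 := by
      have := pow_rpow_inv_natCast hc.le (n := 2 * P.h) (by omega)
      rw [hXY.X_zero_pow hh] at this; rw [one_div]
      push_cast at this; exact this
    have e := mul_integral_comp_mul_left (a := -1) (b := 1) (X₀ 0)
      (f := fun ξ => sqrt 2 / sqrt (1 - ξ ^ (2 * P.h) / (2 * P.h)))
    rw [hXa, kappa, hcr]
    rw [mul_neg_one, mul_one] at e
    have e' : (fun u => sqrt 2 / sqrt (1 - (X₀ 0 * u) ^ (2 * P.h) / (2 * P.h)))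
        = fun u => sqrt 2 * (1 / sqrt (1 - u ^ (2 * P.h))) := by
      ext u
      rw [mul_pow, hXY.X_zero_pow hh, mul_div_assoc', mul_one, mul_div_cancel_left₀ _ h0.ne']
    rw [← e, e', integral_const_mul]; ring
  rw [hL, integral_const, smul_eq_mul, sub_zero] at hint
  have hkk : P.kappa = k * (2 * π) := by rw [hk]; field_simp
  have hapr : a₁ = π := by
    have : k * (2 * π) = k * (2 * a₁) := by linarith
    have := mul_left_cancel₀ hk0.ne' this; linarith
  rw [← hapr]
  exact ⟨hYneg, ha1', hXa⟩

end IsLimitOscillation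
end PerturbedSystem

/-- A smooth bounded function that is the identity on `[-1, 1]`. -/
lemma exists_smooth_truncation : ∃ (ψ : ℝ → ℝ) (C : ℝ), 0 < C ∧ Smooth ψ ∧
    (∀ s, |s| ≤ 1 → ψ s = s) ∧ (∀ s, |ψ s| ≤ C) ∧ ∀ s, |s * deriv ψ s| ≤ C := by
  let χ : ContDiffBump (0 : ℝ) := ⟨1, 2, by norm_num, by norm_num⟩
  have hχ : Smooth (fun s => χ s) := χ.contDiff
  have hψ : Smooth fun s => s * χ s := contDiff_id.mul hχ
  have hcs : HasCompactSupport fun s => s * χ s := χ.hasCompactSupport.mul_left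
  have hcd : Continuous (deriv fun s => s * χ s) := hψ.continuous_deriv (by simp)
  obtain ⟨C₁, hC₁⟩ := hcs.exists_bound_of_continuous hψ.continuous
  obtain ⟨C₂, hC₂⟩ := (hcs.deriv.mul_left (f := fun s : ℝ => s)).exists_bound_of_continuous
    (continuous_id.mul hcd)
  refine ⟨fun s => s * χ s, |C₁| + |C₂| + 1, by positivity, hψ, fun s hs => ?_, fun s => ?_,
    fun s => ?_⟩
  · have : χ s = 1 := χ.one_of_mem_closedBall (by simpa using hs); simp [this]
  · exact (hC₁ s).trans (by linarith [le_abs_self C₁, abs_nonneg C₂])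
  · exact (hC₂ s).trans (by linarith [le_abs_self C₂, abs_nonneg C₁])

lemma ContDiff.exists_truncation_bound {q : ℝ² → ℝ} (hq : Smooth q) {T : ℝ} (hT : 0 < T)
    (hper : ∀ w, Function.Periodic (fun a => q (a, w)) T) (h0 : ∀ a, q (a, 0) = 0) {ψ : ℝ → ℝ}
    {C : ℝ} (hψ : Smooth ψ) (hC : ∀ s, |ψ s| ≤ C) (hC' : ∀ s, |s * deriv ψ s| ≤ C)
    {δ : ℝ} (hδ : 0 < δ) : ∃ w₁ > 0, ∀ w₀, 0 < w₀ → w₀ ≤ w₁ → ∀ a w, |q (a, w₀ * ψ (w / w₀))| ≤ δ ∧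
      ∃ d, HasDerivAt (fun w => q (a, w₀ * ψ (w / w₀))) d w ∧ |w * d| ≤ δ := by
  have hC0 : 0 ≤ C := (abs_nonneg _).trans (hC 0)
  have hcq : Continuous fun p : ℝ² => 𝒟 q p (0, 1) :=
    (hq.continuous_fderiv (by simp)).clm_apply continuous_const
  obtain ⟨M, hM⟩ := (isCompact_Icc.prod isCompact_Icc :
    IsCompact (Icc (0 : ℝ) T ×ˢ Icc (-C) C)).exists_bound_of_continuousOn hcq.continuousOn
  have hqd : ∀ a w, HasDerivAt (fun w => q (a, w)) (𝒟 q (a, w) (0, 1)) w :=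
    fun a w => (hq.diff (a, w)).hasFDerivAt.comp_hasDerivAt w
      (((hasDerivAt_const w a).prodMk (hasDerivAt_id w)) :
        HasDerivAt (fun w : ℝ => ((a, w) : ℝ²)) (0, 1) w)
  refine ⟨min 1 (δ / (|M| * C + 1)), by positivity, fun w₀ hw₀ hw₁ a w => ?_⟩
  have hw1 : w₀ ≤ 1 := hw₁.trans (min_le_left _ _)
  have hw2 : |M| * (w₀ * C) ≤ δ := by
    have h1 : w₀ * (|M| * C + 1) ≤ δ :=
      (le_div_iff₀ (by positivity)).1 (hw₁.trans (min_le_right _ _))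
    linarith [hw₀]
  obtain ⟨a', ha', he⟩ : ∃ a' ∈ Icc (0 : ℝ) T, ∀ w, q (a, w) = q (a', w) := by
    obtain ⟨n, hn, -⟩ := existsUnique_add_zsmul_mem_Ico hT a 0
    refine ⟨a + n • T, ⟨hn.1, by linarith [hn.2]⟩, fun w => ?_⟩
    exact ((hper w).zsmul n a).symm
  simp only [he]
  have hs : ∀ s, |w₀ * ψ s| ≤ w₀ * C := fun s => by
    rw [abs_mul, abs_of_pos hw₀]; exact mul_le_mul_of_nonneg_left (hC s) hw₀.le
  have hsub : w₀ * C ≤ C := by nlinarith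
  have hmem : ∀ v, |v| ≤ w₀ * C → ((a', v) : ℝ²) ∈ Icc (0 : ℝ) T ×ˢ Icc (-C) C := fun v hv =>
    ⟨ha', abs_le.1 (hv.trans hsub)⟩
  have hM' : ∀ v, |v| ≤ w₀ * C → |𝒟 q (a', v) (0, 1)| ≤ |M| := fun v hv =>
    (hM _ (hmem v hv)).trans (le_abs_self _)
  constructor
  · have h1 := (convex_Icc (-(w₀ * C)) (w₀ * C)).norm_image_sub_le_of_norm_hasDerivWithin_le
      (f := fun w => q (a', w)) (C := |M|) (x := 0) (y := w₀ * ψ (w / w₀))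
      (fun v _ => (hqd a' v).hasDerivWithinAt)
      (fun v hv => hM' v (abs_le.2 hv)) (by constructor <;> nlinarith)
      (abs_le.1 (hs _))
    rw [h0, sub_zero, sub_zero, norm_eq_abs, norm_eq_abs] at h1
    exact h1.trans ((mul_le_mul_of_nonneg_left (hs _) (abs_nonneg _)).trans hw2)
  · have h1 : HasDerivAt (fun w => w₀ * ψ (w / w₀)) (deriv ψ (w / w₀)) w := by
      have h2 : HasDerivAt ψ (deriv ψ (w / w₀)) (w / w₀) := (hψ.diff _).hasDerivAt
      have h3 := (h2.comp w ((hasDerivAt_id w).div_const w₀)).const_mul w₀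
      simp only [id, Function.comp_def] at h3
      refine h3.congr_deriv ?_; field_simp
    refine ⟨_, (hqd a' _).comp w h1, ?_⟩
    have e : w * (𝒟 q (a', w₀ * ψ (w / w₀)) (0, 1) * deriv ψ (w / w₀))
        = 𝒟 q (a', w₀ * ψ (w / w₀)) (0, 1) * (w₀ * (w / w₀ * deriv ψ (w / w₀))) := by
      field_simp
    rw [e, abs_mul, abs_mul, abs_of_pos hw₀]
    refine (mul_le_mul (hM' _ (hs _)) (mul_le_mul_of_nonneg_left (hC' _) hw₀.le)
      (by positivity) (abs_nonneg _)).trans hw2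

namespace PerturbedSystem

/-- The lower order part of the potential at `x = X₀ a / w`, relative to `w ^ (-2h)`, with the
monomials weighted by `m`. -/
def polarPert (P : PerturbedSystem) (X₀ : ℝ → ℝ) (m : ℕ → ℝ) (p : ℝ²) : ℝ :=
  ∑ i ∈ Finset.Icc 1 (2 * P.h - 1), m i * P.u i * X₀ p.1 ^ i * p.2 ^ (2 * P.h - i)

/-- Polar coordinates `x = X₀ a / w`, `y = Y₀ a / w ^ h`: on the level `H = z ^ (-2h)` the radial
variable is `w = W (a, z)`. -/
structure PolarChart (P : PerturbedSystem) (X₀ : ℝ → ℝ) (g B W : ℝ² → ℝ) (w₀ : ℝ) : Prop where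
  w_pos : 0 < w₀
  g_smooth : Smooth g
  B_smooth : Smooth B
  W_smooth : Smooth W
  g_mem : ∀ p, g p ∈ Icc (2 / 3 : ℝ) 2
  B_mem : ∀ p, B p ∈ Icc (1 / 2 : ℝ) (3 / 2)
  g_zero : ∀ a, g (a, 0) = 1
  B_zero : ∀ a, B (a, 0) = 1
  g_eq : ∀ a w, |w| ≤ w₀ → g (a, w) ^ (2 * P.h) * (1 + P.polarPert X₀ (fun _ => 1) (a, w)) = 1
  B_eq : ∀ a w, |w| ≤ w₀ → B (a, w) = 1 + P.polarPert X₀ (fun i => i / (2 * P.h)) (a, w)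
  W_left : ∀ a w, W (a, w * g (a, w)) = w
  W_right : ∀ a z, W (a, z) * g (a, W (a, z)) = z
  congr_of_eq : ∀ a a' w, X₀ a = X₀ a' → g (a, w) = g (a', w) ∧ B (a, w) = B (a', w)

lemma rpow_neg_mem {t e : ℝ} (ht : t ∈ Icc (1 / 2 : ℝ) (3 / 2)) (he : 0 ≤ e) (he' : e ≤ 1) :
    t ^ (-e) ∈ Icc (2 / 3 : ℝ) 2 := by
  have ht0 : 0 < t := by linarith [ht.1]
  have hi : t⁻¹ ∈ Icc (2 / 3 : ℝ) 2 := by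
    constructor
    · rw [le_inv_comm₀ (by norm_num) ht0]; linarith [ht.2]
    · rw [inv_le_comm₀ ht0 (by norm_num)]; linarith [ht.1]
  have hi0 : 0 < t⁻¹ := by positivity
  rw [rpow_neg ht0.le, ← inv_rpow ht0.le]
  rcases le_total 1 t⁻¹ with h | h
  · refine ⟨by linarith [one_le_rpow h he], ?_⟩
    refine (rpow_le_rpow_of_exponent_le h he').trans ?_
    rw [rpow_one]; exact hi.2
  · refine ⟨?_, by linarith [rpow_le_one hi0.le h he]⟩
    have := rpow_le_rpow_of_exponent_ge hi0 h he'
    rw [rpow_one] at this; exact hi.1.trans this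

lemma exists_polarChart (P : PerturbedSystem) (hh : 2 ≤ P.h) {X₀ : ℝ → ℝ} (hX : Smooth X₀)
    (hper : Function.Periodic X₀ (2 * π)) : ∃ g B W w₀, P.PolarChart X₀ g B W w₀ := by
  obtain ⟨ψ, C, -, hψ, hψ1, hψC, hψC'⟩ := exists_smooth_truncation
  have hq : ∀ m : ℕ → ℝ, Smooth (P.polarPert X₀ m) := fun m => by
    unfold polarPert
    refine ContDiff.sum fun i _ => ?_
    exact ((contDiff_const.mul ((hX.comp contDiff_fst).pow _))).mul (contDiff_snd.pow _)
  have hqp : ∀ m w, Function.Periodic (fun a => P.polarPert X₀ m (a, w)) (2 * π) :=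
    fun m w a => by simp only [polarPert, hper a]
  have hq0 : ∀ m a, P.polarPert X₀ m (a, 0) = 0 := fun m a => by
    refine Finset.sum_eq_zero fun i hi => ?_
    have := Finset.mem_Icc.1 hi
    rw [zero_pow (by omega), mul_zero]
  obtain ⟨w₁, hw₁, H₁⟩ := (hq fun _ => 1).exists_truncation_bound two_pi_pos (hqp _) (hq0 _)
    hψ hψC hψC' (δ := 1 / 2) (by norm_num)
  obtain ⟨w₂, hw₂, H₂⟩ := (hq fun i => i / (2 * P.h)).exists_truncation_bound two_pi_pos
    (hqp _) (hq0 _) hψ hψC hψC' (δ := 1 / 2) (by norm_num)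
  set w₀ := min w₁ w₂
  have hw0 : 0 < w₀ := lt_min hw₁ hw₂
  replace H₁ := H₁ w₀ hw0 (min_le_left _ _)
  replace H₂ := H₂ w₀ hw0 (min_le_right _ _)
  have hloc : ∀ w, |w| ≤ w₀ → w₀ * ψ (w / w₀) = w := fun w hw => by
    rw [hψ1 _ (by rw [abs_div, abs_of_pos hw0]; exact (div_le_one hw0).2 hw)]
    field_simp
  have htr : Smooth fun p : ℝ² => ((p.1, w₀ * ψ (p.2 / w₀)) : ℝ²) :=
    contDiff_fst.prodMk (contDiff_const.mul (hψ.comp (contDiff_snd.div_const _)))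
  set t : ℝ² → ℝ := fun p => 1 + P.polarPert X₀ (fun _ => 1) (p.1, w₀ * ψ (p.2 / w₀)) with ht
  have ht_mem : ∀ p, t p ∈ Icc (1 / 2 : ℝ) (3 / 2) := fun p => by
    have := abs_le.1 (H₁ p.1 p.2).1
    constructor <;> simp only [ht] <;> linarith [this.1, this.2]
  have ht0 : ∀ p, 0 < t p := fun p => by linarith [(ht_mem p).1]
  have hts : Smooth t := contDiff_const.add ((hq _).comp htr)
  have hh0 : (2 : ℝ) ≤ P.h := by exact_mod_cast hh
  set e : ℝ := 1 / (2 * P.h) with he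
  have he0 : 0 ≤ e := by positivity
  have he4 : e ≤ 1 / 4 := by rw [he]; exact one_div_le_one_div_of_le (by norm_num) (by linarith)
  have hg_mem : ∀ p, t p ^ (-e) ∈ Icc (2 / 3 : ℝ) 2 := fun p =>
    rpow_neg_mem (ht_mem p) he0 (by linarith)
  have hgs : Smooth fun p => t p ^ (-e) := hts.rpow_const_of_ne fun p => (ht0 p).ne'
  have hder : ∀ a w, ∃ d, HasDerivAt (fun w => w * t (a, w) ^ (-e)) d w ∧ 1 / 2 ≤ d := by
    intro a w
    obtain ⟨d, hd, hdw⟩ := (H₁ a w).2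
    have h1 : HasDerivAt (fun w => t (a, w)) d w := hd.const_add 1
    have h2 := (hasDerivAt_id w).mul (h1.rpow_const (p := -e) (Or.inl (ht0 _).ne'))
    refine ⟨_, h2, ?_⟩
    have h3 : t (a, w) ^ (-e - 1) = t (a, w) ^ (-e) / t (a, w) := by
      rw [rpow_sub_one (ht0 _).ne']
    have hg := hg_mem (a, w)
    have htm := ht_mem (a, w)
    have ht0 := ht0 (a, w)
    simp only [id, one_mul]; rw [h3]
    set G := t (a, w) ^ (-e)
    have h4 : G + w * (d * -e * (G / t (a, w))) = G * (1 - e * (w * d) / t (a, w)) := by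
      field_simp; ring
    rw [h4]
    have h5 : e * (w * d) / t (a, w) ≤ 1 / 4 := by
      rw [div_le_iff₀ ht0]
      have h6 : e * (w * d) ≤ 1 / 4 * (1 / 2) :=
        (mul_le_mul_of_nonneg_left ((le_abs_self _).trans hdw) he0).trans
          (mul_le_mul_of_nonneg_right he4 (by norm_num))
      linarith [htm.1]
    have h7 : G * (3 / 4) ≤ G * (1 - e * (w * d) / t (a, w)) :=
      mul_le_mul_of_nonneg_left (by linarith) (by linarith [hg.1])
    linarith [hg.1]
  choose F' hF' hF'' using hder
  obtain ⟨W, hW, hWr, hWl⟩ := (contDiff_snd.mul hgs : Smooth fun p : ℝ² =>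
    p.2 * t p ^ (-e)).exists_fibre_inverse (F' := fun p => F' p.1 p.2) (m := 1 / 2) (by norm_num)
    hF' hF''
  refine ⟨fun p => t p ^ (-e),
    fun p => 1 + P.polarPert X₀ (fun i => i / (2 * P.h)) (p.1, w₀ * ψ (p.2 / w₀)), W, w₀,
    hw0, hgs, contDiff_const.add ((hq _).comp htr), hW, hg_mem, fun p => ?_, fun a => ?_,
    fun a => ?_, fun a w hw => ?_, fun a w hw => ?_, hWl, hWr, fun a a' w ha => ?_⟩
  · have := abs_le.1 (H₂ p.1 p.2).1
    constructor <;> linarith [this.1, this.2]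
  · simp only [ht, hloc 0 (by simpa using hw0.le), hq0, add_zero, one_rpow]
  · simp only [hloc 0 (by simpa using hw0.le), hq0, add_zero]
  · have h1 : t (a, w) = 1 + P.polarPert X₀ (fun _ => 1) (a, w) := by simp only [ht, hloc w hw]
    rw [← h1, ← rpow_natCast, ← rpow_mul (ht0 _).le]
    have h2 : -e * ((2 * P.h : ℕ) : ℝ) = -1 := by rw [he]; push_cast; field_simp
    rw [h2, rpow_neg_one, inv_mul_cancel₀ (ht0 _).ne']
  · simp only [hloc w hw]
  · simp only [ht, polarPert, ha, and_self]

def dU (P : PerturbedSystem) (x : ℝ) : ℝ :=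
  x ^ (2 * P.h - 1) + ∑ i ∈ Finset.Icc 1 (2 * P.h - 1), P.u i * (i * x ^ (i - 1))

lemma hasDerivAt_U (P : PerturbedSystem) (hh : 2 ≤ P.h) (x : ℝ) : HasDerivAt P.U (P.dU x) x := by
  have h1 : HasDerivAt (fun x : ℝ => x ^ (2 * P.h) / (2 * P.h)) (x ^ (2 * P.h - 1)) x := by
    refine ((hasDerivAt_pow (2 * P.h) x).div_const _).congr_deriv ?_; push_cast
    field_simp
  exact h1.add (HasDerivAt.fun_sum fun i _ => (hasDerivAt_pow i x).const_mul (P.u i))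

lemma contDiff_dU (P : PerturbedSystem) : Smooth P.dU := by unfold dU; fun_prop

lemma deriv_U (P : PerturbedSystem) (hh : 2 ≤ P.h) : deriv P.U = P.dU :=
  funext fun x => (P.hasDerivAt_U hh x).deriv

lemma mul_dU (P : PerturbedSystem) (hh : 2 ≤ P.h) (x : ℝ) :
    x * P.dU x = x ^ (2 * P.h) + ∑ i ∈ Finset.Icc 1 (2 * P.h - 1), i * P.u i * x ^ i := by
  rw [dU, mul_add, ← pow_succ', Nat.sub_add_cancel (by omega), mul_sum]; congr 1
  refine sum_congr rfl fun i hi => ?_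
  have : x ^ i = x * x ^ (i - 1) := by rw [← pow_succ', Nat.sub_add_cancel (Finset.mem_Icc.1 hi).1]
  rw [this]; ring

lemma pow_mul_polarPert (P : PerturbedSystem) (X₀ : ℝ → ℝ) (m : ℕ → ℝ) (a : ℝ) {w : ℝ}
    (hw : w ≠ 0) : (w ^ (2 * P.h))⁻¹ * P.polarPert X₀ m (a, w)
      = ∑ i ∈ Finset.Icc 1 (2 * P.h - 1), m i * P.u i * (X₀ a / w) ^ i := by
  rw [polarPert, mul_sum]
  refine sum_congr rfl fun i hi => ?_
  have hi := Finset.mem_Icc.1 hi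
  have : w ^ (2 * P.h) = w ^ i * w ^ (2 * P.h - i) := by rw [← pow_add]; congr 1; omega
  rw [this, div_pow]; field_simp

namespace PolarChart

variable {P : PerturbedSystem} {X₀ Y₀ : ℝ → ℝ} {g B W : ℝ² → ℝ} {w₀ : ℝ}

lemma W_congr (hc : P.PolarChart X₀ g B W w₀) {a a' : ℝ} (h : X₀ a = X₀ a') (z : ℝ) :
    W (a, z) = W (a', z) := by
  have h1 := hc.W_right a z
  have h2 := hc.W_left a' (W (a, z))
  rw [← (hc.congr_of_eq a a' (W (a, z)) h).1, h1] at h2; exact h2.symm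

lemma g_pos (hc : P.PolarChart X₀ g B W w₀) (p : ℝ²) : 0 < g p := by linarith [(hc.g_mem p).1]

lemma B_pos (hc : P.PolarChart X₀ g B W w₀) (p : ℝ²) : 0 < B p := by linarith [(hc.B_mem p).1]

lemma W_pos (hc : P.PolarChart X₀ g B W w₀) {z : ℝ} (hz : 0 < z) (a : ℝ) : 0 < W (a, z) := by
  have h1 := hc.W_right a z
  exact pos_of_mul_pos_left (h1 ▸ hz) (hc.g_pos _).le

lemma W_le (hc : P.PolarChart X₀ g B W w₀) {z : ℝ} (hz : 0 < z) (hz' : z ≤ w₀ / 2) (a : ℝ) :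
    W (a, z) ≤ w₀ := by
  have h1 := hc.W_right a z
  have h2 := (hc.g_mem (a, W (a, z))).1
  nlinarith [hc.W_pos hz a, hc.w_pos]

lemma energy (hc : P.PolarChart X₀ g B W w₀) (hXY : P.IsLimitOscillation X₀ Y₀)
    {w : ℝ} (hw : 0 < w) (hw' : w ≤ w₀) (a : ℝ) :
    P.H (X₀ a / w) (Y₀ a / w ^ P.h) = ((w * g (a, w)) ^ (2 * P.h))⁻¹ := by
  have h1 := hc.g_eq a w (by rwa [abs_of_pos hw])
  have h2 := hXY.energy_eq a
  have h3 := P.pow_mul_polarPert X₀ (fun _ => 1) a hw.ne'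
  simp only [one_mul] at h3
  have h4 : (g (a, w) ^ (2 * P.h))⁻¹ = 1 + P.polarPert X₀ (fun _ => 1) (a, w) :=
    inv_eq_of_mul_eq_one_right h1
  rw [H, U, ← h3, mul_pow, mul_inv, h4, mul_add, mul_one]
  have e1 : (Y₀ a / w ^ P.h) ^ 2 = Y₀ a ^ 2 * (w ^ (2 * P.h))⁻¹ := by
    rw [div_pow, ← pow_mul, mul_comm P.h 2]; rfl
  have e2 : (X₀ a / w) ^ (2 * P.h) = X₀ a ^ (2 * P.h) * (w ^ (2 * P.h))⁻¹ := by rw [div_pow]; rfl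
  rw [e1, e2]
  linear_combination (w ^ (2 * P.h))⁻¹ * h2

lemma energy_level (hc : P.PolarChart X₀ g B W w₀) (hXY : P.IsLimitOscillation X₀ Y₀)
    {z : ℝ} (hz : 0 < z) (hz' : z ≤ w₀ / 2) (a : ℝ) :
    P.H (X₀ a / W (a, z)) (Y₀ a / W (a, z) ^ P.h) = (z ^ (2 * P.h))⁻¹ := by
  rw [hc.energy hXY (hc.W_pos hz a) (hc.W_le hz hz' a), hc.W_right]

lemma hasDerivAt_level (hc : P.PolarChart X₀ g B W w₀) (hXY : P.IsLimitOscillation X₀ Y₀)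
    (hh : 2 ≤ P.h) {z : ℝ} (hz : 0 < z) (hz' : z ≤ w₀ / 2) (a : ℝ) :
    HasDerivAt (fun a => X₀ a / W (a, z)) (Y₀ a / W (a, z) ^ P.h *
      (P.kappa / (2 * π) * W (a, z) ^ (P.h - 1) / B (a, W (a, z)))) a ∧
    HasDerivAt (fun a => Y₀ a / W (a, z) ^ P.h) (-P.dU (X₀ a / W (a, z)) *
      (P.kappa / (2 * π) * W (a, z) ^ (P.h - 1) / B (a, W (a, z)))) a := by
  have hWd : HasDerivAt (fun a => W (a, z)) (𝒟 W (a, z) (1, 0)) a :=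
    hasDerivAt_fst₂ (hc.W_smooth.diff) a z
  set w := W (a, z) with hw
  set k := P.kappa / (2 * π) with hk
  set w' := 𝒟 W (a, z) (1, 0)
  clear_value w' k
  have hw0 : 0 < w := hc.W_pos hz a
  have hBe := hc.B_eq a w (by rw [abs_of_pos hw0]; exact hc.W_le hz hz' a)
  have hB := hc.B_pos (a, w)
  have hx := (hXY.deriv_X a).div hWd hw0.ne'
  have hy := (hXY.deriv_Y a).div (hWd.pow P.h) (pow_ne_zero _ hw0.ne')
  simp only [Pi.div_def, Pi.pow_apply] at hx hy
  rw [← hw, ← hk] at hx hy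
  set x := X₀ a / w with hxd
  set y := Y₀ a / w ^ P.h with hyd
  set x' := (k * Y₀ a * w - X₀ a * w') / w ^ 2 with hx'
  set y' := (-(k * X₀ a ^ (2 * P.h - 1)) * w ^ P.h - Y₀ a * (P.h * w ^ (P.h - 1) * w'))
    / (w ^ P.h) ^ 2 with hy'
  have hE : y * y' + P.dU x * x' = 0 := by
    have h1 : HasDerivAt (fun a => P.H (X₀ a / W (a, z)) (Y₀ a / W (a, z) ^ P.h))
        (y * y' + P.dU x * x') a := by
      have h2 := ((hy.pow 2).div_const 2).add ((P.hasDerivAt_U hh x).comp a hx)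
      refine h2.congr_deriv ?_; simp only [hyd, hw]; ring
    have h3 : (fun a => P.H (X₀ a / W (a, z)) (Y₀ a / W (a, z) ^ P.h))
        = fun _ => (z ^ (2 * P.h))⁻¹ := funext fun a => hc.energy_level hXY hz hz' a
    rw [h3] at h1
    exact h1.unique (hasDerivAt_const _ _)
  obtain ⟨n, hn⟩ : ∃ n, P.h = n + 1 := ⟨P.h - 1, by omega⟩
  have hJ : P.h * y * x' - x * y' = k * (2 * P.h) / w ^ (P.h + 1) := by
    have h2 := hXY.energy_eq a
    have h0 : (P.h : ℝ) ≠ 0 := by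
      have : 0 < P.h := by omega
      positivity
    have h3 : X₀ a * X₀ a ^ (2 * P.h - 1) = 2 * P.h - P.h * Y₀ a ^ 2 := by
      rw [← pow_succ', Nat.sub_add_cancel (by omega)]
      field_simp at h2
      linear_combination h2
    have h4 : w ^ (P.h - 1) = w ^ P.h / w := by rw [hn]; simp [pow_succ]; field_simp
    rw [hxd, hyd, hx', hy', h4, pow_succ]; field_simp
    linear_combination k * w ^ 2 * w ^ P.h * h3
  have hQ : P.h * y ^ 2 + x * P.dU x = 2 * P.h * B (a, w) / w ^ (2 * P.h) := by
    have h2 := hXY.energy_eq a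
    have h0 : (P.h : ℝ) ≠ 0 := by
      have : 0 < P.h := by omega
      positivity
    have h3 := P.pow_mul_polarPert X₀ (fun i => i / (2 * P.h)) a hw0.ne'
    have h5 : ∑ i ∈ Finset.Icc 1 (2 * P.h - 1), i * P.u i * x ^ i
        = 2 * P.h * ((w ^ (2 * P.h))⁻¹ * P.polarPert X₀ (fun i => i / (2 * P.h)) (a, w)) := by
      rw [h3, mul_sum]
      refine sum_congr rfl fun i _ => ?_; field_simp; rw [hxd]
    rw [P.mul_dU hh, h5, hBe, hxd, hyd, div_pow, div_pow, ← pow_mul, mul_comm P.h 2]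
    have hwp : w ^ (2 * P.h) ≠ 0 := pow_ne_zero _ hw0.ne'; field_simp
    field_simp at h2
    linear_combination h2
  have hQ0 : P.h * y ^ 2 + x * P.dU x ≠ 0 := by
    rw [hQ]
    have : 0 < P.h := by omega
    positivity
  have hR : k * w ^ (P.h - 1) / B (a, w) = (P.h * y * x' - x * y') / (P.h * y ^ 2 + x * P.dU x) := by
    have h0 : (P.h : ℝ) ≠ 0 := by
      have : 0 < P.h := by omega
      positivity
    rw [hJ, hQ, div_div_eq_mul_div, div_mul_eq_mul_div, div_div]
    have h6 : w ^ (2 * P.h) = w ^ (P.h - 1) * w ^ (P.h + 1) := by rw [← pow_add]; congr 1; omega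
    rw [h6]; field_simp
  clear_value x y x' y'
  constructor
  · refine hx.congr_deriv ?_
    rw [hR, eq_comm, mul_div_assoc', div_eq_iff hQ0]
    linear_combination (-x) * hE
  · refine hy.congr_deriv ?_
    rw [hR, eq_comm, mul_div_assoc', div_eq_iff hQ0]
    linear_combination (-(P.h * y)) * hE

end PolarChart
/-- Action-angle variables near infinity in terms of `z = E ^ (-1 / (2h))`: on the level `E` one has
`x = X₀ (ang (φ, z)) * gg (φ, z) / z`, `y = Y₀ (ang (φ, z)) * (gg (φ, z) / z) ^ h`, and the frequency
is `om z / z ^ (h - 1)`. -/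
structure ActionAngle (P : PerturbedSystem) (X₀ Y₀ : ℝ → ℝ) (ang gg : ℝ² → ℝ) (om : ℝ → ℝ)
    (z₀ : ℝ) : Prop where
  z_pos : 0 < z₀
  ang_smooth : Smooth ang
  gg_smooth : Smooth gg
  om_smooth : Smooth om
  om_pos : ∀ z, 0 < om z
  ang_zero : ∀ φ, ang (φ, 0) = φ
  gg_zero : ∀ φ, gg (φ, 0) = 1
  om_zero : om 0 = 2 * π / P.kappa
  ang_periodic : ∀ φ z, ang (φ + 2 * π, z) = ang (φ, z) + 2 * π
  gg_periodic : ∀ φ z, gg (φ + 2 * π, z) = gg (φ, z)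
  energy : ∀ z ∈ Ioc 0 z₀, ∀ φ, P.H (X₀ (ang (φ, z)) * gg (φ, z) / z)
    (Y₀ (ang (φ, z)) * gg (φ, z) ^ P.h / z ^ P.h) = (z ^ (2 * P.h))⁻¹
  deriv_X : ∀ z ∈ Ioc 0 z₀, ∀ φ, HasDerivAt (fun φ => X₀ (ang (φ, z)) * gg (φ, z) / z)
    (Y₀ (ang (φ, z)) * gg (φ, z) ^ P.h / z ^ P.h * (z ^ (P.h - 1) / om z)) φ
  deriv_Y : ∀ z ∈ Ioc 0 z₀, ∀ φ, HasDerivAt (fun φ => Y₀ (ang (φ, z)) * gg (φ, z) ^ P.h / z ^ P.h)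
    (-P.dU (X₀ (ang (φ, z)) * gg (φ, z) / z) * (z ^ (P.h - 1) / om z)) φ
  omega_eq : ∀ z ∈ Ioc 0 z₀, P.omega (z ^ (2 * P.h))⁻¹ = om z / z ^ (P.h - 1)
  X_eq : ∀ z ∈ Ioc 0 z₀, ∀ φ, P.X φ (z ^ (2 * P.h))⁻¹ = X₀ (ang (φ, z)) * gg (φ, z) / z
  Y_eq : ∀ z ∈ Ioc 0 z₀, ∀ φ, P.Y φ (z ^ (2 * P.h))⁻¹ = Y₀ (ang (φ, z)) * gg (φ, z) ^ P.h / z ^ P.h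

namespace PolarChart

variable {P : PerturbedSystem} {X₀ Y₀ : ℝ → ℝ} {g B W : ℝ² → ℝ} {w₀ : ℝ}

lemma eq_W_of_energy (hc : P.PolarChart X₀ g B W w₀) (hXY : P.IsLimitOscillation X₀ Y₀)
    (hh : 2 ≤ P.h) {w z : ℝ} (hw : 0 < w) (hw' : w ≤ w₀) (hz : 0 < z) (a : ℝ)
    (h : P.H (X₀ a / w) (Y₀ a / w ^ P.h) = (z ^ (2 * P.h))⁻¹) : w = W (a, z) := by
  rw [hc.energy hXY hw hw', inv_inj, pow_left_inj₀ (mul_pos hw (hc.g_pos _)).le hz.le (by omega)] at h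
  rw [← h, hc.W_left]

lemma xPlus_eq (hc : P.PolarChart X₀ g B W w₀) (hXY : P.IsLimitOscillation X₀ Y₀)
    (hh : 2 ≤ P.h) {z : ℝ} (hz : 0 < z) (hz' : z ≤ w₀ / 2) :
    P.xPlus (z ^ (2 * P.h))⁻¹ = X₀ 0 / W (0, z) := by
  have hW := hc.W_pos hz 0
  refine IsGreatest.csSup_eq ⟨?_, fun x hx => ?_⟩
  · have := hc.energy_level hXY hz hz' 0
    rw [hXY.Y_zero, H] at this; simpa using this
  · by_contra! hlt
    have hx0 : 0 < x := (div_pos hXY.X_pos hW).trans hlt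
    have hw : X₀ 0 / x < W (0, z) := by rw [div_lt_iff₀ hx0]; rw [div_lt_iff₀ hW] at hlt; linarith
    refine hw.ne (hc.eq_W_of_energy hXY hh (div_pos hXY.X_pos hx0)
      (hw.le.trans (hc.W_le hz hz' 0)) hz 0 ?_)
    rw [hXY.Y_zero, H, div_div_cancel₀ hXY.X_pos.ne']; simpa using! hx

lemma xMinus_eq (hc : P.PolarChart X₀ g B W w₀) (hXY : P.IsLimitOscillation X₀ Y₀)
    (hh : 2 ≤ P.h) {z : ℝ} (hz : 0 < z) (hz' : z ≤ w₀ / 2) :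
    P.xMinus (z ^ (2 * P.h))⁻¹ = X₀ π / W (π, z) := by
  have hW := hc.W_pos hz π
  obtain ⟨-, hY, hX⟩ := hXY.half_period hh
  have hXn : X₀ π < 0 := by linarith [hXY.X_pos]
  refine IsLeast.csInf_eq ⟨?_, fun x hx => ?_⟩
  · have := hc.energy_level hXY hz hz' π; rw [hY, H] at this; simpa using this
  · by_contra! hlt
    have hx0 : x < 0 := hlt.trans (div_neg_of_neg_of_pos hXn hW)
    have hw : X₀ π / x < W (π, z) := by
      rw [div_lt_iff_of_neg hx0]; rw [lt_div_iff₀ hW] at hlt; linarith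
    refine hw.ne (hc.eq_W_of_energy hXY hh (div_pos_of_neg_of_neg hXn hx0)
      (hw.le.trans (hc.W_le hz hz' _)) hz π ?_)
    rw [hY, H, div_div_cancel₀ hXn.ne]; simpa using! hx

/-- The time element along a level as a function of the polar angle. -/
def speed (P : PerturbedSystem) (g B W : ℝ² → ℝ) (p : ℝ²) : ℝ :=
  P.kappa / (2 * π) / (g (p.1, W p) ^ (P.h - 1) * B (p.1, W p))

lemma speed_eq (hc : P.PolarChart X₀ g B W w₀) {z : ℝ} (hz : 0 < z) (a : ℝ) :
    P.kappa / (2 * π) * W (a, z) ^ (P.h - 1) / B (a, W (a, z))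
      = z ^ (P.h - 1) * speed P g B W (a, z) := by
  have hW := hc.W_pos hz a
  have hg := hc.g_pos (a, W (a, z))
  have hB := hc.B_pos (a, W (a, z))
  have h1 := hc.W_right a z; rw [speed]
  conv_rhs => rw [← h1, mul_pow]
  simp only; rw [h1]; field_simp

lemma contDiff_speed (hc : P.PolarChart X₀ g B W w₀) : Smooth (speed P g B W) := by
  unfold speed
  have h1 : Smooth fun p : ℝ² => ((p.1, W p) : ℝ²) := contDiff_fst.prodMk hc.W_smooth
  refine contDiff_const.div (((hc.g_smooth.comp h1).pow _).mul (hc.B_smooth.comp h1)) fun p => ?_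
  exact (mul_pos (pow_pos (hc.g_pos _) _) (hc.B_pos _)).ne'

lemma speed_bounds (hc : P.PolarChart X₀ g B W w₀) (hh : 2 ≤ P.h) :
    ∃ m M, 0 < m ∧ m ≤ M ∧ ∀ p, m ≤ speed P g B W p ∧ speed P g B W p ≤ M := by
  have hκ := P.kappa_pos hh
  have hpr := pi_pos
  have hk : 0 < P.kappa / (2 * π) := by positivity
  have key : ∀ p, P.kappa / (2 * π) / (2 ^ (P.h - 1) * (3 / 2)) ≤ speed P g B W p ∧
      speed P g B W p ≤ P.kappa / (2 * π) / ((2 / 3) ^ (P.h - 1) * (1 / 2)) := by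
    intro p
    have hg := hc.g_mem (p.1, W p)
    have hB := hc.B_mem (p.1, W p)
    have hg0 := hc.g_pos (p.1, W p)
    have hB0 := hc.B_pos (p.1, W p)
    constructor
    · refine div_le_div_of_nonneg_left hk.le (by positivity) ?_
      exact mul_le_mul (pow_le_pow_left₀ hg0.le hg.2 _) hB.2 hB0.le (by positivity)
    · refine div_le_div_of_nonneg_left hk.le (by positivity) ?_
      exact mul_le_mul (pow_le_pow_left₀ (by norm_num) hg.1 _) hB.1 (by norm_num) (by positivity)
  exact ⟨_, _, by positivity, (key 0).1.trans (key 0).2, key⟩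

lemma speed_congr (hc : P.PolarChart X₀ g B W w₀) {a a' : ℝ} (h : X₀ a = X₀ a') (z : ℝ) :
    speed P g B W (a, z) = speed P g B W (a', z) := by
  simp only [speed, hc.W_congr h, (hc.congr_of_eq a a' _ h).1, (hc.congr_of_eq a a' _ h).2]

lemma W_zero (hc : P.PolarChart X₀ g B W w₀) (a : ℝ) : W (a, 0) = 0 :=
  (mul_eq_zero.1 (hc.W_right a 0)).resolve_right (hc.g_pos _).ne'

lemma speed_zero (hc : P.PolarChart X₀ g B W w₀) (a : ℝ) :
    speed P g B W (a, 0) = P.kappa / (2 * π) := by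
  simp [speed, hc.W_zero, hc.g_zero, hc.B_zero]

/-- The normalized angle. -/
lemma exists_angle (hc : P.PolarChart X₀ g B W w₀) (hXY : P.IsLimitOscillation X₀ Y₀)
    (hh : 2 ≤ P.h) : ∃ ang : ℝ² → ℝ, Smooth ang ∧
      Smooth (fun z => 2 * π / ∫ a in (0 : ℝ)..2 * π, speed P g B W (a, z)) ∧
      (∀ z, 0 < 2 * π / ∫ a in (0 : ℝ)..2 * π, speed P g B W (a, z)) ∧
      (∀ φ, ang (φ, 0) = φ) ∧ (∀ z, ang (0, z) = 0) ∧
      (∀ φ z, ang (φ + 2 * π, z) = ang (φ, z) + 2 * π) ∧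
      ∀ φ z, HasDerivAt (fun φ => ang (φ, z)) (((2 * π /
        ∫ a in (0 : ℝ)..2 * π, speed P g B W (a, z)) * speed P g B W (ang (φ, z), z))⁻¹) φ := by
  have hpr := pi_pos
  have hκ := P.kappa_pos hh
  set Kt := speed P g B W with hKt
  have hKs : Smooth Kt := hc.contDiff_speed
  obtain ⟨m, M, hm, hmM, hb⟩ := hc.speed_bounds hh
  set Tt : ℝ → ℝ := fun z => ∫ a in (0 : ℝ)..2 * π, Kt (a, z) with hTt
  have hcont : ∀ z, Continuous fun a => Kt (a, z) := fun z => hKs.continuous.comp (by fun_prop)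
  have hTs : Smooth Tt := by
    have : Smooth fun p : ℝ² => Kt (p.2, p.1) := hKs.comp (by fun_prop)
    exact this.intervalIntegral_param two_pi_pos.le
  have hTb : ∀ z, m * (2 * π) ≤ Tt z ∧ Tt z ≤ M * (2 * π) := by
    intro z
    constructor
    · have h1 := integral_mono_on (μ := MeasureTheory.volume) (f := fun _ => m)
        (g := fun a => Kt (a, z)) two_pi_pos.le (continuous_const.intervalIntegrable _ _)
        ((hcont z).intervalIntegrable _ _) (fun a _ => (hb (a, z)).1)
      rw [integral_const, smul_eq_mul, sub_zero] at h1; linarith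
    · have h1 := integral_mono_on (μ := MeasureTheory.volume) (g := fun _ => M)
        (f := fun a => Kt (a, z)) two_pi_pos.le ((hcont z).intervalIntegrable _ _)
        (continuous_const.intervalIntegrable _ _) (fun a _ => (hb (a, z)).2)
      rw [integral_const, smul_eq_mul, sub_zero] at h1; linarith
  have hM : 0 < M := hm.trans_le hmM
  have hT0 : ∀ z, 0 < Tt z := fun z => (by positivity : 0 < m * (2 * π)).trans_le (hTb z).1
  set om : ℝ → ℝ := fun z => 2 * π / Tt z with hom
  have homs : Smooth om := contDiff_const.div hTs fun z => (hT0 z).ne'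
  have hom0 : ∀ z, 0 < om z := fun z => div_pos two_pi_pos (hT0 z)
  have homM : ∀ z, M⁻¹ ≤ om z := fun z => by
    rw [hom]; simp only
    rw [inv_eq_one_div, div_le_div_iff₀ hM (hT0 z)]; linarith [(hTb z).2]
  set F : ℝ² → ℝ := fun p => om p.1 * (p.2 * ∫ s in (0 : ℝ)..1, Kt (s * p.2, p.1)) with hF
  have hFs : Smooth F := by
    have h1 : Smooth fun q : ℝ² × ℝ => Kt (q.2 * q.1.2, q.1.1) := hKs.comp (by fun_prop)
    exact (homs.comp contDiff_fst).mul (contDiff_snd.mul (h1.intervalIntegral_param zero_le_one))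
  have hFd : ∀ z a, HasDerivAt (fun a => F (z, a)) (om z * Kt (a, z)) a := fun z a =>
    (hasDerivAt_mul_integral_comp_mul (hcont z) a).const_mul (om z)
  obtain ⟨V, hV, hVr, hVl⟩ := hFs.exists_fibre_inverse (F' := fun p => om p.1 * Kt (p.2, p.1))
    (m := M⁻¹ * m) (by positivity) hFd (fun z a => mul_le_mul (homM z) (hb _).1 hm.le (hom0 z).le)
  have hFint : ∀ z a, F (z, a) = om z * ∫ s in (0 : ℝ)..a, Kt (s, z) := fun z a => by
    simp only [hF]
    rw [mul_integral_comp_mul_right (f := fun s => Kt (s, z))]; simp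
  have hKper : ∀ z, Function.Periodic (fun a => Kt (a, z)) (2 * π) := fun z a =>
    hc.speed_congr (hXY.periodic_X a) z
  refine ⟨fun p => V (p.2, p.1), hV.comp (by fun_prop), homs, hom0, fun φ => ?_, fun z => ?_,
    fun φ z => ?_, fun φ z => ?_⟩
  · have h1 := hVl 0 φ
    have h2 : F (0, φ) = φ := by
      simp only [hF, hom, hTt, hKt, hc.speed_zero, integral_const, smul_eq_mul]
      field_simp; simp
    rwa [h2] at h1
  · have h1 := hVl z 0
    have h2 : F (z, 0) = 0 := by simp [hF]
    rwa [h2] at h1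
  · have h1 : F (z, V (z, φ) + 2 * π) = φ + 2 * π := by
      have h2 := hVr z φ; rw [hFint] at h2 ⊢
      rw [← integral_add_adjacent_intervals
        ((hcont z).intervalIntegrable 0 (V (z, φ))) ((hcont z).intervalIntegrable _ _),
        mul_add, h2, (hKper z).intervalIntegral_add_eq (V (z, φ)) 0, zero_add]
      have := (hT0 z).ne'; simp only [hom]
      rw [div_mul_cancel₀ _ this]
    have h3 := hVl z (V (z, φ) + 2 * π)
    rwa [h1] at h3
  · have h1 : HasDerivAt (fun φ => V (z, φ)) (𝒟 V (z, φ) (0, 1)) φ :=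
      hasDerivAt_snd₂ (hV.diff) z φ
    have h2 := (hFd z (V (z, φ))).comp φ h1
    have h3 : (fun a => F (z, a)) ∘ (fun φ => V (z, φ)) = id := funext fun φ => hVr z φ
    rw [h3] at h2
    have h4 := h2.unique (hasDerivAt_id φ)
    exact h1.congr_deriv (eq_inv_of_mul_eq_one_right h4)

end PolarChart
namespace PolarChart

variable {P : PerturbedSystem} {X₀ Y₀ : ℝ → ℝ} {g B W : ℝ² → ℝ} {w₀ : ℝ}

lemma omega_eq (hc : P.PolarChart X₀ g B W w₀) (hXY : P.IsLimitOscillation X₀ Y₀)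
    (hh : 2 ≤ P.h) {z : ℝ} (hz : 0 < z) (hz' : z ≤ w₀ / 2) : P.omega (z ^ (2 * P.h))⁻¹
      = 2 * π / (∫ a in (0 : ℝ)..2 * π, speed P g B W (a, z)) / z ^ (P.h - 1) := by
  have hpr := pi_pos
  have hcont : Continuous fun a => speed P g B W (a, z) :=
    hc.contDiff_speed.continuous.comp (by fun_prop)
  have hWc : Continuous fun a => W (a, z) := hc.W_smooth.continuous.comp (by fun_prop)
  obtain ⟨m, M, hm, -, hb⟩ := hc.speed_bounds hh
  have hint := integral_sqrt_two_div_sqrt_eq (x := fun a => X₀ a / W (a, z))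
    (y := fun a => Y₀ a / W (a, z) ^ P.h) (k := fun a => z ^ (P.h - 1) * speed P g B W (a, z))
    (G := fun ξ => (z ^ (2 * P.h))⁻¹ - P.U ξ) hpr.le
    (hXY.contDiff.1.continuous.div hWc fun a => (hc.W_pos hz a).ne').continuousOn (fun a _ => by
      rw [← hc.speed_eq hz]
      exact (hc.hasDerivAt_level hXY hh hz hz' a).1)
    (fun a ha => div_neg_of_neg_of_pos ((hXY.half_period hh).1 a ha) (pow_pos (hc.W_pos hz a) _))
    (fun a _ => mul_pos (pow_pos hz _) (hm.trans_le (hb _).1)) (fun a _ => by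
      rw [← hc.energy_level hXY hz hz' a, H]; ring)
  have hsym : ∫ a in (0 : ℝ)..2 * π, speed P g B W (a, z)
      = 2 * ∫ a in (0 : ℝ)..π, speed P g B W (a, z) := by
    rw [← integral_add_adjacent_intervals
      (hcont.intervalIntegrable 0 π) (hcont.intervalIntegrable _ _)]
    have h1 := integral_comp_sub_left (a := 0) (b := π)
      (fun a => speed P g B W (a, z)) (2 * π)
    rw [sub_zero, show 2 * π - π = π by ring] at h1
    have h2 : ∫ a in (0 : ℝ)..π, speed P g B W (2 * π - a, z)
        = ∫ a in (0 : ℝ)..π, speed P g B W (a, z) := by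
      refine integral_congr fun a _ => hc.speed_congr ?_ z
      rw [← (hXY.symm a).1, ← hXY.periodic_X (-a)]; congr 1; ring
    rw [← h1, h2]; ring
  rw [omega, T, hc.xPlus_eq hXY hh hz hz', hc.xMinus_eq hXY hh hz hz', hint,
    integral_const_mul, hsym, div_div]
  congr 1; ring

lemma exists_actionAngle (hc : P.PolarChart X₀ g B W w₀) (hXY : P.IsLimitOscillation X₀ Y₀)
    (hh : 2 ≤ P.h) : ∃ ang gg om, P.ActionAngle X₀ Y₀ ang gg om (w₀ / 2) := by
  obtain ⟨ang, hang, homs, hom0, hang0, hang0', hangp, hangd⟩ := hc.exists_angle hXY hh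
  set om : ℝ → ℝ := fun z => 2 * π / ∫ a in (0 : ℝ)..2 * π, speed P g B W (a, z)
    with hom
  set gg : ℝ² → ℝ := fun p => g (ang p, W (ang p, p.2)) with hgg
  have hW1 : Smooth fun p : ℝ² => W (ang p, p.2) := hc.W_smooth.comp (hang.prodMk contDiff_snd)
  have hggs : Smooth gg := hc.g_smooth.comp (hang.prodMk hW1)
  have hx : ∀ z, 0 < z → ∀ φ, X₀ (ang (φ, z)) * gg (φ, z) / z
      = X₀ (ang (φ, z)) / W (ang (φ, z), z) := fun z hz φ => by
    have h1 := hc.W_right (ang (φ, z)) z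
    have h2 := hc.W_pos hz (ang (φ, z))
    rw [div_eq_div_iff hz.ne' h2.ne']
    linear_combination X₀ (ang (φ, z)) * h1
  have hy : ∀ z, 0 < z → ∀ φ, Y₀ (ang (φ, z)) * gg (φ, z) ^ P.h / z ^ P.h
      = Y₀ (ang (φ, z)) / W (ang (φ, z), z) ^ P.h := fun z hz φ => by
    have h1 := congrArg (· ^ P.h) (hc.W_right (ang (φ, z)) z)
    have h2 := hc.W_pos hz (ang (φ, z))
    simp only [mul_pow] at h1
    rw [div_eq_div_iff (by positivity) (by positivity)]
    linear_combination Y₀ (ang (φ, z)) * h1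
  have hdX : ∀ z ∈ Ioc 0 (w₀ / 2), ∀ φ, HasDerivAt (fun φ => X₀ (ang (φ, z)) * gg (φ, z) / z)
      (Y₀ (ang (φ, z)) * gg (φ, z) ^ P.h / z ^ P.h * (z ^ (P.h - 1) / om z)) φ ∧
      HasDerivAt (fun φ => Y₀ (ang (φ, z)) * gg (φ, z) ^ P.h / z ^ P.h)
      (-P.dU (X₀ (ang (φ, z)) * gg (φ, z) / z) * (z ^ (P.h - 1) / om z)) φ := by
    intro z hz φ
    obtain ⟨h1, h2⟩ := hc.hasDerivAt_level hXY hh hz.1 hz.2 (ang (φ, z))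
    have h3 := hangd φ z
    rw [hc.speed_eq hz.1] at h1 h2
    have hs : speed P g B W (ang (φ, z), z) ≠ 0 := by
      obtain ⟨m, M, hm, -, hb⟩ := hc.speed_bounds hh
      exact (hm.trans_le (hb _).1).ne'
    have ho := (hom0 z).ne'
    constructor
    · rw [funext (hx z hz.1), hy z hz.1]
      refine (h1.comp φ h3).congr_deriv ?_; simp only [hom]; field_simp
    · rw [funext (hy z hz.1), hx z hz.1]
      refine (h2.comp φ h3).congr_deriv ?_; simp only [hom]; field_simp
  have hom_eq : ∀ z ∈ Ioc 0 (w₀ / 2), P.omega (z ^ (2 * P.h))⁻¹ = om z / z ^ (P.h - 1) :=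
    fun z hz => hc.omega_eq hXY hh hz.1 hz.2
  have horb : ∀ z ∈ Ioc 0 (w₀ / 2), P.orbit (z ^ (2 * P.h))⁻¹ = fun t =>
      (X₀ (ang (om z / z ^ (P.h - 1) * t, z)) * gg (om z / z ^ (P.h - 1) * t, z) / z,
        Y₀ (ang (om z / z ^ (P.h - 1) * t, z)) * gg (om z / z ^ (P.h - 1) * t, z) ^ P.h
          / z ^ P.h) := by
    intro z hz
    set o := om z / z ^ (P.h - 1) with ho
    have ho0 : o * (z ^ (P.h - 1) / om z) = 1 := by
      have := (hom0 z).ne'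
      have := pow_pos hz.1 (P.h - 1)
      rw [ho, div_mul_div_comm, mul_comm, div_self]
      exact mul_ne_zero this.ne' (hom0 z).ne'
    set γ : ℝ → ℝ² := fun t => (X₀ (ang (o * t, z)) * gg (o * t, z) / z,
        Y₀ (ang (o * t, z)) * gg (o * t, z) ^ P.h / z ^ P.h) with hγ
    have hγ0 : γ 0 = (P.xPlus (z ^ (2 * P.h))⁻¹, 0) := by
      rw [hc.xPlus_eq hXY hh hz.1 hz.2]
      have := hx z hz.1 0; rw [hang0'] at this
      simp only [hγ, mul_zero, hang0', this, hXY.Y_zero, zero_mul, zero_div]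
    have hγd : ∀ t, HasDerivAt γ ((γ t).2, -deriv P.U (γ t).1) t := by
      intro t
      have hl : HasDerivAt (fun t => o * t) o t := by simpa using (hasDerivAt_id t).const_mul o
      have h1 := (hdX z hz (o * t)).1.comp t hl
      have h2 := (hdX z hz (o * t)).2.comp t hl; rw [P.deriv_U hh]
      refine HasDerivAt.prodMk (h1.congr_deriv ?_) (h2.congr_deriv ?_)
      · rw [mul_assoc, mul_comm _ o, ho0, mul_one]
      · rw [mul_assoc, mul_comm _ o, ho0, mul_one]
    have hspec := Classical.epsilon_spec (p := fun γ : ℝ → ℝ² =>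
      γ 0 = (P.xPlus (z ^ (2 * P.h))⁻¹, 0) ∧
      ∀ t, HasDerivAt γ ((γ t).2, -deriv P.U (γ t).1) t) ⟨γ, hγ0, hγd⟩
    have hv : ContDiff ℝ 1 fun p : ℝ² => ((p.2, -deriv P.U p.1) : ℝ²) := by
      rw [P.deriv_U hh]
      exact contDiff_snd.prodMk ((P.contDiff_dU.of_le (by simp)).comp contDiff_fst).neg
    exact hv.ode_unique (t₀ := 0) hspec.2 hγd (hspec.1.trans hγ0.symm)
  have hcancel : ∀ z ∈ Ioc 0 (w₀ / 2), ∀ φ, om z / z ^ (P.h - 1) * (φ / P.omega (z ^ (2 * P.h))⁻¹)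
      = φ := fun z hz φ => by
    have := (hom0 z)
    have := pow_pos hz.1 (P.h - 1)
    rw [hom_eq z hz, mul_div_cancel₀]
    exact (div_pos (hom0 z) this).ne'
  refine ⟨ang, gg, om, by linarith [hc.w_pos], hang, hggs, homs, hom0, hang0,
    fun φ => ?_, ?_, hangp, fun φ z => ?_, fun z hz φ => ?_, fun z hz φ => (hdX z hz φ).1,
    fun z hz φ => (hdX z hz φ).2, hom_eq, fun z hz φ => ?_, fun z hz φ => ?_⟩
  · simp only [hgg, hc.W_zero, hc.g_zero]
  · have := pi_pos
    simp only [hom, hc.speed_zero, integral_const, smul_eq_mul]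
    field_simp; simp
  · have hXp : X₀ (ang (φ + 2 * π, z)) = X₀ (ang (φ, z)) := by
      rw [hangp]; exact hXY.periodic_X _
    simp only [hgg, hc.W_congr hXp]
    exact (hc.congr_of_eq _ _ _ hXp).1
  · rw [hx z hz.1, hy z hz.1]
    exact hc.energy_level hXY hz.1 hz.2 _
  · rw [X, horb z hz]
    simp only [hcancel z hz]
  · rw [Y, horb z hz]
    simp only [hcancel z hz]

end PolarChart

lemma IsLimitOscillation.exists_actionAngle {P : PerturbedSystem} {X₀ Y₀ : ℝ → ℝ}
    (hXY : P.IsLimitOscillation X₀ Y₀) (hh : 2 ≤ P.h) :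
    ∃ ang gg om z₀, P.ActionAngle X₀ Y₀ ang gg om z₀ := by
  obtain ⟨g, B, W, w₀, hc⟩ := P.exists_polarChart hh hXY.contDiff.1 hXY.periodic_X
  obtain ⟨ang, gg, om, h⟩ := hc.exists_actionAngle hXY hh
  exact ⟨ang, gg, om, _, h⟩

/-- Action-angle variables together with the resonant value `z = s * Zu s` of the action variable
for the frequency `s ^ (-(h-1))`, and a truncation `tr` of the identity. -/
structure ResonantChart (P : PerturbedSystem) (X₀ Y₀ : ℝ → ℝ) where
  ang : ℝ² → ℝ
  gg : ℝ² → ℝ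
  om : ℝ → ℝ
  Zu : ℝ → ℝ
  tr : ℝ → ℝ
  z₀ : ℝ
  s₀ : ℝ
  w₁ : ℝ
  aa : P.ActionAngle X₀ Y₀ ang gg om z₀
  s_pos : 0 < s₀
  w_pos : 0 < w₁
  Zu_smooth : Smooth Zu
  tr_smooth : Smooth tr
  Zu_pos : ∀ s, 0 < Zu s
  Zu_zero : Zu 0 ^ (P.h - 1) = om 0
  Z_le : ∀ s ∈ Ioc 0 s₀, s * Zu s ≤ z₀ / 2
  Z_eq : ∀ s ∈ Ioc 0 s₀, om (s * Zu s) / (s * Zu s) ^ (P.h - 1) = (s ^ (P.h - 1))⁻¹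
  Z_unique : ∀ s ∈ Ioc 0 s₀, ∀ z ∈ Ioc 0 (s * Zu s),
    om z / z ^ (P.h - 1) = (s ^ (P.h - 1))⁻¹ → z = s * Zu s
  tr_le : ∀ w, |tr w| ≤ 1 / 2
  tr_eq : ∀ w, |w| ≤ w₁ → tr w = w

lemma ActionAngle.exists_resonantChart {P : PerturbedSystem} {X₀ Y₀ : ℝ → ℝ}
    {ang gg : ℝ² → ℝ} {om : ℝ → ℝ} {z₀ : ℝ} (hA : P.ActionAngle X₀ Y₀ ang gg om z₀)
    (hh : 2 ≤ P.h) : Nonempty (P.ResonantChart X₀ Y₀) := by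
  obtain ⟨ψ, C, hC0, hψ, hψ1, hψC, hψC'⟩ := exists_smooth_truncation
  have hloc : ∀ w₀, 0 < w₀ → ∀ w, |w| ≤ w₀ → w₀ * ψ (w / w₀) = w := fun w₀ hw₀ w hw => by
    rw [hψ1 _ (by rw [abs_div, abs_of_pos hw₀]; exact (div_le_one hw₀).2 hw)]
    field_simp
  set e : ℝ := 1 / (P.h - 1 : ℕ) with he
  have hh1 : ((P.h - 1 : ℕ) : ℝ) ≠ 0 := Nat.cast_ne_zero.2 (by omega)
  set q : ℝ² → ℝ := fun p => (om p.2 / om 0) ^ (-e) - 1 with hq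
  have hdiv : ∀ z, 0 < om z / om 0 := fun z => div_pos (hA.om_pos z) (hA.om_pos 0)
  have hqs : Smooth q :=
    (((hA.om_smooth.comp contDiff_snd).div_const _).rpow_const_of_ne fun p => (hdiv p.2).ne').sub
      contDiff_const
  obtain ⟨w₁, hw₁, hb⟩ := hqs.exists_truncation_bound one_pos (fun w a => rfl)
    (fun a => by simp [hq, (hA.om_pos 0).ne']) hψ hψC hψC' (δ := 1 / 4) (by norm_num)
  replace hb := hb w₁ hw₁ le_rfl
  set Q : ℝ² → ℝ := fun p => q (p.1, w₁ * ψ (p.2 / w₁)) with hQ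
  have hQs : Smooth Q := hqs.comp (by fun_prop)
  choose d hd hdb using fun a w => (hb a w).2
  obtain ⟨W, hW, hWr, hWl⟩ := (contDiff_snd.mul (contDiff_const.add hQs) : Smooth
    fun p : ℝ² => p.2 * (1 + Q p)).exists_fibre_inverse
    (F' := fun p => (1 + Q p) + p.2 * d p.1 p.2) (m := 1 / 2) (by norm_num) (fun a w => by
      have := (hasDerivAt_id w).mul ((hd a w).const_add 1)
      simpa using! this)
    (fun a w => by
      have h1 := abs_le.1 (hb a w).1
      have h2 := abs_le.1 (hdb a w); simp only [hQ]
      linarith [h1.1, h2.1])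
  have hQb : ∀ w, 3 / 4 ≤ 1 + Q (0, w) := fun w => by
    have h1 := abs_le.1 (hb 0 w).1; simp only [hQ]; linarith [h1.1]
  set o : ℝ := om 0 ^ e with ho
  have ho0 : 0 < o := rpow_pos_of_pos (hA.om_pos 0) _
  have hoh : o ^ (P.h - 1) = om 0 := by
    rw [ho, he, one_div]
    exact rpow_inv_natCast_pow (hA.om_pos 0).le (by omega)
  have hiff : ∀ z s, 0 < z → z ≤ w₁ → 0 < s →
      (om z / z ^ (P.h - 1) = (s ^ (P.h - 1))⁻¹ ↔ z * (1 + Q (0, z)) = s * o) := by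
    intro z s hz hzw hs
    have hQz : 0 < 1 + Q (0, z) := by linarith [hQb z]
    have h1 : (1 + Q (0, z)) ^ (P.h - 1) = om 0 / om z := by
      have h2 : 1 + Q (0, z) = (om z / om 0) ^ (-e) := by
        simp only [hQ, hq, hloc w₁ hw₁ z (by rwa [abs_of_pos hz])]; ring
      rw [h2, ← rpow_natCast, ← rpow_mul (hdiv z).le,
        show -e * ((P.h - 1 : ℕ) : ℝ) = -1 by rw [he]; field_simp, rpow_neg_one, inv_div]
    rw [← pow_left_inj₀ (mul_pos hz hQz).le (mul_pos hs ho0).le (show P.h - 1 ≠ 0 by omega),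
      mul_pow, mul_pow, h1, hoh]
    have := hA.om_pos z
    have := hA.om_pos 0; field_simp; exact eq_comm
  have hWpos : ∀ s, 0 < s → 0 < W (0, s) := fun s hs => by
    have h1 := hWr 0 s
    exact pos_of_mul_pos_left (h1 ▸ hs) (by linarith [hQb (W (0, s))])
  have hWle : ∀ s, 0 < s → W (0, s) ≤ 2 * s := fun s hs => by
    have h1 := hWr 0 s; simp only at h1
    nlinarith [hQb (W (0, s)), hWpos s hs]
  set Zu : ℝ → ℝ := fun s => o / (1 + Q (0, W (0, s * o))) with hZu
  have hZW : ∀ s, s * Zu s = W (0, s * o) := fun s => by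
    have h1 := hWr 0 (s * o)
    have h2 : 1 + Q (0, W (0, s * o)) ≠ 0 := by linarith [hQb (W (0, s * o))]
    simp only at h1; simp only [hZu]
    rw [mul_div_assoc', div_eq_iff h2, h1]
  set m := min w₁ (z₀ / 2)
  have hm0 : 0 < m := lt_min hw₁ (half_pos hA.z_pos)
  have hsm : ∀ s ∈ Ioc 0 (m / (2 * o)), s * Zu s ≤ m := fun s hs => by
    rw [hZW]
    refine (hWle _ (mul_pos hs.1 ho0)).trans ?_
    have := (le_div_iff₀ (by positivity)).1 hs.2; linarith
  have hZ0 : ∀ s ∈ Ioc 0 (m / (2 * o)), 0 < s * Zu s := fun s hs => by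
    rw [hZW]; exact hWpos _ (mul_pos hs.1 ho0)
  refine ⟨⟨ang, gg, om, Zu, fun w => 1 / (2 * C) * ψ (w / (1 / (2 * C))), z₀, m / (2 * o),
    1 / (2 * C), hA, by positivity, by positivity, ?_, ?_, fun s => ?_, ?_, fun s hs => ?_,
    fun s hs => ?_, fun s hs z hz h => ?_, fun w => ?_, fun w hw => ?_⟩⟩
  · refine contDiff_const.div (contDiff_const.add (hQs.comp (contDiff_const.prodMk
      (hW.comp (contDiff_const.prodMk (contDiff_id.mul contDiff_const)))))) fun s => ?_
    have := hQb (W (0, s * o))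
    intro h
    have h' : 1 + Q (0, W (0, s * o)) = 0 := h; linarith
  · exact contDiff_const.mul (hψ.comp (contDiff_id.div_const _))
  · have := hQb (W (0, s * o))
    exact div_pos ho0 (by linarith)
  · have h1 : W (0, 0) = 0 := by have := hWl 0 0; simpa using this
    have h2 : Q (0, 0) = 0 := by
      have := (hloc w₁ hw₁ 0 (by simpa using hw₁.le))
      simp only [hQ, this, hq]
      simp [(hA.om_pos 0).ne']
    simp only [hZu, zero_mul, h1, h2, add_zero, div_one, hoh]
  · exact (hsm s hs).trans (min_le_right _ _)
  · rw [hiff _ _ (hZ0 s hs) ((hsm s hs).trans (min_le_left _ _)) hs.1, hZW]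
    exact hWr 0 (s * o)
  · rw [hiff _ _ hz.1 (hz.2.trans ((hsm s hs).trans (min_le_left _ _))) hs.1] at h
    rw [hZW, ← h]; exact (hWl 0 z).symm
  · rw [abs_mul, abs_of_pos (by positivity : (0 : ℝ) < 1 / (2 * C))]
    calc _ ≤ 1 / (2 * C) * C := mul_le_mul_of_nonneg_left (hψC _) (by positivity)
      _ = 1 / 2 := by field_simp
  · exact hloc _ (by positivity) w hw

/-- The scale of the resonant action variable: `I_* ^ (-1/(2h)) = s * Zu s` for
`s = scale * t ^ (-b/((h-1)q))`. -/
def scale (P : PerturbedSystem) (ϰ : ℕ) : ℝ := ((ϰ : ℝ) / P.vartheta) ^ (1 / ((P.h - 1 : ℕ) : ℝ))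

lemma vartheta_pos (P : PerturbedSystem) (hP : P.IsAdmissible) : 0 < P.vartheta := by
  have := hP.s_pos
  unfold vartheta; positivity

lemma scale_pos (P : PerturbedSystem) (hP : P.IsAdmissible) {ϰ : ℕ} (hϰ : 1 ≤ ϰ) :
    0 < P.scale ϰ := by
  have h1 := P.vartheta_pos hP
  exact rpow_pos_of_pos (by positivity) _

lemma scale_pow (P : PerturbedSystem) (hP : P.IsAdmissible) (ϰ : ℕ) :
    P.scale ϰ ^ (P.h - 1) = ϰ / P.vartheta := by
  have h1 := P.vartheta_pos hP
  have := hP.two_le_h; rw [scale, one_div]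
  exact rpow_inv_natCast_pow (by positivity) (by omega)

lemma exponent_eq (P : PerturbedSystem) (hP : P.IsAdmissible) (hσ : P.SigmaCondition) {i j : ℕ}
    (hij : i + j ≤ P.p) : (j < P.l → 2 * P.M + 2 * P.b * (P.p - (i + j) + (P.h - 1) * (P.l - 1 - j))
        + 2 * P.b * (i + P.h * j) = 2 * (P.a + P.b) * (P.h - 1) + 2 * P.b) ∧
      (j ≤ P.l → 2 * P.M + 2 * P.b * (P.p - (i + j) + (P.h - 1) * (P.l - j))
        + 2 * P.b * (i + P.h * j) = 2 * (P.a + P.b) * (P.h - 1) + 2 * P.b * P.h) := by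
  have hM : (P.M : ℤ) = ((P.h : ℤ) - 1) * (P.a + P.b)
      - P.b * (((P.l : ℤ) - 1) * ((P.h : ℤ) - 1) + ((P.p : ℤ) - 1)) := by
    refine Int.toNat_of_nonneg (le_of_lt ?_)
    by_contra! h
    have h1 := (P.M_cast hP hσ).2
    rw [M, Int.toNat_of_nonpos h] at h1; omega
  have hh := hP.two_le_h
  refine ⟨fun hj => ?_, fun hj => ?_⟩
  · zify [hij, show j ≤ P.l - 1 by omega, show 1 ≤ P.l by omega, show 1 ≤ P.h by omega]
    rw [hM]; ring
  · zify [hij, hj, show 1 ≤ P.h by omega]; rw [hM]; ring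

namespace ResonantChart

variable {P : PerturbedSystem} {X₀ Y₀ : ℝ → ℝ} (C : P.ResonantChart X₀ Y₀) (ϰ : ℕ)

lemma exists_kap : ∃ κ₁ : ℝ² → ℝ, Smooth κ₁ ∧ κ₁ (0, 0) = ((P.h - 1 : ℕ) : ℝ) * C.om 0 ∧ ∀ w z,
      (1 + C.tr w) ^ (P.h - 1) * C.om (z / (1 + C.tr w)) - C.om z = w * κ₁ (w, z) := by
  have hρ : ∀ w, 1 + C.tr w ≠ 0 := fun w => by have := (abs_le.1 (C.tr_le w)).1; linarith
  have h0 : C.tr 0 = 0 := C.tr_eq 0 (by simpa using C.w_pos.le)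
  have htr := C.tr_smooth
  have hom := C.aa.om_smooth
  set f : ℝ² → ℝ := fun p => (1 + C.tr p.1) ^ (P.h - 1) * C.om (p.2 / (1 + C.tr p.1)) - C.om p.2
    with hf
  have hfs : Smooth f := by
    have h1 : Smooth fun p : ℝ² => p.2 / (1 + C.tr p.1) :=
      contDiff_snd.div (contDiff_const.add (htr.comp contDiff_fst)) fun p => hρ p.1
    exact (((contDiff_const.add (htr.comp contDiff_fst)).pow _).mul (hom.comp h1)).sub
      (hom.comp contDiff_snd)
  obtain ⟨g, hg, hg0, hfg⟩ := hfs.exists_eq_add_smul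
  have hf0 : ∀ z, f (0, z) = 0 := fun z => by simp [hf, h0]
  refine ⟨g, hg, ?_, fun w z => ?_⟩
  · rw [hg0]
    have h1 := hasDerivAt_fst₂ (hfs.diff) 0 0
    have h2 : HasDerivAt C.tr 1 0 := by
      refine (hasDerivAt_id (0 : ℝ)).congr_of_eventuallyEq ?_
      filter_upwards [Metric.closedBall_mem_nhds (0 : ℝ) C.w_pos] with w hw
      exact C.tr_eq w (by simpa using hw)
    have h3 : HasDerivAt (fun w => f (w, 0))
        (((P.h - 1 : ℕ) : ℝ) * (1 + C.tr 0) ^ (P.h - 1 - 1) * 1 * C.om 0) 0 := by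
      have := (((h2.const_add 1).pow (P.h - 1)).mul_const (C.om 0)).sub_const (C.om 0)
      simpa [hf] using! this
    rw [h1.unique h3, h0]; simp
  · have := hfg w z
    rw [hf0, zero_add, smul_eq_mul] at this; exact this

/-- The resonant action variable is `e ^ (2 b) * vs e`, where `e = t ^ (-1/(2 q (h-1)))`. -/
def vs (e : ℝ) : ℝ := P.scale ϰ * C.Zu (P.scale ϰ * e ^ (2 * P.b))

/-- The factor `1 + t ^ (-μ) r`. -/
def rho (e r : ℝ) : ℝ := 1 + C.tr (e ^ P.M * r)

/-- The action variable `z = e ^ (2 b) * v e r`. -/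
def v (e r : ℝ) : ℝ := C.vs ϰ e / C.rho e r

def zz (e r : ℝ) : ℝ := e ^ (2 * P.b) * C.v ϰ e r

def Xs (p : ℝ²) : ℝ := X₀ (C.ang p) * C.gg p

def Ys (p : ℝ²) : ℝ := Y₀ (C.ang p) * C.gg p ^ P.h

def Us (p : ℝ²) : ℝ := C.Xs p ^ (2 * P.h - 1) + ∑ i ∈ Finset.Icc 1 (2 * P.h - 1),
    P.u i * (i * C.Xs p ^ (i - 1)) * p.2 ^ (2 * P.h - i)

/-- The weights of `f` and `g` in the equation for the action. -/
def wF : (ℝ² → ℝ) × (ℝ² → ℝ) := (C.Us, C.Ys)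

/-- The weights of `f` and `g` in the equation for the angle. -/
def wG : (ℝ² → ℝ) × (ℝ² → ℝ) :=
  (fun p => C.om p.2 * (P.h * C.Ys p - p.2 * 𝒟 C.Ys p (0, 1)) / (2 * P.h),
    fun p => -(C.om p.2 * (C.Xs p - p.2 * 𝒟 C.Xs p (0, 1)) / (2 * P.h)))

/-- A term of the forcing, with `x = (e, r, θ)`. -/
def forcingTerm (α : ℝ² → ℝ) (E i j n : ℕ) (x : ℝ³) (ζ : ℝ) : ℝ :=
  x.1 ^ (2 * P.b * E) * ((C.v ϰ x.1 x.2.1)⁻¹ ^ (i + P.h * j) * C.v ϰ x.1 x.2.1 ^ n *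
    (C.Xs (x.2.2 + ζ / ϰ, C.zz ϰ x.1 x.2.1) ^ i * C.Ys (x.2.2 + ζ / ϰ, C.zz ϰ x.1 x.2.1) ^ j *
      α (x.2.2 + ζ / ϰ, C.zz ϰ x.1 x.2.1)))

/-- The coefficients of the scaled forcing with the weights `w`. -/
def forcingCoef (k : ℕ) (w : (ℝ² → ℝ) × (ℝ² → ℝ)) (x : ℝ³) (ζ : ℝ) : ℝ :=
  (∑ i ∈ range (P.p + 1), ∑ j ∈ range P.l, P.A k i j ζ *
      C.forcingTerm ϰ w.1 (P.p - (i + j) + (P.h - 1) * (P.l - 1 - j)) i j 1 x ζ)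
    + ∑ i ∈ range (P.p + 1), ∑ j ∈ range (P.l + 1), P.B k i j ζ *
      C.forcingTerm ϰ w.2 (P.p - (i + j) + (P.h - 1) * (P.l - j)) i j P.h x ζ

/-- The first `m` terms of the scaled forcing with the weights `w`. -/
def forcing (m : ℕ) (w : (ℝ² → ℝ) × (ℝ² → ℝ)) (x : ℝ³) (ζ : ℝ) : ℝ :=
  ∑ k ∈ range m, x.1 ^ (2 * (P.h - 1) * k) * C.forcingCoef ϰ k w x ζ

lemma rho_mem (e r : ℝ) : C.rho e r ∈ Icc (1 / 2 : ℝ) (3 / 2) := by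
  have := abs_le.1 (C.tr_le (e ^ P.M * r))
  constructor <;> simp only [rho] <;> linarith [this.1, this.2]

lemma rho_pos (e r : ℝ) : 0 < C.rho e r := by linarith [(C.rho_mem e r).1]

section

variable (hP : P.IsAdmissible) (hXY : P.IsLimitOscillation X₀ Y₀) {ϰ} (hϰ : 1 ≤ ϰ)

include hP hϰ in
lemma vs_pos (e : ℝ) : 0 < C.vs ϰ e := mul_pos (P.scale_pos hP hϰ) (C.Zu_pos _)

include hP hϰ in
lemma v_pos (e r : ℝ) : 0 < C.v ϰ e r := div_pos (C.vs_pos hP hϰ e) (C.rho_pos e r)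

lemma contDiff_vs : Smooth (C.vs ϰ) := by have := C.Zu_smooth; unfold vs; fun_prop

lemma contDiff_rho : Smooth fun p : ℝ² => C.rho p.1 p.2 := by
  have := C.tr_smooth
  unfold rho; fun_prop

lemma contDiff_v : Smooth fun p : ℝ² => C.v ϰ p.1 p.2 :=
  (C.contDiff_vs.comp contDiff_fst).div C.contDiff_rho fun p => (C.rho_pos p.1 p.2).ne'

lemma contDiff_zz : Smooth fun p : ℝ² => C.zz ϰ p.1 p.2 := (contDiff_fst.pow _).mul C.contDiff_v

include hXY

lemma contDiff_Xs : Smooth C.Xs := (hXY.contDiff.1.comp C.aa.ang_smooth).mul C.aa.gg_smooth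

lemma contDiff_Ys : Smooth C.Ys := (hXY.contDiff.2.comp C.aa.ang_smooth).mul (C.aa.gg_smooth.pow _)

lemma Xs_periodic (φ z : ℝ) : C.Xs (φ + 2 * π, z) = C.Xs (φ, z) := by
  simp only [Xs, C.aa.ang_periodic, C.aa.gg_periodic]; rw [hXY.periodic_X]

lemma Ys_periodic (φ z : ℝ) : C.Ys (φ + 2 * π, z) = C.Ys (φ, z) := by
  simp only [Ys, C.aa.ang_periodic, C.aa.gg_periodic]; rw [hXY.periodic_Y]

def _root_.PeriodicWeight (α : ℝ² → ℝ) : Prop := Smooth α ∧ ∀ φ z, α (φ + 2 * π, z) = α (φ, z)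

omit hXY in
lemma _root_.PeriodicWeight.fderiv {α : ℝ² → ℝ} (h : PeriodicWeight α) :
    PeriodicWeight fun p => 𝒟 α p (0, 1) := by
  refine ⟨(h.1.fderiv_right (by simp)).clm_apply contDiff_const, fun φ z => ?_⟩
  have h1 := hasDerivAt_snd₂ (h.1.diff) (φ + 2 * π) z
  simp only [h.2] at h1
  exact h1.unique (hasDerivAt_snd₂ (h.1.diff) φ z)

lemma periodicWeight_wF : PeriodicWeight C.wF.1 ∧ PeriodicWeight C.wF.2 := by
  have h1 := C.contDiff_Xs hXY
  refine ⟨⟨?_, fun φ z => ?_⟩, C.contDiff_Ys hXY, C.Ys_periodic hXY⟩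
  · show Smooth C.Us
    unfold Us; fun_prop
  · simp only [wF, Us, C.Xs_periodic hXY]

lemma periodicWeight_wG : PeriodicWeight C.wG.1 ∧ PeriodicWeight C.wG.2 := by
  have hX : PeriodicWeight C.Xs := ⟨C.contDiff_Xs hXY, C.Xs_periodic hXY⟩
  have hY : PeriodicWeight C.Ys := ⟨C.contDiff_Ys hXY, C.Ys_periodic hXY⟩
  have h1 := hX.1
  have h2 := hY.1
  have h5 := C.aa.om_smooth
  refine ⟨⟨?_, fun φ z => ?_⟩, ⟨?_, fun φ z => ?_⟩⟩
  · simp only [wG]; fun_prop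
  · have := hY.fderiv.2 φ z
    simp only [wG, hY.2, this]
  · simp only [wG]; fun_prop
  · have := hX.fderiv.2 φ z
    simp only [wG, hX.2, this]

include hP hϰ

lemma paramSmooth_forcingTerm {α : ℝ² → ℝ} (hα : PeriodicWeight α) (E i j n : ℕ) :
    ParamSmooth (2 * π * ϰ) (C.forcingTerm ϰ α E i j n) := by
  have hv := C.contDiff_v (ϰ := ϰ)
  have hz := C.contDiff_zz (ϰ := ϰ)
  have hX := C.contDiff_Xs hXY
  have hY := C.contDiff_Ys hXY
  have hϰ0 : (ϰ : ℝ) ≠ 0 := by positivity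
  have hp : Smooth fun q : ℝ³ × ℝ => ((q.1.2.2 + q.2 / ϰ, C.zz ϰ q.1.1 q.1.2.1) : ℝ²) :=
    (by fun_prop : Smooth fun q : ℝ³ × ℝ => q.1.2.2 + q.2 / ϰ).prodMk
      (hz.comp (by fun_prop : Smooth fun q : ℝ³ × ℝ => (q.1.1, q.1.2.1)))
  have hv' : Smooth fun q : ℝ³ × ℝ => C.v ϰ q.1.1 q.1.2.1 :=
    hv.comp (by fun_prop : Smooth fun q : ℝ³ × ℝ => (q.1.1, q.1.2.1))
  refine ParamSmooth.of_contDiff (f := fun q => C.forcingTerm ϰ α E i j n q.1 q.2) ?_ fun x ζ => ?_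
  · refine ContDiff.mul (by fun_prop) ((((hv'.inv fun q => (C.v_pos hP hϰ _ _).ne').pow _).mul
      (hv'.pow _)).mul ((((hX.comp hp).pow _).mul ((hY.comp hp).pow _)).mul (hα.1.comp hp)))
  · have e : x.2.2 + (ζ + 2 * π * ϰ) / ϰ = x.2.2 + ζ / ϰ + 2 * π := by field_simp; ring
    simp only [forcingTerm, e, C.Xs_periodic hXY, C.Ys_periodic hXY, hα.2]

lemma paramSmooth_forcingCoef (hA : ∀ k, ∀ i < P.p + 1, ∀ j < P.l, Continuous (P.A k i j))
    (hB : ∀ k, ∀ i < P.p + 1, ∀ j < P.l + 1, Continuous (P.B k i j))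
    (hfg : P.HasPowerAsymptotics) {w : (ℝ² → ℝ) × (ℝ² → ℝ)} (h1 : PeriodicWeight w.1)
    (h2 : PeriodicWeight w.2) (k : ℕ) : ParamSmooth (2 * π * ϰ) (C.forcingCoef ϰ k w) := by
  have hper : ∀ c : ℝ → ℝ, Function.Periodic c (2 * π) →
      Function.Periodic c (2 * π * ϰ) := fun c hc => by
    have := hc.nat_mul ϰ
    rwa [mul_comm] at this
  refine (ParamSmooth.sum fun i hi => ParamSmooth.sum fun j hj => ?_).add
      (ParamSmooth.sum fun i hi => ParamSmooth.sum fun j hj => ?_)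
  · exact (ParamSmooth.of_periodic (hA k i (Finset.mem_range.1 hi) j (Finset.mem_range.1 hj))
      (hper _ (hfg.A_periodic k i j))).mul (C.paramSmooth_forcingTerm hP hXY hϰ h1 _ _ _ _)
  · exact (ParamSmooth.of_periodic (hB k i (Finset.mem_range.1 hi) j (Finset.mem_range.1 hj))
      (hper _ (hfg.B_periodic k i j))).mul (C.paramSmooth_forcingTerm hP hXY hϰ h2 _ _ _ _)

omit hXY in
lemma pow_mul_forcingTerm {e r θ ζ : ℝ} (he : 0 < e) (α : ℝ² → ℝ) {E i j n B : ℕ}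
    (hE : 2 * P.M + 2 * P.b * E + 2 * P.b * (i + P.h * j) = B + 2 * P.b * n) :
    e ^ (2 * P.M) * C.forcingTerm ϰ α E i j n (e, r, θ) ζ = e ^ B *
      ((C.Xs (θ + ζ / ϰ, C.zz ϰ e r) / C.zz ϰ e r) ^ i *
        (C.Ys (θ + ζ / ϰ, C.zz ϰ e r) / C.zz ϰ e r ^ P.h) ^ j *
        (C.zz ϰ e r ^ n * α (θ + ζ / ϰ, C.zz ϰ e r))) := by
  have hv := C.v_pos hP hϰ e r
  simp only [forcingTerm]
  set X := C.Xs (θ + ζ / ϰ, C.zz ϰ e r)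
  set Y := C.Ys (θ + ζ / ϰ, C.zz ϰ e r)
  set a := α (θ + ζ / ϰ, C.zz ϰ e r); rw [zz]
  set v := C.v ϰ e r
  have h1 : e ^ (2 * P.M) * e ^ (2 * P.b * E) * (e ^ (2 * P.b)) ^ (i + P.h * j)
      = e ^ B * (e ^ (2 * P.b)) ^ n := by
    rw [← pow_mul, ← pow_mul, ← pow_add, ← pow_add, hE, pow_add]
  set s := e ^ (2 * P.b)
  have hs0 : 0 < s := pow_pos he _
  have h2 : (X / (s * v)) ^ i * (Y / (s * v) ^ P.h) ^ j
      = X ^ i * Y ^ j * (v⁻¹) ^ (i + P.h * j) / s ^ (i + P.h * j) := by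
    rw [div_pow, div_pow, ← pow_mul, div_mul_div_comm, ← pow_add, mul_pow, inv_pow]
    field_simp
  rw [h2, mul_pow]
  have hsp : s ^ (i + P.h * j) ≠ 0 := (pow_pos hs0 _).ne'
  rw [div_mul_eq_mul_div, mul_div_assoc', eq_div_iff hsp]
  linear_combination (X ^ i * Y ^ j * v⁻¹ ^ (i + P.h * j) * v ^ n * a) * h1

omit hXY in
lemma pow_mul_forcing (hσ : P.SigmaCondition) (hfg : P.HasPowerAsymptotics) {e r θ ζ : ℝ}
    (he : 0 < e) (m : ℕ) (w : (ℝ² → ℝ) × (ℝ² → ℝ)) :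
    e ^ (2 * P.M) * C.forcing ϰ m w (e, r, θ) ζ = e ^ (2 * (P.a + P.b) * (P.h - 1)) *
      ((∑ k ∈ range m, e ^ (2 * (P.h - 1) * k) *
          P.fk k (C.Xs (θ + ζ / ϰ, C.zz ϰ e r) / C.zz ϰ e r)
            (C.Ys (θ + ζ / ϰ, C.zz ϰ e r) / C.zz ϰ e r ^ P.h) ζ) *
          (C.zz ϰ e r * w.1 (θ + ζ / ϰ, C.zz ϰ e r))
        + (∑ k ∈ range m, e ^ (2 * (P.h - 1) * k) *
          P.gk k (C.Xs (θ + ζ / ϰ, C.zz ϰ e r) / C.zz ϰ e r)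
            (C.Ys (θ + ζ / ϰ, C.zz ϰ e r) / C.zz ϰ e r ^ P.h) ζ) *
          (C.zz ϰ e r ^ P.h * w.2 (θ + ζ / ϰ, C.zz ϰ e r))) := by
  rw [forcing, mul_sum, sum_mul, sum_mul, ← sum_add_distrib,
    mul_sum]
  refine sum_congr rfl fun k _ => ?_
  have hf : e ^ (2 * P.M) * ∑ i ∈ range (P.p + 1), ∑ j ∈ range P.l, P.A k i j ζ *
        C.forcingTerm ϰ w.1 (P.p - (i + j) + (P.h - 1) * (P.l - 1 - j)) i j 1 (e, r, θ) ζ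
      = e ^ (2 * (P.a + P.b) * (P.h - 1)) * (P.fk k (C.Xs (θ + ζ / ϰ, C.zz ϰ e r) / C.zz ϰ e r)
            (C.Ys (θ + ζ / ϰ, C.zz ϰ e r) / C.zz ϰ e r ^ P.h) ζ *
          (C.zz ϰ e r * w.1 (θ + ζ / ϰ, C.zz ϰ e r))) := by
    simp only [fk, sum_mul, mul_sum]
    refine sum_congr rfl fun i _ => sum_congr rfl fun j hj => ?_
    by_cases hij : i + j ≤ P.p
    · have hE := (P.exponent_eq hP hσ hij).1 (Finset.mem_range.1 hj)
      have := C.pow_mul_forcingTerm hP hϰ he (r := r) (θ := θ) (ζ := ζ) w.1 (n := 1)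
        (hE.trans (by rw [mul_one]))
      rw [mul_left_comm, this, pow_one]; ring
    · rw [hfg.A_zero k i j (by omega)]; ring
  have hg : e ^ (2 * P.M) * ∑ i ∈ range (P.p + 1), ∑ j ∈ range (P.l + 1),
        P.B k i j ζ *
        C.forcingTerm ϰ w.2 (P.p - (i + j) + (P.h - 1) * (P.l - j)) i j P.h (e, r, θ) ζ
      = e ^ (2 * (P.a + P.b) * (P.h - 1)) * (P.gk k (C.Xs (θ + ζ / ϰ, C.zz ϰ e r) / C.zz ϰ e r)
            (C.Ys (θ + ζ / ϰ, C.zz ϰ e r) / C.zz ϰ e r ^ P.h) ζ *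
          (C.zz ϰ e r ^ P.h * w.2 (θ + ζ / ϰ, C.zz ϰ e r))) := by
    simp only [gk, sum_mul, mul_sum]
    refine sum_congr rfl fun i _ => sum_congr rfl fun j hj => ?_
    by_cases hij : i + j ≤ P.p
    · have := C.pow_mul_forcingTerm hP hϰ he (r := r) (θ := θ) (ζ := ζ) w.2 (n := P.h)
        ((P.exponent_eq hP hσ hij).2 (Nat.lt_succ_iff.1 (Finset.mem_range.1 hj)))
      rw [mul_left_comm, this]; ring
    · rw [hfg.B_zero k i j (by omega)]; ring
  simp only [forcingCoef]
  linear_combination e ^ (2 * (P.h - 1) * k) * (hf + hg)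

end

end ResonantChart

end PerturbedSystem

lemma inv_pow_rpow_eq_pow {e x : ℝ} (he : 0 < e) {n m : ℕ} (h : -(n * x) = m) :
    ((e ^ n)⁻¹) ^ x = e ^ m := by
  rw [← rpow_natCast e n, ← rpow_neg he.le, ← rpow_mul he.le, neg_mul, h,
    rpow_natCast]

lemma inv_pow_rpow_eq_inv_pow {e x : ℝ} (he : 0 < e) {n m : ℕ} (h : n * x = m) :
    ((e ^ n)⁻¹) ^ x = (e ^ m)⁻¹ := by
  rw [← rpow_natCast e n, ← rpow_neg he.le, ← rpow_mul he.le, neg_mul, h,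
    rpow_neg he.le, rpow_natCast]

namespace PerturbedSystem

variable {P : PerturbedSystem} {X₀ Y₀ : ℝ → ℝ}

def beta (P : PerturbedSystem) : ℝ := (P.b : ℝ) / (((P.h : ℝ) - 1) * P.q)

lemma q_pos (hP : P.IsAdmissible) : (0 : ℝ) < P.q := by
  have := le_trans hP.one_le_a hP.a_le_q; exact_mod_cast this

lemma h_sub_one_pos (hP : P.IsAdmissible) : (0 : ℝ) < (P.h : ℝ) - 1 := by
  have : (2 : ℝ) ≤ P.h := by exact_mod_cast hP.two_le_h
  linarith

lemma h_sub_one_cast (hP : P.IsAdmissible) : ((P.h - 1 : ℕ) : ℝ) = (P.h : ℝ) - 1 := by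
  have := hP.two_le_h
  rw [Nat.cast_sub (by omega), Nat.cast_one]

lemma hasDerivAt_S {t : ℝ} (ht : 0 < t) :
    HasDerivAt P.S (P.vartheta * t ^ ((P.b : ℝ) / P.q)) t := by
  refine ((hasDerivAt_rpow_const (p := 1 + (P.b : ℝ) / P.q) (Or.inl ht.ne')).const_mul
    P.s).congr_deriv ?_
  rw [vartheta, add_sub_cancel_left]; ring

namespace ResonantChart

variable (C : P.ResonantChart X₀ Y₀)

lemma resonance_eq (hP : P.IsAdmissible) {ϰ : ℕ} (hϰ : 1 ≤ ϰ) {t : ℝ} (ht : 0 < t) :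
    deriv P.S t / ϰ = ((P.scale ϰ * t ^ (-P.beta)) ^ (P.h - 1))⁻¹ := by
  have h1 := P.vartheta_pos hP
  have hq := q_pos hP
  have hh := h_sub_one_pos hP
  rw [(hasDerivAt_S ht).deriv, mul_pow, P.scale_pow hP, ← rpow_natCast,
    ← rpow_mul ht.le, h_sub_one_cast hP, beta]
  have e : -((P.b : ℝ) / (((P.h : ℝ) - 1) * P.q)) * ((P.h : ℝ) - 1) = -((P.b : ℝ) / P.q) := by
    field_simp
  rw [e, rpow_neg ht.le]
  have := rpow_pos_of_pos ht ((P.b : ℝ) / P.q); field_simp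

lemma Istar_eq (hP : P.IsAdmissible) {ϰ : ℕ} (hϰ : 1 ≤ ϰ) {t : ℝ} (ht : 0 < t)
    (hs : P.scale ϰ * t ^ (-P.beta) ≤ C.s₀) : P.Istar ϰ t =
      ((P.scale ϰ * t ^ (-P.beta) * C.Zu (P.scale ϰ * t ^ (-P.beta))) ^ (2 * P.h))⁻¹ := by
  have hh := hP.two_le_h
  set s := P.scale ϰ * t ^ (-P.beta)
  have hs0 : 0 < s := mul_pos (P.scale_pos hP hϰ) (rpow_pos_of_pos ht _)
  have hz := C.Z_eq s ⟨hs0, hs⟩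
  set z := s * C.Zu s
  have hz0 : 0 < z := mul_pos hs0 (C.Zu_pos s)
  have hzle : z ≤ C.z₀ / 2 := C.Z_le s ⟨hs0, hs⟩
  rw [Istar, resonance_eq hP hϰ ht]
  refine IsGreatest.csSup_eq ⟨?_, fun E hE => ?_⟩
  · show P.omega _ = _
    rw [C.aa.omega_eq z ⟨hz0, by linarith⟩, hz]
  · by_contra! hlt
    have hE0 : 0 < E := lt_trans (by positivity) hlt
    set z' := (E⁻¹) ^ (((2 * P.h : ℕ) : ℝ)⁻¹)
    have hz'0 : 0 < z' := rpow_pos_of_pos (by positivity) _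
    have hz'p : z' ^ (2 * P.h) = E⁻¹ := rpow_inv_natCast_pow (by positivity) (by omega)
    have hlt' : z' < z := by
      rw [← pow_lt_pow_iff_left₀ hz'0.le hz0.le (show 2 * P.h ≠ 0 by omega), hz'p]
      exact inv_lt_of_inv_lt₀ (by positivity) hlt
    have hE' : E = (z' ^ (2 * P.h))⁻¹ := by rw [hz'p, inv_inv]
    have h1 : P.omega E = (s ^ (P.h - 1))⁻¹ := hE
    rw [hE', C.aa.omega_eq z' ⟨hz'0, by linarith⟩] at h1
    exact hlt'.ne (C.Z_unique s ⟨hs0, hs⟩ z' ⟨hz'0, hlt'.le⟩ h1)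

def logDeriv (s : ℝ) : ℝ := (C.Zu s + s * deriv C.Zu s) / C.Zu s

lemma contDiff_logDeriv : Smooth C.logDeriv := by
  have h1 : Smooth (deriv C.Zu) := (contDiff_infty_iff_deriv.1 C.Zu_smooth).2
  exact (C.Zu_smooth.add (contDiff_id.mul h1)).div C.Zu_smooth fun s => (C.Zu_pos s).ne'

lemma hasDerivAt_resonantAction (ϰ : ℕ) {t : ℝ} (ht : 0 < t) : HasDerivAt
      (fun t : ℝ => P.scale ϰ * t ^ (-P.beta) * C.Zu (P.scale ϰ * t ^ (-P.beta)))
      (P.scale ϰ * t ^ (-P.beta) * C.Zu (P.scale ϰ * t ^ (-P.beta)) *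
        (-(P.beta / t) * C.logDeriv (P.scale ϰ * t ^ (-P.beta)))) t := by
  have h1 : HasDerivAt (fun t : ℝ => P.scale ϰ * t ^ (-P.beta))
      (-(P.beta / t) * (P.scale ϰ * t ^ (-P.beta))) t := by
    refine ((hasDerivAt_rpow_const (p := -P.beta) (Or.inl ht.ne')).const_mul _).congr_deriv ?_
    rw [rpow_sub_one ht.ne']; ring
  have h2 : HasDerivAt C.Zu (deriv C.Zu (P.scale ϰ * t ^ (-P.beta))) (P.scale ϰ * t ^ (-P.beta)) :=
    (C.Zu_smooth.diff _).hasDerivAt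
  refine (h1.mul (h2.comp t h1)).congr_deriv ?_
  have := (C.Zu_pos (P.scale ϰ * t ^ (-P.beta))).ne'
  simp only [logDeriv, Function.comp]; field_simp; ring

lemma deriv_Istar_div (hP : P.IsAdmissible) {ϰ : ℕ} (hϰ : 1 ≤ ϰ) {t : ℝ} (ht : 0 < t)
    (hs : P.scale ϰ * t ^ (-P.beta) < C.s₀) : deriv (P.Istar ϰ) t / P.Istar ϰ t =
      2 * P.h * (P.beta / t) * C.logDeriv (P.scale ϰ * t ^ (-P.beta)) := by
  have hh := hP.two_le_h
  set z := fun t : ℝ => P.scale ϰ * t ^ (-P.beta) * C.Zu (P.scale ϰ * t ^ (-P.beta))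
  have hzt : 0 < z t := mul_pos (mul_pos (P.scale_pos hP hϰ) (rpow_pos_of_pos ht _))
    (C.Zu_pos _)
  have h1 := C.hasDerivAt_resonantAction ϰ ht
  have h2 : P.Istar ϰ =ᶠ[𝓝 t] fun t => (z t ^ (2 * P.h))⁻¹ := by
    have hc : ContinuousAt (fun t : ℝ => P.scale ϰ * t ^ (-P.beta)) t :=
      continuousAt_const.mul (continuousAt_rpow_const _ _ (Or.inl ht.ne'))
    filter_upwards [hc.eventually (gt_mem_nhds hs), lt_mem_nhds ht] with t' h1 h2
    exact C.Istar_eq hP hϰ h2 h1.le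
  have h3 := ((h1.pow (2 * P.h)).inv (pow_ne_zero _ hzt.ne')).congr_of_eventuallyEq h2
  rw [h3.deriv, h2.eq_of_nhds]
  have e : z t ^ (2 * P.h) = z t * z t ^ (2 * P.h - 1) := by
    rw [← pow_succ', Nat.sub_add_cancel (by omega)]
  simp only [Pi.pow_apply]
  change -(((2 * P.h : ℕ) : ℝ) * z t ^ (2 * P.h - 1) * (z t * (-(P.beta / t) * _))) /
    (z t ^ (2 * P.h)) ^ 2 / (z t ^ (2 * P.h))⁻¹ = _
  rw [e]; push_cast; field_simp

lemma dU_eq (hh : 2 ≤ P.h) (φ : ℝ) {z : ℝ} (hz : 0 < z) :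
    P.dU (C.Xs (φ, z) / z) = C.Us (φ, z) / z ^ (2 * P.h - 1) := by
  rw [dU, Us, add_div, div_pow, sum_div]; congr 1
  refine sum_congr rfl fun i hi => ?_
  have hi := Finset.mem_Icc.1 hi
  have : z ^ (2 * P.h - 1) = z ^ (i - 1) * z ^ (2 * P.h - i) := by rw [← pow_add]; congr 1; omega
  rw [this, div_pow]; field_simp

lemma hasDerivAt_rpow_neg_inv_energy (hh : 2 ≤ P.h) {z : ℝ} (hz : 0 < z) :
    HasDerivAt (fun E : ℝ => E⁻¹ ^ (((2 * P.h : ℕ) : ℝ)⁻¹)) (-(z ^ (2 * P.h + 1) / (2 * P.h)))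
      (z ^ (2 * P.h))⁻¹ := by
  have hzp : 0 < z ^ (2 * P.h) := pow_pos hz _
  have h1 := (hasDerivAt_inv (inv_pos.2 hzp).ne').rpow_const (p := (((2 * P.h : ℕ) : ℝ)⁻¹))
    (Or.inl (inv_pos.2 (inv_pos.2 hzp)).ne')
  refine h1.congr_deriv ?_
  have e1 : (z ^ (2 * P.h)) ^ ((((2 * P.h : ℕ) : ℝ))⁻¹) = z :=
    pow_rpow_inv_natCast hz.le (by omega)
  rw [inv_inv, rpow_sub_one hzp.ne', e1, inv_pow, inv_inv]; push_cast; field_simp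
  ring

lemma deriv_energy (hP : P.IsAdmissible) (hXY : P.IsLimitOscillation X₀ Y₀) (φ : ℝ) {z : ℝ}
    (hz : 0 < z) (hz' : z < C.z₀) : deriv (fun E => P.X φ E) (z ^ (2 * P.h))⁻¹ = z ^ (2 * P.h - 1) *
      ((C.Xs (φ, z) - z * 𝒟 C.Xs (φ, z) (0, 1)) / (2 * P.h)) ∧
    deriv (fun E => P.Y φ E) (z ^ (2 * P.h))⁻¹ = z ^ P.h *
      ((P.h * C.Ys (φ, z) - z * 𝒟 C.Ys (φ, z) (0, 1)) / (2 * P.h)) := by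
  have hh := hP.two_le_h
  have hzp : 0 < z ^ (2 * P.h) := pow_pos hz _
  set ζ : ℝ → ℝ := fun E => E⁻¹ ^ (((2 * P.h : ℕ) : ℝ)⁻¹) with hζ
  have hd := hasDerivAt_rpow_neg_inv_energy hh hz
  have hζz : ζ (z ^ (2 * P.h))⁻¹ = z := by
    rw [hζ]; simp only [inv_inv]
    exact pow_rpow_inv_natCast hz.le (by omega)
  have hev : ∀ᶠ E in 𝓝 (z ^ (2 * P.h))⁻¹, ζ E ∈ Ioc 0 C.z₀ ∧ E = (ζ E ^ (2 * P.h))⁻¹ := by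
    have hc := hd.continuousAt.eventually (gt_mem_nhds (show ζ (z ^ (2 * P.h))⁻¹ < C.z₀ by
      rwa [hζz]))
    filter_upwards [hc, lt_mem_nhds (inv_pos.2 hzp)] with E h1 h2
    refine ⟨⟨rpow_pos_of_pos (inv_pos.2 h2) _, h1.le⟩, ?_⟩; rw [hζ]; simp only
    rw [rpow_inv_natCast_pow (inv_pos.2 h2).le (by omega), inv_inv]
  have hX := C.contDiff_Xs hXY
  have hY := C.contDiff_Ys hXY
  have hdX := hasDerivAt_snd₂ (hX.diff) φ z
  have hdY := hasDerivAt_snd₂ (hY.diff) φ z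
  constructor
  · have h1 : (fun E => P.X φ E) =ᶠ[𝓝 (z ^ (2 * P.h))⁻¹] fun E => C.Xs (φ, ζ E) / ζ E := by
      filter_upwards [hev] with E hE
      rw [hE.2, C.aa.X_eq _ hE.1, ← hE.2]; rfl
    have h2 : HasDerivAt (fun z => C.Xs (φ, z) / z)
        ((𝒟 C.Xs (φ, z) (0, 1) * z - C.Xs (φ, z) * 1) / z ^ 2) z :=
      hdX.div (hasDerivAt_id z) hz.ne'
    rw [← hζz] at h2
    have h3 := (h2.comp _ hd).congr_of_eventuallyEq h1; rw [h3.deriv, hζz]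
    have e : z ^ (2 * P.h + 1) = z ^ (2 * P.h - 1) * z ^ 2 := by rw [← pow_add]; congr 1; omega
    rw [e]; field_simp; ring
  · have h1 : (fun E => P.Y φ E) =ᶠ[𝓝 (z ^ (2 * P.h))⁻¹] fun E => C.Ys (φ, ζ E) / ζ E ^ P.h := by
      filter_upwards [hev] with E hE
      rw [hE.2, C.aa.Y_eq _ hE.1, ← hE.2]; rfl
    have h2 : HasDerivAt (fun z => C.Ys (φ, z) / z ^ P.h)
        ((𝒟 C.Ys (φ, z) (0, 1) * z ^ P.h - C.Ys (φ, z) * (P.h * z ^ (P.h - 1)))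
          / (z ^ P.h) ^ 2) z :=
      hdY.div (hasDerivAt_pow _ z) (pow_pos hz _).ne'
    rw [← hζz] at h2
    have h3 := (h2.comp _ hd).congr_of_eventuallyEq h1; rw [h3.deriv, hζz]
    have e : z ^ (2 * P.h + 1) = z ^ P.h * z ^ P.h * z := by
      rw [← pow_add, ← pow_succ]; congr 1; omega
    have e' : z ^ P.h = z ^ (P.h - 1) * z := by rw [← pow_succ]; congr 1; omega
    rw [e, e']; field_simp; ring

end ResonantChart

/-- The ratio of `t ^ (-1/(2q(h-1)))` and `τ ^ (-1/N)`. -/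
def ratio (P : PerturbedSystem) : ℝ := P.nu ^ (-(1 / (P.N : ℝ)))

lemma nu_pos (hP : P.IsAdmissible) : 0 < P.nu := by have := q_pos hP; rw [nu_eq]; positivity

lemma N_pos (hP : P.IsAdmissible) : 0 < P.N := by
  have := hP.two_le_h
  have := hP.one_le_b; rw [N]
  exact Nat.mul_pos (by omega) (by omega)

lemma ratio_pos (hP : P.IsAdmissible) : 0 < P.ratio := rpow_pos_of_pos (nu_pos hP) _

lemma ratio_pow (hP : P.IsAdmissible) : P.ratio ^ P.N = P.nu⁻¹ := by
  have := N_pos hP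
  rw [ratio, rpow_neg (nu_pos hP).le, inv_pow, one_div,
    rpow_inv_natCast_pow (nu_pos hP).le this.ne']

lemma time_inv_pow (hP : P.IsAdmissible) {ε : ℝ} (hε : 0 < ε) :
    P.time (ε ^ P.N)⁻¹ = ((P.ratio * ε) ^ (2 * P.q * (P.h - 1)))⁻¹ := by
  have hν := nu_pos hP
  have e1 : P.nu * (ε ^ P.N)⁻¹ = ((P.ratio * ε) ^ P.N)⁻¹ := by
    rw [mul_pow, ratio_pow hP, mul_inv, inv_inv]
  rw [time, e1]
  refine inv_pow_rpow_eq_inv_pow (mul_pos (ratio_pos hP) hε) ?_; rw [N_cast P hP]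
  push_cast [h_sub_one_cast hP]; field_simp

section powers

variable (hP : P.IsAdmissible) (hσ : P.SigmaCondition) {e : ℝ} (he : 0 < e)
include hP he

lemma inv_pow_rpow_neg_beta : ((e ^ (2 * P.q * (P.h - 1)))⁻¹) ^ (-P.beta) = e ^ (2 * P.b) := by
  have := q_pos hP
  have := h_sub_one_pos hP
  refine inv_pow_rpow_eq_pow he ?_
  rw [beta]; push_cast [h_sub_one_cast hP]; field_simp

lemma inv_pow_rpow_neg_div (k : ℕ) :
    ((e ^ (2 * P.q * (P.h - 1)))⁻¹) ^ (-((k : ℝ) / P.q)) = e ^ (2 * (P.h - 1) * k) := by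
  have := q_pos hP
  refine inv_pow_rpow_eq_pow he ?_
  push_cast [h_sub_one_cast hP]; field_simp

lemma inv_pow_rpow_one_sub_nu :
    ((e ^ (2 * P.q * (P.h - 1)))⁻¹) ^ (1 - P.nu) = e ^ (2 * (P.h - 1) * P.b) := by
  rw [← inv_pow_rpow_neg_div hP he, nu_eq]; congr 1; ring

include hσ

lemma inv_pow_rpow_neg_mu : ((e ^ (2 * P.q * (P.h - 1)))⁻¹) ^ (-P.mu) = e ^ P.M := by
  refine inv_pow_rpow_eq_pow he ?_
  rw [(M_cast P hP hσ).1]; push_cast [h_sub_one_cast hP]; ring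

lemma inv_pow_rpow_mu : ((e ^ (2 * P.q * (P.h - 1)))⁻¹) ^ P.mu = (e ^ P.M)⁻¹ := by
  refine inv_pow_rpow_eq_inv_pow he ?_
  rw [(M_cast P hP hσ).1]; push_cast [h_sub_one_cast hP]; ring

end powers

namespace ResonantChart

variable (C : P.ResonantChart X₀ Y₀) (ϰ : ℕ)

/-- The domain where the truncations are not active. -/
def Good (e r : ℝ) : Prop :=
  0 < e ∧ P.scale ϰ * e ^ (2 * P.b) < C.s₀ ∧ |e ^ P.M * r| ≤ C.w₁ ∧ |e ^ P.M * r| ≤ 1 / 4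

/-- The factor `κ₁` in the expansion of the frequency. -/
def kap : ℝ² → ℝ := C.exists_kap.choose

/-- The right-hand side of the equation for `r`, with the forcing `Φ`. -/
def fieldA (Φ e r : ℝ) : ℝ := C.rho e r / (2 * P.h) *
    (Φ - 2 * P.h * P.beta * e ^ (P.N - 2 * P.M) * C.logDeriv (P.scale ϰ * e ^ (2 * P.b)))
    + P.mu * r * e ^ (P.N - P.M)

/-- The right-hand side of the equation for `θ`, with the forcing `Φ`. -/
def fieldB (Φ e r : ℝ) : ℝ :=
  r * ((C.vs ϰ e ^ (P.h - 1))⁻¹ * C.kap (e ^ P.M * r, e ^ (2 * P.b) * C.vs ϰ e)) + e ^ P.M * Φ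

section

variable {C ϰ} {e r : ℝ} (hP : P.IsAdmissible) (hϰ : 1 ≤ ϰ) (hg : C.Good ϰ e r)
include hg

lemma Good.rho_eq : C.rho e r = 1 + e ^ P.M * r := by rw [rho, C.tr_eq _ hg.2.2.1]

include hP hϰ

lemma Good.zz_mem : C.zz ϰ e r ∈ Ioo 0 C.z₀ := by
  have h1 := C.vs_pos hP hϰ e
  have h2 := C.rho_pos e r
  have h0 := pow_pos hg.1 (2 * P.b)
  have hz := C.aa.z_pos
  refine ⟨mul_pos h0 (C.v_pos hP hϰ e r), ?_⟩
  have h3 := C.Z_le _ ⟨mul_pos (P.scale_pos hP hϰ) h0, hg.2.1.le⟩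
  have h4 : 3 / 4 ≤ C.rho e r := by rw [hg.rho_eq]; linarith [(abs_le.1 hg.2.2.2).1]
  have : e ^ (2 * P.b) * C.vs ϰ e ≤ C.z₀ / 2 := by rw [vs]; linarith
  rw [zz, v, ← mul_div_assoc, div_lt_iff₀ h2]; nlinarith

lemma Good.energy_eq (hσ : P.SigmaCondition) :
    P.energy ϰ r (e ^ (2 * P.q * (P.h - 1)))⁻¹ = (C.zz ϰ e r ^ (2 * P.h))⁻¹ := by
  have he := hg.1
  have h2 := C.rho_pos e r
  have h0 := inv_pow_rpow_neg_beta hP he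
  rw [energy, C.Istar_eq hP hϰ (by positivity) (by rw [h0]; exact hg.2.1.le), h0,
    inv_pow_rpow_neg_mu hP hσ he, ← hg.rho_eq, zz, v, vs, ← inv_pow, ← mul_pow, ← inv_pow]
  congr 1
  have := P.scale_pos hP hϰ
  have := C.Zu_pos (P.scale ϰ * e ^ (2 * P.b)); field_simp

lemma Good.XY_eq (φ : ℝ) :
    P.X φ (C.zz ϰ e r ^ (2 * P.h))⁻¹ = C.Xs (φ, C.zz ϰ e r) / C.zz ϰ e r ∧
    P.Y φ (C.zz ϰ e r ^ (2 * P.h))⁻¹ = C.Ys (φ, C.zz ϰ e r) / C.zz ϰ e r ^ P.h :=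
  have ⟨hz, hz'⟩ := hg.zz_mem hP hϰ
  ⟨C.aa.X_eq _ ⟨hz, hz'.le⟩ φ, C.aa.Y_eq _ ⟨hz, hz'.le⟩ φ⟩

lemma Good.Fk_eq (k : ℕ) (φ S : ℝ) : P.Fk k (C.zz ϰ e r ^ (2 * P.h))⁻¹ φ S =
    (P.fk k (C.Xs (φ, C.zz ϰ e r) / C.zz ϰ e r) (C.Ys (φ, C.zz ϰ e r) / C.zz ϰ e r ^ P.h) S *
        (C.zz ϰ e r * C.wF.1 (φ, C.zz ϰ e r))
      + P.gk k (C.Xs (φ, C.zz ϰ e r) / C.zz ϰ e r) (C.Ys (φ, C.zz ϰ e r) / C.zz ϰ e r ^ P.h) S *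
        (C.zz ϰ e r ^ P.h * C.wF.2 (φ, C.zz ϰ e r))) * (C.zz ϰ e r ^ (2 * P.h))⁻¹ := by
  have hz := (hg.zz_mem hP hϰ).1
  have hh := hP.two_le_h
  rw [Fk, (hg.XY_eq hP hϰ φ).1, (hg.XY_eq hP hϰ φ).2, deriv_U P hh, C.dU_eq hh φ hz]; simp only [wF]
  generalize C.zz ϰ e r = z at *
  have e1 : z ^ (2 * P.h) = z ^ (2 * P.h - 1) * z := by rw [← pow_succ]; congr 1; omega
  have e2 : z ^ (2 * P.h) = z ^ P.h * z ^ P.h := by rw [← pow_add]; congr 1; omega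
  rw [add_mul]; congr 1
  · rw [e1]; field_simp
  · rw [e2]; field_simp

lemma Good.Gk_eq (hXY : P.IsLimitOscillation X₀ Y₀) (k : ℕ) (φ S : ℝ) :
    P.Gk k (C.zz ϰ e r ^ (2 * P.h))⁻¹ φ S =
    P.fk k (C.Xs (φ, C.zz ϰ e r) / C.zz ϰ e r) (C.Ys (φ, C.zz ϰ e r) / C.zz ϰ e r ^ P.h) S *
        (C.zz ϰ e r * C.wG.1 (φ, C.zz ϰ e r))
      + P.gk k (C.Xs (φ, C.zz ϰ e r) / C.zz ϰ e r) (C.Ys (φ, C.zz ϰ e r) / C.zz ϰ e r ^ P.h) S *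
        (C.zz ϰ e r ^ P.h * C.wG.2 (φ, C.zz ϰ e r)) := by
  obtain ⟨hz, hz'⟩ := hg.zz_mem hP hϰ
  have hh := hP.two_le_h
  have hd := C.deriv_energy hP hXY φ hz hz'
  rw [Gk, (hg.XY_eq hP hϰ φ).1, (hg.XY_eq hP hϰ φ).2, hd.1, hd.2, C.aa.omega_eq _ ⟨hz, hz'.le⟩]; simp only [wG]
  generalize C.zz ϰ e r = z at *
  have e1 : z ^ (2 * P.h - 1) = z ^ (P.h - 1) * z ^ P.h := by rw [← pow_add]; congr 1; omega
  have e2 : z ^ P.h = z ^ (P.h - 1) * z := by rw [← pow_succ]; congr 1; omega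
  rw [e1, e2]; field_simp; ring

lemma Good.omega_sub : e ^ (2 * (P.h - 1) * P.b) * (C.om (C.zz ϰ e r) / C.zz ϰ e r ^ (P.h - 1)
      - ((P.scale ϰ * e ^ (2 * P.b)) ^ (P.h - 1))⁻¹) = e ^ P.M * (r * ((C.vs ϰ e ^ (P.h - 1))⁻¹ *
        C.kap (e ^ P.M * r, e ^ (2 * P.b) * C.vs ϰ e))) := by
  have h0 := pow_pos hg.1 (2 * P.b)
  have hz := C.Z_eq _ ⟨mul_pos (P.scale_pos hP hϰ) h0, hg.2.1.le⟩
  have hv : P.scale ϰ * e ^ (2 * P.b) * C.Zu (P.scale ϰ * e ^ (2 * P.b))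
    = e ^ (2 * P.b) * C.vs ϰ e := by rw [vs]; ring
  have hk := C.exists_kap.choose_spec.2.2 (e ^ P.M * r) (e ^ (2 * P.b) * C.vs ϰ e)
  have e1 : e ^ (2 * (P.h - 1) * P.b) = (e ^ (2 * P.b)) ^ (P.h - 1) := by
    rw [← pow_mul]; congr 1; ring
  change C.rho e r ^ (P.h - 1) * C.om (e ^ (2 * P.b) * C.vs ϰ e / C.rho e r) - _ = _ * C.kap _ at hk
  have hvs := C.vs_pos hP hϰ e
  have hρ := C.rho_pos e r
  rw [← hz, hv, e1, zz, v, mul_div_assoc', div_pow, mul_pow]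
  generalize C.rho e r = ρ at *
  generalize C.om (e ^ (2 * P.b) * C.vs ϰ e / ρ) = o at *
  generalize C.kap _ = κ at *
  generalize C.om (e ^ (2 * P.b) * C.vs ϰ e) = o' at *
  have h1 := pow_pos h0 (P.h - 1)
  have h2 := pow_pos hvs (P.h - 1)
  generalize (e ^ (2 * P.b)) ^ (P.h - 1) = x at *
  generalize C.vs ϰ e ^ (P.h - 1) = y at *
  generalize ρ ^ (P.h - 1) = w at *; field_simp
  linear_combination hk

end

section

variable {C ϰ} {e r : ℝ}

lemma fieldA_eq (he : 0 < e) (hMN : 2 * P.M ≤ P.N) {Φ Φ₀ : ℝ}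
    (hΦ : e ^ (2 * P.M) * Φ = e ^ (2 * (P.a + P.b) * (P.h - 1)) * Φ₀) :
    C.fieldA ϰ Φ e r = (e ^ P.M)⁻¹ * e ^ (2 * (P.h - 1) * P.b) *
      ((e ^ P.M)⁻¹ * C.rho e r / (2 * P.h) * (e ^ (2 * (P.h - 1) * P.a) * Φ₀ -
        2 * P.h * (P.beta * e ^ (2 * P.q * (P.h - 1))) *
          C.logDeriv (P.scale ϰ * e ^ (2 * P.b))) + P.mu * r * e ^ (2 * P.q * (P.h - 1))) := by
  have hn1 : e ^ (2 * (P.h - 1) * P.b) * e ^ (2 * P.q * (P.h - 1)) = e ^ P.N := by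
    rw [← pow_add, N]; congr 1; ring
  have hn2 : e ^ P.N = e ^ P.M * e ^ (P.N - P.M) := by rw [← pow_add]; congr 1; omega
  have hn3 : e ^ P.N = e ^ P.M * e ^ P.M * e ^ (P.N - 2 * P.M) := by
    rw [← pow_add, ← pow_add]; congr 1; omega
  rw [two_mul, pow_add, show 2 * (P.a + P.b) * (P.h - 1) = 2 * (P.h - 1) * P.b +
    2 * (P.h - 1) * P.a by ring, pow_add] at hΦ
  have hpM := pow_pos he P.M; rw [fieldA]
  generalize C.logDeriv (P.scale ϰ * e ^ (2 * P.b)) = l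
  have k1 : e ^ (P.N - P.M) = (e ^ P.M)⁻¹ *
      (e ^ (2 * (P.h - 1) * P.b) * e ^ (2 * P.q * (P.h - 1))) := by
    rw [hn1, hn2, inv_mul_cancel_left₀ hpM.ne']
  have k2 : e ^ (P.N - 2 * P.M) = (e ^ P.M)⁻¹ * (e ^ P.M)⁻¹ *
      (e ^ (2 * (P.h - 1) * P.b) * e ^ (2 * P.q * (P.h - 1))) := by
    rw [hn1, hn3]; field_simp
  have k3 : Φ = (e ^ P.M)⁻¹ * (e ^ P.M)⁻¹ *
      (e ^ (2 * (P.h - 1) * P.b) * e ^ (2 * (P.h - 1) * P.a) * Φ₀) := by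
    rw [← hΦ]; field_simp
  rw [k1, k2, k3]; ring

lemma fieldB_eq (hP : P.IsAdmissible) (hϰ : 1 ≤ ϰ) (hg : C.Good ϰ e r) {Φ Φ₀ : ℝ}
    (hΦ : e ^ (2 * P.M) * Φ = e ^ (2 * (P.a + P.b) * (P.h - 1)) * Φ₀) :
    C.fieldB ϰ Φ e r = (e ^ P.M)⁻¹ * e ^ (2 * (P.h - 1) * P.b) *
      (C.om (C.zz ϰ e r) / C.zz ϰ e r ^ (P.h - 1) - ((P.scale ϰ * e ^ (2 * P.b)) ^ (P.h - 1))⁻¹ +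
        e ^ (2 * (P.h - 1) * P.a) * Φ₀) := by
  rw [two_mul, pow_add, show 2 * (P.a + P.b) * (P.h - 1) = 2 * (P.h - 1) * P.b +
    2 * (P.h - 1) * P.a by ring, pow_add] at hΦ
  have hos := hg.omega_sub hP hϰ
  have hpM := pow_pos hg.1 P.M
  rw [mul_assoc, mul_add, hos, ← mul_assoc _ _ Φ₀, ← hΦ, fieldB]; field_simp

end

section

variable {C ϰ} {ε r : ℝ} (hP : P.IsAdmissible) (hσ : P.SigmaCondition) (hfg : P.HasPowerAsymptotics)
  (hϰ : 1 ≤ ϰ) (hε : 0 < ε) (hg : C.Good ϰ (P.ratio * ε) r)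
include hP hε

lemma inv_pow_rpow_div : ((ε ^ P.N)⁻¹) ^ ((P.M : ℝ) / P.N) =
    P.ratio ^ P.M * ((P.ratio * ε) ^ P.M)⁻¹ := by
  have hk := ratio_pos hP
  have hN0 : (P.N : ℝ) ≠ 0 := by exact_mod_cast (N_pos hP).ne'
  rw [inv_pow_rpow_eq_inv_pow hε (m := P.M) (by field_simp), mul_pow]; field_simp

include hσ hϰ hg hfg

lemma calA_eq (hMN : 2 * P.M ≤ P.N) (K : ℕ) (θ ζ : ℝ) : P.calA ϰ K r θ ζ (ε ^ P.N)⁻¹ =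
    P.ratio ^ P.M *
      C.fieldA ϰ (C.forcing ϰ (K + 1) C.wF (P.ratio * ε, r, θ) ζ) (P.ratio * ε) r := by
  have he := hg.1
  rw [fieldA_eq he hMN
    (C.pow_mul_forcing hP hϰ hσ hfg (r := r) (θ := θ) (ζ := ζ) he (K + 1) C.wF)]
  simp only [calA]
  rw [time_inv_pow hP hε, inv_pow_rpow_div hP hε, hg.energy_eq hP hϰ hσ,
    C.deriv_Istar_div hP hϰ (by positivity) (by rw [inv_pow_rpow_neg_beta hP he]; exact hg.2.1)]
  simp only [inv_pow_rpow_neg_div hP he, inv_pow_rpow_one_sub_nu hP he, inv_pow_rpow_mu hP hσ he,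
    inv_pow_rpow_neg_mu hP hσ he, inv_pow_rpow_neg_beta hP he, hg.Fk_eq hP hϰ, div_inv_eq_mul,
    ← hg.rho_eq]
  have hzp : C.zz ϰ (P.ratio * ε) r ^ (2 * P.h) ≠ 0 := (pow_pos (hg.zz_mem hP hϰ).1 _).ne'
  simp only [← mul_assoc _ _ ((C.zz ϰ (P.ratio * ε) r ^ (2 * P.h))⁻¹), ← sum_mul,
    mul_assoc _ ((C.zz ϰ (P.ratio * ε) r ^ (2 * P.h))⁻¹) _, inv_mul_cancel₀ hzp, mul_one]
  simp only [mul_add, sum_add_distrib, ← mul_assoc, ← sum_mul]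

lemma calB_eq (hXY : P.IsLimitOscillation X₀ Y₀) (K : ℕ) (θ ζ : ℝ) :
    P.calB ϰ K r θ ζ (ε ^ P.N)⁻¹ = P.ratio ^ P.M *
      C.fieldB ϰ (C.forcing ϰ (K + 1) C.wG (P.ratio * ε, r, θ) ζ) (P.ratio * ε) r := by
  have he := hg.1
  have hI : P.omega (P.Istar ϰ ((P.ratio * ε) ^ (2 * P.q * (P.h - 1)))⁻¹) =
      ((P.scale ϰ * (P.ratio * ε) ^ (2 * P.b)) ^ (P.h - 1))⁻¹ := by
    have h0 := pow_pos he (2 * P.b)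
    have hs : P.scale ϰ * (P.ratio * ε) ^ (2 * P.b) ∈ Ioc 0 C.s₀ :=
      ⟨mul_pos (P.scale_pos hP hϰ) h0, hg.2.1.le⟩
    rw [C.Istar_eq hP hϰ (by positivity) (by rw [inv_pow_rpow_neg_beta hP he]; exact hs.2),
      inv_pow_rpow_neg_beta hP he, C.aa.omega_eq _ ⟨mul_pos hs.1 (C.Zu_pos _), ?_⟩, C.Z_eq _ hs]
    linarith [C.Z_le _ hs, C.aa.z_pos]
  have hz := hg.zz_mem hP hϰ
  rw [fieldB_eq hP hϰ hg
    (C.pow_mul_forcing hP hϰ hσ hfg (r := r) (θ := θ) (ζ := ζ) he (K + 1) C.wG)]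
  simp only [calB]
  rw [time_inv_pow hP hε, inv_pow_rpow_div hP hε, hg.energy_eq hP hϰ hσ, hI,
    C.aa.omega_eq _ ⟨hz.1, hz.2.le⟩]
  simp only [inv_pow_rpow_neg_div hP he, inv_pow_rpow_one_sub_nu hP he, hg.Gk_eq hP hϰ hXY]
  simp only [mul_add, sum_add_distrib, ← mul_assoc, ← sum_mul]

end

end ResonantChart

end PerturbedSystem

lemma continuous_coeff_of_continuous_sum {n : ℕ} {a : ℕ → ℝ → ℝ}
    (h : ∀ x : ℝ, Continuous fun S => ∑ i ∈ range n, a i S * x ^ i) :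
    ∀ i < n, Continuous (a i) := by
  induction n generalizing a with
  | zero => intro i hi; omega
  | succ n ih =>
    have h1 : ∀ i < n, Continuous (a i) := fun i hi => by
      have h2 := ih (a := fun i S => a i S * ((2 : ℝ) ^ i - 2 ^ n)) (fun x => by
        refine ((h (2 * x)).sub ((h x).const_mul (2 ^ n))).congr fun S => ?_
        simp only [Pi.sub_apply]
        rw [sum_range_succ, sum_range_succ, mul_add, mul_sum, add_sub_add_comm, ← sum_sub_distrib, mul_pow]
        have : a n S * (2 ^ n * x ^ n) - 2 ^ n * (a n S * x ^ n) = 0 := by ring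
        rw [this, add_zero]
        refine sum_congr rfl fun i _ => ?_
        rw [mul_pow]; ring) i hi
      have h3 : (2 : ℝ) ^ i - 2 ^ n ≠ 0 := by
        have : (2 : ℝ) ^ i < 2 ^ n := pow_lt_pow_right₀ (by norm_num) hi; linarith
      exact (h2.div_const ((2 : ℝ) ^ i - 2 ^ n)).congr fun S => mul_div_cancel_right₀ _ h3
    intro i hi
    rcases Nat.lt_succ_iff_lt_or_eq.1 hi with hi | rfl
    · exact h1 i hi
    · refine ((h 1).sub (continuous_finsetSum (range i) fun j hj =>
        h1 j (Finset.mem_range.1 hj))).congr fun S => ?_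
      simp [sum_range_succ]

lemma continuous_of_uniform_expansion {F : ℝ → ℝ → ℝ} {c : ℕ → ℝ → ℝ} {q : ℝ} (hq : 0 < q)
    (hF : ∀ t, 0 < t → Continuous fun S => F S t) (h : ∀ n : ℕ, ∃ C t₀ : ℝ, 0 < t₀ ∧ ∀ S t, t₀ ≤ t →
      |F S t - ∑ k ∈ range n, t ^ (-((k : ℝ) / q)) * c k S| ≤ C * t ^ (-((n : ℝ) / q)))
    (k : ℕ) : Continuous (c k) := by
  induction k using Nat.strong_induction_on with
  | _ k ih =>
    obtain ⟨C, t₀, ht₀, hC⟩ := h (k + 1)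
    refine continuous_of_uniform_approx_of_continuous fun u hu => ?_
    obtain ⟨ε, hε, hu⟩ := Metric.mem_uniformity_dist.1 hu
    have hl : Tendsto (fun t : ℝ => C * t ^ (-(1 / q))) atTop (𝓝 0) := by
      simpa using (tendsto_rpow_neg_atTop (one_div_pos.2 hq)).const_mul C
    obtain ⟨t, ht1, ht2⟩ := ((hl.eventually (gt_mem_nhds hε)).and (eventually_ge_atTop t₀)).exists
    have ht : 0 < t := ht₀.trans_le ht2
    refine ⟨fun S => t ^ ((k : ℝ) / q) *
      (F S t - ∑ j ∈ range k, t ^ (-((j : ℝ) / q)) * c j S), ?_, fun S => hu ?_⟩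
    · exact continuous_const.mul ((hF t ht).sub (continuous_finsetSum _ fun j hj =>
        continuous_const.mul (ih j (Finset.mem_range.1 hj))))
    · have h1 := hC S t ht2
      have hk : 0 < t ^ ((k : ℝ) / q) := rpow_pos_of_pos ht _
      rw [sum_range_succ, ← sub_sub] at h1
      rw [dist_eq, abs_sub_comm]
      have e1 : t ^ ((k : ℝ) / q) * t ^ (-((k : ℝ) / q)) = 1 := by
        rw [← rpow_add ht, add_neg_cancel, rpow_zero]
      have e2 : t ^ ((k : ℝ) / q) * t ^ (-(((k + 1 : ℕ) : ℝ) / q)) = t ^ (-(1 / q)) := by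
        rw [← rpow_add ht]; congr 1; push_cast; ring
      have e3 : t ^ ((k : ℝ) / q) * (F S t - ∑ j ∈ range k, t ^ (-((j : ℝ) / q)) * c j S)
          - c k S = t ^ ((k : ℝ) / q) * (F S t -
            ∑ j ∈ range k, t ^ (-((j : ℝ) / q)) * c j S - t ^ (-((k : ℝ) / q)) * c k S) := by
        linear_combination c k S * e1
      rw [e3, abs_mul, abs_of_pos hk]
      refine (mul_le_mul_of_nonneg_left h1 hk.le).trans_lt ?_; rw [mul_left_comm, e2]
      exact ht1

namespace PerturbedSystem

variable {P : PerturbedSystem} {X₀ Y₀ : ℝ → ℝ}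

lemma continuous_slice {F : ℝ → ℝ → ℝ → ℝ → ℝ} (h : ContDiffOn ℝ ((⊤ : ℕ∞) : WithTop ℕ∞)
    (fun v : ℝ × ℝ × ℝ × ℝ => F v.1 v.2.1 v.2.2.1 v.2.2.2) {v | 0 < v.2.2.2}) (x y : ℝ) {t : ℝ}
    (ht : 0 < t) : Continuous fun S => F x y S t :=
  h.continuousOn.comp_continuous (f := fun S : ℝ => (x, y, S, t)) (by fun_prop) fun _ => ht

lemma continuous_A (hP : P.IsAdmissible) (hfg : P.HasPowerAsymptotics) (k : ℕ) :
    ∀ i < P.p + 1, ∀ j < P.l, Continuous (P.A k i j) := by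
  intro i hi
  refine continuous_coeff_of_continuous_sum fun y => ?_
  refine continuous_coeff_of_continuous_sum (n := P.p + 1)
    (a := fun i S => ∑ j ∈ range P.l, P.A k i j S * y ^ j) (fun x => ?_) i hi
  obtain ⟨m, hm⟩ := hfg.f_asymp
  refine (continuous_of_uniform_expansion (F := fun S t => P.f x y S t)
    (c := fun k S => P.fk k x y S) (q_pos hP) (fun t ht => continuous_slice hP.f_smooth x y ht)
    (fun n => ?_) k).congr fun S => ?_
  · obtain ⟨C, t₀, ht₀, h⟩ := hm n
    refine ⟨C * (1 + |x| + |y|) ^ m, t₀, ht₀, fun S t ht => (h x y S t ht).trans_eq (by ring)⟩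
  · simp only [fk, sum_mul]
    exact sum_congr rfl fun i _ => sum_congr rfl fun j _ => by ring

lemma continuous_B (hP : P.IsAdmissible) (hfg : P.HasPowerAsymptotics) (k : ℕ) :
    ∀ i < P.p + 1, ∀ j < P.l + 1, Continuous (P.B k i j) := by
  intro i hi
  refine continuous_coeff_of_continuous_sum fun y => ?_
  refine continuous_coeff_of_continuous_sum (n := P.p + 1)
    (a := fun i S => ∑ j ∈ range (P.l + 1), P.B k i j S * y ^ j) (fun x => ?_) i hi
  obtain ⟨m, hm⟩ := hfg.g_asymp
  refine (continuous_of_uniform_expansion (F := fun S t => P.g x y S t)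
    (c := fun k S => P.gk k x y S) (q_pos hP) (fun t ht => continuous_slice hP.g_smooth x y ht)
    (fun n => ?_) k).congr fun S => ?_
  · obtain ⟨C, t₀, ht₀, h⟩ := hm n
    refine ⟨C * (1 + |x| + |y|) ^ m, t₀, ht₀, fun S t ht => (h x y S t ht).trans_eq (by ring)⟩
  · simp only [gk, sum_mul]
    exact sum_congr rfl fun i _ => sum_congr rfl fun j _ => by ring

namespace ResonantChart

variable (C : P.ResonantChart X₀ Y₀) (ϰ : ℕ)

/-- The truncated field `𝒜` with `x = (ε, r, θ)`, `ε = τ ^ (-1/N)`. -/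
def hatA (m : ℕ) (x : ℝ³) (ζ : ℝ) : ℝ := P.ratio ^ P.M *
  C.fieldA ϰ (C.forcing ϰ m C.wF (P.ratio * x.1, x.2) ζ) (P.ratio * x.1) x.2.1

/-- The truncated field `ℬ` with `x = (ε, r, θ)`, `ε = τ ^ (-1/N)`. -/
def hatB (m : ℕ) (x : ℝ³) (ζ : ℝ) : ℝ := P.ratio ^ P.M *
  C.fieldB ϰ (C.forcing ϰ m C.wG (P.ratio * x.1, x.2) ζ) (P.ratio * x.1) x.2.1

/-- The dependence of the resonant frequency on the amplitude. -/
def hatc (ε : ℝ) : ℝ := P.ratio ^ P.M * ((C.vs ϰ (P.ratio * ε) ^ (P.h - 1))⁻¹ *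
  C.kap (0, (P.ratio * ε) ^ (2 * P.b) * C.vs ϰ (P.ratio * ε)))

variable {ϰ} (hP : P.IsAdmissible) (hϰ : 1 ≤ ϰ)

lemma contDiff_kap : Smooth C.kap := C.exists_kap.choose_spec.1

lemma eventually_good (hM : 1 ≤ P.M) (r : ℝ) (hP : P.IsAdmissible) :
    ∀ᶠ ε in 𝓝[>] (0 : ℝ), C.Good ϰ (P.ratio * ε) r := by
  have hb := hP.one_le_b
  have h1 : Tendsto (fun ε : ℝ => P.scale ϰ * (P.ratio * ε) ^ (2 * P.b)) (𝓝[>] 0) (𝓝 0) :=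
    (Continuous.tendsto' (by fun_prop) 0 0 (by simp [show P.b ≠ 0 by omega])).mono_left
      nhdsWithin_le_nhds
  have h2 : Tendsto (fun ε : ℝ => |(P.ratio * ε) ^ P.M * r|) (𝓝[>] 0) (𝓝 0) :=
    (Continuous.tendsto' (by fun_prop) 0 0 (by simp [show P.M ≠ 0 by omega])).mono_left
      nhdsWithin_le_nhds
  filter_upwards [h1.eventually (gt_mem_nhds C.s_pos), h2.eventually (gt_mem_nhds C.w_pos),
    h2.eventually (gt_mem_nhds (show (0 : ℝ) < 1 / 4 by norm_num)), self_mem_nhdsWithin]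
    with ε a1 a2 a3 a4
  exact ⟨mul_pos (ratio_pos hP) a4, a1, a2.le, a3.le⟩

include hP hϰ

lemma hatc_zero_pos : 0 < C.hatc ϰ 0 := by
  have h1 := C.vs_pos hP hϰ (P.ratio * 0)
  have h2 := ratio_pos hP
  have h3 := C.aa.om_pos 0
  have hb := hP.one_le_b
  have hh := hP.two_le_h
  have h4 : (0 : ℝ) < (P.h - 1 : ℕ) := Nat.cast_pos.2 (by omega)
  have h5 : C.kap (0, 0) = ((P.h - 1 : ℕ) : ℝ) * C.om 0 := C.exists_kap.choose_spec.2.1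
  rw [hatc, show (P.ratio * 0) ^ (2 * P.b) = 0 by rw [mul_zero, zero_pow (by omega)], zero_mul, h5]
  positivity

lemma contDiff_hatc : Smooth (C.hatc ϰ) := by
  have h1 : Smooth fun ε : ℝ => C.vs ϰ (P.ratio * ε) := C.contDiff_vs.comp (by fun_prop)
  have h2 : Smooth fun ε : ℝ => (C.vs ϰ (P.ratio * ε) ^ (P.h - 1))⁻¹ :=
    (h1.pow _).inv fun ε => (pow_pos (C.vs_pos hP hϰ _) _).ne'
  exact contDiff_const.mul (h2.mul (C.contDiff_kap.comp (contDiff_const.prodMk (by fun_prop))))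

variable (hXY : P.IsLimitOscillation X₀ Y₀) (hfg : P.HasPowerAsymptotics)
include hXY hfg

lemma paramSmooth_coef {w : (ℝ² → ℝ) × (ℝ² → ℝ)} (h1 : PeriodicWeight w.1)
    (h2 : PeriodicWeight w.2) (k : ℕ) : ParamSmooth (2 * π * ϰ)
      fun (x : ℝ³) ζ => C.forcingCoef ϰ k w (P.ratio * x.1, x.2) ζ :=
  (C.paramSmooth_forcingCoef hP hXY hϰ (continuous_A hP hfg) (continuous_B hP hfg) hfg h1 h2 k).comp
    (φ := fun x : ℝ³ => (P.ratio * x.1, x.2)) (by fun_prop)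

lemma paramSmooth_forcing {w : (ℝ² → ℝ) × (ℝ² → ℝ)} (h1 : PeriodicWeight w.1)
    (h2 : PeriodicWeight w.2) (m : ℕ) : ParamSmooth (2 * π * ϰ)
      fun (x : ℝ³) ζ => C.forcing ϰ m w (P.ratio * x.1, x.2) ζ :=
  ParamSmooth.sum fun k _ => (ParamSmooth.of_param (by fun_prop)).mul
    (C.paramSmooth_coef hP hϰ hXY hfg h1 h2 k)

lemma paramSmooth_hatA (m : ℕ) : ParamSmooth (2 * π * ϰ) (C.hatA ϰ m) := by
  have hF := C.paramSmooth_forcing hP hϰ hXY hfg (C.periodicWeight_wF hXY).1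
    (C.periodicWeight_wF hXY).2 m
  have h1 : Smooth fun x : ℝ³ => C.rho (P.ratio * x.1) x.2.1 :=
    C.contDiff_rho.comp (by fun_prop : Smooth fun x : ℝ³ => (P.ratio * x.1, x.2.1))
  have h2 : Smooth fun x : ℝ³ =>
      C.logDeriv (P.scale ϰ * (P.ratio * x.1) ^ (2 * P.b)) := C.contDiff_logDeriv.comp (by fun_prop)
  exact (ParamSmooth.const _).mul (((ParamSmooth.of_param (h1.div_const _)).mul
    (hF.sub (ParamSmooth.of_param (by fun_prop)))).add (ParamSmooth.of_param (by fun_prop)))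

lemma hatB_eq (m : ℕ) : ∃ B₁ : ℝ³ → ℝ → ℝ, ParamSmooth (2 * π * ϰ) B₁ ∧
    ∀ x ζ, C.hatB ϰ m x ζ = C.hatc ϰ x.1 * x.2.1 + x.1 ^ P.M * B₁ x ζ := by
  obtain ⟨g, hg, -, hgk⟩ := C.contDiff_kap.exists_eq_add_smul
  have hF := C.paramSmooth_forcing hP hϰ hXY hfg (C.periodicWeight_wG hXY).1
    (C.periodicWeight_wG hXY).2 m
  have h1 : Smooth fun x : ℝ³ => C.vs ϰ (P.ratio * x.1) := C.contDiff_vs.comp (by fun_prop)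
  have h2 : Smooth fun x : ℝ³ => (C.vs ϰ (P.ratio * x.1) ^ (P.h - 1))⁻¹ :=
    (h1.pow _).inv fun ε => (pow_pos (C.vs_pos hP hϰ _) _).ne'
  refine ⟨fun x ζ => P.ratio ^ P.M * P.ratio ^ P.M * (x.2.1 * x.2.1 *
    ((C.vs ϰ (P.ratio * x.1) ^ (P.h - 1))⁻¹ * g ((P.ratio * x.1) ^ P.M * x.2.1,
      (P.ratio * x.1) ^ (2 * P.b) * C.vs ϰ (P.ratio * x.1))) +
    C.forcing ϰ m C.wG (P.ratio * x.1, x.2) ζ), ?_, fun x ζ => ?_⟩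
  · exact (ParamSmooth.const _).mul ((ParamSmooth.of_param (by fun_prop)).add hF)
  · rw [hatB, fieldB, hgk, hatc, smul_eq_mul]; ring

lemma hatA_succ (m : ℕ) : ∃ g : ℝ³ → ℝ → ℝ, ParamSmooth (2 * π * ϰ) g ∧
    ∀ x ζ, C.hatA ϰ (m + 1) x ζ - C.hatA ϰ m x ζ = x.1 ^ m * g x ζ := by
  have hF := C.paramSmooth_coef hP hϰ hXY hfg (C.periodicWeight_wF hXY).1
    (C.periodicWeight_wF hXY).2 m
  have h1 : Smooth fun x : ℝ³ => C.rho (P.ratio * x.1) x.2.1 :=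
    C.contDiff_rho.comp (by fun_prop : Smooth fun x : ℝ³ => (P.ratio * x.1, x.2.1))
  refine ⟨fun x ζ => P.ratio ^ P.M * (C.rho (P.ratio * x.1) x.2.1 / (2 * P.h)) *
    P.ratio ^ m * (P.ratio * x.1) ^ ((2 * (P.h - 1) - 1) * m) *
      C.forcingCoef ϰ m C.wF (P.ratio * x.1, x.2) ζ,
    (ParamSmooth.of_param (by fun_prop)).mul hF, fun x ζ => ?_⟩
  have := hP.two_le_h
  have e := Nat.add_sub_of_le (Nat.le_mul_of_pos_left m (show 0 < 2 * (P.h - 1) by omega))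
  simp only [hatA, fieldA, forcing, sum_range_succ]; rw [← e, ← Nat.sub_one_mul, pow_add]; ring

lemma hatB_succ (m : ℕ) : ∃ g : ℝ³ → ℝ → ℝ, ParamSmooth (2 * π * ϰ) g ∧
    ∀ x ζ, C.hatB ϰ (m + 1) x ζ - C.hatB ϰ m x ζ = x.1 ^ m * g x ζ := by
  have hF := C.paramSmooth_coef hP hϰ hXY hfg (C.periodicWeight_wG hXY).1
    (C.periodicWeight_wG hXY).2 m
  refine ⟨fun x ζ => P.ratio ^ P.M * (P.ratio * x.1) ^ P.M *
    P.ratio ^ m * (P.ratio * x.1) ^ ((2 * (P.h - 1) - 1) * m) *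
      C.forcingCoef ϰ m C.wG (P.ratio * x.1, x.2) ζ,
    (ParamSmooth.of_param (by fun_prop)).mul hF, fun x ζ => ?_⟩
  have := hP.two_le_h
  have e := Nat.add_sub_of_le (Nat.le_mul_of_pos_left m (show 0 < 2 * (P.h - 1) by omega))
  simp only [hatB, fieldB, forcing, sum_range_succ]; rw [← e, ← Nat.sub_one_mul, pow_add]; ring

omit hP hXY hfg C in
lemma taylorCoef_eq_of_succ {F : ℕ → ℝ³ → ℝ → ℝ}
    (hF : ∀ m, ParamSmooth (2 * π * ϰ) (F m)) (h : ∀ m, ∃ g : ℝ³ → ℝ → ℝ,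
      ParamSmooth (2 * π * ϰ) g ∧ ∀ x ζ, F (m + 1) x ζ - F m x ζ = x.1 ^ m * g x ζ)
    {K m : ℕ} (hm : K + 1 ≤ m) (r θ ζ : ℝ) : taylorCoef K (fun ε => F (K + 1) (ε, r, θ) ζ) =
      taylorCoef K fun ε => F m (ε, r, θ) ζ := by
  have hT : 0 < 2 * π * ϰ := by positivity
  have hs : ∀ {F : ℝ³ → ℝ → ℝ}, ParamSmooth (2 * π * ϰ) F →
      Smooth fun ε => F (ε, r, θ) ζ := fun hF =>
    (hF.eval hT ζ).comp (by fun_prop : Smooth fun ε : ℝ => (ε, r, θ))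
  induction m, hm using Nat.le_induction with
  | base => rfl
  | succ m hm ih =>
    rw [ih]
    obtain ⟨g, hg, hgF⟩ := h m
    symm
    refine taylorCoef_congr_of_isBigO (hs (hF _)) (hs (hF _)) (n := m) ?_ (by omega)
    simp only [hgF]
    simpa using (isBigO_refl (fun ε : ℝ => ε ^ m) (𝓝[>] 0)).mul (hs hg).continuous.isBigO_one_nhdsGT

lemma hatField (hσ : P.SigmaCondition) (hMN : 2 * P.M ≤ P.N) {n m : ℕ} (hnm : n ≤ m) :
    P.HatField ϰ n (C.hatA ϰ m) (C.hatB ϰ m) (C.hatc ϰ) := by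
  have hT : 0 < 2 * π * ϰ := by positivity
  have hM := (P.M_cast hP hσ).2
  have hA := C.paramSmooth_hatA hP hϰ hXY hfg
  have hB : ∀ m, ParamSmooth (2 * π * ϰ) (C.hatB ϰ m) := fun m => by
    obtain ⟨B₁, h1, h2⟩ := C.hatB_eq hP hϰ hXY hfg m
    have hc := C.contDiff_hatc hP hϰ
    have := (ParamSmooth.of_param (T := 2 * π * ϰ)
      (by fun_prop : Smooth fun x : ℝ³ => C.hatc ϰ x.1 * x.2.1)).add
        ((ParamSmooth.of_param (by fun_prop : Smooth fun x : ℝ³ => x.1 ^ P.M)).mul h1)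
    convert this using 2 with x
    exact funext fun ζ => h2 x ζ
  have hs : ∀ {F : ℝ³ → ℝ → ℝ}, ParamSmooth (2 * π * ϰ) F → ∀ r θ ζ,
      Smooth fun ε => F (ε, r, θ) ζ := fun hF r θ ζ =>
    (hF.eval hT ζ).comp (by fun_prop : Smooth fun ε : ℝ => (ε, r, θ))
  have hAc : ∀ K r θ ζ, P.Acoeff ϰ K r θ ζ = taylorCoef K fun ε => C.hatA ϰ (K + 1) (ε, r, θ) ζ := by
    intro K r θ ζ
    refine asympCoeff_eq_taylorCoef (hs (hA _) r θ ζ) ?_ K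
    filter_upwards [C.eventually_good hM r hP, self_mem_nhdsWithin] with ε h1 h2
    exact calA_eq hP hσ hfg hϰ h2 h1 hMN K θ ζ
  have hBc : ∀ K r θ ζ, P.Bcoeff ϰ K r θ ζ = taylorCoef K fun ε => C.hatB ϰ (K + 1) (ε, r, θ) ζ := by
    intro K r θ ζ
    refine asympCoeff_eq_taylorCoef (hs (hB _) r θ ζ) ?_ K
    filter_upwards [C.eventually_good hM r hP, self_mem_nhdsWithin] with ε h1 h2
    exact calB_eq hP hσ hfg hϰ h2 h1 hXY K θ ζ
  exact
    { A := hA m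
      B := hB m
      Acoeff_smooth := fun k => by
        convert (hA (k + 1)).taylorCoef_param hT k using 3 with p ζ
        exact hAc k p.1 p.2 ζ
      Bcoeff_smooth := fun k => by
        convert (hB (k + 1)).taylorCoef_param hT k using 3 with p ζ
        exact hBc k p.1 p.2 ζ
      Acoeff_eq := fun K hK r θ ζ => (hAc K r θ ζ).trans
        (taylorCoef_eq_of_succ hϰ hA (C.hatA_succ hP hϰ hXY hfg) (by omega) r θ ζ)
      Bcoeff_eq := fun K hK r θ ζ => (hBc K r θ ζ).trans
        (taylorCoef_eq_of_succ hϰ hB (C.hatB_succ hP hϰ hXY hfg) (by omega) r θ ζ)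
      c_smooth := C.contDiff_hatc hP hϰ
      c_pos := C.hatc_zero_pos hP hϰ
      B_eq := C.hatB_eq hP hϰ hXY hfg m }

end ResonantChart

namespace ResonantChart

variable (C : P.ResonantChart X₀ Y₀) (ϰ : ℕ)

/-- The forcing with the weights `w`. -/
def fullForcing (w : (ℝ² → ℝ) × (ℝ² → ℝ)) (e r φ ζ : ℝ) : ℝ :=
  (P.f (C.Xs (φ, C.zz ϰ e r) / C.zz ϰ e r) (C.Ys (φ, C.zz ϰ e r) / C.zz ϰ e r ^ P.h) ζ
      (e ^ (2 * P.q * (P.h - 1)))⁻¹ * (C.zz ϰ e r * w.1 (φ, C.zz ϰ e r)) +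
    P.g (C.Xs (φ, C.zz ϰ e r) / C.zz ϰ e r) (C.Ys (φ, C.zz ϰ e r) / C.zz ϰ e r ^ P.h) ζ
      (e ^ (2 * P.q * (P.h - 1)))⁻¹ * (C.zz ϰ e r ^ P.h * w.2 (φ, C.zz ϰ e r)))

def scaledForcing (w : (ℝ² → ℝ) × (ℝ² → ℝ)) (e r θ ζ : ℝ) : ℝ :=
  e ^ (2 * (P.a + P.b) * (P.h - 1)) / e ^ (2 * P.M) * C.fullForcing ϰ w e r (θ + ζ / ϰ) ζ

variable {ϰ}

/-- Substitution of an expansion with a polynomial weight. -/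
lemma expansion_bound {F : ℝ → ℝ → ℝ → ℝ → ℝ} {c : ℕ → ℝ → ℝ → ℝ → ℝ} (hP : P.IsAdmissible)
    {m₀ : ℕ} (h : ∀ n : ℕ, ∃ C t₀ : ℝ, 0 < t₀ ∧ ∀ x y S t, t₀ ≤ t →
    |F x y S t - ∑ k ∈ range n, t ^ (-((k : ℝ) / P.q)) * c k x y S|
      ≤ C * t ^ (-((n : ℝ) / P.q)) * (1 + |x| + |y|) ^ m₀) {A B : ℝ} (hA : 0 < A)
      (n m : ℕ) (hm : n + 2 * P.b * P.h * m₀ ≤ m) :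
    ∃ K, 0 ≤ K ∧ ∃ e₀, 0 < e₀ ∧ ∀ e ∈ Ioc 0 e₀, ∀ X Y S v z, A ≤ v → z = e ^ (2 * P.b) * v →
      |X| ≤ B → |Y| ≤ B →
      |F (X / z) (Y / z ^ P.h) S (e ^ (2 * P.q * (P.h - 1)))⁻¹ -
        ∑ k ∈ range m, e ^ (2 * (P.h - 1) * k) * c k (X / z) (Y / z ^ P.h) S| ≤ K * e ^ n := by
  obtain ⟨C, t₀, ht₀, hC⟩ := h m
  have hh := hP.two_le_h
  have hq : 1 ≤ P.q := hP.one_le_a.trans hP.a_le_q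
  have hn0 : 2 * P.q * (P.h - 1) ≠ 0 := by
    have : 0 < P.q * (P.h - 1) := Nat.mul_pos (by omega) (by omega)
    rw [mul_assoc]; omega
  refine ⟨|C| * (1 + B / A + B / A ^ P.h) ^ m₀ ⊔ 0, le_max_right _ _, min 1 (min 1 t₀⁻¹),
    by positivity, ?_⟩
  rintro e ⟨he, hel⟩ X Y S v z hv hz hX hY
  simp only [le_min_iff] at hel
  obtain ⟨he1, -, het⟩ := hel
  have ht : t₀ ≤ (e ^ (2 * P.q * (P.h - 1)))⁻¹ := by
    rw [le_inv_comm₀ ht₀ (by positivity)]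
    exact (pow_le_of_le_one he.le he1 hn0).trans het
  have h1 := hC (X / z) (Y / z ^ P.h) S _ ht
  simp only [inv_pow_rpow_neg_div hP he] at h1
  refine h1.trans (le_trans ?_ (mul_le_mul_of_nonneg_right (le_max_left _ _) (by positivity)))
  have hB : 0 ≤ B := (abs_nonneg X).trans hX
  have hs : 0 < e ^ (2 * P.b) := by positivity
  have hs1 : e ^ (2 * P.b) ≤ 1 := pow_le_one₀ he.le he1
  have hzA : e ^ (2 * P.b) * A ≤ z := by rw [hz]; gcongr
  have hz0 : 0 < z := lt_of_lt_of_le (by positivity) hzA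
  have b1 : |X / z| ≤ (e ^ (2 * P.b * P.h))⁻¹ * (B / A) := by
    rw [abs_div, abs_of_pos hz0, pow_mul]
    calc |X| / z ≤ B / (e ^ (2 * P.b) * A) := by gcongr
      _ = (e ^ (2 * P.b))⁻¹ * (B / A) := by field_simp
      _ ≤ _ := by gcongr; exact pow_le_of_le_one hs.le hs1 (by omega)
  have b2 : |Y / z ^ P.h| ≤ (e ^ (2 * P.b * P.h))⁻¹ * (B / A ^ P.h) := by
    rw [abs_div, abs_of_pos (pow_pos hz0 _), pow_mul]
    calc |Y| / z ^ P.h ≤ B / (e ^ (2 * P.b) * A) ^ P.h := by gcongr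
      _ = _ := by rw [mul_pow]; field_simp
  have b3 : 1 + |X / z| + |Y / z ^ P.h| ≤ (e ^ (2 * P.b * P.h))⁻¹ * (1 + B / A + B / A ^ P.h) := by
    have : 1 ≤ (e ^ (2 * P.b * P.h))⁻¹ := (one_le_inv₀ (by positivity)).2 (pow_le_one₀ he.le he1)
    linarith
  have b4 : e ^ (2 * (P.h - 1) * m) ≤ e ^ n * (e ^ (2 * P.b * P.h)) ^ m₀ := by
    rw [← pow_mul, ← pow_add]
    refine pow_le_pow_of_le_one he.le he1 (hm.trans ?_)
    exact Nat.le_mul_of_pos_left _ (by omega)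
  calc C * e ^ (2 * (P.h - 1) * m) * (1 + |X / z| + |Y / z ^ P.h|) ^ m₀
      ≤ |C| * (e ^ n * (e ^ (2 * P.b * P.h)) ^ m₀) *
        ((e ^ (2 * P.b * P.h))⁻¹ * (1 + B / A + B / A ^ P.h)) ^ m₀ := by
        gcongr; exact le_abs_self C
    _ = _ := by rw [mul_pow, inv_pow]; field_simp

variable (hP : P.IsAdmissible) (hϰ : 1 ≤ ϰ) (hXY : P.IsLimitOscillation X₀ Y₀)
include hP hϰ hXY

lemma weight_bound {α : ℝ² → ℝ} (hα : PeriodicWeight α) (φ₀ : ℝ) : ∃ B, 0 ≤ B ∧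
    ∀ e ∈ Icc (0 : ℝ) 1, ∀ r ∈ Icc (-1 : ℝ) 1, ∀ θ ∈ Icc (φ₀ - 1) (φ₀ + 1), ∀ ζ,
      |α (θ + ζ / ϰ, C.zz ϰ e r)| ≤ B := by
  have hT : 0 < 2 * π * ϰ := by positivity
  obtain ⟨B, hB, h⟩ := (C.paramSmooth_forcingTerm hP hXY hϰ hα 0 0 0 0).exists_bound hT
    ((isCompact_Icc (a := (0 : ℝ)) (b := 1)).prod ((isCompact_Icc (a := (-1 : ℝ)) (b := 1)).prod
      (isCompact_Icc (a := φ₀ - 1) (b := φ₀ + 1))))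
  refine ⟨B, hB, fun e he r hr θ hθ ζ => ?_⟩
  simpa [forcingTerm] using h (e, r, θ) ⟨he, hr, hθ⟩ ζ

lemma forcing_close (hσ : P.SigmaCondition) (hfg : P.HasPowerAsymptotics) (φ₀ : ℝ) (n : ℕ) :
    ∃ m₁ : ℕ, ∀ m ≥ m₁, ∀ w : (ℝ² → ℝ) × (ℝ² → ℝ), PeriodicWeight w.1 → PeriodicWeight w.2 →
      ∃ K, 0 ≤ K ∧ ∃ e₀, 0 < e₀ ∧ ∀ e ∈ Ioc 0 e₀, ∀ r ∈ Icc (-1 : ℝ) 1,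
        ∀ θ ∈ Icc (φ₀ - 1) (φ₀ + 1), ∀ ζ,
          |C.scaledForcing ϰ w e r θ ζ - C.forcing ϰ m w (e, r, θ) ζ| ≤ K * e ^ n := by
  obtain ⟨mf, hf⟩ := hfg.f_asymp
  obtain ⟨mg, hg⟩ := hfg.g_asymp
  refine ⟨n + 2 * P.M + 2 * P.b * P.h * mf + 2 * P.b * P.h * mg, fun m hm w hw1 hw2 => ?_⟩
  obtain ⟨Bw1, hBw1, hw1⟩ := C.weight_bound hP hϰ hXY hw1 φ₀
  obtain ⟨Bw2, hBw2, hw2⟩ := C.weight_bound hP hϰ hXY hw2 φ₀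
  obtain ⟨BX, hBX, hX⟩ := C.weight_bound hP hϰ hXY ⟨C.contDiff_Xs hXY, C.Xs_periodic hXY⟩ φ₀
  obtain ⟨BY, hBY, hY⟩ := C.weight_bound hP hϰ hXY ⟨C.contDiff_Ys hXY, C.Ys_periodic hXY⟩ φ₀
  obtain ⟨Bz, hBz, hz⟩ := C.weight_bound hP hϰ hXY (α := fun p => p.2) ⟨by fun_prop, fun _ _ => rfl⟩ φ₀
  obtain ⟨A, hA, hv⟩ : ∃ A, 0 < A ∧ ∀ e ∈ Icc (0 : ℝ) 1, ∀ r ∈ Icc (-1 : ℝ) 1, A ≤ C.v ϰ e r := by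
    obtain ⟨p, -, hp⟩ := ((isCompact_Icc (a := (0 : ℝ)) (b := 1)).prod
      (isCompact_Icc (a := (-1 : ℝ)) (b := 1))).exists_isMinOn ⟨(0, 0), by simp⟩
      (C.contDiff_v (ϰ := ϰ)).continuous.continuousOn
    exact ⟨_, C.v_pos hP hϰ p.1 p.2, fun e he r hr => hp (show (e, r) ∈ _ from ⟨he, hr⟩)⟩
  obtain ⟨Kf, hKf, ef, hef, hf⟩ := expansion_bound hP hf hA (B := max BX BY) (n + 2 * P.M) m (by omega)
  obtain ⟨Kg, hKg, eg, heg, hg⟩ := expansion_bound hP hg hA (B := max BX BY) (n + 2 * P.M) m (by omega)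
  refine ⟨Kf * (Bz * Bw1) + Kg * (Bz ^ P.h * Bw2), by positivity, min 1 (min ef eg), by positivity,
    fun e he r hr θ hθ ζ => ?_⟩
  obtain ⟨he0, he2⟩ := he
  simp only [le_min_iff] at he2
  obtain ⟨he1, hef, heg⟩ := he2
  have heI : e ∈ Icc (0 : ℝ) 1 := ⟨he0.le, he1⟩
  have hX := (hX e heI r hr θ hθ ζ).trans (le_max_left BX BY)
  have hY := (hY e heI r hr θ hθ ζ).trans (le_max_right BX BY)
  have hf := hf e ⟨he0, hef⟩ _ _ ζ _ _
    (hv e heI r hr) rfl hX hY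
  have hg := hg e ⟨he0, heg⟩ _ _ ζ _ _
    (hv e heI r hr) rfl hX hY
  have hw1 := hw1 e heI r hr θ hθ ζ
  have hw2 := hw2 e heI r hr θ hθ ζ
  have hz := hz e heI r hr θ hθ ζ
  have hF := C.pow_mul_forcing hP hϰ hσ hfg (r := r) (θ := θ) (ζ := ζ) he0 m w
  have hpM : 0 < e ^ (2 * P.M) := by positivity
  rw [mul_comm, ← eq_div_iff hpM.ne', mul_div_right_comm] at hF
  rw [hF, scaledForcing, fullForcing, zz] at *
  rw [← mul_sub, abs_mul]
  generalize P.f _ _ _ _ = f at *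
  generalize P.g _ _ _ _ = g at *
  generalize ∑ k ∈ range m, e ^ (2 * (P.h - 1) * k) * P.fk k _ _ ζ = f' at *
  generalize ∑ k ∈ range m, e ^ (2 * (P.h - 1) * k) * P.gk k _ _ ζ = g' at *
  generalize w.1 _ = α at *
  generalize w.2 _ = β at *
  generalize e ^ (2 * P.b) * C.v ϰ e r = z at *
  have e1 : f * (z * α) + g * (z ^ P.h * β) - (f' * (z * α) + g' * (z ^ P.h * β)) =
    (f - f') * (z * α) + (g - g') * (z ^ P.h * β) := by ring
  have e2 : |f * (z * α) + g * (z ^ P.h * β) - (f' * (z * α) + g' * (z ^ P.h * β))| ≤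
      Kf * e ^ (n + 2 * P.M) * (Bz * Bw1) + Kg * e ^ (n + 2 * P.M) * (Bz ^ P.h * Bw2) := by
    rw [e1]
    refine (abs_add_le _ _).trans (add_le_add ?_ ?_)
    · rw [abs_mul, abs_mul]; gcongr
    · rw [abs_mul, abs_mul, abs_pow]; gcongr
  have e3 : |e ^ (2 * (P.a + P.b) * (P.h - 1)) / e ^ (2 * P.M)| ≤ 1 / e ^ (2 * P.M) := by
    rw [abs_of_pos (by positivity)]; gcongr
    exact pow_le_one₀ he0.le he1
  refine (mul_le_mul e3 e2 (abs_nonneg _) (by positivity)).trans_eq ?_; rw [pow_add]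
  field_simp

lemma exists_field_close (hσ : P.SigmaCondition) (hfg : P.HasPowerAsymptotics) (φ₀ : ℝ) (n : ℕ) :
    ∃ m ≥ n, ∃ K, 0 ≤ K ∧ ∃ ε₀, 0 < ε₀ ∧ ∀ ε ∈ Ioc 0 ε₀, ∀ r ∈ Icc (-1 : ℝ) 1,
        ∀ θ ∈ Icc (φ₀ - 1) (φ₀ + 1), ∀ ζ,
      |P.ratio ^ P.M * C.fieldA ϰ (C.scaledForcing ϰ C.wF (P.ratio * ε) r θ ζ) (P.ratio * ε) r
        - C.hatA ϰ m (ε, r, θ) ζ| ≤ K * ε ^ n ∧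
      |P.ratio ^ P.M * C.fieldB ϰ (C.scaledForcing ϰ C.wG (P.ratio * ε) r θ ζ) (P.ratio * ε) r
        - C.hatB ϰ m (ε, r, θ) ζ| ≤ K * ε ^ n := by
  obtain ⟨m₁, hm₁⟩ := C.forcing_close hP hϰ hXY hσ hfg φ₀ n
  obtain ⟨KA, hKA, eA, heA, hA⟩ := hm₁ (max m₁ n) (le_max_left _ _) C.wF
    (C.periodicWeight_wF hXY).1 (C.periodicWeight_wF hXY).2
  obtain ⟨KB, hKB, eB, heB, hB⟩ := hm₁ (max m₁ n) (le_max_left _ _) C.wG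
    (C.periodicWeight_wG hXY).1 (C.periodicWeight_wG hXY).2
  have hk := ratio_pos hP
  refine ⟨max m₁ n, le_max_right _ _, P.ratio ^ P.M * (KA + KB) * P.ratio ^ n, by positivity,
    min 1 (min eA eB) / P.ratio, by positivity, fun ε hε r hr θ hθ ζ => ?_⟩
  have hh := hP.two_le_h
  have hε0 := hε.1
  have hle := (le_div_iff₀' hk).1 hε.2
  simp only [le_min_iff] at hle
  obtain ⟨he1, hlA, hlB⟩ := hle
  have he0 : 0 < P.ratio * ε := by positivity
  have hA := hA (P.ratio * ε) ⟨he0, hlA⟩ r hr θ hθ ζ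
  have hB := hB (P.ratio * ε) ⟨he0, hlB⟩ r hr θ hθ ζ
  have hρ := C.rho_mem (P.ratio * ε) r
  have hρ' : |C.rho (P.ratio * ε) r / (2 * P.h)| ≤ 1 := by
    have h2 : (2 : ℝ) ≤ P.h := by exact_mod_cast hh
    rw [abs_of_pos (div_pos (C.rho_pos _ _) (by linarith)), div_le_one (by linarith)]
    linarith [hρ.2]
  have hM' : |(P.ratio * ε) ^ P.M| ≤ 1 := by
    rw [abs_of_pos (by positivity)]; exact pow_le_one₀ he0.le he1
  simp only [hatA, hatB, fieldA, fieldB]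
  rw [← mul_sub, ← mul_sub, add_sub_add_left_eq_sub, add_sub_add_right_eq_sub, ← mul_sub, ← mul_sub,
    sub_sub_sub_cancel_right, abs_mul, abs_mul, abs_mul, abs_mul, abs_of_pos (pow_pos hk P.M)]
  have e1 : P.ratio ^ P.M * (KA + KB) * P.ratio ^ n * ε ^ n =
    P.ratio ^ P.M * (1 * ((KA + KB) * (P.ratio * ε) ^ n)) := by rw [mul_pow]; ring
  rw [e1]
  constructor
  · gcongr
    exact hA.trans (by gcongr; linarith)
  · gcongr
    exact hB.trans (by gcongr; linarith)

end ResonantChart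

end PerturbedSystem

section Trapping

variable {E : Type} [NormedAddCommGroup E] [NormedSpace ℝ E] {V : ℝ → E → E} {a : ℝ}

lemma eqOn_Icc_of_hasDerivWithinAt {b : ℝ}
    (hV : ∀ R : ℝ, ∃ K, ∀ t ∈ Icc a b, LipschitzOnWith K (V t) (Metric.closedBall 0 R))
    {γ γ' : ℝ → E} (h : ∀ t ∈ Icc a b, HasDerivWithinAt γ (V t (γ t)) (Icc a b) t)
    (h' : ∀ t ∈ Icc a b, HasDerivWithinAt γ' (V t (γ' t)) (Icc a b) t) (h0 : γ a = γ' a) :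
    EqOn γ γ' (Icc a b) := by
  have hc : ContinuousOn γ (Icc a b) := fun t ht => (h t ht).continuousWithinAt
  have hc' : ContinuousOn γ' (Icc a b) := fun t ht => (h' t ht).continuousWithinAt
  obtain ⟨R, hR⟩ := isCompact_Icc.exists_bound_of_continuousOn hc
  obtain ⟨R', hR'⟩ := isCompact_Icc.exists_bound_of_continuousOn hc'
  obtain ⟨K, hK⟩ := hV (max R R')
  have hm : ∀ t ∈ Ico a b, Icc a b ∈ 𝓝[≥] t := fun t ht =>
    mem_of_superset (Icc_mem_nhdsGE ht.2) (Icc_subset_Icc_left ht.1)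
  refine ODE_solution_unique_of_mem_Icc_right (v := V) (s := fun _ => Metric.closedBall 0 (max R R'))
    (fun t ht => hK t (Ico_subset_Icc_self ht)) hc
    (fun t ht => (h t (Ico_subset_Icc_self ht)).mono_of_mem_nhdsWithin (hm t ht)) (fun t ht => ?_) hc'
    (fun t ht => (h' t (Ico_subset_Icc_self ht)).mono_of_mem_nhdsWithin (hm t ht)) (fun t ht => ?_) h0
  · exact mem_closedBall_zero_iff.2 ((hR t (Ico_subset_Icc_self ht)).trans (le_max_left _ _))
  · exact mem_closedBall_zero_iff.2 ((hR' t (Ico_subset_Icc_self ht)).trans (le_max_right _ _))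

/-- Global existence for an equation with a bounded Lipschitz right-hand side. -/
lemma exists_solution_Ici [CompleteSpace E] (hV : ∀ b, ∃ K, ∀ t ∈ Icc a b, LipschitzWith K (V t))
    (hb : ∀ b, ∃ B : NNReal, ∀ t ∈ Icc a b, ∀ x, ‖V t x‖ ≤ B)
    (hc : ∀ x, ContinuousOn (fun t => V t x) (Ici a)) (x₀ : E) :
    ∃ γ : ℝ → E, γ a = x₀ ∧ ∀ t ∈ Ici a, HasDerivWithinAt γ (V t (γ t)) (Ici a) t := by
  have hex : ∀ n : ℕ, ∃ γ : ℝ → E, γ a = x₀ ∧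
      ∀ t ∈ Icc a (a + n), HasDerivWithinAt γ (V t (γ t)) (Icc a (a + n)) t := fun n => by
    obtain ⟨K, hK⟩ := hV (a + n)
    obtain ⟨B, hB⟩ := hb (a + n)
    have hn : a ≤ a + n := by simp
    have hPL : IsPicardLindelof V (⟨a, le_rfl, hn⟩ : Icc a (a + n)) x₀ (B * n) 0 B K :=
      { lipschitzOnWith := fun t ht => (hK t ht).lipschitzOnWith
        continuousOn := fun x _ => (hc x).mono Icc_subset_Ici_self
        norm_le := fun t ht x _ => hB t ht x
        mul_max_le := by simp }
    exact hPL.exists_eq_forall_mem_Icc_hasDerivWithinAt₀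
  choose γ h0 hγ using hex
  have huniq : ∀ m n : ℕ, m ≤ n → EqOn (γ m) (γ n) (Icc a (a + m)) := fun m n hmn => by
    have hs : Icc a (a + m) ⊆ Icc a (a + n) := Icc_subset_Icc_right (by simpa using hmn)
    obtain ⟨K, hK⟩ := hV (a + m)
    exact eqOn_Icc_of_hasDerivWithinAt (fun R => ⟨K, fun t ht => (hK t ht).lipschitzOnWith⟩) (hγ m)
      (fun t ht => (hγ n t (hs ht)).mono hs) ((h0 m).trans (h0 n).symm)
  have heq : ∀ n : ℕ, ∀ t ∈ Icc a (a + n), γ ⌈t - a⌉₊ t = γ n t := fun n t ht =>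
    huniq _ n (Nat.ceil_le.2 (by linarith [ht.2])) ⟨ht.1, by linarith [Nat.le_ceil (t - a)]⟩
  refine ⟨fun t => γ ⌈t - a⌉₊ t, by simpa using h0 0, fun t ht => ?_⟩
  obtain ⟨n, hn⟩ := exists_nat_gt (t - a)
  have ht' : t ∈ Icc a (a + n) := ⟨ht, by linarith⟩
  have hm : Icc a (a + n) ∈ 𝓝[Ici a] t :=
    mem_nhdsWithin.2 ⟨Iio (a + n), isOpen_Iio, by rw [mem_Iio]; linarith, fun x hx => ⟨hx.2, hx.1.le⟩⟩
  show HasDerivWithinAt _ (V t (γ ⌈t - a⌉₊ t)) _ _; rw [heq n t ht']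
  refine ((hγ n t ht').mono_of_mem_nhdsWithin hm).congr_of_eventuallyEq ?_ (heq n t ht')
  filter_upwards [hm] with s hs using heq n s hs

/-- A solution that cannot reach the boundary of a region exists for all times. -/
lemma exists_trapped_solution [CompleteSpace E] {pr : E → E} {g : ℝ → E → ℝ}
    (hV : ∀ b, ∃ K, ∀ t ∈ Icc a b, LipschitzWith K fun x => V t (pr x))
    (hb : ∀ b, ∃ B : NNReal, ∀ t ∈ Icc a b, ∀ x, ‖V t (pr x)‖ ≤ B)
    (hc : ∀ x, ContinuousOn (fun t => V t (pr x)) (Ici a))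
    (hg : ContinuousOn (fun p : ℝ × E => g p.1 p.2) (Ici a ×ˢ univ))
    (hpr : ∀ t ≥ a, ∀ x, g t x ≤ 1 → pr x = x) {x₀ : E} (hx₀ : g a x₀ ≤ 1)
    (htrap : ∀ b ≥ a, ∀ γ : ℝ → E, γ a = x₀ →
      (∀ t ∈ Icc a b, g t (γ t) ≤ 1 ∧ HasDerivWithinAt γ (V t (γ t)) (Icc a b) t) →
      ∀ t ∈ Icc a b, g t (γ t) ≤ 3 / 4) :
    ∃ γ : ℝ → E, γ a = x₀ ∧
      ∀ t ∈ Ici a, g t (γ t) ≤ 1 ∧ HasDerivWithinAt γ (V t (γ t)) (Ici a) t := by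
  obtain ⟨γ, h0, hγ⟩ := exists_solution_Ici hV hb hc x₀
  have hγc : ContinuousOn γ (Ici a) := fun t ht => (hγ t ht).continuousWithinAt
  have hgc : ContinuousOn (fun t => g t (γ t)) (Ici a) :=
    hg.comp (continuousOn_id.prodMk hγc) fun t ht => ⟨ht, mem_univ _⟩
  have key : ∀ b ≥ a, (∀ t ∈ Icc a b, g t (γ t) ≤ 1) → g b (γ b) ≤ 3 / 4 := fun b hb hle =>
    htrap b hb γ h0 (fun t ht => ⟨hle t ht, by
      have := (hγ t ht.1).mono Icc_subset_Ici_self (s := Icc a b)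
      rwa [hpr t ht.1 _ (hle t ht)] at this⟩) b ⟨hb, le_rfl⟩
  have hlt : ∀ t ≥ a, g t (γ t) < 1 := by
    by_contra! hne
    obtain ⟨t₁, ht₁, h1⟩ := hne
    have ha : g a (γ a) < 1 := by
      have := key a le_rfl (fun t ht => by
        rw [show t = a from le_antisymm ht.2 ht.1, h0]; exact hx₀)
      linarith
    set S := Icc a t₁ ∩ (fun t => g t (γ t)) ⁻¹' Ici 1
    have hSc : IsClosed S :=
      (hgc.mono Icc_subset_Ici_self).preimage_isClosed_of_isClosed isClosed_Icc isClosed_Ici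
    have hbd : BddBelow S := ⟨a, fun t ht => ht.1.1⟩
    have hc := hSc.csInf_mem ⟨t₁, ⟨ht₁, le_rfl⟩, h1⟩ hbd
    set c := sInf S
    have hlt : ∀ t ∈ Ico a c, g t (γ t) < 1 := fun t ht => by
      by_contra! h
      exact absurd (csInf_le hbd (show t ∈ S from ⟨⟨ht.1, ht.2.le.trans hc.1.2⟩, h⟩)) (not_le.2 ht.2)
    have hac : a < c := lt_of_le_of_ne hc.1.1 fun h => by
      have h2 : 1 ≤ g c (γ c) := hc.2; rw [← h] at h2; linarith
    have hle : g c (γ c) ≤ 1 := by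
      have h3 : ContinuousWithinAt (fun t => g t (γ t)) (Ico a c) c :=
        (hgc c hc.1.1).mono Ico_subset_Ici_self
      have := right_nhdsWithin_Ico_neBot hac
      exact le_of_tendsto h3 (eventually_mem_nhdsWithin.mono fun t ht => (hlt t ht).le)
    have := key c hc.1.1 fun t ht => by
      rcases ht.2.lt_or_eq with h | h
      · exact (hlt t ⟨ht.1, h⟩).le
      · rw [h]; exact hle
    have h2 : 1 ≤ g c (γ c) := hc.2; linarith
  refine ⟨γ, h0, fun t ht => ⟨(hlt t ht).le, ?_⟩⟩
  have := hγ t ht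
  rwa [hpr t ht _ (hlt t ht).le] at this

end Trapping

namespace PerturbedSystem

variable {P : PerturbedSystem} {X₀ Y₀ : ℝ → ℝ}

/-- The small parameter `t ^ (-1/(2q(h-1)))` as a function of `τ`. -/
def small (P : PerturbedSystem) (τ : ℝ) : ℝ := P.ratio * τ ^ (-(1 / (P.N : ℝ)))

section time

variable (hP : P.IsAdmissible)
include hP

lemma small_pos {τ : ℝ} (hτ : 0 < τ) : 0 < P.small τ :=
  mul_pos (ratio_pos hP) (rpow_pos_of_pos hτ _)

lemma time_eq {τ : ℝ} (hτ : 0 < τ) : P.time τ = (P.small τ ^ (2 * P.q * (P.h - 1)))⁻¹ := by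
  rw [small, ← time_inv_pow hP (rpow_pos_of_pos hτ _), rpow_neg hτ.le, inv_pow, one_div,
    rpow_inv_natCast_pow hτ.le (N_pos hP).ne', inv_inv]

lemma time_pos {τ : ℝ} (hτ : 0 < τ) : 0 < P.time τ :=
  rpow_pos_of_pos (mul_pos (nu_pos hP) hτ) _

lemma time_rpow {t : ℝ} (ht : 0 < t) : P.time (t ^ P.nu / P.nu) = t := by
  have := nu_pos hP
  rw [time, mul_div_cancel₀ _ this.ne', ← rpow_mul ht.le, mul_one_div_cancel this.ne',
    rpow_one]

lemma rpow_time {τ : ℝ} (hτ : 0 < τ) : P.time τ ^ P.nu / P.nu = τ := by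
  have := nu_pos hP
  rw [time, ← rpow_mul (mul_pos this hτ).le, one_div_mul_cancel this.ne', rpow_one,
    mul_div_cancel_left₀ _ this.ne']

lemma S_eq (t : ℝ) : P.S t = P.vartheta * (t ^ P.nu / P.nu) := by
  have := nu_pos hP
  rw [S, vartheta, ← nu_eq]; field_simp

lemma hasDerivAt_phaseTime {t : ℝ} (ht : 0 < t) :
    HasDerivAt (fun t : ℝ => t ^ P.nu / P.nu) (t ^ (1 - P.nu))⁻¹ t := by
  have := nu_pos hP
  refine ((hasDerivAt_rpow_const (p := P.nu) (Or.inl ht.ne')).div_const P.nu).congr_deriv ?_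
  rw [← rpow_neg ht.le, neg_sub]; field_simp

end time

lemma hasDerivAt_H (hh : 2 ≤ P.h) (x y : ℝ) :
    deriv (fun v => P.H x v) y = y ∧ deriv (fun v => P.H v y) x = P.dU x := by
  constructor
  · refine HasDerivAt.deriv ?_
    exact (((hasDerivAt_pow 2 y).div_const 2).add_const (P.U x)).congr_deriv (by norm_num)
  · exact ((hasDerivAt_U P hh x).const_add (y ^ 2 / 2)).deriv

namespace ResonantChart

variable (C : P.ResonantChart X₀ Y₀)

/-- The derivatives of the original variables with respect to the angle and the action. -/
lemma hasStrictFDerivAt_chart (hP : P.IsAdmissible) (hXY : P.IsLimitOscillation X₀ Y₀) (φ : ℝ)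
    {z : ℝ} (hz : z ∈ Ioo 0 C.z₀) : ∃ (Lx Ly : ℝ² →L[ℝ] ℝ) (A B : ℝ),
      HasStrictFDerivAt (fun p : ℝ² => C.Xs p / p.2) Lx (φ, z) ∧
      HasStrictFDerivAt (fun p : ℝ² => C.Ys p / p.2 ^ P.h) Ly (φ, z) ∧
      (∀ u v, Lx (u, v) = C.Ys (φ, z) / z ^ P.h * (z ^ (P.h - 1) / C.om z) * u + A * v) ∧
      (∀ u v, Ly (u, v) = -P.dU (C.Xs (φ, z) / z) * (z ^ (P.h - 1) / C.om z) * u + B * v) ∧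
      P.dU (C.Xs (φ, z) / z) * A + C.Ys (φ, z) / z ^ P.h * B = -(2 * P.h / z ^ (2 * P.h + 1)) ∧
      C.wG.1 (φ, z) = -(C.om z * z ^ (P.h + 1) * B / (2 * P.h)) ∧
      C.wG.2 (φ, z) = C.om z * z ^ 2 * A / (2 * P.h) := by
  have hh := hP.two_le_h
  have hz0 := hz.1
  have hX := C.contDiff_Xs hXY
  have hY := C.contDiff_Ys hXY
  have hdX := hasDerivAt_snd₂ (hX.diff) φ z
  have hdY := hasDerivAt_snd₂ (hY.diff) φ z
  have cX : ContDiffAt ℝ ∞ (fun p : ℝ² => C.Xs p / p.2) (φ, z) :=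
    hX.contDiffAt.div contDiffAt_snd hz0.ne'
  have cY : ContDiffAt ℝ ∞ (fun p : ℝ² => C.Ys p / p.2 ^ P.h) (φ, z) :=
    hY.contDiffAt.div (contDiffAt_snd.pow _) (pow_pos hz0 _).ne'
  have sX := cX.hasStrictFDerivAt (by simp)
  have sY := cY.hasStrictFDerivAt (by simp)
  set Lx := 𝒟 (fun p : ℝ² => C.Xs p / p.2) (φ, z)
  set Ly := 𝒟 (fun p : ℝ² => C.Ys p / p.2 ^ P.h) (φ, z)
  have l1 : HasDerivAt (fun u : ℝ => (u, z)) ((1, 0) : ℝ²) φ :=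
    (hasDerivAt_id φ).prodMk (hasDerivAt_const φ z)
  have l2 : HasDerivAt (fun v : ℝ => (φ, v)) ((0, 1) : ℝ²) z :=
    (hasDerivAt_const z φ).prodMk (hasDerivAt_id z)
  have x1' : HasDerivAt (fun u => C.Xs (u, z) / z) (Lx (1, 0)) φ :=
    HasFDerivAt.comp_hasDerivAt (f := fun u : ℝ => (u, z)) φ sX.hasFDerivAt l1
  have y1' : HasDerivAt (fun u => C.Ys (u, z) / z ^ P.h) (Ly (1, 0)) φ :=
    HasFDerivAt.comp_hasDerivAt (f := fun u : ℝ => (u, z)) φ sY.hasFDerivAt l1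
  have x1 := x1'.unique (C.aa.deriv_X z ⟨hz0, hz.2.le⟩ φ)
  have y1 := y1'.unique (C.aa.deriv_Y z ⟨hz0, hz.2.le⟩ φ)
  have x2 : HasDerivAt (fun v => C.Xs (φ, v) / v) (Lx (0, 1)) z :=
    sX.hasFDerivAt.comp_hasDerivAt z l2
  have y2 : HasDerivAt (fun v => C.Ys (φ, v) / v ^ P.h) (Ly (0, 1)) z :=
    sY.hasFDerivAt.comp_hasDerivAt z l2
  have x3 := x2.unique (hdX.div (hasDerivAt_id z) hz0.ne')
  have y3 := y2.unique (hdY.div (hasDerivAt_pow P.h z) (pow_pos hz0 _).ne')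
  have lin : ∀ (L : ℝ² →L[ℝ] ℝ) (u v : ℝ), L (u, v) = L (1, 0) * u + L (0, 1) * v := by
    intro L u v
    rw [show ((u, v) : ℝ²) = u • (1, 0) + v • (0, 1) by simp, map_add, map_smul, map_smul,
      smul_eq_mul, smul_eq_mul]
    ring
  have en : P.dU (C.Xs (φ, z) / z) * Lx (0, 1) + C.Ys (φ, z) / z ^ P.h * Ly (0, 1)
      = -(2 * P.h / z ^ (2 * P.h + 1)) := by
    have h1 : HasDerivAt (fun v => (C.Ys (φ, v) / v ^ P.h) ^ 2 / 2 + P.U (C.Xs (φ, v) / v))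
        (C.Ys (φ, z) / z ^ P.h * Ly (0, 1) + P.dU (C.Xs (φ, z) / z) * Lx (0, 1)) z := by
      refine (((y2.pow 2).div_const 2).add ((hasDerivAt_U P hh _).comp z x2)).congr_deriv ?_
      push_cast; ring
    have h2 : HasDerivAt (fun v => (v ^ (2 * P.h))⁻¹)
        (-((2 * P.h : ℕ) * z ^ (2 * P.h - 1)) / (z ^ (2 * P.h)) ^ 2) z :=
      (hasDerivAt_pow (2 * P.h) z).inv (pow_pos hz0 _).ne'
    have h3 := h1.congr_of_eventuallyEq (f₁ := fun v => (v ^ (2 * P.h))⁻¹) (by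
      filter_upwards [Ioo_mem_nhds hz0 hz.2] with v hv
      exact (C.aa.energy v ⟨hv.1, hv.2.le⟩ φ).symm)
    rw [add_comm, h3.unique h2]
    have e : z ^ (2 * P.h) = z ^ (2 * P.h - 1) * z := by rw [← pow_succ]; congr 1; omega
    have e' : z ^ (2 * P.h + 1) = z ^ (2 * P.h - 1) * z ^ 2 := by rw [pow_succ, e]; ring
    rw [e', e]; push_cast; field_simp
  refine ⟨Lx, Ly, Lx (0, 1), Ly (0, 1), sX, sY, fun u v => ?_, fun u v => ?_, en, ?_, ?_⟩
  · rw [lin, x1]; rfl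
  · rw [lin, y1]; rfl
  · have e : z ^ P.h = z ^ (P.h - 1) * z := by rw [← pow_succ]; congr 1; omega
    rw [y3]; simp only [wG]; rw [pow_succ, e]; field_simp; ring
  · rw [x3]; simp only [wG]; field_simp; ring

def toXY (p : ℝ²) : ℝ² := (C.Xs p / p.2, C.Ys p / p.2 ^ P.h)

/-- The equations of motion in action-angle variables yield those in the original variables. -/
lemma hasDerivWithinAt_toXY (hP : P.IsAdmissible) (hXY : P.IsLimitOscillation X₀ Y₀)
    {φ z : ℝ → ℝ} {s : Set ℝ} {t T f g : ℝ} (hz : z t ∈ Ioo 0 C.z₀)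
    (hφ' : HasDerivWithinAt φ (C.om (z t) / z t ^ (P.h - 1) + T * (f * (z t * C.wG.1 (φ t, z t)) +
      g * (z t ^ P.h * C.wG.2 (φ t, z t)))) s t)
    (hz' : HasDerivWithinAt z (-(z t / (2 * P.h) * (T * (f * (z t * C.wF.1 (φ t, z t)) +
      g * (z t ^ P.h * C.wF.2 (φ t, z t)))))) s t) :
    HasDerivWithinAt (fun t => (C.toXY (φ t, z t)).1) ((C.toXY (φ t, z t)).2 + T * f) s t ∧
    HasDerivWithinAt (fun t => (C.toXY (φ t, z t)).2)
      (-P.dU (C.toXY (φ t, z t)).1 + T * g) s t := by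
  obtain ⟨Lx, Ly, A, B, sX, sY, hLx, hLy, en, w1, w2⟩ := C.hasStrictFDerivAt_chart hP hXY (φ t) hz
  have hh := hP.two_le_h
  have hz0 := hz.1
  have hU := C.dU_eq hh (φ t) hz0
  have ho := C.aa.om_pos (z t)
  have k1 := sX.hasFDerivAt.comp_hasDerivWithinAt t (hφ'.prodMk hz')
  have k2 := sY.hasFDerivAt.comp_hasDerivWithinAt t (hφ'.prodMk hz')
  have e1 : z t ^ (2 * P.h + 1) = z t ^ (2 * P.h - 1) * z t * z t := by
    rw [← pow_succ, ← pow_succ]; congr 1; omega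
  have e2 : z t ^ (2 * P.h + 1) = z t ^ P.h * z t ^ P.h * z t := by
    rw [← pow_add, ← pow_succ]; congr 1; omega
  have e3 : z t ^ P.h = z t ^ (P.h - 1) * z t := by rw [← pow_succ]; congr 1; omega
  have hU' : z t * (z t * C.wF.1 (φ t, z t)) = z t ^ (2 * P.h + 1) *
      P.dU (C.Xs (φ t, z t) / z t) := by
    rw [hU, e1, wF]; field_simp
  have hY' : z t * (z t ^ P.h * C.wF.2 (φ t, z t)) = z t ^ (2 * P.h + 1) *
      (C.Ys (φ t, z t) / z t ^ P.h) := by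
    rw [e2, wF]; field_simp
  have e4 : z t ^ (P.h - 1) / C.om (z t) * (C.om (z t) / z t ^ (P.h - 1)) = 1 := by
    have := pow_pos hz0 (P.h - 1); field_simp
  have e5 : z t ^ (P.h - 1) / C.om (z t) * (z t * C.wG.1 (φ t, z t)) =
      -(z t ^ (2 * P.h + 1) * B / (2 * P.h)) := by
    rw [w1, e2, pow_succ, e3]; field_simp
  have e6 : z t ^ (P.h - 1) / C.om (z t) * (z t ^ P.h * C.wG.2 (φ t, z t)) =
      z t ^ (2 * P.h + 1) * A / (2 * P.h) := by
    rw [w2, e2, e3]; field_simp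
  have e7 : z t ^ (2 * P.h + 1) / (2 * P.h) * (P.dU (C.Xs (φ t, z t) / z t) * A +
      C.Ys (φ t, z t) / z t ^ P.h * B) = -1 := by
    rw [en]
    have := pow_pos hz0 (2 * P.h + 1); field_simp
  refine ⟨k1.congr_deriv ?_, k2.congr_deriv ?_⟩
  all_goals
    simp only [hLx, hLy, toXY]; clear k1 k2
    generalize z t ^ (P.h - 1) / C.om (z t) = q at *
    generalize C.om (z t) / z t ^ (P.h - 1) = q' at *
    generalize C.Xs (φ t, z t) / z t = x at *
    generalize C.Ys (φ t, z t) / z t ^ P.h = y at *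
    generalize C.wG.1 (φ t, z t) = g1 at *
    generalize C.wG.2 (φ t, z t) = g2 at *
    generalize C.wF.1 (φ t, z t) = f1 at *
    generalize C.wF.2 (φ t, z t) = f2 at *
  · linear_combination y * e4 + y * T * f * e5 + y * T * g * e6 - A / (2 * P.h) * T * f * hU' -
      A / (2 * P.h) * T * g * hY' - T * f * e7
  · linear_combination -P.dU x * e4 - P.dU x * T * f * e5 - P.dU x * T * g * e6 -
      B / (2 * P.h) * T * f * hU' - B / (2 * P.h) * T * g * hY' - T * g * e7

variable (ϰ : ℕ)

lemma pow_mul_scaledForcing {ϰ : ℕ} {e : ℝ} (he : 0 < e) (w : (ℝ² → ℝ) × (ℝ² → ℝ))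
    (r θ ζ : ℝ) : e ^ (2 * P.M) * C.scaledForcing ϰ w e r θ ζ =
      e ^ (2 * (P.a + P.b) * (P.h - 1)) * C.fullForcing ϰ w e r (θ + ζ / ϰ) ζ := by
  have := pow_pos he (2 * P.M); rw [scaledForcing]; field_simp

/-- The equations of motion in the resonance variables. -/
def field (τ : ℝ) (p : ℝ²) : ℝ² :=
  (P.small τ ^ P.M * C.fieldA ϰ (C.scaledForcing ϰ C.wF (P.small τ) p.1 p.2 (P.vartheta * τ))
      (P.small τ) p.1,
    P.small τ ^ P.M * C.fieldB ϰ (C.scaledForcing ϰ C.wG (P.small τ) p.1 p.2 (P.vartheta * τ))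
      (P.small τ) p.1)

/-- The action-angle variables in terms of the resonance variables. -/
def angleAction (τ : ℝ) (p : ℝ²) : ℝ² := (p.2 + P.vartheta * τ / ϰ, C.zz ϰ (P.small τ) p.1)

variable {ϰ}

lemma time_inv (hP : P.IsAdmissible) {t : ℝ} (ht : 0 < t) :
    t = (P.small (t ^ P.nu / P.nu) ^ (2 * P.q * (P.h - 1)))⁻¹ := by
  have := nu_pos hP
  rw [← time_eq hP (by positivity), time_rpow hP ht]

lemma zz_time (hP : P.IsAdmissible) (hσ : P.SigmaCondition) {t r : ℝ} (ht : 0 < t)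
    (hg : C.Good ϰ (P.small (t ^ P.nu / P.nu)) r) : C.zz ϰ (P.small (t ^ P.nu / P.nu)) r =
      P.scale ϰ * t ^ (-P.beta) * C.Zu (P.scale ϰ * t ^ (-P.beta)) / (1 + t ^ (-P.mu) * r) := by
  have e1 := inv_pow_rpow_neg_beta hP hg.1
  have e2 := inv_pow_rpow_neg_mu hP hσ hg.1
  rw [← time_inv hP ht] at e1 e2
  rw [e1, e2, zz, v, vs, hg.rho_eq]; ring

/-- Solutions in the resonance variables yield solutions of the original system. -/
lemma isSolutionFrom (hP : P.IsAdmissible) (hσ : P.SigmaCondition) (hϰ : 1 ≤ ϰ)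
    (hMN : 2 * P.M ≤ P.N) (hXY : P.IsLimitOscillation X₀ Y₀) {γ : ℝ → ℝ²} {a : ℝ} (ha : 0 < a)
    (hγ : ∀ τ ∈ Ici a, C.Good ϰ (P.small τ) (γ τ).1 ∧
      HasDerivWithinAt γ (C.field ϰ τ (γ τ)) (Ici a) τ) :
    P.IsSolutionFrom (P.time a)
      (fun t => (C.toXY (C.angleAction ϰ (t ^ P.nu / P.nu) (γ (t ^ P.nu / P.nu)))).1)
      (fun t => (C.toXY (C.angleAction ϰ (t ^ P.nu / P.nu) (γ (t ^ P.nu / P.nu)))).2) := by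
  have hν := nu_pos hP
  have hta := time_pos hP ha
  have hpos : ∀ t ∈ Ici (P.time a), 0 < t := fun t ht => hta.trans_le ht
  have hmap : MapsTo (fun t : ℝ => t ^ P.nu / P.nu) (Ici (P.time a)) (Ici a) := fun t ht => by
    have : P.time a ^ P.nu / P.nu ≤ t ^ P.nu / P.nu := by have := mem_Ici.1 ht; gcongr
    rwa [rpow_time hP ha] at this
  intro t ht
  have ht0 := hpos t ht
  obtain ⟨hg, hd⟩ := hγ _ (hmap ht)
  have hd := hd.scomp t (hasDerivAt_phaseTime hP ht0).hasDerivWithinAt hmap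
  have hr := hasFDerivAt_fst.comp_hasDerivWithinAt t hd
  have hθ := hasFDerivAt_snd.comp_hasDerivWithinAt t hd
  have hh := hP.two_le_h
  rw [(hasDerivAt_H hh _ _).1, (hasDerivAt_H hh _ _).2]
  have hN := hasDerivAt_phaseTime hP ht0
  have hS := S_eq hP t
  have hzz := fun t ht => C.zz_time hP hσ (hpos t ht) (hγ _ (hmap ht)).1
  have hzt := hzz t ht
  refine C.hasDerivWithinAt_toXY hP hXY (φ := fun t => (C.angleAction ϰ (t ^ P.nu / P.nu)
    (γ (t ^ P.nu / P.nu))).1) (z := fun t => (C.angleAction ϰ (t ^ P.nu / P.nu)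
    (γ (t ^ P.nu / P.nu))).2) (hg.zz_mem hP hϰ) ?_ ?_
  · have h1 := hθ.add ((hN.const_mul P.vartheta).div_const (ϰ : ℝ)).hasDerivWithinAt
    refine h1.congr_deriv ?_
    have hΦ : P.small (t ^ P.nu / P.nu) ^ (2 * P.M) * C.scaledForcing ϰ C.wG _ _ _ _ = _ :=
      C.pow_mul_scaledForcing hg.1 C.wG (γ (t ^ P.nu / P.nu)).1 (γ (t ^ P.nu / P.nu)).2
        (P.vartheta * (t ^ P.nu / P.nu))
    have hF := fieldB_eq hP hϰ hg hΦ
    have he := hg.1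
    have n1 := inv_pow_rpow_one_sub_nu hP he
    have n2 := inv_pow_rpow_neg_div hP he P.a
    rw [← time_inv hP ht0] at n1 n2
    simp only [ContinuousLinearMap.coe_snd', field, angleAction, Prod.smul_snd, smul_eq_mul, toXY]
    rw [hF, fullForcing, ← time_inv hP ht0, hS, mul_pow, P.scale_pow hP, n1, n2, ← pow_mul,
      show 2 * P.b * (P.h - 1) = 2 * (P.h - 1) * P.b by ring]
    have hp1 := pow_pos he P.M
    have hp2 := pow_pos he (2 * (P.h - 1) * P.b)
    generalize P.small (t ^ P.nu / P.nu) = e at *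
    generalize e ^ P.M = m at *
    generalize e ^ (2 * (P.h - 1) * P.b) = n at *; field_simp; ring
  · have h2 : HasDerivWithinAt (fun t : ℝ => 1 + t ^ (-P.mu) * (γ (t ^ P.nu / P.nu)).1) _
        (Ici (P.time a)) t := (((hasDerivAt_rpow_const (p := -P.mu)
      (Or.inl ht0.ne')).hasDerivWithinAt (s := Ici (P.time a))).mul hr).const_add 1
    have hρ : 1 + t ^ (-P.mu) * (γ (t ^ P.nu / P.nu)).1 ≠ 0 := by
      have he := hg.1
      have e2 := inv_pow_rpow_neg_mu hP hσ he
      rw [← time_inv hP ht0] at e2; rw [e2, ← hg.rho_eq]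
      exact (C.rho_pos _ _).ne'
    have h1 := ((C.hasDerivAt_resonantAction ϰ ht0).hasDerivWithinAt.div h2 hρ).congr_of_mem hzz ht
    refine h1.congr_deriv ?_
    have hΦ : P.small (t ^ P.nu / P.nu) ^ (2 * P.M) * C.scaledForcing ϰ C.wF _ _ _ _ = _ :=
      C.pow_mul_scaledForcing hg.1 C.wF (γ (t ^ P.nu / P.nu)).1 (γ (t ^ P.nu / P.nu)).2
        (P.vartheta * (t ^ P.nu / P.nu))
    have hF := fieldA_eq (C := C) (ϰ := ϰ) (r := (γ (t ^ P.nu / P.nu)).1) hg.1 hMN hΦ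
    have he := hg.1
    have n1 := inv_pow_rpow_one_sub_nu hP he
    have n2 := inv_pow_rpow_neg_div hP he P.a
    have n3 := inv_pow_rpow_neg_mu hP hσ he
    have n4 := inv_pow_rpow_neg_beta hP he
    have n5 : t⁻¹ = P.small (t ^ P.nu / P.nu) ^ (2 * P.q * (P.h - 1)) := by
      rw [inv_eq_iff_eq_inv]; exact time_inv hP ht0
    rw [← time_inv hP ht0] at n1 n2 n3 n4
    have hρ' : C.rho (P.small (t ^ P.nu / P.nu)) (γ (t ^ P.nu / P.nu)).1 =
      1 + t ^ (-P.mu) * (γ (t ^ P.nu / P.nu)).1 := by rw [n3, hg.rho_eq]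
    rw [← n4, ← n5, hρ'] at hF
    simp only [Function.comp, ContinuousLinearMap.coe_fst', field, angleAction, Prod.smul_fst,
      smul_eq_mul, toXY]
    rw [hF, fullForcing, ← time_inv hP ht0, hS, n2, rpow_sub_one ht0.ne', n1, hzt]
    rw [n3] at hρ ⊢
    have hp1 := pow_pos he P.M
    have hp2 := pow_pos he (2 * (P.h - 1) * P.b)
    clear hF hΦ h1 h2 hzz n1 n2 n3 n5 hρ' hzt
    generalize C.logDeriv _ = ld at *
    generalize P.small (t ^ P.nu / P.nu) = e at *
    generalize e ^ P.M = m at *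
    generalize e ^ (2 * (P.h - 1) * P.b) = n at *
    generalize P.scale ϰ * t ^ (-P.beta) * C.Zu _ = Z at *
    generalize (γ (t ^ P.nu / P.nu)).1 = r at *
    generalize P.f _ _ _ _ = f at *
    generalize P.g _ _ _ _ = g at *
    generalize C.wF.1 _ = w1 at *
    generalize C.wF.2 _ = w2 at *
    have hρ0 : 1 + m * r ≠ 0 := hρ; field_simp; ring

end ResonantChart

end PerturbedSystem

/-- A smooth vector field is Lipschitz on compact convex sets, uniformly in time. -/
lemma exists_lipschitzOnWith_slices {E : Type} [NormedAddCommGroup E] [NormedSpace ℝ E]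
    {V : ℝ → E → E} (hV : ∀ q : ℝ × E, 0 < q.1 → ContDiffAt ℝ 1 (fun q : ℝ × E => V q.1 q.2) q)
    {a b : ℝ} (ha : 0 < a) {B : Set E} (hB : Convex ℝ B) (hB' : IsCompact B) :
    ∃ K, ∀ t ∈ Icc a b, LipschitzOnWith K (V t) B := by
  obtain ⟨K, hK⟩ := ContDiffOn.exists_lipschitzOnWith (s := Icc a b ×ˢ B) (n := 1)
    (fun q hq => (hV q (ha.trans_le hq.1.1)).contDiffWithinAt) one_ne_zero
    ((convex_Icc a b).prod hB) (isCompact_Icc.prod hB')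
  refine ⟨K, fun t ht x hx y hy => ?_⟩
  have := hK (show (t, x) ∈ _ from ⟨ht, hx⟩) (show (t, y) ∈ _ from ⟨ht, hy⟩)
  simpa [Prod.edist_eq] using this

namespace PerturbedSystem

variable {P : PerturbedSystem} {X₀ Y₀ : ℝ → ℝ}

def rhs (P : PerturbedSystem) (t : ℝ) (p : ℝ²) : ℝ² :=
  (p.2 + t ^ (-((P.a : ℝ) / P.q)) * P.f p.1 p.2 (P.S t) t,
    -P.dU p.1 + t ^ (-((P.a : ℝ) / P.q)) * P.g p.1 p.2 (P.S t) t)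

lemma contDiffAt_of_pos {F : ℝ → ℝ → ℝ → ℝ → ℝ} (h : ContDiffOn ℝ ((⊤ : ℕ∞) : WithTop ℕ∞)
    (fun v : ℝ × ℝ × ℝ × ℝ => F v.1 v.2.1 v.2.2.1 v.2.2.2) {v | 0 < v.2.2.2}) {E : Type}
    [NormedAddCommGroup E] [NormedSpace ℝ E] {x y S t : E → ℝ} {q : E} (hx : ContDiffAt ℝ 1 x q)
    (hy : ContDiffAt ℝ 1 y q) (hS : ContDiffAt ℝ 1 S q) (ht : ContDiffAt ℝ 1 t q) (h0 : 0 < t q) :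
    ContDiffAt ℝ 1 (fun q => F (x q) (y q) (S q) (t q)) q := by
  have ho : IsOpen {v : ℝ × ℝ × ℝ × ℝ | 0 < v.2.2.2} := isOpen_lt continuous_const (by fun_prop)
  exact ((h.contDiffAt (x := (x q, y q, S q, t q)) (ho.mem_nhds h0)).of_le (by simp)).comp
    (f := fun q => (x q, y q, S q, t q)) q (hx.prodMk (hy.prodMk (hS.prodMk ht)))

lemma contDiffAt_rhs (hP : P.IsAdmissible) (q : ℝ³) (hq : 0 < q.1) :
    ContDiffAt ℝ 1 (fun q : ℝ³ => P.rhs q.1 q.2) q := by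
  have h1 : ∀ x : ℝ, ContDiffAt ℝ 1 (fun q : ℝ³ => q.1 ^ x) q := fun x =>
    (contDiffAt_rpow_const_of_ne hq.ne').comp q contDiffAt_fst
  have hS : ContDiffAt ℝ 1 (fun q : ℝ³ => P.S q.1) q := contDiffAt_const.mul (h1 _)
  have hx : ContDiffAt ℝ 1 (fun q : ℝ³ => q.2.1) q := by fun_prop
  have hy : ContDiffAt ℝ 1 (fun q : ℝ³ => q.2.2) q := by fun_prop
  have hU : ContDiffAt ℝ 1 (fun q : ℝ³ => P.dU q.2.1) q :=
    ((contDiff_dU P).of_le (by simp)).contDiffAt.comp (f := fun q : ℝ³ => q.2.1) q hx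
  exact (hy.add ((h1 _).mul (contDiffAt_of_pos hP.f_smooth hx hy hS contDiffAt_fst hq))).prodMk
    (hU.neg.add ((h1 _).mul (contDiffAt_of_pos hP.g_smooth hx hy hS contDiffAt_fst hq)))

lemma IsSolutionFrom.eq (hP : P.IsAdmissible) {ts : ℝ} (hts : 0 < ts) {x y x' y' : ℝ → ℝ}
    (h : P.IsSolutionFrom ts x y) (h' : P.IsSolutionFrom ts x' y') (hx : x ts = x' ts)
    (hy : y ts = y' ts) : ∀ t ∈ Ici ts, x t = x' t ∧ y t = y' t := by
  have hd : ∀ {x y : ℝ → ℝ} {b : ℝ}, P.IsSolutionFrom ts x y → ∀ t ∈ Icc ts b,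
      HasDerivWithinAt (fun t => (x t, y t)) (P.rhs t (x t, y t)) (Icc ts b) t := by
    intro x y b h t ht
    obtain ⟨h1, h2⟩ := h t ht.1
    rw [(hasDerivAt_H hP.two_le_h _ _).1] at h1
    rw [(hasDerivAt_H hP.two_le_h _ _).2] at h2
    exact (h1.prodMk h2).mono Icc_subset_Ici_self
  intro t ht
  have := eqOn_Icc_of_hasDerivWithinAt (a := ts) (b := t) (fun R =>
    exists_lipschitzOnWith_slices (contDiffAt_rhs hP) hts (convex_closedBall 0 R)
      (isCompact_closedBall 0 R)) (hd h) (hd h') (by rw [hx, hy]) ⟨ht, le_rfl⟩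
  exact ⟨congrArg Prod.fst this, congrArg Prod.snd this⟩

namespace ResonantChart

variable (C : P.ResonantChart X₀ Y₀) {ϰ : ℕ} (hP : P.IsAdmissible) (hϰ : 1 ≤ ϰ)
  (hXY : P.IsLimitOscillation X₀ Y₀)
include hP hϰ hXY

lemma contDiffAt_scaledForcing {w : (ℝ² → ℝ) × (ℝ² → ℝ)} (h1 : PeriodicWeight w.1)
    (h2 : PeriodicWeight w.2) {E : Type} [NormedAddCommGroup E] [NormedSpace ℝ E]
    {e r θ ζ : E → ℝ} {q : E} (he : ContDiffAt ℝ 1 e q) (hr : ContDiffAt ℝ 1 r q)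
    (hθ : ContDiffAt ℝ 1 θ q) (hζ : ContDiffAt ℝ 1 ζ q) (h0 : 0 < e q) :
    ContDiffAt ℝ 1 (fun q => C.scaledForcing ϰ w (e q) (r q) (θ q) (ζ q)) q := by
  have hz : ContDiffAt ℝ 1 (fun q => C.zz ϰ (e q) (r q)) q :=
    (C.contDiff_zz.of_le (by simp)).contDiffAt.comp (f := fun q => (e q, r q)) q (he.prodMk hr)
  have hp : ContDiffAt ℝ 1 (fun q => ((θ q + ζ q / ϰ, C.zz ϰ (e q) (r q)) : ℝ²)) q :=
    (hθ.add (hζ.div_const _)).prodMk hz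
  have hc : ∀ {α : ℝ² → ℝ}, Smooth α →
      ContDiffAt ℝ 1 (fun q => α (θ q + ζ q / ϰ, C.zz ϰ (e q) (r q))) q := fun hα =>
    (hα.of_le (by simp)).contDiffAt.comp
      (f := fun q => ((θ q + ζ q / ϰ, C.zz ϰ (e q) (r q)) : ℝ²)) q hp
  have hz0 : C.zz ϰ (e q) (r q) ≠ 0 := (mul_pos (pow_pos h0 _) (C.v_pos hP hϰ _ _)).ne'
  have hx := (hc (C.contDiff_Xs hXY)).div hz hz0
  have hy := (hc (C.contDiff_Ys hXY)).div (hz.pow P.h) (pow_ne_zero _ hz0)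
  have ht : ContDiffAt ℝ 1 (fun q => (e q ^ (2 * P.q * (P.h - 1)))⁻¹) q :=
    (he.pow _).inv (pow_pos h0 _).ne'
  have ht0 : 0 < (e q ^ (2 * P.q * (P.h - 1)))⁻¹ := by positivity
  exact ((he.pow _).div (he.pow _) (pow_pos h0 _).ne').mul
    (((contDiffAt_of_pos hP.f_smooth hx hy hζ ht ht0).mul (hz.mul (hc h1.1))).add
      ((contDiffAt_of_pos hP.g_smooth hx hy hζ ht ht0).mul ((hz.pow _).mul (hc h2.1))))

lemma contDiffAt_field (q : ℝ³) (hq : 0 < q.1) :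
    ContDiffAt ℝ 1 (fun q : ℝ³ => C.field ϰ q.1 q.2) q := by
  have he : ContDiffAt ℝ 1 (fun q : ℝ³ => P.small q.1) q :=
    contDiffAt_const.mul ((contDiffAt_rpow_const_of_ne hq.ne').comp q contDiffAt_fst)
  have hr : ContDiffAt ℝ 1 (fun q : ℝ³ => q.2.1) q := by fun_prop
  have hθ : ContDiffAt ℝ 1 (fun q : ℝ³ => q.2.2) q := by fun_prop
  have hζ : ContDiffAt ℝ 1 (fun q : ℝ³ => P.vartheta * q.1) q := by fun_prop
  have h0 := small_pos hP hq
  have hF := C.contDiffAt_scaledForcing hP hϰ hXY (C.periodicWeight_wF hXY).1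
    (C.periodicWeight_wF hXY).2 he hr hθ hζ h0
  have hG := C.contDiffAt_scaledForcing hP hϰ hXY (C.periodicWeight_wG hXY).1
    (C.periodicWeight_wG hXY).2 he hr hθ hζ h0
  have hρ : ContDiffAt ℝ 1 (fun q : ℝ³ => C.rho (P.small q.1) q.2.1) q :=
    (C.contDiff_rho.of_le (by simp)).contDiffAt.comp (f := fun q : ℝ³ => (P.small q.1, q.2.1))
      q (he.prodMk hr)
  have hl : ContDiffAt ℝ 1 (fun q : ℝ³ => C.logDeriv (P.scale ϰ * P.small q.1 ^ (2 * P.b))) q :=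
    (C.contDiff_logDeriv.of_le (by simp)).contDiffAt.comp
      (f := fun q : ℝ³ => P.scale ϰ * P.small q.1 ^ (2 * P.b)) q (contDiffAt_const.mul (he.pow _))
  have hv : ContDiffAt ℝ 1 (fun q : ℝ³ => C.vs ϰ (P.small q.1)) q :=
    (C.contDiff_vs.of_le (by simp)).contDiffAt.comp (f := fun q : ℝ³ => P.small q.1) q he
  have hk : ContDiffAt ℝ 1 (fun q : ℝ³ => C.kap (P.small q.1 ^ P.M * q.2.1,
      P.small q.1 ^ (2 * P.b) * C.vs ϰ (P.small q.1))) q :=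
    (C.contDiff_kap.of_le (by simp)).contDiffAt.comp (f := fun q : ℝ³ =>
      (P.small q.1 ^ P.M * q.2.1, P.small q.1 ^ (2 * P.b) * C.vs ϰ (P.small q.1))) q
      (((he.pow _).mul hr).prodMk ((he.pow _).mul hv))
  exact ((he.pow _).mul (((hρ.div_const _).mul (hF.sub ((contDiffAt_const.mul (he.pow _)).mul hl))).add
      ((contDiffAt_const.mul hr).mul (he.pow _)))).prodMk
    ((he.pow _).mul ((hr.mul (((hv.pow _).inv (pow_pos (C.vs_pos hP hϰ _) _).ne').mul hk)).add
      ((he.pow _).mul hG)))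

lemma exists_trapped {a φ₀ : ℝ} (ha : 0 < a) {g : ℝ → ℝ² → ℝ}
    (hg : ContinuousOn (fun p : ℝ³ => g p.1 p.2) (Ici a ×ˢ univ))
    (hg1 : ∀ τ ≥ a, ∀ p, g τ p ≤ 1 → p.1 ∈ Icc (-1 : ℝ) 1 ∧ p.2 ∈ Icc (φ₀ - 1) (φ₀ + 1))
    {p₀ : ℝ²} (hp₀ : g a p₀ ≤ 1) (htrap : ∀ b ≥ a, ∀ γ : ℝ → ℝ², γ a = p₀ →
      (∀ τ ∈ Icc a b, g τ (γ τ) ≤ 1 ∧ HasDerivWithinAt γ (C.field ϰ τ (γ τ)) (Icc a b) τ) →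
      ∀ τ ∈ Icc a b, g τ (γ τ) ≤ 3 / 4) :
    ∃ γ : ℝ → ℝ², γ a = p₀ ∧
      ∀ τ ∈ Ici a, g τ (γ τ) ≤ 1 ∧ HasDerivWithinAt γ (C.field ϰ τ (γ τ)) (Ici a) τ := by
  set B : Set ℝ² := Icc (-1) 1 ×ˢ Icc (φ₀ - 1) (φ₀ + 1)
  set pr : ℝ² → ℝ² := fun p => (max (-1) (min 1 p.1), max (φ₀ - 1) (min (φ₀ + 1) p.2))
  have hpr : LipschitzWith 1 pr := by
    have := ((LipschitzWith.prod_fst (α := ℝ) (β := ℝ)).const_min 1).const_max (-1)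
    simpa using this.prodMk (((LipschitzWith.prod_snd (α := ℝ) (β := ℝ)).const_min (φ₀ + 1)).const_max
      (φ₀ - 1))
  have hprB : ∀ p, pr p ∈ B := fun p =>
    ⟨⟨le_max_left _ _, max_le (by norm_num) (min_le_left _ _)⟩,
      ⟨le_max_left _ _, max_le (by linarith) (min_le_left _ _)⟩⟩
  have hBc : IsCompact B := isCompact_Icc.prod isCompact_Icc
  have hC : ContinuousOn (fun q : ℝ³ => C.field ϰ q.1 q.2) {q | 0 < q.1} := fun q hq =>
    (C.contDiffAt_field hP hϰ hXY q hq).continuousAt.continuousWithinAt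
  refine exists_trapped_solution (pr := pr) (g := g) (fun b => ?_) (fun b => ?_) (fun p => ?_) hg
    (fun τ hτ p hp => ?_) hp₀ htrap
  · obtain ⟨K, hK⟩ := exists_lipschitzOnWith_slices (C.contDiffAt_field hP hϰ hXY) ha (b := b)
      ((convex_Icc _ _).prod (convex_Icc _ _) : Convex ℝ B) hBc
    refine ⟨K * 1, fun t ht => ?_⟩
    rw [← lipschitzOnWith_univ] at hpr ⊢
    exact (hK t ht).comp hpr fun p _ => hprB p
  · obtain ⟨R, hR⟩ := (isCompact_Icc.prod hBc).exists_bound_of_continuousOn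
      (hC.mono fun q (hq : q ∈ Icc a b ×ˢ B) => ha.trans_le hq.1.1)
    exact ⟨R.toNNReal, fun t ht p => (hR (t, pr p) ⟨ht, hprB p⟩).trans (le_coe_toNNReal R)⟩
  · exact hC.comp (f := fun t => (t, pr p)) (by fun_prop) fun t ht => ha.trans_le ht
  · obtain ⟨h1, h2⟩ := hg1 τ hτ p hp
    exact Prod.ext (by simp [pr, h1.1, h1.2]) (by simp [pr, h2.1, h2.2])

end ResonantChart

end PerturbedSystem

lemma PeriodicWeight.abs_le {α : ℝ² → ℝ} (h : PeriodicWeight α) (h0 : ∀ φ, α (φ, 0) = 0) :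
    ∃ K, 0 ≤ K ∧ ∀ φ, ∀ z ∈ Icc (0 : ℝ) 1, |α (φ, z)| ≤ K * z := by
  have hs : Smooth fun p : ℝ² => α (p.2, p.1) := h.1.comp (by fun_prop)
  obtain ⟨g, hg, -, hgα⟩ := hs.exists_eq_add_smul
  obtain ⟨K, hK⟩ := (isCompact_Icc.prod isCompact_Icc).exists_bound_of_continuousOn
    (s := Icc (0 : ℝ) 1 ×ˢ Icc 0 (2 * π)) hg.continuous.continuousOn
  refine ⟨max K 0, le_max_right _ _, fun φ z hz => ?_⟩
  have hper : Function.Periodic (fun φ => α (φ, z)) (2 * π) := fun φ => h.2 φ z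
  obtain ⟨ψ, hψ, e⟩ := hper.exists_mem_Ico₀ two_pi_pos φ
  have e2 := hgα z ψ
  simp only [h0, zero_add, smul_eq_mul] at e2
  rw [e, e2, abs_mul, abs_of_nonneg hz.1, mul_comm]
  exact mul_le_mul_of_nonneg_right ((hK (z, ψ) ⟨hz, hψ.1, hψ.2.le⟩).trans (le_max_left _ _)) hz.1

namespace PerturbedSystem

variable {P : PerturbedSystem} {X₀ Y₀ : ℝ → ℝ}

lemma tendsto_rpow_neg_inv_nhdsGT (hP : P.IsAdmissible) :
    Tendsto (fun τ : ℝ => τ ^ (-(1 / (P.N : ℝ)))) atTop (𝓝[>] 0) := by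
  have hN : (0 : ℝ) < P.N := by exact_mod_cast N_pos hP
  refine tendsto_nhdsWithin_iff.2 ⟨tendsto_rpow_neg_atTop (by positivity), ?_⟩
  filter_upwards [eventually_gt_atTop 0] with τ hτ using rpow_pos_of_pos hτ _

namespace ResonantChart

variable (C : P.ResonantChart X₀ Y₀) {ϰ : ℕ} (hP : P.IsAdmissible) (hϰ : 1 ≤ ϰ)
include hP hϰ

lemma c_eq : P.c ϰ = P.scale ϰ * C.Zu 0 := by
  have h1 := P.scale_pos hP hϰ
  have h2 := C.Zu_pos 0
  have hh := hP.two_le_h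
  have e : P.kappa * P.vartheta ≠ 0 → 2 * π / P.kappa * ϰ / P.vartheta =
      (P.scale ϰ * C.Zu 0) ^ (P.h - 1) := fun _ => by
    rw [mul_pow, P.scale_pow hP, C.Zu_zero, C.aa.om_zero]; ring
  rw [c, e (mul_pos (kappa_pos P hh) (P.vartheta_pos hP)).ne', ← h_sub_one_cast hP, one_div,
    pow_rpow_inv_natCast (by positivity) (by omega)]

lemma eventually_zz_le : ∃ K, 0 ≤ K ∧ ∀ᶠ τ in atTop, P.small τ ≤ 1 ∧ ∀ r,
    C.zz ϰ (P.small τ) r ∈ Icc 0 1 ∧ C.zz ϰ (P.small τ) r ≤ K * P.small τ ^ (2 * P.b) := by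
  have hb := hP.one_le_b
  have h0 : Tendsto P.small atTop (𝓝 0) := by
    have := ((tendsto_rpow_neg_inv_nhdsGT hP).mono_right nhdsWithin_le_nhds).const_mul P.ratio
    rwa [mul_zero] at this
  have h1 : Tendsto (fun τ => C.vs ϰ (P.small τ)) atTop (𝓝 (C.vs ϰ 0)) :=
    (C.contDiff_vs.continuous.tendsto 0).comp h0
  have hv := C.vs_pos hP hϰ 0
  have h2 : Tendsto (fun τ => 2 * (C.vs ϰ 0 + 1) * P.small τ ^ (2 * P.b)) atTop (𝓝 0) := by
    have := (h0.pow (2 * P.b)).const_mul (2 * (C.vs ϰ 0 + 1))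
    rwa [zero_pow (by omega), mul_zero] at this
  refine ⟨2 * (C.vs ϰ 0 + 1), by positivity, ?_⟩
  filter_upwards [h1.eventually (gt_mem_nhds (lt_add_one _)), h2.eventually (gt_mem_nhds one_pos),
    h0.eventually (gt_mem_nhds one_pos), eventually_gt_atTop 0] with τ a1 a2 a3 a4
  have hs := small_pos hP a4
  refine ⟨a3.le, fun r => ?_⟩
  have hle : C.zz ϰ (P.small τ) r ≤ 2 * (C.vs ϰ 0 + 1) * P.small τ ^ (2 * P.b) := by
    have : C.v ϰ (P.small τ) r ≤ 2 * (C.vs ϰ 0 + 1) := by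
      rw [v, div_le_iff₀ (C.rho_pos _ _)]
      nlinarith [(C.rho_mem (P.small τ) r).1]
    rw [zz, mul_comm]; gcongr
  exact ⟨⟨(mul_pos (pow_pos hs _) (C.v_pos hP hϰ _ _)).le, hle.trans a2.le⟩, hle⟩

lemma image_mem_nhds (hXY : P.IsLimitOscillation X₀ Y₀) {τ θ : ℝ} (hg : C.Good ϰ (P.small τ) 0)
    {O : Set ℝ²} (hO : O ∈ 𝓝 (0, θ)) :
    (fun p => C.toXY (C.angleAction ϰ τ p)) '' O ∈ 𝓝 (C.toXY (C.angleAction ϰ τ (0, θ))) := by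
  have he := hg.1
  have hz := hg.zz_mem hP hϰ
  obtain ⟨Lx, Ly, A, B, sX, sY, hLx, hLy, en, -⟩ :=
    C.hasStrictFDerivAt_chart hP hXY (θ + P.vartheta * τ / ϰ) hz
  have hv := C.vs_pos hP hϰ (P.small τ)
  obtain ⟨d, hd0, hd⟩ : ∃ d : ℝ, d ≠ 0 ∧ HasStrictDerivAt (fun r => C.zz ϰ (P.small τ) r) d 0 := by
    have hs : Smooth fun r => C.zz ϰ (P.small τ) r :=
      C.contDiff_zz.comp (by fun_prop : Smooth fun r : ℝ => (P.small τ, r))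
    have h1 := hs.contDiffAt.hasStrictDerivAt (x := 0) (by simp); refine ⟨_, ?_, h1⟩
    have h2 : HasDerivAt (fun r => P.small τ ^ (2 * P.b) * (C.vs ϰ (P.small τ) /
        (1 + P.small τ ^ P.M * r))) _ 0 := ((hasDerivAt_const (0 : ℝ) (C.vs ϰ (P.small τ))).div
      (((hasDerivAt_id (0 : ℝ)).const_mul (P.small τ ^ P.M)).const_add 1)
      (by simp)).const_mul (P.small τ ^ (2 * P.b))
    have h3 : (fun r => C.zz ϰ (P.small τ) r) =ᶠ[𝓝 0] fun r => P.small τ ^ (2 * P.b) *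
        (C.vs ϰ (P.small τ) / (1 + P.small τ ^ P.M * r)) := by
      have hc : Tendsto (fun r : ℝ => |P.small τ ^ P.M * r|) (𝓝 0) (𝓝 0) := by
        simpa using (by fun_prop : Continuous fun r : ℝ => |P.small τ ^ P.M * r|).tendsto 0
      filter_upwards [hc.eventually (gt_mem_nhds C.w_pos)] with r hr
      rw [zz, v, rho, C.tr_eq _ hr.le]
    rw [(h2.congr_of_eventuallyEq h3).deriv]
    have h4 := pow_pos he (2 * P.b)
    have h5 := pow_pos he P.M
    simp only [mul_zero, add_zero, mul_one, zero_sub, one_pow, div_one, id]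
    exact mul_ne_zero h4.ne' (neg_ne_zero.2 (mul_pos hv h5).ne')
  have hA : HasStrictFDerivAt (C.angleAction ϰ τ)
      ((ContinuousLinearMap.snd ℝ ℝ ℝ).prod (d • ContinuousLinearMap.fst ℝ ℝ ℝ)) (0, θ) :=
    (hasStrictFDerivAt_snd.add_const _).prodMk (HasStrictDerivAt.comp_hasStrictFDerivAt
      (h₂ := fun r => C.zz ϰ (P.small τ) r) (f := Prod.fst) (0, θ) hd hasStrictFDerivAt_fst)
  have hT : HasStrictFDerivAt (fun p => C.toXY (C.angleAction ϰ τ p)) _ (0, θ) :=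
    HasStrictFDerivAt.comp (f := C.angleAction ϰ τ) (0, θ) (sX.prodMk sY) hA
  rw [← hT.map_nhds_eq_of_surj ?_]
  · exact image_mem_map hO
  refine LinearMap.range_eq_top.2 fun p => ?_
  have hh : (P.h : ℝ) ≠ 0 := by have := hP.two_le_h; positivity
  have ho := C.aa.om_pos (C.zz ϰ (P.small τ) 0)
  have hz0 := hz.1
  generalize C.zz ϰ (P.small τ) 0 = z at *
  set k := z ^ (P.h - 1) / C.om z
  have hk : 0 < k := by positivity
  set x := P.dU (C.Xs (θ + P.vartheta * τ / ϰ, z) / z)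
  set y := C.Ys (θ + P.vartheta * τ / ϰ, z) / z ^ P.h
  have hdet : k * (x * A + y * B) ≠ 0 := by
    rw [en]
    have := pow_pos hz0 (2 * P.h + 1)
    simp [hk.ne', hh, this.ne']
  clear_value k x y
  refine ⟨((y * k * p.2 + x * k * p.1) / (k * (x * A + y * B)) / d,
    (p.1 * B - A * p.2) / (k * (x * A + y * B))), Prod.ext
    (?_ : Lx ((p.1 * B - A * p.2) / (k * (x * A + y * B)),
      d * ((y * k * p.2 + x * k * p.1) / (k * (x * A + y * B)) / d)) = p.1)
    (?_ : Ly ((p.1 * B - A * p.2) / (k * (x * A + y * B)),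
      d * ((y * k * p.2 + x * k * p.1) / (k * (x * A + y * B)) / d)) = p.2)⟩
  all_goals
    rw [mul_div_cancel₀ _ hd0]; simp only [hLx, hLy]
    generalize hw : x * A + y * B = w at hdet ⊢
    have := right_ne_zero_of_mul hdet; field_simp; rw [← hw]; ring

lemma hasResonantForm (hσ : P.SigmaCondition) {L D : ℕ} {φ₀ ς K a : ℝ} (hK : 0 ≤ K)
    {γ : ℝ → ℝ²} (hg : ∀ τ ≥ a, C.Good ϰ (P.small τ) (γ τ).1)
    (hr : ∀ τ ≥ a, |(γ τ).1| ≤ K * P.lockingRate ϰ L D φ₀ ς (P.M / P.N) τ)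
    (hθ : ∀ τ ≥ a, |(γ τ).2 - φ₀| ≤ K * P.lockingRate ϰ L D φ₀ ς (1 / P.N) τ) {x y : ℝ → ℝ}
    (hxy : ∀ t ≥ P.time a, x t = (C.toXY (C.angleAction ϰ (t ^ P.nu / P.nu)
        (γ (t ^ P.nu / P.nu)))).1 ∧
      y t = (C.toXY (C.angleAction ϰ (t ^ P.nu / P.nu) (γ (t ^ P.nu / P.nu)))).2) :
    ∃ R Ψ : ℝ → ℝ, P.HasLockingAsymptotics ϰ L D φ₀ ς R Ψ ∧ P.HasResonantForm ϰ X₀ Y₀ R Ψ x y := by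
  have hν := nu_pos hP
  have hb := hP.one_le_b
  obtain ⟨Kz, hKz, hz⟩ := C.eventually_zz_le hP hϰ
  obtain ⟨Ka, hKa, hang⟩ := PeriodicWeight.abs_le (α := fun p => C.ang p - p.1)
    ⟨C.aa.ang_smooth.sub contDiff_fst, fun φ z => by simp only [C.aa.ang_periodic]; ring⟩
    fun φ => by simp [C.aa.ang_zero]
  obtain ⟨Kg, hKg, hgg⟩ := PeriodicWeight.abs_le (α := fun p => C.gg p - 1)
    ⟨C.aa.gg_smooth.sub contDiff_const, fun φ z => by simp only [C.aa.gg_periodic]⟩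
    fun φ => by simp [C.aa.gg_zero]
  refine ⟨fun τ => (γ τ).1, fun τ => C.ang (C.angleAction ϰ τ (γ τ)) - P.vartheta * τ / ϰ,
    ⟨?_, ?_⟩, ?_⟩
  · refine IsBigO.of_bound K ?_
    filter_upwards [eventually_ge_atTop a] with τ hτ
    exact (hr τ hτ).trans (mul_le_mul_of_nonneg_left (le_abs_self _) hK)
  · refine IsBigO.of_bound (K + Ka * (Kz * P.ratio)) ?_
    filter_upwards [eventually_ge_atTop a, eventually_gt_atTop 0, hz] with τ hτ hτ0 hz
    have hs := small_pos hP hτ0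
    have hk := ratio_pos hP
    have h1 := hang ((γ τ).2 + P.vartheta * τ / ϰ) _ (hz.2 (γ τ).1).1
    have h2 : C.zz ϰ (P.small τ) (γ τ).1 ≤ Kz * P.ratio * τ ^ (-(1 / (P.N : ℝ))) := by
      refine (hz.2 _).2.trans ?_; rw [mul_assoc]
      exact mul_le_mul_of_nonneg_left (pow_le_of_le_one hs.le hz.1 (by omega)) hKz
    have h3 : τ ^ (-(1 / (P.N : ℝ))) ≤ P.lockingRate ϰ L D φ₀ ς (1 / P.N) τ := by
      rw [lockingRate]
      exact le_add_of_nonneg_left (by positivity)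
    have h4 := (h1.trans (mul_le_mul_of_nonneg_left h2 hKa)).trans
      (mul_le_mul_of_nonneg_left (mul_le_mul_of_nonneg_left h3 (mul_nonneg hKz hk.le)) hKa)
    have h5 := abs_add_le (C.ang (C.angleAction ϰ τ (γ τ)) - ((γ τ).2 + P.vartheta * τ / ϰ))
      ((γ τ).2 - φ₀)
    have h6 : C.ang (C.angleAction ϰ τ (γ τ)) - ((γ τ).2 + P.vartheta * τ / ϰ) + ((γ τ).2 - φ₀) =
      C.ang (C.angleAction ϰ τ (γ τ)) - P.vartheta * τ / ϰ - φ₀ := by ring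
    rw [h6] at h5
    have h7 : _ ≤ (K + Ka * (Kz * P.ratio)) * P.lockingRate ϰ L D φ₀ ς (1 / P.N) τ :=
      (h5.trans (add_le_add h4 (hθ τ hτ))).trans_eq (by ring)
    exact h7.trans (mul_le_mul_of_nonneg_left (le_abs_self _) (by positivity))
  · have hβ : 0 < P.beta := by
      have := q_pos hP
      have := h_sub_one_pos hP
      have : (0 : ℝ) < P.b := by exact_mod_cast hb
      rw [beta]; positivity
    have hτ : Tendsto (fun t : ℝ => t ^ P.nu / P.nu) atTop atTop :=
      (tendsto_rpow_atTop hν).atTop_div_const hν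
    have hβ0 : Tendsto (fun t : ℝ => t ^ (-P.beta)) atTop (𝓝 0) := tendsto_rpow_neg_atTop hβ
    have hs0 : Tendsto (fun t : ℝ => P.scale ϰ * t ^ (-P.beta)) atTop (𝓝 0) := by
      simpa using hβ0.const_mul (P.scale ϰ)
    have hsc := P.scale_pos hP hϰ
    set G : ℝ → ℝ := fun t => C.gg (C.angleAction ϰ (t ^ P.nu / P.nu) (γ (t ^ P.nu / P.nu)))
    set Q : ℝ → ℝ := fun u => C.Zu 0 / C.Zu u
    have hZ := C.Zu_pos
    have hQ : DifferentiableAt ℝ Q 0 := (differentiableAt_const _).div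
      (C.Zu_smooth.diff 0) (hZ 0).ne'
    have hQ0 : Q 0 = 1 := div_self (hZ 0).ne'
    have b1 : (fun t => G t - 1) =O[atTop] fun t : ℝ => t ^ (-P.beta) := by
      refine IsBigO.of_bound (Kg * Kz) ?_
      filter_upwards [hτ.eventually hz, eventually_gt_atTop 0] with t hz ht
      have e1 := inv_pow_rpow_neg_beta hP (small_pos hP (show 0 < t ^ P.nu / P.nu by positivity))
      rw [← time_inv hP ht] at e1
      have h1 := hgg ((γ (t ^ P.nu / P.nu)).2 + P.vartheta * (t ^ P.nu / P.nu) / ϰ) _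
        (hz.2 (γ (t ^ P.nu / P.nu)).1).1
      refine h1.trans ((mul_le_mul_of_nonneg_left (hz.2 _).2 hKg).trans ?_)
      rw [← e1, ← mul_assoc]
      exact mul_le_mul_of_nonneg_left (le_abs_self _) (by positivity)
    have b2 : (fun t : ℝ => Q (P.scale ϰ * t ^ (-P.beta)) - 1) =O[atTop]
        fun t : ℝ => t ^ (-P.beta) := by
      have := hQ.isBigO_sub.comp_tendsto hs0
      simp only [hQ0, Function.comp_def, sub_zero] at this
      exact this.trans (isBigO_const_mul_self _ _ _)
    have b3 : (fun t : ℝ => Q (P.scale ϰ * t ^ (-P.beta))) =O[atTop] fun _ => (1 : ℝ) :=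
      (hQ.continuousAt.tendsto.comp hs0).isBigO_one ℝ
    set e₁ : ℝ → ℝ := fun t => G t * Q (P.scale ϰ * t ^ (-P.beta)) - 1 with he₁
    have b4 : e₁ =O[atTop] fun t : ℝ => t ^ (-P.beta) := by
      have h1 := b1.mul b3
      simp only [mul_one] at h1
      refine (h1.add b2).congr_left fun t => ?_; simp only [he₁]; ring
    have b5 : (fun t => (1 + e₁ t) ^ P.h - 1) =O[atTop] fun t : ℝ => t ^ (-P.beta) := by
      have hd : DifferentiableAt ℝ (fun u : ℝ => (1 + u) ^ P.h) 0 := by fun_prop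
      have := hd.isBigO_sub.comp_tendsto (b4.trans_tendsto hβ0)
      simp only [Function.comp_def, sub_zero, add_zero, one_pow] at this
      exact this.trans b4
    refine ⟨e₁, fun t => (1 + e₁ t) ^ P.h - 1, b4, b5, ?_⟩
    filter_upwards [eventually_ge_atTop (P.time a), eventually_gt_atTop 0,
      hτ.eventually (eventually_ge_atTop a)] with t ht ht0 hta
    have hza := C.zz_time hP hσ ht0 (hg _ hta)
    have hρ := C.rho_pos (P.small (t ^ P.nu / P.nu)) (γ (t ^ P.nu / P.nu)).1
    have e2 := inv_pow_rpow_neg_mu hP hσ (hg _ hta).1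
    rw [← time_inv hP ht0] at e2
    rw [(hg _ hta).rho_eq, ← e2] at hρ
    rw [(hxy t ht).1, (hxy t ht).2, c_eq C hP hϰ, S_eq hP t]
    have hang : P.vartheta * (t ^ P.nu / P.nu) / ϰ +
        (C.ang (C.angleAction ϰ (t ^ P.nu / P.nu) (γ (t ^ P.nu / P.nu))) -
          P.vartheta * (t ^ P.nu / P.nu) / ϰ) =
        C.ang (C.angleAction ϰ (t ^ P.nu / P.nu) (γ (t ^ P.nu / P.nu))) := by ring
    rw [hang]
    have hz1 : (C.angleAction ϰ (t ^ P.nu / P.nu) (γ (t ^ P.nu / P.nu))).2 = _ := hza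
    have hβh : t ^ (P.h * P.beta) = (t ^ P.beta) ^ P.h := by
      rw [mul_comm, rpow_mul_natCast ht0.le]
    change _ = t ^ P.beta * _ * _ * _ * _ ∧ _ = t ^ (P.h * P.beta) * _ * _ * _ * _
    simp only [toXY, Xs, Ys, hz1, hβh, he₁, Q, add_sub_cancel]
    rw [rpow_neg ht0.le P.beta] at *
    change _ * G t / _ = _ ∧ _ * G t ^ P.h / _ = _
    have hZ0 := hZ 0
    have hZs := hZ (P.scale ϰ * (t ^ P.beta)⁻¹)
    generalize G t = g
    generalize C.Zu (P.scale ϰ * (t ^ P.beta)⁻¹) = Zs at *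
    generalize 1 + t ^ (-P.mu) * (γ (t ^ P.nu / P.nu)).1 = ρ at *
    constructor
    · field_simp
    · simp only [div_pow, mul_pow, inv_pow]; field_simp

end ResonantChart

end PerturbedSystem

theorem mainTheorem1 (P : PerturbedSystem) (hP : P.IsAdmissible)
    (hfg : P.HasPowerAsymptotics) (hσ : P.SigmaCondition) (ϰ : ℕ) (hϰ : 1 ≤ ϰ) (L D : ℕ) (φ₀ : ℝ)
    (hL : P.IsLeadingOrder ϰ L) (hφ₀ : P.IsSimpleZero ϰ L φ₀) (hlam : P.lam ϰ L φ₀ < 0)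
    (hD : P.IsDivergenceOrder ϰ D φ₀) (hgam : P.gamHat ϰ L D φ₀ < 0) (hMD : P.M + D ≤ P.N)
    (X₀ Y₀ : ℝ → ℝ) (hXY : P.IsLimitOscillation X₀ Y₀) (E₀ ς : ℝ) (hς : ς ∈ Set.Ioo (0 : ℝ) 1) :
    ∃ ts : ℝ, 0 < ts ∧ ∃ Ds : Set ℝ², Ds.Nonempty ∧ IsOpen Ds ∧ Ds ⊆ {z | E₀ < P.H z.1 z.2} ∧
      ∀ z ∈ Ds, (∃ x y : ℝ → ℝ, P.IsSolutionFrom ts x y ∧ x ts = z.1 ∧ y ts = z.2) ∧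
        ∀ x y : ℝ → ℝ, P.IsSolutionFrom ts x y → x ts = z.1 → y ts = z.2 →
          ∃ R Ψ : ℝ → ℝ, P.HasLockingAsymptotics ϰ L D φ₀ ς R Ψ ∧
            P.HasResonantForm ϰ X₀ Y₀ R Ψ x y := by
  obtain ⟨ang, gg, om, z₀, hA⟩ := hXY.exists_actionAngle hP.two_le_h
  obtain ⟨C⟩ := hA.exists_resonantChart hP.two_le_h
  have hM := (P.M_cast hP hσ).2
  have hMN : 2 * P.M ≤ P.N := by have := hD.1; omega
  have hN := PerturbedSystem.N_pos hP
  obtain ⟨m, hnm, K₁, hK₁, ε₀, hε₀, close⟩ := C.exists_field_close hP hϰ hXY hσ hfg φ₀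
    ⌈2 * P.N * (|P.gam ϰ D φ₀| + 4)⌉₊
  set n := ⌈2 * P.N * (|P.gam ϰ D φ₀| + 4)⌉₊
  obtain ⟨δ, hδ, hδ1, δ', hδ', τ₀, hτ₀, cap⟩ :=
    (C.hatField hP hϰ hXY hfg hσ hMN hnm).capture hϰ hM (P.vartheta_pos hP).ne' hL hφ₀ hlam hD hgam
      hMD hς (Nat.le_ceil _) hK₁ one_pos
  have lim := PerturbedSystem.tendsto_rpow_neg_inv_nhdsGT hP
  obtain ⟨Kz, hKz, hz⟩ := C.eventually_zz_le hP hϰ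
  have hsmall : Tendsto (fun τ => Kz * P.small τ ^ (2 * P.b)) atTop (𝓝 0) := by
    have hb := hP.one_le_b
    have := (((lim.mono_right nhdsWithin_le_nhds).const_mul P.ratio).pow (2 * P.b)).const_mul Kz
    rwa [mul_zero, zero_pow (by omega), mul_zero] at this
  obtain ⟨a, ha⟩ := (((lim.mono_right nhdsWithin_le_nhds).eventually_le_const hε₀).and
    ((lim.eventually (C.eventually_good hM 1 hP)).and (hz.and ((hsmall.eventually_lt_const
      (show 0 < 1 / (|E₀| + 1) by positivity)).and (eventually_ge_atTop τ₀))))).exists_forall_of_atTop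
  have haτ := (ha a le_rfl).2.2.2.2
  have ha1 : 1 ≤ a := hτ₀.trans haτ
  have ha0 : 0 < a := by linarith
  have hgood : ∀ τ ≥ a, ∀ r, |r| ≤ 1 → C.Good ϰ (P.small τ) r := fun τ hτ r hr => by
    obtain ⟨h1, h2, h3, h4⟩ := (ha τ hτ).2.1
    have hle : |(P.small τ) ^ P.M * r| ≤ |(P.small τ) ^ P.M * 1| := by
      rw [abs_mul, abs_mul, abs_one]; gcongr
    exact ⟨h1, h2, hle.trans h3, hle.trans h4⟩
  set η : ℝ → ℝ := fun τ => (τ ^ (-(1 / (2 * P.N : ℝ)))) ^ L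
  have hη0 : ∀ τ ≥ a, 0 < η τ := fun τ hτ => pow_pos (rpow_pos_of_pos (by linarith) _) _
  have hη1 : ∀ τ ≥ a, η τ ≤ 1 := fun τ hτ =>
    pow_le_one₀ (rpow_nonneg (by linarith) _)
      (rpow_le_one_of_one_le_of_nonpos (by linarith) (by rw [neg_nonpos]; positivity))
  set d := min δ δ'
  have hd : 0 < d := lt_min hδ hδ'
  set O : Set ℝ² := {p | |p.1| < d * η a ∧ |p.2 - φ₀| < d}
  have hO : IsOpen O := (isOpen_lt continuous_fst.abs continuous_const).inter
    (isOpen_lt (continuous_snd.sub continuous_const).abs continuous_const)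
  have hO₀ : (0, φ₀) ∈ O := by have := mul_pos hd (hη0 a le_rfl); simp [O, hd, this]
  set g : ℝ → ℝ² → ℝ := fun τ p => max (|p.1| / (δ * η τ)) (|p.2 - φ₀| / δ)
  have hgle : ∀ τ ≥ a, ∀ p c, g τ p ≤ c ↔ |p.1| ≤ c * δ * η τ ∧ |p.2 - φ₀| ≤ c * δ :=
    fun τ hτ p c => by
      rw [max_le_iff, div_le_iff₀ (mul_pos hδ (hη0 τ hτ)), div_le_iff₀ hδ, mul_assoc]
  have hg1 : ∀ τ ≥ a, ∀ p, g τ p ≤ 1 → |p.1| ≤ 1 ∧ |p.2 - φ₀| ≤ 1 := fun τ hτ p hp => by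
    obtain ⟨h1, h2⟩ := (hgle τ hτ p 1).1 hp
    rw [one_mul] at h1 h2
    exact ⟨h1.trans (mul_le_one₀ hδ1 (hη0 τ hτ).le (hη1 τ hτ)), h2.trans hδ1⟩
  have hbox : ∀ τ ≥ a, ∀ p, g τ p ≤ 1 → p.1 ∈ Icc (-1 : ℝ) 1 ∧ p.2 ∈ Icc (φ₀ - 1) (φ₀ + 1) :=
    fun τ hτ p hp => by
      obtain ⟨h1, h2⟩ := hg1 τ hτ p hp
      rw [abs_le] at h1 h2
      exact ⟨h1, by linarith [h2.1], by linarith [h2.2]⟩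
  have hgc : ContinuousOn (fun p : ℝ³ => g p.1 p.2) (Ici a ×ˢ univ) := by
    have hc : ContinuousOn (fun p : ℝ³ => η p.1) (Ici a ×ˢ univ) :=
      (continuousOn_fst.rpow_const fun p hp => Or.inl (by linarith [show a ≤ p.1 from hp.1] :
        0 < p.1).ne').pow L
    exact ContinuousOn.sup (ContinuousOn.div (by fun_prop) (hc.const_mul δ |>.congr fun _ _ => rfl)
      fun p hp => (mul_pos hδ (hη0 p.1 hp.1)).ne') (by fun_prop)
  obtain ⟨K, hK, cap⟩ := cap a haτ
  have cap' : ∀ p ∈ O, ∀ b ≥ a, ∀ γ : ℝ → ℝ², γ a = p →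
      (∀ τ ∈ Icc a b, g τ (γ τ) ≤ 1 ∧ HasDerivWithinAt γ (C.field ϰ τ (γ τ)) (Icc a b) τ) →
      ∀ τ ∈ Icc a b, g τ (γ τ) ≤ 3 / 4 ∧
        |(γ τ).1| ≤ K * P.lockingRate ϰ L D φ₀ ς (P.M / P.N) τ ∧
        |(γ τ).2 - φ₀| ≤ K * P.lockingRate ϰ L D φ₀ ς (1 / P.N) τ := by
    intro p hp b hb γ hγ sol τ hτ
    have := cap b hb (fun τ => (γ τ).1) (fun τ => (γ τ).2) (fun τ => (C.field ϰ τ (γ τ)).1)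
      (fun τ => (C.field ϰ τ (γ τ)).2) (fun τ hτ => ?_) ?_ ?_ τ hτ
    · rw [hgle τ hτ.1]
      exact ⟨⟨this.1, this.2.1⟩, this.2.2⟩
    · obtain ⟨h1, h2⟩ := sol τ hτ
      have h3 := (hgle τ hτ.1 _ 1).1 h1; rw [one_mul] at h3
      refine ⟨h2.fst, h2.snd, h3.1, h3.2, ?_⟩
      rintro ε rfl
      have hε : 0 < τ ^ (-(1 / (P.N : ℝ))) := rpow_pos_of_pos (by linarith [hτ.1]) _
      obtain ⟨b1, b2⟩ := hbox τ hτ.1 _ h1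
      obtain ⟨c1, c2⟩ := close _ ⟨hε, (ha τ hτ.1).1⟩ _ b1 _ b2 (P.vartheta * τ)
      simp only [PerturbedSystem.ResonantChart.field, PerturbedSystem.small]
      generalize τ ^ (-(1 / (P.N : ℝ))) = ε at *
      have key : ∀ x y : ℝ, |P.ratio ^ P.M * x - y| ≤ K₁ * ε ^ n →
          |(P.ratio * ε) ^ P.M * x - ε ^ P.M * y| ≤ K₁ * ε ^ (P.M + n) := fun x y h => by
        rw [show (P.ratio * ε) ^ P.M * x - ε ^ P.M * y = ε ^ P.M * (P.ratio ^ P.M * x - y) by ring,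
          abs_mul, abs_of_pos (pow_pos hε _), pow_add, mul_left_comm]
        gcongr
      exact ⟨key _ _ c1, key _ _ c2⟩
    · rw [hγ]
      exact hp.1.le.trans (by gcongr; exact min_le_right _ _)
    · rw [hγ]
      exact hp.2.le.trans (min_le_right _ _)
  set G : ℝ² → ℝ² := fun p => C.toXY (C.angleAction ϰ a p)
  have hta := PerturbedSystem.time_pos hP ha0
  have hback := PerturbedSystem.rpow_time hP ha0
  refine ⟨P.time a, hta, interior (G '' O), ⟨G (0, φ₀), mem_interior_iff_mem_nhds.2
    (C.image_mem_nhds hP hϰ hXY (hgood a le_rfl 0 (by simp)) (hO.mem_nhds hO₀))⟩,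
    isOpen_interior, ?_, ?_⟩
  · intro z hz'
    obtain ⟨p, hp, rfl⟩ := interior_subset hz'
    have hp1 : |p.1| ≤ 1 := hp.1.le.trans (mul_le_one₀ ((min_le_left _ _).trans hδ1)
      (hη0 a le_rfl).le (hη1 a le_rfl))
    have hzz := (hgood a le_rfl p.1 hp1).zz_mem hP hϰ
    have hen := C.aa.energy (C.zz ϰ (P.small a) p.1) ⟨hzz.1, hzz.2.le⟩ (p.2 + P.vartheta * a / ϰ)
    obtain ⟨-, -, h3, h4, -⟩ := ha a le_rfl
    obtain ⟨h5, h6⟩ := h3.2 p.1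
    refine lt_of_lt_of_eq ?_ hen.symm
    have h7 := h6.trans_lt h4
    have hz0 := hzz.1
    calc E₀ < |E₀| + 1 := (le_abs_self _).trans_lt (lt_add_one _)
      _ ≤ (C.zz ϰ (P.small a) p.1)⁻¹ := (le_inv_comm₀ (by positivity) hz0).2 (by
        rw [← one_div]; exact h7.le)
      _ ≤ _ := inv_anti₀ (by positivity) (pow_le_of_le_one h5.1 h5.2
        (by have := hP.two_le_h; omega))
  intro z hz'
  obtain ⟨p, hp, rfl⟩ := interior_subset hz'
  have hp₀ : g a p ≤ 1 := by
    rw [hgle a le_rfl, one_mul]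
    exact ⟨hp.1.le.trans (by gcongr; exact min_le_left _ _), hp.2.le.trans (min_le_left _ _)⟩
  obtain ⟨γ, hγ, sol⟩ := C.exists_trapped hP hϰ hXY ha0 hgc hbox hp₀ fun b hb γ hγ sol τ hτ =>
    (cap' p hp b hb γ hγ sol τ hτ).1
  have rates := fun τ (hτ : τ ≥ a) => (cap' p hp τ hτ γ hγ (fun s hs =>
    ⟨(sol s hs.1).1, (sol s hs.1).2.mono Icc_subset_Ici_self⟩) τ ⟨hτ, le_rfl⟩).2
  have hgγ : ∀ τ ≥ a, C.Good ϰ (P.small τ) (γ τ).1 := fun τ hτ =>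
    hgood τ hτ _ (hg1 τ hτ _ (sol τ hτ).1).1
  have hsol := C.isSolutionFrom hP hσ hϰ hMN hXY ha0 fun τ hτ => ⟨hgγ τ hτ, (sol τ hτ).2⟩
  have hini : C.toXY (C.angleAction ϰ (P.time a ^ P.nu / P.nu) (γ (P.time a ^ P.nu / P.nu))) =
    G p := by rw [hback, hγ]
  refine ⟨⟨_, _, hsol, congrArg Prod.fst hini, congrArg Prod.snd hini⟩, fun x y hxy hx hy => ?_⟩
  exact C.hasResonantForm hP hϰ hσ hK hgγ (fun τ hτ => (rates τ hτ).1) (fun τ hτ => (rates τ hτ).2)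
    (hxy.eq hP hta hsol (hx.trans (congrArg Prod.fst hini).symm)
      (hy.trans (congrArg Prod.snd hini).symm))
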